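/- **Setting.** Let $p\ge 5$ be prime, $n=2p-1$, and let $X_n$ be the spine of auter space. It is the geometric realization of the poset of equivalence classes of marked graphs $(\varphi,G,x_0)$, where $(G,x_0)$ is a finite connected basepointed graph with no free edges in which all vertices other than $x_0$ have valence at least $3$, and $\varphi$ is an isomorphism $F_n\cong\pi_1(G,x_0)$; one has $x\le y$ if $x$ is obtained from $y$ by collapsing a forest, compatibly with the markings. An $r$-simplex is thus given by a marked graph $G_r$ (its maximal vertex) with a flag of forests $\emptyset\subsetneq F_r\subsetneq\dots\subsetneq F_1$ in $G_r$, its vertices being $G_r, G_r/F_r,\dots,G_r/F_1$; we write it $(G_r\,;F_r\subset\dots\subset F_1)$. $\mathrm{Aut}(F_n)$ acts on $X_n$ by changing markings. The $p$-singular locus consists of the simplices whose stabilizer contains an element of order $p$. A simplex $\sigma$ of the $p$-singular locus has *exactly $\mathbb Z/p$ symmetry* if $H^{2k}(\mathrm{stab}(\sigma);\mathbb Z_{(p)})\cong\mathbb Z/p$ for all $k$ with $0<2k<2(p-1)$, and *at most dihedral symmetry* if $H^{4k}(\mathrm{stab}(\sigma);\mathbb Z_{(p)})\cong\mathbb Z/p$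 for all $k$ with $0<4k<2(p-1)$ (so the former implies the latter). **Graphs** (indices in $\mathbb Z/p$; the basepoint of the last three is $a$). * $\Xi_p$: the $1$-skeleton of the cone over a $p$-gon. * $\Upsilon_{2p-1}$: vertices $a,b,x_i$; edges $x_ix_{i+1}$, $L=\{ax_i\}$, $R=\{bx_i\}$. * $\Upsilon^1_{2p-1}$: vertices $a,b,x_i,y_i$; edges $x_ix_{i+1}$, $E=\{x_iy_i\}$, $L=\{ay_i\}$, $R=\{by_i\}$. * $\Upsilon^2_{2p-1}$: vertices $a,b,u_i,w_i$; edges $C=\{u_iw_i\}$, $C'=\{w_iu_{i+1}\}$, $L=\{au_i\}$, $R=\{bw_i\}$. **Corollary.** Let $\sigma$ be a simplex of $X_n$. 1. $\sigma$ lies in the $p$-singular locus and has at most dihedral symmetry if and only if at least one of the following holds. (i) For some marking of its maximal vertex, $\sigma$ is one of * $(\Upsilon_{2p-1})$, $(\Upsilon_{2p-1};L)$, $(\Upsilon_{2p-1};R)$; * $(\Upsilon^1_{2p-1})$, or $(\Upsilon^1_{2p-1};F)$ with $F\in\{E,\,L,\,R,\,E\cup L,\,E\cup R\}$, or $(\Upsilon^1_{2p-1};F\subset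 F')$ with $(F,F')\in\{(E,E\cup L),(L,E\cup L),(E,E\cup R),(R,E\cup R)\}$; * $(\Upsilon^2_{2p-1})$, $(\Upsilon^2_{2p-1};L)$, $(\Upsilon^2_{2p-1};R)$, $(\Upsilon^2_{2p-1};L\cup R)$, $(\Upsilon^2_{2p-1};L\subset L\cup R)$, $(\Upsilon^2_{2p-1};R\subset L\cup R)$; * one of the simplices listed in 2. (ii) The maximal vertex of $\sigma$ has underlying graph of the form $\Xi_p\vee\Gamma_{p-1}$, where $\Gamma_{p-1}$ is a basepointed graph with free fundamental group of rank $p-1$, the cone point of $\Xi_p$ is glued to an arbitrary point of $\Gamma_{p-1}$, and the basepoint is that of $\Gamma_{p-1}$; and each of the forests collapsed in $\sigma$ is invariant under the rotation action of $\mathbb Z/p$ on $\Xi_p$. 2. $\sigma$ lies in the $p$-singular locus and has exactly $\mathbb Z/p$ symmetry if and only if, for some marking of its maximal vertex, $\sigma$ is one of the three edges $$(\Upsilon^2_{2p-1};C),\quad(\Upsilon^2_{2p-1};C\cup L),\quad(\Upsilon^2_{2p-1};C\cup R)$$ or of the four $2$-simplices $$(\Upsilon^2_{2p-1};C\subset C\cup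 L),\quad(\Upsilon^2_{2p-1};C\subset C\cup R),\quad(\Upsilon^2_{2p-1};L\subset C\cup L),\quad(\Upsilon^2_{2p-1};R\subset C\cup R).$$ -/

import Mathlib

namespace Auter

/-! ### Finite graphs with basepoint, edge paths and the fundamental group -/

/-- A graph in the sense of Serre (loops and multiple edges allowed) with a basepoint. An element
of `D` is an edge with a direction; `src` is its initial vertex and `inv` reverses the direction. -/
structure PGraph where
  V : Type
  D : Type
  src : D → V
  inv : D → D
  inv_inv : ∀ d, inv (inv d) = d
  inv_ne : ∀ d, inv d ≠ d
  base : V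

namespace PGraph

/-- `G.IsWalk v w v'`: the list `w` of directed edges is an edge path from `v` to `v'`. -/
def IsWalk (G : PGraph) : G.V → List G.D → G.V → Prop
  | v, [], v' => v = v'
  | v, d :: w, v' => G.src d = v ∧ IsWalk G (G.src (G.inv d)) w v'

/-- An edge path without backtracking. -/
def IsReduced (G : PGraph) (w : List G.D) : Prop :=
  w.IsChain (fun d e => e ≠ G.inv d)

/-- A set of edges (a set of directed edges stable under reversal) is a forest if it contains no
nontrivial reduced closed edge path. All vertices of `G` are regarded as belonging to the forest,
so that its components are trees, some of which may be single vertices. -/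
def IsForest (G : PGraph) (F : Set G.D) : Prop :=
  (∀ d ∈ F, G.inv d ∈ F) ∧
  ∀ (v : G.V) (w : List G.D), (∀ d ∈ w, d ∈ F) → G.IsWalk v w v → G.IsReduced w → w = []

/-- The vertices `v` and `v'` lie in the same component of the set of edges `F`. -/
def JoinedIn (G : PGraph) (F : Set G.D) (v v' : G.V) : Prop :=
  ∃ w : List G.D, (∀ d ∈ w, d ∈ F) ∧ G.IsWalk v w v'

/-- The number of directed edges that start at `v` (a loop counts twice). -/
noncomputable def valence (G : PGraph) (v : G.V) : ℕ := Nat.card {d : G.D // G.src d = v}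

/-- Finite connected graphs without free edges in which every vertex except possibly the
basepoint has valence at least three. -/
structure Admissible (G : PGraph) : Prop where
  finite_V : Finite G.V
  finite_D : Finite G.D
  connected : ∀ v, ∃ w, G.IsWalk G.base w v
  no_free_edge : ∀ v, G.valence v ≠ 1
  three_le_valence : ∀ v, v ≠ G.base → 3 ≤ G.valence v

/-- The group generated by the directed edges, subject to `d * inv d = 1`: the free group on the
(undirected) edges. -/
abbrev EdgeGroup (G : PGraph) : Type :=
  PresentedGroup (Set.range fun d : G.D => FreeGroup.of d * FreeGroup.of (G.inv d))

/-- The generator of the edge group given by a directed edge. -/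
def gen (G : PGraph) (d : G.D) : G.EdgeGroup := PresentedGroup.of d

theorem gen_mul_gen_inv (G : PGraph) (d : G.D) : G.gen d * G.gen (G.inv d) = 1 := by
  have h := PresentedGroup.one_of_mem
    (rels := Set.range fun d : G.D => FreeGroup.of d * FreeGroup.of (G.inv d))
    (Set.mem_range_self d)
  simpa [gen, PresentedGroup.of] using h

theorem gen_inv (G : PGraph) (d : G.D) : G.gen (G.inv d) = (G.gen d)⁻¹ :=
  (inv_eq_of_mul_eq_one_right (G.gen_mul_gen_inv d)).symm

theorem IsWalk.append {G : PGraph} {w₁ w₂ : List G.D} {u v x : G.V}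
    (h₁ : G.IsWalk u w₁ v) (h₂ : G.IsWalk v w₂ x) : G.IsWalk u (w₁ ++ w₂) x := by
  induction w₁ generalizing u with
  | nil =>
    have h : u = v := h₁
    subst h
    exact h₂
  | cons d w ih => exact ⟨h₁.1, ih h₁.2⟩

theorem IsWalk.reverse {G : PGraph} {w : List G.D} {u v : G.V}
    (h : G.IsWalk u w v) : G.IsWalk v (w.map G.inv).reverse u := by
  induction w generalizing u with
  | nil => exact (show u = v from h).symm
  | cons d w ih =>
    rw [List.map_cons, List.reverse_cons]
    refine (ih h.2).append ⟨rfl, ?_⟩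
    rw [G.inv_inv]
    exact h.1

/-- The product in the edge group of the edges of a path. Two edge paths with the same endpoints
are homotopic (related by inserting and deleting backtracks `d, inv d`) if and only if these
products agree. -/
def walkProd (G : PGraph) (w : List G.D) : G.EdgeGroup := (w.map G.gen).prod

theorem walkProd_reverse (G : PGraph) (w : List G.D) :
    G.walkProd (w.map G.inv).reverse = (G.walkProd w)⁻¹ := by
  induction w with
  | nil => simp [walkProd]
  | cons d w ih =>
    simp only [walkProd, List.map_cons, List.reverse_cons, List.map_append, List.prod_append,
      List.prod_cons, mul_inv_rev] at ih ⊢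
    rw [ih]
    simp [gen_inv]

/-- The fundamental group of `G` at the basepoint: homotopy classes of closed edge paths at the
basepoint, where a homotopy class is recorded by its product in the edge group. -/
def pi1 (G : PGraph) : Subgroup G.EdgeGroup where
  carrier := {g | ∃ w, G.IsWalk G.base w G.base ∧ G.walkProd w = g}
  one_mem' := ⟨[], rfl, rfl⟩
  mul_mem' := by
    rintro _ _ ⟨w₁, h₁, rfl⟩ ⟨w₂, h₂, rfl⟩
    exact ⟨w₁ ++ w₂, h₁.append h₂, by simp [walkProd]⟩
  inv_mem' := by
    rintro _ ⟨w, h, rfl⟩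
    exact ⟨_, h.reverse, G.walkProd_reverse w⟩

/-- The graph with vertex set `V` and edge set `E`, where `e` joins `s e` to `t e`. The directed
edge `(e, false)` runs from `s e` to `t e`, and `(e, true)` is its reverse. -/
def ofEdges (V E : Type) (s t : E → V) (base : V) : PGraph where
  V := V
  D := E × Bool
  src d := if d.2 then t d.1 else s d.1
  inv d := (d.1, !d.2)
  inv_inv d := by simp
  inv_ne d h := by simpa using congrArg Prod.snd h
  base := base

open Classical in
/-- The one-point union of `A` and `B`: the basepoint of `B` is glued to the vertex `a` of `A`,
and the basepoint of the result is that of `A`. -/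
noncomputable def wedge (A : PGraph) (a : A.V) (B : PGraph) : PGraph where
  V := A.V ⊕ {v : B.V // v ≠ B.base}
  D := A.D ⊕ B.D
  src := Sum.elim (fun d => Sum.inl (A.src d))
    (fun d => if h : B.src d = B.base then Sum.inl a else Sum.inr ⟨B.src d, h⟩)
  inv := Sum.map A.inv B.inv
  inv_inv := by rintro (d | d) <;> simp [A.inv_inv, B.inv_inv]
  inv_ne := by rintro (d | d) <;> simp [A.inv_ne, B.inv_ne]
  base := Sum.inl A.base

/-- Basepoint-preserving isomorphisms of graphs: the basepoint-preserving homeomorphisms of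
admissible graphs, up to isotopy. -/
structure Iso (A B : PGraph) where
  onV : A.V ≃ B.V
  onD : A.D ≃ B.D
  src_onD : ∀ d, B.src (onD d) = onV (A.src d)
  onD_inv : ∀ d, onD (A.inv d) = B.inv (onD d)
  onV_base : onV A.base = B.base

/-- The homomorphism induced by an isomorphism of graphs. -/
def Iso.hom {A B : PGraph} (i : Iso A B) : A.EdgeGroup →* B.EdgeGroup :=
  PresentedGroup.toGroup (f := fun d => B.gen (i.onD d)) (by
    rintro _ ⟨d, rfl⟩
    simp [i.onD_inv, gen_mul_gen_inv])

theorem Iso.hom_gen {A B : PGraph} (i : Iso A B) (d : A.D) :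
    i.hom (A.gen d) = B.gen (i.onD d) :=
  PresentedGroup.toGroup.of _

/-- The identity. -/
def Iso.refl (A : PGraph) : Iso A A where
  onV := Equiv.refl _
  onD := Equiv.refl _
  src_onD _ := rfl
  onD_inv _ := rfl
  onV_base := rfl

/-- The inverse of an isomorphism. -/
def Iso.symm {A B : PGraph} (i : Iso A B) : Iso B A where
  onV := i.onV.symm
  onD := i.onD.symm
  src_onD d := by
    rw [Equiv.eq_symm_apply, ← i.src_onD, Equiv.apply_symm_apply]
  onD_inv d := by
    rw [Equiv.symm_apply_eq, i.onD_inv, Equiv.apply_symm_apply]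
  onV_base := by rw [Equiv.symm_apply_eq, i.onV_base]

/-- The composition of two isomorphisms. -/
def Iso.trans {A B C : PGraph} (i : Iso A B) (j : Iso B C) : Iso A C where
  onV := i.onV.trans j.onV
  onD := i.onD.trans j.onD
  src_onD d := by simp [i.src_onD, j.src_onD]
  onD_inv d := by simp [i.onD_inv, j.onD_inv]
  onV_base := by simp [i.onV_base, j.onV_base]

theorem Iso.refl_hom (A : PGraph) (x : A.EdgeGroup) : (Iso.refl A).hom x = x := by
  have h : (Iso.refl A).hom = MonoidHom.id _ :=
    PresentedGroup.ext fun d => (Iso.refl A).hom_gen d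
  rw [h]
  rfl

theorem Iso.trans_hom {A B C : PGraph} (i : Iso A B) (j : Iso B C) (x : A.EdgeGroup) :
    (i.trans j).hom x = j.hom (i.hom x) := by
  have h : (i.trans j).hom = j.hom.comp i.hom :=
    PresentedGroup.ext fun d => by
      change (i.trans j).hom (A.gen d) = j.hom (i.hom (A.gen d))
      rw [hom_gen, hom_gen, hom_gen]
      rfl
  rw [h]
  rfl

theorem Iso.symm_hom {A B : PGraph} (i : Iso A B) (x : A.EdgeGroup) :
    i.symm.hom (i.hom x) = x := by
  have h : i.symm.hom.comp i.hom = MonoidHom.id _ :=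
    PresentedGroup.ext fun d => by
      change i.symm.hom (i.hom (A.gen d)) = A.gen d
      rw [hom_gen, hom_gen]
      exact congrArg A.gen (i.onD.symm_apply_apply d)
  exact DFunLike.congr_fun h x

/-- A map `A → B` that exhibits `B` as the graph obtained from `A` by collapsing each component
of the forest `F` to a point. An edge is sent to `none` when it is collapsed. -/
structure Collapse (A : PGraph) (F : Set A.D) (B : PGraph) where
  forest : A.IsForest F
  onV : A.V → B.V
  onD : A.D → Option B.D
  onV_base : onV A.base = B.base
  onV_surjective : Function.Surjective onV
  onV_eq_iff : ∀ v v', onV v = onV v' ↔ A.JoinedIn F v v'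
  onD_eq_none : ∀ d, onD d = none ↔ d ∈ F
  onD_inv : ∀ d, onD (A.inv d) = (onD d).map B.inv
  onD_bijective : ∀ e : B.D, ∃! d, onD d = some e
  src_onD : ∀ d e, onD d = some e → B.src e = onV (A.src d)

/-- The homomorphism induced by a forest collapse; it sends collapsed edges to `1`. -/
def Collapse.hom {A B : PGraph} {F : Set A.D} (c : Collapse A F B) :
    A.EdgeGroup →* B.EdgeGroup :=
  PresentedGroup.toGroup (f := fun d => (c.onD d).elim 1 B.gen) (by
    rintro _ ⟨d, rfl⟩
    rcases h : c.onD d with _ | e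
    · simp [c.onD_inv, h]
    · simp [c.onD_inv, h, gen_mul_gen_inv])

end PGraph

open PGraph

/-! ### The spine of auter space -/

/-- A marked graph of rank `n`: an admissible graph with an isomorphism from the free group of
rank `n` (the fundamental group of the rose) to its fundamental group. -/
structure MarkedGraph (n : ℕ) where
  graph : PGraph
  admissible : graph.Admissible
  marking : FreeGroup (Fin n) ≃* graph.pi1

/-- Equivalence of marked graphs. -/
instance MarkedGraph.setoid (n : ℕ) : Setoid (MarkedGraph n) where
  r A B := ∃ i : Iso A.graph B.graph, ∀ g, i.hom (A.marking g) = B.marking g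
  iseqv :=
    { refl := fun A => ⟨Iso.refl _, fun g => Iso.refl_hom _ _⟩
      symm := by
        rintro A B ⟨i, hi⟩
        exact ⟨i.symm, fun g => by rw [← hi, Iso.symm_hom]⟩
      trans := by
        rintro A B C ⟨i, hi⟩ ⟨j, hj⟩
        exact ⟨i.trans j, fun g => by rw [Iso.trans_hom, hi, hj]⟩ }

/-- The vertices of the spine `X_n` of auter space: equivalence classes of marked graphs. -/
abbrev SpineVertex (n : ℕ) : Type 1 := Quotient (MarkedGraph.setoid n)

/-- `x ≤ y` if `x` is obtained from `y` by collapsing a forest, compatibly with the markings.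
The spine `X_n` is the geometric realization of this poset. -/
instance (n : ℕ) : LE (SpineVertex n) where
  le x y := ∃ A B : MarkedGraph n, Quotient.mk _ A = x ∧ Quotient.mk _ B = y ∧
    ∃ (F : Set B.graph.D) (c : Collapse B.graph F A.graph),
      ∀ g, c.hom (B.marking g) = A.marking g

/-- `Aut(F_n)` acts on marked graphs by changing the marking. -/
def MarkedGraph.act {n : ℕ} (f : MulAut (FreeGroup (Fin n))) (A : MarkedGraph n) :
    MarkedGraph n where
  graph := A.graph
  admissible := A.admissible
  marking := (f⁻¹ : MulAut (FreeGroup (Fin n))).trans A.marking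

instance (n : ℕ) : MulAction (MulAut (FreeGroup (Fin n))) (SpineVertex n) where
  smul f := Quotient.map (MarkedGraph.act f) (by
    rintro A B ⟨i, hi⟩
    exact ⟨i, fun g => hi _⟩)
  one_smul := by
    rintro ⟨A⟩
    rfl
  mul_smul := by
    rintro f g ⟨A⟩
    exact congrArg (Quotient.mk _) (by simp [MarkedGraph.act]; rfl)

/-- The simplices of `X_n`, as sets of vertices: the finite nonempty chains. -/
def IsSimplex {n : ℕ} (σ : Set (SpineVertex n)) : Prop :=
  σ.Finite ∧ σ.Nonempty ∧ IsChain (· ≤ ·) σ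

/-- The stabilizer in `Aut(F_n)` of a simplex. As the action preserves the order, an automorphism
that maps a finite chain to itself fixes each of its elements. -/
abbrev stab {n : ℕ} (σ : Set (SpineVertex n)) : Subgroup (MulAut (FreeGroup (Fin n))) :=
  fixingSubgroup (MulAut (FreeGroup (Fin n))) σ

/-- The simplex `σ` lies in the `p`-singular locus: its stabilizer has `p`-torsion. -/
def InSingularLocus (p : ℕ) {n : ℕ} (σ : Set (SpineVertex n)) : Prop :=
  ∃ g ∈ stab σ, orderOf g = p

/-! ### Symmetry of a simplex, measured by the cohomology of its stabilizer -/

instance span_isPrime (p : ℕ) [hp : Fact p.Prime] : (Ideal.span {(p : ℤ)}).IsPrime :=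
  (Ideal.span_singleton_prime (by exact_mod_cast hp.out.ne_zero)).2
    (Nat.prime_iff_prime_int.1 hp.out)

/-- The integers localized at the prime ideal `(p)`. -/
abbrev ZLoc (p : ℕ) [Fact p.Prime] : Type := Localization.AtPrime (Ideal.span {(p : ℤ)})

/-- `σ` contributes exactly one copy of `ℤ/p` to the row `s` of the first page of the equivariant
spectral sequence, whose entry in position `(r, s)` is the product of the groups
`H^s(stab δ; ℤ_(p))` over the orbits of the `r`-simplices `δ`. -/
def ContributesOneCopy (p : ℕ) [Fact p.Prime] {n : ℕ} (σ : Set (SpineVertex n)) (s : ℕ) : Prop :=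
  Nonempty (groupCohomology (Rep.trivial (ZLoc p) (stab σ) (ZLoc p)) s ≃+ ZMod p)

/-- Simplices of the `p`-singular locus with exactly `ℤ/p` symmetry. -/
def HasExactlyCyclicSymmetry (p : ℕ) [Fact p.Prime] {n : ℕ} (σ : Set (SpineVertex n)) : Prop :=
  IsSimplex σ ∧ InSingularLocus p σ ∧
    ∀ k : ℕ, 0 < 2 * k → 2 * k < 2 * (p - 1) → ContributesOneCopy p σ (2 * k)

/-- Simplices of the `p`-singular locus with at most dihedral symmetry. -/
def HasAtMostDihedralSymmetry (p : ℕ) [Fact p.Prime] {n : ℕ} (σ : Set (SpineVertex n)) : Prop :=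
  IsSimplex σ ∧ InSingularLocus p σ ∧
    ∀ k : ℕ, 0 < 4 * k → 4 * k < 2 * (p - 1) → ContributesOneCopy p σ (4 * k)

/-! ### Simplices given by a graph and a flag of forests -/

/-- A set of forests of `G` that is totally ordered by inclusion and contains the empty forest. -/
def IsFlag (G : PGraph) (𝓕 : Set (Set G.D)) : Prop :=
  ∅ ∈ 𝓕 ∧ (∀ F ∈ 𝓕, G.IsForest F) ∧ IsChain (· ⊆ ·) 𝓕

/-- `σ` is the simplex whose maximal vertex is `G` with some marking, and whose vertices are
obtained from that marked graph by collapsing the forests in the flag `𝓕` (the maximal vertex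
corresponds to the empty forest). For fixed `G` and `𝓕` these `σ` form one orbit. -/
def IsSimplexOfFlag {n : ℕ} (G : PGraph) (𝓕 : Set (Set G.D)) (σ : Set (SpineVertex n)) : Prop :=
  G.Admissible ∧ IsFlag G 𝓕 ∧ ∃ φ : FreeGroup (Fin n) ≃* G.pi1,
    σ = {x | ∃ F ∈ 𝓕, ∃ B : MarkedGraph n, Quotient.mk _ B = x ∧
      ∃ c : Collapse G F B.graph, ∀ g, c.hom (φ g) = B.marking g}

/-! ### The graphs `Ξ_p`, `Υ`, `Υ¹`, `Υ²` -/

/-- The two classes of edges of `Ξ_p`. -/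
inductive XiEdge
  | rim
  | spoke

/-- `Ξ_p`, the 1-skeleton of the cone over a `p`-gon. The basepoint `none` is the cone point, and
`some i` are the vertices of the `p`-gon. -/
def Xi (p : ℕ) : PGraph :=
  ofEdges (Option (ZMod p)) (XiEdge × ZMod p)
    (fun
      | (.rim, i) => some i
      | (.spoke, _) => none)
    (fun
      | (.rim, i) => some (i + 1)
      | (.spoke, i) => some i)
    none

/-- The action on the directed edges of `Ξ_p` of the generator of `ℤ/p`, by rotation. -/
def Xi.rotate (p : ℕ) (d : (Xi p).D) : (Xi p).D := ((d.1.1, d.1.2 + 1), d.2)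

/-- The three classes of edges of `Υ_{2p-1}`. -/
inductive UpsilonEdge
  | rim
  | left
  | right

/-- `Υ_{2p-1}`, the 1-skeleton of the suspension of a `p`-gon. The two suspension points are
`Sum.inl false`, which is the basepoint, and `Sum.inl true`. -/
def Upsilon (p : ℕ) : PGraph :=
  ofEdges (Bool ⊕ ZMod p) (UpsilonEdge × ZMod p)
    (fun
      | (.rim, i) => .inr i
      | (.left, _) => .inl false
      | (.right, _) => .inl true)
    (fun
      | (.rim, i) => .inr (i + 1)
      | (.left, i) => .inr i
      | (.right, i) => .inr i)
    (.inl false)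

/-- The four classes of edges of `Υ¹_{2p-1}`. -/
inductive UpsilonOneEdge
  | rim
  | stem
  | left
  | right

/-- `Υ¹_{2p-1}`: a `p`-gon with vertices `x i = Sum.inr (false, i)`, edges (stems) from `x i` to
`y i = Sum.inr (true, i)`, and the 1-skeleton of the suspension of the `p` points `y i`, with
suspension points `Sum.inl false` (the basepoint) and `Sum.inl true`. -/
def UpsilonOne (p : ℕ) : PGraph :=
  ofEdges (Bool ⊕ (Bool × ZMod p)) (UpsilonOneEdge × ZMod p)
    (fun
      | (.rim, i) => .inr (false, i)
      | (.stem, i) => .inr (false, i)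
      | (.left, _) => .inl false
      | (.right, _) => .inl true)
    (fun
      | (.rim, i) => .inr (false, i + 1)
      | (.stem, i) => .inr (true, i)
      | (.left, i) => .inr (true, i)
      | (.right, i) => .inr (true, i))
    (.inl false)

/-- The four classes of edges of `Υ²_{2p-1}`. -/
inductive UpsilonTwoEdge
  | rimA
  | rimB
  | left
  | right

/-- `Υ²_{2p-1}`: a `2p`-gon with vertices `u 0, w 0, u 1, w 1, …` (that is, a `p`-gon with vertices
`u i = Sum.inr (false, i)` whose edges are subdivided by midpoints `w i = Sum.inr (true, i)`), a
cone over the `u i` with cone point `Sum.inl false` (the basepoint) and a cone over the `w i` with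
cone point `Sum.inl true`. The edges of the `2p`-gon are alternately of class `rimA` and `rimB`. -/
def UpsilonTwo (p : ℕ) : PGraph :=
  ofEdges (Bool ⊕ (Bool × ZMod p)) (UpsilonTwoEdge × ZMod p)
    (fun
      | (.rimA, i) => .inr (false, i)
      | (.rimB, i) => .inr (true, i)
      | (.left, _) => .inl false
      | (.right, _) => .inl true)
    (fun
      | (.rimA, i) => .inr (true, i)
      | (.rimB, i) => .inr (false, i + 1)
      | (.left, i) => .inr (false, i)
      | (.right, i) => .inr (true, i))
    (.inl false)

/-- The directed edges whose class belongs to `S`, in a graph whose edges are indexed by a class in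
`K` and an element of `ℤ/p`. -/
def edgesOf {K : Type} (p : ℕ) (S : Set K) : Set ((K × ZMod p) × Bool) := {d | d.1.1 ∈ S}

/-- The flags of forests of `Υ` that occur, by the classes of the collapsed edges. -/
def upsilonFlags : Set (Set (Set UpsilonEdge)) :=
  { {∅},
    {∅, {.left}},
    {∅, {.right}} }

/-- The flags of forests of `Υ¹` that occur, by the classes of the collapsed edges. -/
def upsilonOneFlags : Set (Set (Set UpsilonOneEdge)) :=
  { {∅},
    {∅, {.stem}},
    {∅, {.left}},
    {∅, {.right}},
    {∅, {.stem, .left}},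
    {∅, {.stem, .right}},
    {∅, {.stem}, {.stem, .left}},
    {∅, {.left}, {.stem, .left}},
    {∅, {.stem}, {.stem, .right}},
    {∅, {.right}, {.stem, .right}} }

/-- The flags of forests of `Υ²` that are preserved by the reflection of `Υ²`. -/
def upsilonTwoDihedralFlags : Set (Set (Set UpsilonTwoEdge)) :=
  { {∅},
    {∅, {.left}},
    {∅, {.right}},
    {∅, {.left, .right}},
    {∅, {.left}, {.left, .right}},
    {∅, {.right}, {.left, .right}} }

/-- The flags of forests of `Υ²` that are preserved by the rotation but not by the reflection, up to
the automorphisms of `Υ²` (the reflection interchanges the classes `rimA` and `rimB`). -/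
def upsilonTwoCyclicFlags : Set (Set (Set UpsilonTwoEdge)) :=
  { {∅, {.rimA}},
    {∅, {.rimA, .left}},
    {∅, {.rimA, .right}},
    {∅, {.rimA}, {.rimA, .left}},
    {∅, {.rimA}, {.rimA, .right}},
    {∅, {.left}, {.rimA, .left}},
    {∅, {.right}, {.rimA, .right}} }

/-- The list of the simplices with exactly `ℤ/p` symmetry: three edges and four 2-simplices, up to
the action of `Aut(F_n)`. -/
def InCyclicList (p : ℕ) {n : ℕ} (σ : Set (SpineVertex n)) : Prop :=
  ∃ T ∈ upsilonTwoCyclicFlags, IsSimplexOfFlag (UpsilonTwo p) (edgesOf p '' T) σ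

/-- The list of simplices with at most dihedral symmetry and maximal vertex `Υ`, `Υ¹` or `Υ²`. -/
def InDihedralList (p : ℕ) {n : ℕ} (σ : Set (SpineVertex n)) : Prop :=
  (∃ T ∈ upsilonFlags, IsSimplexOfFlag (Upsilon p) (edgesOf p '' T) σ) ∨
  (∃ T ∈ upsilonOneFlags, IsSimplexOfFlag (UpsilonOne p) (edgesOf p '' T) σ) ∨
  (∃ T ∈ upsilonTwoDihedralFlags ∪ upsilonTwoCyclicFlags,
    IsSimplexOfFlag (UpsilonTwo p) (edgesOf p '' T) σ)

/-- `σ` has maximal vertex of the form `Ξ_p ∨ Γ_{p-1}`, where `Γ_{p-1}` is a basepointed graph with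
fundamental group free of rank `p - 1`, the cone point of `Ξ_p` is glued to any point of `Γ_{p-1}`
(subdivide `Γ_{p-1}` if this point is not a vertex), and the basepoint is that of `Γ_{p-1}`; and the
forest collapses of `σ` respect the action of `ℤ/p` on `Ξ_p` by rotation. -/
def HasWheelWedgeForm (p : ℕ) {n : ℕ} (σ : Set (SpineVertex n)) : Prop :=
  ∃ (Γ : PGraph) (a : Γ.V) (𝓕 : Set (Set (Γ.wedge a (Xi p)).D)),
    Nonempty (FreeGroup (Fin (p - 1)) ≃* Γ.pi1) ∧
    (∀ F ∈ 𝓕, ∀ d : (Xi p).D, Sum.inr d ∈ F ↔ Sum.inr (Xi.rotate p d) ∈ F) ∧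
    IsSimplexOfFlag (Γ.wedge a (Xi p)) 𝓕 σ

end Auter

/-!
The simplices of the spine are given by graphs with flags of forests, and the stabilizer of such a
simplex is the finite group `S = flagAut G 𝓕` of graph automorphisms that preserve all forests of
the flag (`IsSimplexOfFlag.nonempty_mulEquiv`, `IsSimplex.exists_flag`). The reason is that a reduced
edge path is determined by the element of the edge group that it represents, so that automorphisms
and collapsed forests can be recognized from their effect on the fundamental group. What remains is
to compute `H^*(S; ℤ_(p))` in low degrees.

Two mechanisms determine this cohomology. If `S` acts on a `p`-gon by rotations and reflections,
containing the rotations, and the kernel of the action has no cohomology in low degrees, then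
the exact sequence `0 → M → M^p → M^p → M → 0`, whose middle map is a central difference, shifts the
cohomology by two degrees and twists the coefficients by the sign of the action (`rim_zloc`). Hence
`H^{4k}` is `ℤ/p`, and `H^{2k}` is `ℤ/p` if there is no reflection, while `H^2` vanishes if there is
one. On the other hand, let `z` be an element of order `p`. Suppose that the directed edges moved by
`z` can be indexed by `ℤ/p` so that multiplication of the indices by a primitive root `r` defines an
automorphism; it maps every edge into its orbit under `z`, hence belongs to `S`. Then the subgroup of
`S` that normalizes `⟨z⟩` and preserves its orbits acts on several affine lines over `ℤ/p`. The same
kind of exact sequence, now with differentiation as its middle map, twists by the linear part, and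
induction on the number of lines shows that `H^4` vanishes (`isZero_of_weights`,
`Admissible.isZero_of_untwisted`). This requires that a Sylow subgroup of `S` has the same orbits as
`⟨z⟩`, which holds for a suitable `z` since the Euler characteristic bounds the number of moved edges
by `p²` (`Admissible.exists_generic`).

Therefore a simplex whose stabilizer has `H^4 ≅ ℤ/p` admits a rotation that cannot be rescaled. The
Euler characteristic of a graph of rank `2 p - 1` leaves room for at most four orbits of moved edges
and two orbits of moved vertices (`Admissible.orbit_numbers`), and if the rotation is twisted then
the edges at the moved vertices form a wheel, or the graph is `Υ`, `Υ¹` or `Υ²`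
(`Admissible.classify`). In the first case the graph is a one-point union with a wheel
(`IsWheel.exists_iso`). In the other cases the forests of the flag are unions of classes of edges,
and the classes that form a forest are easily enumerated.

Conversely, in all these graphs the vertices of the rim are permuted as those of a `p`-gon. In the
graphs `Υ` an automorphism that fixes the rim is trivial. In a one-point union with a wheel the group
of these automorphisms either has order prime to `p`, or its elements of order `p` permute a single
set of `p` edges with common ends, which is invisible in low degrees (`Admissible.fixed_wheel`). So
`IsSimplexOfFlag.symmetry` applies. The stabilizer contains a reflection unless some forest contains
exactly one of the two classes of rim edges of `Υ²`.
-/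

set_option linter.unusedSectionVars false

namespace Auter

/-! ### Function modules: Shapiro's lemma and transfer -/

open CategoryTheory Limits

section CohomologyBasics

variable {k : Type} [CommRing k] {G : Type} [Group G] {M : Type} [CommRing M] [Algebra k M]
  {X : Type}

/-- The one-dimensional representation on `M` through a character `c : G → Mˣ`. -/
def chRep (k : Type) [CommRing k] [Algebra k M] (c : G →* Mˣ) : Representation k G M where
  toFun g := LinearMap.mulLeft k (c g : M)
  map_one' := by ext; simp
  map_mul' a b := by ext; simp

@[simp] theorem chRep_apply (c : G →* Mˣ) (g : G) (x : M) : chRep k c g x = c g * x := rfl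

/-- The representation on the functions `X → M` induced by an action of `G` on `X`, twisted by a
character `c`. -/
def funRep (k : Type) [CommRing k] [Algebra k M] (A : G →* Equiv.Perm X) (c : G →* Mˣ) :
    Representation k G (X → M) where
  toFun g :=
    { toFun := fun f x => c g * f (A g⁻¹ x)
      map_add' := fun f f' => by ext; simp [mul_add]
      map_smul' := fun r f => by ext; simp }
  map_one' := by ext; simp
  map_mul' a b := by
    apply LinearMap.ext
    intro f
    ext x
    simp [mul_assoc]

@[simp] theorem funRep_apply (A : G →* Equiv.Perm X) (c : G →* Mˣ) (g : G) (f : X → M) (x : X) :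
    funRep k A c g f x = c g * f (A g⁻¹ x) := rfl

/-- The stabilizer of a point under an action given by a homomorphism to a permutation group. -/
def permStab (A : G →* Equiv.Perm X) (x : X) : Subgroup G where
  carrier := {g | A g x = x}
  one_mem' := by simp
  mul_mem' {a b} ha hb := by
    simp only [Set.mem_ofPred_eq] at *
    simp [ha, hb]
  inv_mem' {a} ha := by
    simp only [Set.mem_ofPred_eq] at *
    rw [map_inv, Equiv.Perm.inv_eq_iff_eq, ha]

@[simp] theorem mem_permStab (A : G →* Equiv.Perm X) (x : X) (g : G) :
    g ∈ permStab A x ↔ A g x = x := Iff.rfl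

/-- The functions on a transitive `G`-set are coinduced from the stabilizer of a point. -/
noncomputable def funRepEquivCoind (A : G →* Equiv.Perm X) (c : G →* Mˣ) (x₀ : X)
    (hA : ∀ x, ∃ g, A g x₀ = x) :
    (funRep k A c).Equiv (Representation.coind (permStab A x₀).subtype
      (chRep k (c.comp (permStab A x₀).subtype))) := by
  classical
  have key : ∀ (F : G → M), (∀ (s : permStab A x₀) (h : G), F (s * h) = c s * F h) →
      ∀ g h : G, A g x₀ = A h x₀ → c g * F g⁻¹ = c h * F h⁻¹ := by
    intro F hF g h hgh
    have hs : g⁻¹ * h ∈ permStab A x₀ := by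
      simp [← hgh]
    have := hF ⟨_, hs⟩ h⁻¹
    simp only [mul_inv_cancel_right] at this
    rw [this, map_mul, map_inv]
    simp [← mul_assoc]
  exact
  { toFun := fun f => ⟨fun h => c h * f (A h⁻¹ x₀), fun s h => by
      have hs : A (s : G)⁻¹ x₀ = x₀ := (inv_mem s.2 : (s : G)⁻¹ ∈ permStab A x₀)
      simp only [Subgroup.coe_subtype, mul_inv_rev, map_mul, Equiv.Perm.mul_apply, hs,
        MonoidHom.comp_apply, chRep_apply]
      simp [mul_assoc]⟩
    map_add' := fun f f' => by ext; simp [mul_add]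
    map_smul' := fun r f => by ext; simp
    isIntertwining' := fun g => by
      apply LinearMap.ext
      intro f
      ext h
      change (c h : M) * (c g * f (A g⁻¹ (A h⁻¹ x₀))) = c (h * g) * f (A (h * g)⁻¹ x₀)
      simp [mul_assoc]
    invFun := fun F x => c (hA x).choose * F.1 (hA x).choose⁻¹
    left_inv := fun f => by
      ext x
      simp [← mul_assoc, (hA x).choose_spec]
    right_inv := fun F => by
      ext h
      have := key F.1 F.2 (hA (A h⁻¹ x₀)).choose h⁻¹ (hA (A h⁻¹ x₀)).choose_spec
      simp only
      rw [this]
      simp [← mul_assoc] }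

/-- Shapiro's lemma, as far as vanishing is concerned. -/
theorem isZero_funRep (A : G →* Equiv.Perm X) (c : G →* Mˣ) (x₀ : X)
    (hA : ∀ x, ∃ g, A g x₀ = x) {n : ℕ}
    (h : IsZero (groupCohomology (Rep.of (chRep k (c.comp (permStab A x₀).subtype))) n)) :
    IsZero (groupCohomology (Rep.of (funRep k A c)) n) := by
  have e₁ := (groupCohomology.functor k G n).mapIso (Rep.mkIso (funRepEquivCoind (k := k) A c x₀ hA))
  have e₂ := groupCohomology.coindIso (Rep.of (chRep k (c.comp (permStab A x₀).subtype))) n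
  exact (h.of_iso e₂).of_iso e₁

/-- Multiplication by a scalar on a representation. -/
def mulHom {V : Type} [AddCommGroup V] [Module k V] (ρ : Representation k G V) (r : k) :
    Rep.of ρ ⟶ Rep.of ρ :=
  Rep.ofHom ⟨r • LinearMap.id, fun g => by ext; simp⟩

theorem mulHom_mul {V : Type} [AddCommGroup V] [Module k V] (ρ : Representation k G V) (r s : k) :
    mulHom ρ (r * s) = mulHom ρ s ≫ mulHom ρ r := by
  ext v
  simp [mulHom, mul_smul]

theorem mulHom_one {V : Type} [AddCommGroup V] [Module k V] (ρ : Representation k G V) :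
    mulHom ρ (1 : k) = 𝟙 _ := by
  ext v
  simp [mulHom]

theorem isIso_mulHom {V : Type} [AddCommGroup V] [Module k V] (ρ : Representation k G V) {r : k}
    (hr : IsUnit r) : IsIso (mulHom ρ r) := by
  obtain ⟨u, rfl⟩ := hr
  refine ⟨mulHom ρ (u⁻¹ : kˣ), ?_, ?_⟩ <;> rw [← mulHom_mul] <;> simp [mulHom_one]

/-- The transfer argument: multiplication by the index of `N` factors through the cohomology of
a coinduced module, hence vanishes on cohomology if the cohomology of `N` vanishes. -/
theorem map_mulHom_index_eq_zero (N : Subgroup G) [Finite (G ⧸ N)] (c : G →* Mˣ) {n : ℕ}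
    (h : IsZero (groupCohomology (Rep.of (chRep k (c.comp N.subtype))) n)) :
    (groupCohomology.functor k G n).map (mulHom (chRep k c) (N.index : k)) = 0 := by
  classical
  have : Fintype (G ⧸ N) := Fintype.ofFinite _
  let A : G →* Equiv.Perm (G ⧸ N) := MulAction.toPermHom G (G ⧸ N)
  have hst : permStab A ((1 : G) : G ⧸ N) = N := by
    ext g
    rw [mem_permStab]
    change g • ((1 : G) : G ⧸ N) = ((1 : G) : G ⧸ N) ↔ _
    rw [MulAction.Quotient.smul_coe, eq_comm, QuotientGroup.eq]
    simp
  have hz : IsZero (groupCohomology (Rep.of (funRep k A c)) n) := by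
    refine isZero_funRep A c ((1 : G) : G ⧸ N) (fun x => ?_) ?_
    · obtain ⟨g, rfl⟩ := QuotientGroup.mk_surjective x
      refine ⟨g, ?_⟩
      change g • ((1 : G) : G ⧸ N) = _
      rw [MulAction.Quotient.smul_coe]
      simp
    · rw [hst]
      exact h
  let ι : Rep.of (chRep k c) ⟶ Rep.of (funRep k A c) :=
    Rep.ofHom ⟨{ toFun := fun m _ => m
                 map_add' := fun _ _ => rfl
                 map_smul' := fun _ _ => rfl }, fun g => by ext; simp⟩
  let π : Rep.of (funRep k A c) ⟶ Rep.of (chRep k c) :=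
    Rep.ofHom ⟨{ toFun := fun f => ∑ x, f x
                 map_add' := fun _ _ => by simp [Finset.sum_add_distrib]
                 map_smul' := fun _ _ => by simp [Finset.smul_sum] }, fun g => by
      apply LinearMap.ext
      intro f
      simp only [LinearMap.coe_comp, LinearMap.coe_mk, AddHom.coe_mk, Function.comp_apply,
        funRep_apply, chRep_apply]
      rw [← Finset.mul_sum, Equiv.sum_comp (A g⁻¹) f]⟩
  have hc : mulHom (chRep k c) (N.index : k) = ι ≫ π := by
    ext v
    change (N.index : k) • v = ∑ x : G ⧸ N, v
    rw [Finset.sum_const, Finset.card_univ, ← Nat.card_eq_fintype_card, ← Subgroup.index,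
      Nat.cast_smul_eq_nsmul]
  have hz' : IsZero ((groupCohomology.functor k G n).obj (Rep.of (funRep k A c))) := hz
  rw [hc, Functor.map_comp, hz'.eq_zero_of_tgt ((groupCohomology.functor k G n).map ι)]
  exact zero_comp

/-- If the index of `N` is invertible then vanishing of the cohomology of `N` implies vanishing of
the cohomology of `G`. -/
theorem isZero_of_index (N : Subgroup G) [Finite (G ⧸ N)] (c : G →* Mˣ) {n : ℕ}
    (hu : IsUnit (N.index : k))
    (h : IsZero (groupCohomology (Rep.of (chRep k (c.comp N.subtype))) n)) :
    IsZero (groupCohomology (Rep.of (chRep k c)) n) := by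
  have := isIso_mulHom (chRep k c) hu
  have h0 := map_mulHom_index_eq_zero N c h
  have : IsIso ((groupCohomology.functor k G n).map (mulHom (chRep k c) (N.index : k))) :=
    inferInstance
  rw [h0] at this
  have hz : IsZero ((groupCohomology.functor k G n).obj (Rep.of (chRep k c))) := by
    have h1 := @IsIso.hom_inv_id _ _ _ _ _ this
    rw [IsZero.iff_id_eq_zero, ← h1]
    exact zero_comp
  exact hz

/-- The order of the group annihilates its cohomology in positive degrees. -/
theorem map_mulHom_card_eq_zero [Finite G] (c : G →* Mˣ) (n : ℕ) :
    (groupCohomology.functor k G (n + 1)).map (mulHom (chRep k c) (Nat.card G : k)) = 0 := by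
  have := map_mulHom_index_eq_zero (k := k) (⊥ : Subgroup G) c (n := n + 1)
    (isZero_groupCohomology_succ_of_subsingleton _ _)
  rwa [Subgroup.index_bot] at this

theorem isZero_of_isUnit_card [Finite G] (c : G →* Mˣ) (n : ℕ) (hu : IsUnit (Nat.card G : k)) :
    IsZero (groupCohomology (Rep.of (chRep k c)) (n + 1)) :=
  isZero_of_index (⊥ : Subgroup G) c (by rwa [Subgroup.index_bot])
    (isZero_groupCohomology_succ_of_subsingleton _ _)

/-- The cohomology in degree zero vanishes if there are no invariants. -/
theorem isZero_zero_of_invariants {V : Type} [AddCommGroup V] [Module k V]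
    (ρ : Representation k G V) (h : ∀ v, (∀ g, ρ g v = v) → v = 0) :
    IsZero (groupCohomology (Rep.of ρ) 0) := by
  refine IsZero.of_iso ?_ (groupCohomology.H0Iso (Rep.of ρ))
  rw [ModuleCat.isZero_iff_subsingleton]
  refine ⟨fun a b => Subtype.ext ?_⟩
  rw [h a.1 a.2, h b.1 b.2]

/-- Transport of cohomology along an isomorphism of groups. -/
theorem nonempty_iso_of_mulEquiv {H : Type} [Group H] (e : H ≃* G) (c : G →* Mˣ) (n : ℕ) :
    Nonempty (groupCohomology (Rep.of (chRep k c)) n ≅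
      groupCohomology (Rep.of (chRep k (c.comp (e : H →* G)))) n) :=
  ⟨(groupCohomology.mapIso (A := Rep.of (chRep k c))
    (B := Rep.of (chRep k (c.comp (e : H →* G)))) e (LinearEquiv.refl _ _) (by
      intro g
      ext x
      simp) n).symm⟩

end CohomologyBasics

end Auter

namespace Auter

/-! ### Four-term exact sequences and dimension shifting -/

open CategoryTheory Limits

section FourTerm

variable {k : Type} [CommRing k] {G : Type} [Group G]

/-- A short exact sequence of representations from an exact sequence of linear maps. -/
theorem shortExact_of {V₁ V₂ V₃ : Type} [AddCommGroup V₁] [AddCommGroup V₂] [AddCommGroup V₃]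
    [Module k V₁] [Module k V₂] [Module k V₃] {ρ₁ : Representation k G V₁}
    {ρ₂ : Representation k G V₂} {ρ₃ : Representation k G V₃}
    (f : ρ₁.IntertwiningMap ρ₂) (g : ρ₂.IntertwiningMap ρ₃) (hf : Function.Injective f)
    (hg : Function.Surjective g) (hfg : ∀ x, g x = 0 ↔ ∃ y, f y = x) :
    (ShortComplex.mk (Rep.ofHom f) (Rep.ofHom g) (by
      ext x
      exact (hfg _).2 ⟨x, rfl⟩)).ShortExact where
  exact := by
    rw [← ShortComplex.exact_map_iff_of_faithful _ (forget₂ (Rep k G) (ModuleCat k)),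
      ShortComplex.moduleCat_exact_iff]
    intro x hx
    exact (hfg x).1 hx
  mono_f := (Rep.mono_iff_injective _).2 hf
  epi_g := (Rep.epi_iff_surjective _).2 hg

/-- In a short exact sequence, the cohomology of the first module vanishes in a given degree if
that of the second one does, and that of the third one does in the degree below. -/
theorem isZero_left {S : ShortComplex (Rep k G)} (hS : S.ShortExact) {n : ℕ}
    (h₂ : IsZero (groupCohomology S.X₂ n))
    (h₃ : ∀ m, m + 1 = n → IsZero (groupCohomology S.X₃ m)) :
    IsZero (groupCohomology S.X₁ n) := by
  rcases n with _ | m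
  · have := hS.mono_f
    have hm : Mono (groupCohomology.map (MonoidHom.id G) S.f 0) := inferInstance
    exact @IsZero.of_mono _ _ _ _ _ _ hm h₂
  · exact (groupCohomology.mapShortComplex₁_exact hS (rfl : m + 1 = m + 1)).isZero_of_both_zeros
      ((h₃ m rfl).eq_zero_of_src _) (h₂.eq_zero_of_tgt _)

variable {M : Type} [CommRing M] [Algebra k M] {X : Type} [Fintype X]

/-- The functions with sum zero. -/
def sumZero (k M X : Type) [CommRing k] [CommRing M] [Algebra k M] [Fintype X] :
    Submodule k (X → M) where
  carrier := {f | ∑ x, f x = 0}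
  add_mem' {f g} hf hg := by
    simp only [Set.mem_ofPred_eq, Pi.add_apply] at *
    rw [Finset.sum_add_distrib, hf, hg, add_zero]
  zero_mem' := by simp
  smul_mem' r f hf := by
    simp only [Set.mem_ofPred_eq, Pi.smul_apply] at *
    rw [← Finset.smul_sum, hf, smul_zero]

theorem mem_sumZero {f : X → M} : f ∈ sumZero k M X ↔ ∑ x, f x = 0 := Iff.rfl

/-- The representation on the functions with sum zero. -/
def sumZeroRep (k : Type) [CommRing k] [Algebra k M] (A : G →* Equiv.Perm X) (c : G →* Mˣ) :
    Representation k G (sumZero k M X) where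
  toFun g := (funRep k A c g).restrict fun f hf => by
    rw [mem_sumZero] at *
    simp only [funRep_apply]
    rw [← Finset.mul_sum, Equiv.sum_comp (A g⁻¹) f, hf, mul_zero]
  map_one' := by
    apply LinearMap.ext
    intro f
    apply Subtype.ext
    change funRep k A c 1 f.1 = f.1
    rw [map_one]
    rfl
  map_mul' a b := by
    apply LinearMap.ext
    intro f
    apply Subtype.ext
    change funRep k A c (a * b) f.1 = funRep k A c a (funRep k A c b f.1)
    rw [map_mul]
    rfl

/-- A linear endomorphism of the functions on `X` that extends to an exact sequence
`0 → M → (X → M) → (X → M) → M → 0` of representations with the given characters; the first map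
is the inclusion of the constants, the last one is the sum. -/
structure IsDifference (A : G →* Equiv.Perm X) (c c' : G →* Mˣ)
    (T : (X → M) →ₗ[k] (X → M)) : Prop where
  ker : ∀ f, T f = 0 ↔ ∃ m : M, f = fun _ => m
  range : ∀ f, (∃ f', T f' = f) ↔ ∑ x, f x = 0
  comm : ∀ g f, T (funRep k A c g f) = funRep k A c' g (T f)

variable {A : G →* Equiv.Perm X} {c c' : G →* Mˣ} {T : (X → M) →ₗ[k] (X → M)}

/-- The inclusion of the constant functions. -/
def constMap (k : Type) [CommRing k] [Algebra k M] (A : G →* Equiv.Perm X) (c : G →* Mˣ) :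
    (chRep k c).IntertwiningMap (funRep k A c) :=
  ⟨{ toFun := fun m _ => m
     map_add' := fun _ _ => rfl
     map_smul' := fun _ _ => rfl }, fun g => by ext; simp⟩

/-- The sum of the values of a function. -/
def sumMap (k : Type) [CommRing k] [Algebra k M] (A : G →* Equiv.Perm X) (c : G →* Mˣ) :
    (funRep k A c).IntertwiningMap (chRep k c) :=
  ⟨{ toFun := fun f => ∑ x, f x
     map_add' := fun _ _ => by simp [Finset.sum_add_distrib]
     map_smul' := fun _ _ => by simp [Finset.smul_sum] }, fun g => by
      apply LinearMap.ext
      intro f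
      simp only [LinearMap.coe_comp, LinearMap.coe_mk, AddHom.coe_mk, Function.comp_apply,
        funRep_apply, chRep_apply]
      rw [← Finset.mul_sum, Equiv.sum_comp (A g⁻¹) f]⟩

/-- The difference operator as a map onto the functions with sum zero. -/
def IsDifference.toSumZero (h : IsDifference A c c' T) :
    (funRep k A c).IntertwiningMap (sumZeroRep k A c') :=
  ⟨T.codRestrict (sumZero k M X) fun f => mem_sumZero.2 ((h.range _).1 ⟨f, rfl⟩), fun g => by
    apply LinearMap.ext
    intro f
    exact Subtype.ext (h.comm g f)⟩

/-- The inclusion of the functions with sum zero. -/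
def sumZeroIncl (k : Type) [CommRing k] [Algebra k M] (A : G →* Equiv.Perm X) (c : G →* Mˣ) :
    (sumZeroRep k A c).IntertwiningMap (funRep k A c) :=
  ⟨Submodule.subtype (sumZero k M X), fun _ => rfl⟩

theorem IsDifference.shortExact₁ [Nonempty X] (h : IsDifference A c c' T) :
    (ShortComplex.mk (Rep.ofHom (constMap k A c)) (Rep.ofHom h.toSumZero) (by
      ext m
      exact congrFun ((h.ker _).2 ⟨m, rfl⟩) _)).ShortExact :=
  shortExact_of _ _
    (fun a b hab => congrFun hab (Classical.arbitrary X))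
    (fun f => by
      obtain ⟨f', hf'⟩ := (h.range f.1).2 (mem_sumZero.1 f.2)
      exact ⟨f', Subtype.ext hf'⟩)
    (fun f => by
      refine (Subtype.ext_iff (a2 := (0 : sumZero k M X))).trans ((h.ker f).trans ?_)
      exact ⟨fun ⟨m, hm⟩ => ⟨m, hm.symm⟩, fun ⟨m, hm⟩ => ⟨m, hm.symm⟩⟩)

theorem shortExact₂ [Nonempty X] (A : G →* Equiv.Perm X) (c : G →* Mˣ) :
    (ShortComplex.mk (Rep.ofHom (sumZeroIncl k A c)) (Rep.ofHom (sumMap k A c)) (by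
      ext f
      exact mem_sumZero.1 f.2)).ShortExact := by
  classical
  exact shortExact_of _ _ Subtype.val_injective
    (fun m => ⟨Pi.single (Classical.arbitrary X) m, by
      change ∑ x, (Pi.single (Classical.arbitrary X) m : X → M) x = m
      simp⟩)
    (fun f => ⟨fun hf => ⟨⟨f, mem_sumZero.2 hf⟩, rfl⟩, fun ⟨y, hy⟩ => hy ▸ mem_sumZero.1 y.2⟩)

/-- Vanishing along the sequence `0 → M → (X → M) → (X → M) → M → 0`. -/
theorem IsDifference.isZero [Nonempty X] (h : IsDifference A c c' T) {n : ℕ}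
    (h₁ : IsZero (groupCohomology (Rep.of (funRep k A c)) n))
    (h₂ : ∀ m, m + 1 = n → IsZero (groupCohomology (Rep.of (funRep k A c')) m))
    (h₃ : ∀ m, m + 2 = n → IsZero (groupCohomology (Rep.of (chRep k c')) m)) :
    IsZero (groupCohomology (Rep.of (chRep k c)) n) :=
  isZero_left h.shortExact₁ h₁ fun m hm =>
    isZero_left (shortExact₂ A c') (h₂ m hm) fun l hl => h₃ l (by omega)

/-- Cohomology with values in the functions with sum zero, one degree lower. -/
theorem IsDifference.nonempty_iso_sumZero [Nonempty X] (h : IsDifference A c c' T) {n : ℕ}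
    (h₁ : IsZero (groupCohomology (Rep.of (funRep k A c)) n))
    (h₂ : IsZero (groupCohomology (Rep.of (funRep k A c)) (n + 1))) :
    Nonempty (groupCohomology (Rep.of (sumZeroRep k A c')) n ≅
      groupCohomology (Rep.of (chRep k c)) (n + 1)) := by
  have := groupCohomology.isIso_δ_of_isZero h.shortExact₁ n h₁ h₂
  exact ⟨@asIso _ _ _ _ _ this⟩

/-- Dimension shifting by two. -/
theorem IsDifference.nonempty_iso [Nonempty X] (h : IsDifference A c c' T) {n : ℕ}
    (h₁ : IsZero (groupCohomology (Rep.of (funRep k A c')) n))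
    (h₂ : IsZero (groupCohomology (Rep.of (funRep k A c')) (n + 1)))
    (h₃ : IsZero (groupCohomology (Rep.of (funRep k A c)) (n + 1)))
    (h₄ : IsZero (groupCohomology (Rep.of (funRep k A c)) (n + 2))) :
    Nonempty (groupCohomology (Rep.of (chRep k c')) n ≅
      groupCohomology (Rep.of (chRep k c)) (n + 2)) := by
  have := groupCohomology.isIso_δ_of_isZero (shortExact₂ A c') n h₁ h₂
  obtain ⟨e⟩ := h.nonempty_iso_sumZero h₃ h₄
  exact ⟨(@asIso _ _ _ _ _ this) ≪≫ e⟩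

/-- If the action is transitive and `c' = 1`, then the second cohomology group is the cokernel of
the multiplication by the number of elements of `X`. -/
theorem IsDifference.nonempty_addEquiv [Nonempty X] (h : IsDifference A c c' T)
    (hA : ∀ x y, ∃ g, A g x = y) (hc' : c' = 1)
    (h₁ : IsZero (groupCohomology (Rep.of (funRep k A c')) 1))
    (h₂ : IsZero (groupCohomology (Rep.of (funRep k A c)) 1))
    (h₃ : IsZero (groupCohomology (Rep.of (funRep k A c)) 2))
    {Q : Type} [AddCommGroup Q] (q : M →+ Q) (hq : Function.Surjective q)
    (hker : ∀ m, q m = 0 ↔ ∃ m', m = (Fintype.card X) • m') :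
    Nonempty (groupCohomology (Rep.of (chRep k c)) 2 ≃+ Q) := by
  obtain ⟨e⟩ := h.nonempty_iso_sumZero h₂ h₃
  have hS := shortExact₂ (k := k) A c'
  have hepi := groupCohomology.epi_δ_of_isZero hS 0 h₁
  have hinv : ∀ m : M, m ∈ (Rep.of (chRep k c')).ρ.invariants := by
    intro m g
    simp [hc']
  let ψ : M →+ groupCohomology (Rep.of (sumZeroRep k A c')) 1 :=
    { toFun := fun m => groupCohomology.δ hS 0 1 rfl
        ((groupCohomology.H0Iso (Rep.of (chRep k c'))).inv ⟨m, hinv m⟩)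
      map_zero' := by
        have : (⟨0, hinv 0⟩ : (Rep.of (chRep k c')).ρ.invariants) = 0 := rfl
        rw [this, map_zero, map_zero]
      map_add' := fun a b => by
        have : (⟨a + b, hinv _⟩ : (Rep.of (chRep k c')).ρ.invariants) =
          ⟨a, hinv _⟩ + ⟨b, hinv _⟩ := rfl
        rw [this, map_add, map_add] }
  have hψ : Function.Surjective ψ := by
    intro y
    obtain ⟨x, hx⟩ := (ModuleCat.epi_iff_surjective _).1 hepi y
    refine ⟨((groupCohomology.H0Iso (Rep.of (chRep k c'))).hom x).1, ?_⟩
    change groupCohomology.δ hS 0 1 rfl ((groupCohomology.H0Iso (Rep.of (chRep k c'))).inv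
      ((groupCohomology.H0Iso (Rep.of (chRep k c'))).hom x)) = y
    rw [Iso.hom_inv_id_apply]
    exact hx
  have hψk : ∀ m, ψ m = 0 ↔ ∃ m', m = (Fintype.card X) • m' := by
    intro m
    have hnat := groupCohomology.map_id_comp_H0Iso_hom (Rep.ofHom (sumMap k A c'))
    constructor
    · intro hm
      obtain ⟨x, hx⟩ := (ShortComplex.moduleCat_exact_iff _).1
        (groupCohomology.mapShortComplex₃_exact hS (rfl : 0 + 1 = 1)) _ hm
      have hx' : groupCohomology.map (MonoidHom.id G) (Rep.ofHom (sumMap k A c')) 0 x =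
        (groupCohomology.H0Iso (Rep.of (chRep k c'))).inv ⟨m, hinv m⟩ := hx
      set f := (groupCohomology.H0Iso (Rep.of (funRep k A c'))).hom x with hf
      have hfm : ∑ y, f.1 y = m := by
        have h5 := ConcreteCategory.congr_hom hnat x
        have h6 := congrArg (groupCohomology.H0Iso (Rep.of (chRep k c'))).hom hx'
        rw [Iso.inv_hom_id_apply] at h6
        have h7 := congrArg Subtype.val (h6.symm.trans h5)
        exact h7.symm
      have hconst : ∀ y, f.1 y = f.1 (Classical.arbitrary X) := by
        intro y
        obtain ⟨g, hg⟩ := hA y (Classical.arbitrary X)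
        have h8 := congrFun (f.2 g) (Classical.arbitrary X)
        change funRep k A c' g f.1 (Classical.arbitrary X) = _ at h8
        have hone : (c' g : M) = 1 := by simp [hc']
        have h9 : A g⁻¹ (Classical.arbitrary X) = y := by rw [← hg]; simp
        rwa [funRep_apply, hone, h9, one_mul] at h8
      refine ⟨f.1 (Classical.arbitrary X), ?_⟩
      rw [← hfm, Finset.sum_congr rfl fun y _ => hconst y]
      simp
    · rintro ⟨m', rfl⟩
      have hf : (fun _ => m' : X → M) ∈ (Rep.of (funRep k A c')).ρ.invariants := by
        intro g
        ext x
        simp [hc']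
      have h5 := ConcreteCategory.congr_hom hnat
        ((groupCohomology.H0Iso (Rep.of (funRep k A c'))).inv ⟨_, hf⟩)
      have hz := (groupCohomology.mapShortComplex₃ hS (rfl : 0 + 1 = 1)).zero
      have hz' := ConcreteCategory.congr_hom hz
        ((groupCohomology.H0Iso (Rep.of (funRep k A c'))).inv ⟨_, hf⟩)
      have h6 : (groupCohomology.H0Iso (Rep.of (chRep k c'))).inv ⟨Fintype.card X • m', hinv _⟩ =
          groupCohomology.map (MonoidHom.id G) (Rep.ofHom (sumMap k A c')) 0
            ((groupCohomology.H0Iso (Rep.of (funRep k A c'))).inv ⟨_, hf⟩) := by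
        apply (ConcreteCategory.bijective_of_isIso
          (groupCohomology.H0Iso (Rep.of (chRep k c'))).hom).1
        rw [Iso.inv_hom_id_apply]
        refine Eq.trans ?_ h5.symm
        apply Subtype.ext
        rw [ConcreteCategory.comp_apply, Iso.inv_hom_id_apply]
        change Fintype.card X • m' = ∑ x : X, m'
        simp
      change groupCohomology.δ hS 0 1 rfl _ = 0
      rw [h6]
      exact hz'
  have hk : ψ.ker = q.ker := by
    ext m
    rw [AddMonoidHom.mem_ker, AddMonoidHom.mem_ker, hψk, hker]
  exact ⟨(e.symm.toLinearEquiv.toAddEquiv).trans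
    ((QuotientAddGroup.quotientKerEquivOfSurjective ψ hψ).symm.trans
      ((QuotientAddGroup.quotientAddEquivOfEq hk).trans
        (QuotientAddGroup.quotientKerEquivOfSurjective q hq)))⟩

end FourTerm

end Auter

namespace Auter

/-! ### Difference operators on functions on `ℤ/p` -/

open CategoryTheory Limits Polynomial

section Operators

variable {p : ℕ} [Fact p.Prime]

theorem eq_const_of_shift {M : Type} {f : ZMod p → M} (h : ∀ x, f (x + 1) = f x) :
    ∃ m, f = fun _ => m := by
  refine ⟨f 0, funext fun x => ?_⟩
  have : ∀ j : ℕ, f (j : ZMod p) = f 0 := by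
    intro j
    induction j with
    | zero => simp
    | succ j ih => rw [Nat.cast_succ, h, ih]
  rw [← ZMod.natCast_zmod_val x, this]

theorem sum_zmod {M : Type} [AddCommMonoid M] (f : ZMod p → M) :
    ∑ x, f x = ∑ j ∈ Finset.range p, f (j : ZMod p) := by
  refine (Finset.sum_bij (g := f) (fun (j : ℕ) _ => (j : ZMod p)) (fun _ _ => Finset.mem_univ _) ?_ ?_
    (fun _ _ => rfl)).symm
  · intro a ha b hb hab
    rw [Finset.mem_range] at ha hb
    have := congrArg ZMod.val hab
    rwa [ZMod.val_cast_of_lt ha, ZMod.val_cast_of_lt hb] at this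
  · intro b _
    exact ⟨b.val, Finset.mem_range.2 (ZMod.val_lt b), ZMod.natCast_zmod_val b⟩

theorem exists_shift_sub {M : Type} [AddCommGroup M] {f : ZMod p → M} (h : ∑ x, f x = 0) :
    ∃ g : ZMod p → M, ∀ x, g (x + 1) - g x = f x := by
  refine ⟨fun x => ∑ j ∈ Finset.range x.val, f (j : ZMod p), fun x => ?_⟩
  have hp := (Fact.out : p.Prime)
  have hx := ZMod.val_lt x
  dsimp only
  rcases Nat.lt_or_ge (x.val + 1) p with h1 | h1
  · have : (x + 1).val = x.val + 1 := by
      rw [ZMod.val_add_of_lt] <;> rw [ZMod.val_one p]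
      exact h1
    rw [this, Finset.sum_range_succ, ZMod.natCast_zmod_val]
    abel
  · have h2 : x.val + 1 = p := by omega
    have h3 : x + 1 = 0 := by
      rw [← ZMod.natCast_zmod_val x]
      exact_mod_cast (ZMod.natCast_eq_zero_iff _ _).2 (by rw [h2])
    have h4 : ∑ j ∈ Finset.range x.val, f (j : ZMod p) + f x = 0 := by
      have h5 := Finset.sum_range_succ (fun j : ℕ => f (j : ZMod p)) x.val
      rw [h2, ← sum_zmod f, h, ZMod.natCast_zmod_val] at h5
      exact h5.symm
    rw [h3, ZMod.val_zero, Finset.sum_range_zero, zero_sub, ← eq_neg_of_add_eq_zero_right h4]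

/-- The symmetric difference operator `f ↦ (x ↦ f (x + 1/2) - f (x - 1/2))`, which is equivariant up
to a sign for the dihedral group. -/
noncomputable def centralDiff (k : Type) [CommRing k] (p : ℕ) [Fact p.Prime] :
    (ZMod p → k) →ₗ[k] (ZMod p → k) where
  toFun f x := f (x + 2⁻¹) - f (x - 2⁻¹)
  map_add' f g := by ext; simp; ring
  map_smul' r f := by ext; simp; ring

theorem two_inv_add (h2 : p ≠ 2) : (2⁻¹ + 2⁻¹ : ZMod p) = 1 := by
  have : (2 : ZMod p) ≠ 0 := by
    have h := (ZMod.natCast_eq_zero_iff 2 p).not.2 (by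
      rw [Nat.prime_dvd_prime_iff_eq Fact.out Nat.prime_two]
      exact h2)
    exact_mod_cast h
  field_simp
  norm_num

/-- The central difference `f (x + 1/2) - f (x - 1/2)` changes sign under reflections, so it relates a
character of a dihedral group to its twist by the sign. -/
theorem isDifference_centralDiff {k : Type} [CommRing k] {G : Type} [Group G] (h2 : p ≠ 2)
    (A : G →* Equiv.Perm (ZMod p)) (ε : G →* ℤˣ)
    (hA : ∀ g x y, A g x - A g y = ((ε g : ℤ) : ZMod p) * (x - y)) (c : G →* kˣ) :
    IsDifference A c (c * (Units.map (Int.castRingHom k : ℤ →* k)).comp ε) (centralDiff k p) where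
  ker f := by
    constructor
    · intro h
      refine eq_const_of_shift fun x => ?_
      have := congrFun h (x + 2⁻¹)
      simp only [centralDiff, LinearMap.coe_mk, AddHom.coe_mk, Pi.zero_apply] at this
      rw [add_assoc, two_inv_add h2, add_sub_cancel_right] at this
      exact sub_eq_zero.1 this
    · rintro ⟨m, rfl⟩
      ext x
      simp [centralDiff]
  range f := by
    constructor
    · rintro ⟨g, rfl⟩
      simp only [centralDiff, LinearMap.coe_mk, AddHom.coe_mk]
      rw [Finset.sum_sub_distrib]
      exact sub_eq_zero.2 ((Equiv.sum_comp (Equiv.addRight (2⁻¹ : ZMod p)) g).trans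
        (Equiv.sum_comp (Equiv.subRight (2⁻¹ : ZMod p)) g).symm)
    · intro h
      obtain ⟨g, hg⟩ := exists_shift_sub h
      refine ⟨fun x => g (x + 2⁻¹), ?_⟩
      ext x
      simp only [centralDiff, LinearMap.coe_mk, AddHom.coe_mk]
      rw [add_assoc, two_inv_add h2, sub_add_cancel, hg]
  comm g f := by
    ext x
    simp only [centralDiff, LinearMap.coe_mk, AddHom.coe_mk, funRep_apply, MonoidHom.mul_apply,
      Units.val_mul]
    have h := hA g⁻¹
    have h₁ := h (x + 2⁻¹) x
    have h₂ := h (x - 2⁻¹) x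
    rw [map_inv ε] at h₁ h₂
    rcases Int.units_eq_one_or (ε g) with he | he <;>
      simp only [he, inv_one, Units.val_one, Int.cast_one, one_mul, inv_neg, Units.val_neg,
        Int.cast_neg, neg_mul, add_sub_cancel_left, sub_sub_cancel_left, neg_neg] at h₁ h₂
    · rw [eq_add_of_sub_eq h₁, eq_add_of_sub_eq h₂]
      simp [he, sub_eq_add_neg, add_comm]
      ring
    · rw [eq_add_of_sub_eq h₁, eq_add_of_sub_eq h₂]
      simp [he, sub_eq_add_neg, add_comm]
      ring

/-- The operator `f ↦ (x ↦ -∑_{c ≠ 0} f (x + c) / c)` on the functions `ZMod p → ZMod p`. It is the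
derivative of polynomial functions of degree less than `p`, hence equivariant up to a character for
the affine group. -/
noncomputable def polyDeriv (k : Type) [CommRing k] (p : ℕ) [Fact p.Prime] [Algebra k (ZMod p)] :
    (ZMod p → ZMod p) →ₗ[k] (ZMod p → ZMod p) where
  toFun f x := -∑ c : ZMod p, c⁻¹ * f (x + c)
  map_add' f g := by
    ext x
    simp only [Pi.add_apply, mul_add, Finset.sum_add_distrib]
    ring
  map_smul' r f := by
    ext x
    simp only [Pi.smul_apply, RingHom.id_apply, smul_neg, Finset.smul_sum, mul_smul_comm]

theorem polyDeriv_apply (k : Type) [CommRing k] [Algebra k (ZMod p)] (f : ZMod p → ZMod p)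
    (x : ZMod p) : polyDeriv k p f x = -∑ c : ZMod p, c⁻¹ * f (x + c) := rfl

/-- The shift operator. -/
def shift (p : ℕ) [Fact p.Prime] : Module.End (ZMod p) (ZMod p → ZMod p) where
  toFun f x := f (x + 1)
  map_add' _ _ := rfl
  map_smul' _ _ := rfl

theorem shift_pow_apply (j : ℕ) (f : ZMod p → ZMod p) (x : ZMod p) :
    (shift p ^ j) f x = f (x + j) := by
  induction j generalizing x with
  | zero => simp
  | succ j ih =>
    rw [pow_succ', Module.End.mul_apply]
    change (shift p ^ j) f (x + 1) = _
    rw [ih, Nat.cast_succ]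
    congr 1
    ring

theorem sum_inv_eq_zero (h2 : p ≠ 2) : ∑ c : ZMod p, c⁻¹ = 0 := by
  have h := Fintype.sum_equiv (Equiv.neg (ZMod p)) (fun c => c⁻¹) (fun c => -c⁻¹)
    (fun c => by simp [inv_neg])
  rw [Finset.sum_neg_distrib] at h
  have h4 : (∑ c : ZMod p, c⁻¹) * (2⁻¹ + 2⁻¹) = 0 := by
    have : (∑ c : ZMod p, c⁻¹) + ∑ c : ZMod p, c⁻¹ = 0 := by
      nth_rewrite 1 [h]
      ring
    linear_combination 2⁻¹ * this
  rwa [two_inv_add h2, mul_one] at h4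

/-- The difference quotient of the polynomial in the shift operator that represents `polyDeriv`. -/
noncomputable def derivQuot (p : ℕ) : (ZMod p)[X] :=
  -∑ j ∈ Finset.range p, C ((j : ZMod p)⁻¹) * ∑ l ∈ Finset.range j, X ^ l

/-- The constant term vanishes because the inverses of the elements of `ZMod p` add up to zero. -/
theorem derivQuot_mul (h2 : p ≠ 2) :
    derivQuot p * (X - 1) = -∑ j ∈ Finset.range p, C ((j : ZMod p)⁻¹) * X ^ j := by
  have h0 : ∑ j ∈ Finset.range p, (C ((j : ZMod p)⁻¹) : (ZMod p)[X]) = 0 := by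
    rw [← map_sum, ← sum_zmod (fun c : ZMod p => c⁻¹), sum_inv_eq_zero h2, map_zero]
  rw [derivQuot, neg_mul, Finset.sum_mul]
  congr 1
  calc _ = ∑ j ∈ Finset.range p, (C ((j : ZMod p)⁻¹) * X ^ j - C ((j : ZMod p)⁻¹)) :=
        Finset.sum_congr rfl fun j _ => by rw [mul_assoc, geom_sum_mul, mul_sub, mul_one]
    _ = _ := by rw [Finset.sum_sub_distrib, h0, sub_zero]

theorem derivQuot_eval : (derivQuot p).eval 1 = 1 := by
  have hp := (Fact.out : p.Prime)
  have : ∑ j ∈ Finset.range p, (j : ZMod p)⁻¹ * j = -1 := by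
    have hs : ∑ j ∈ Finset.range p, (j : ZMod p)⁻¹ * j =
        ∑ c : ZMod p, (if c = 0 then 0 else 1) := by
      rw [sum_zmod]
      refine Finset.sum_congr rfl fun j _ => ?_
      split_ifs with h
      · simp [h]
      · exact inv_mul_cancel₀ h
    rw [hs]
    have h1 : ∑ c : ZMod p, (if c = 0 then (0 : ZMod p) else 1) =
        ∑ c : ZMod p, ((1 : ZMod p) - if c = 0 then 1 else 0) :=
      Finset.sum_congr rfl fun c _ => by split_ifs <;> simp
    rw [h1, Finset.sum_sub_distrib]
    simp [ZMod.card]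
  simp only [derivQuot, eval_neg, eval_finsetSum, eval_mul, eval_C, eval_pow, eval_X, one_pow,
    Finset.sum_const, Finset.card_range, nsmul_eq_mul, mul_one]
  rw [this, neg_neg]

/-- The difference quotient is invertible: its value at `1` is not zero, and the shift operator
satisfies `(X - 1) ^ p = 0`. -/
theorem exists_inverse_derivQuot :
    ∃ Q : (ZMod p)[X], aeval (shift p) Q * aeval (shift p) (derivQuot p) = 1 := by
  have h1 : IsCoprime (derivQuot p) (X - C 1) := by
    obtain ⟨q, hq⟩ := X_sub_C_dvd_sub_C_eval (p := derivQuot p) (a := (1 : ZMod p))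
    rw [derivQuot_eval] at hq
    exact ⟨1, -q, by rw [one_mul, sub_eq_iff_eq_add.1 hq, C_1]; ring⟩
  obtain ⟨a, b, hab⟩ := h1.pow_right (n := p)
  have hz : aeval (shift p) ((X - C 1 : (ZMod p)[X]) ^ p) = 0 := by
    rw [sub_pow_char, ← C_pow, one_pow]
    simp only [map_sub, map_pow, aeval_X, aeval_C]
    apply LinearMap.ext
    intro f
    ext x
    simp [shift_pow_apply]
  refine ⟨a, ?_⟩
  have := congrArg (aeval (shift p)) hab
  rwa [map_add, map_mul, map_mul, hz, mul_zero, add_zero, map_one] at this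

theorem polyDeriv_eq (k : Type) [CommRing k] [Algebra k (ZMod p)] (h2 : p ≠ 2)
    (f : ZMod p → ZMod p) :
    polyDeriv k p f = aeval (shift p) (derivQuot p) (shift p f - f) := by
  have h1 : aeval (shift p) (derivQuot p) (shift p f - f) =
      aeval (shift p) (derivQuot p * (X - 1)) f := by
    simp [map_mul]
  rw [h1, derivQuot_mul h2]
  ext x
  rw [polyDeriv_apply, sum_zmod]
  simp [map_sum, LinearMap.sum_apply, shift_pow_apply, Finset.sum_apply, Algebra.smul_def]

/-- On polynomial functions on `ZMod p` of degree less than `p` this operator is differentiation, so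
it relates a character of a group of affine transformations to its twist by the linear part. -/
theorem isDifference_polyDeriv {k : Type} [CommRing k] [Algebra k (ZMod p)] {G : Type} [Group G]
    (h2 : p ≠ 2) (A : G →* Equiv.Perm (ZMod p)) (τ : G →* (ZMod p)ˣ)
    (hA : ∀ g x y, A g x - A g y = (τ g : ZMod p) * (x - y)) (c : G →* (ZMod p)ˣ) :
    IsDifference A c (c * τ⁻¹) (polyDeriv k p) where
  ker f := by
    constructor
    · intro h
      obtain ⟨Q, hQ⟩ := exists_inverse_derivQuot (p := p)
      rw [polyDeriv_eq k h2] at h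
      have h3 := congrArg (aeval (shift p) Q) h
      rw [← Module.End.mul_apply, hQ, map_zero, Module.End.one_apply] at h3
      exact eq_const_of_shift fun x => sub_eq_zero.1 (congrFun h3 x)
    · rintro ⟨m, rfl⟩
      ext x
      rw [polyDeriv_apply, ← Finset.sum_mul, sum_inv_eq_zero h2]
      simp
  range f := by
    constructor
    · rintro ⟨g, rfl⟩
      simp only [polyDeriv_apply]
      rw [Finset.sum_neg_distrib, Finset.sum_comm]
      have : ∀ c : ZMod p, ∑ x, c⁻¹ * g (x + c) = c⁻¹ * ∑ x, g x := by
        intro c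
        rw [← Finset.mul_sum]
        exact congrArg _ (Equiv.sum_comp (Equiv.addRight c) g)
      rw [Finset.sum_congr rfl fun c _ => this c, ← Finset.sum_mul, sum_inv_eq_zero h2]
      simp
    · intro h
      obtain ⟨Q, hQ⟩ := exists_inverse_derivQuot (p := p)
      obtain ⟨g, hg⟩ := exists_shift_sub h
      have hg' : shift p g - g = f := funext hg
      refine ⟨aeval (shift p) Q g, ?_⟩
      rw [polyDeriv_eq k h2]
      have hc : shift p (aeval (shift p) Q g) = aeval (shift p) Q (shift p g) := by
        have : shift p * aeval (shift p) Q = aeval (shift p) Q * shift p := by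
          have h5 : aeval (shift p) (X * Q) = aeval (shift p) (Q * X) := by rw [mul_comm]
          rwa [map_mul, map_mul, aeval_X] at h5
        exact LinearMap.congr_fun this g
      rw [hc, ← map_sub, hg', ← Module.End.mul_apply, ← map_mul, mul_comm, map_mul, hQ,
        Module.End.one_apply]
  comm g f := by
    ext x
    simp only [polyDeriv_apply, funRep_apply, MonoidHom.mul_apply, MonoidHom.inv_apply,
      Units.val_mul]
    have h : ∀ y, A g⁻¹ (x + y) = A g⁻¹ x + ((τ g)⁻¹ : (ZMod p)ˣ) * y := by
      intro y
      have := hA g⁻¹ (x + y) x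
      rw [map_inv τ, add_sub_cancel_left] at this
      linear_combination this
    rw [Fintype.sum_equiv (Units.mulLeft (τ g)⁻¹) (fun y => y⁻¹ * (c g * f (A g⁻¹ (x + y))))
      (fun z => (c g * ((τ g)⁻¹ : (ZMod p)ˣ)) * (z⁻¹ * f (A g⁻¹ x + z))), ← Finset.mul_sum]
    · ring
    · intro y
      rw [h, Units.mulLeft_apply, mul_inv]
      rw [show ((((τ g)⁻¹ : (ZMod p)ˣ) : ZMod p))⁻¹ = (τ g : ZMod p) by
        rw [Units.val_inv_eq_inv_val, inv_inv]]
      have hu : (((τ g)⁻¹ : (ZMod p)ˣ) : ZMod p) * (τ g : ZMod p) = 1 := Units.inv_mul _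
      linear_combination (-(y⁻¹ * (c g * f (A g⁻¹ x + ((τ g)⁻¹ : (ZMod p)ˣ) * y)))) * hu

end Operators

end Auter

namespace Auter

/-! ### Groups of affine and dihedral transformations of `ℤ/p` -/

open CategoryTheory Limits

section Weights

variable {p : ℕ} [Fact p.Prime] {k : Type} [CommRing k]

theorem coprime_card_of_forall {G : Type} [Group G] [Finite G] (h : ∀ g : G, g ^ p = 1 → g = 1) :
    (Nat.card G).Coprime p := by
  have hp := (Fact.out : p.Prime)
  rw [Nat.coprime_comm, hp.coprime_iff_not_dvd]
  intro hd
  obtain ⟨g, hg⟩ := exists_prime_orderOf_dvd_card' p hd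
  have := h g (by rw [← hg]; exact pow_orderOf_eq_one g)
  rw [this, orderOf_one] at hg
  exact hp.one_lt.ne hg

/-- An element whose image in `(ZMod p)ˣ` has order `p - 1` maps to a generator. -/
theorem exists_pow_eq_of_primitive {G : Type} [Group G] (τ : G →* (ZMod p)ˣ) {g₀ : G}
    (h : ∀ j : ℕ, τ g₀ ^ j = 1 → p - 1 ∣ j) (u : (ZMod p)ˣ) : ∃ j : ℕ, τ g₀ ^ j = u := by
  have h1 : Nat.card (Subgroup.zpowers (τ g₀)) = Nat.card (ZMod p)ˣ := by
    rw [Nat.card_zpowers, Nat.card_eq_fintype_card, ZMod.card_units_eq_totient,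
      Nat.totient_prime Fact.out]
    refine Nat.dvd_antisymm ?_ (h _ (pow_orderOf_eq_one _))
    have := orderOf_dvd_natCard (τ g₀)
    rwa [Nat.card_eq_fintype_card, ZMod.card_units_eq_totient, Nat.totient_prime Fact.out] at this
  have h2 := Subgroup.eq_top_of_card_eq _ h1
  have h3 : u ∈ Subgroup.zpowers (τ g₀) := h2 ▸ Subgroup.mem_top u
  obtain ⟨j, hj⟩ := (mem_powers_iff_mem_zpowers.2 h3)
  exact ⟨j, hj⟩

/-- Vanishing of cohomology with coefficients in a character `τ⁻ⁱ` of a group of affine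
transformations: if `G` acts on `m` copies of the affine line over `ZMod p` with common linear part
`τ`, contains an element that fixes all origins and has primitive linear part, and contains no
`p`-torsion that fixes all origins, then the `n`-th cohomology has weights between `n / 2` and
`(n + m) / 2`. -/
theorem isZero_of_weights [Algebra k (ZMod p)] (h2 : p ≠ 2)
    (hu : ∀ n : ℕ, n.Coprime p → IsUnit (n : k)) (m : ℕ) :
    ∀ (n : ℕ) {G : Type} [Group G] [Finite G] (A : Fin m → G →* Equiv.Perm (ZMod p))
      (τ : G →* (ZMod p)ˣ), (∀ l g x y, A l g x - A l g y = (τ g : ZMod p) * (x - y)) →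
      ∀ g₀ : G, (∀ l, A l g₀ 0 = 0) → (∀ j : ℕ, τ g₀ ^ j = 1 → p - 1 ∣ j) →
      (∀ g, (∀ l, A l g 0 = 0) → g ^ p = 1 → g = 1) →
      ∀ i : ℕ, (∀ j, n ≤ 2 * j → 2 * j ≤ n + m → ¬ (p - 1 ∣ i + j)) →
      IsZero (groupCohomology (Rep.of (chRep k (τ⁻¹ ^ i))) n) := by
  have hp := (Fact.out : p.Prime)
  induction m with
  | zero =>
    intro n G _ _ A τ hA g₀ hg₀ hτ hK i h
    have hc := coprime_card_of_forall (p := p) (fun g hg => hK g (fun l => l.elim0) hg)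
    rcases n with _ | n
    · refine isZero_zero_of_invariants _ fun v hv => ?_
      have h3 := hv g₀
      rw [chRep_apply] at h3
      have h4 : (τ⁻¹ ^ i) g₀ ≠ 1 := by
        intro h5
        rw [MonoidHom.pow_apply, MonoidHom.inv_apply, inv_pow, inv_eq_one] at h5
        exact h 0 (by omega) (by omega) (hτ i h5)
      by_contra hv0
      exact h4 (Units.ext (mul_right_cancel₀ hv0 (h3.trans (one_mul v).symm)))
    · exact isZero_of_isUnit_card _ _ (hu _ hc)
  | succ m ihm =>
    intro n
    induction n using Nat.strong_induction_on with
    | _ n ihn =>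
    intro G _ _ A τ hA g₀ hg₀ hτ hK i h
    -- Either the origin of the first line is fixed, and this line can be omitted, or the action on
    -- it is transitive, and the four-term sequence of its functions applies.
    by_cases hall : ∀ g, A 0 g 0 = 0
    · refine ihm n (fun l => A l.succ) τ (fun l => hA _) g₀ (fun l => hg₀ _) hτ (fun g hg => ?_) i
        (fun j h1 h2 => h j h1 (by omega))
      exact hK g (fun l => by
        refine Fin.cases (hall g) (fun l => hg l) l)
    · push Not at hall
      obtain ⟨g₁, hg₁⟩ := hall
      have htr : ∀ x, ∃ g, A 0 g 0 = x := by
        intro x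
        by_cases hx : x = 0
        · exact ⟨1, by rw [hx, map_one]; rfl⟩
        obtain ⟨j, hj⟩ := exists_pow_eq_of_primitive τ hτ (Units.mk0 (x / A 0 g₁ 0) (div_ne_zero hx hg₁))
        refine ⟨g₀ ^ j * g₁, ?_⟩
        have h0 : A 0 (g₀ ^ j) 0 = 0 := by
          rw [map_pow]
          have : ∀ j : ℕ, (A 0 g₀ ^ j) 0 = 0 := by
            intro j
            induction j with
            | zero => rfl
            | succ j ih => rw [pow_succ, Equiv.Perm.mul_apply, hg₀, ih]
          exact this j
        have h3 := hA 0 (g₀ ^ j) (A 0 g₁ 0) 0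
        rw [h0, map_pow τ, hj, sub_zero, sub_zero, Units.val_mk0, div_mul_cancel₀ _ hg₁] at h3
        rw [map_mul, Equiv.Perm.mul_apply, h3]
      have hfun : ∀ n' i', (∀ j, n' ≤ 2 * j → 2 * j ≤ n' + m → ¬ (p - 1 ∣ i' + j)) →
          IsZero (groupCohomology (Rep.of (funRep k (A 0) (τ⁻¹ ^ i'))) n') := by
        intro n' i' h'
        refine isZero_funRep (A 0) _ 0 htr ?_
        exact ihm n' (fun l => (A l.succ).comp (permStab (A 0) 0).subtype)
          (τ.comp (permStab (A 0) 0).subtype) (fun l g => hA l.succ g) ⟨g₀, hg₀ 0⟩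
          (fun l => hg₀ l.succ) hτ (fun g hg hgp => Subtype.ext (hK g.1 (fun l => by
            refine Fin.cases g.2 (fun l => hg l) l) (by
              have := congrArg Subtype.val hgp
              exact this))) i' h'
      have hpow : ∀ i : ℕ, τ⁻¹ ^ (i + 1) = τ⁻¹ ^ i * τ⁻¹ := fun i => by
        apply MonoidHom.ext
        intro g
        simp only [MonoidHom.pow_apply, MonoidHom.mul_apply, pow_succ]
      refine (isDifference_polyDeriv (k := k) h2 (A 0) τ (hA 0) (τ⁻¹ ^ i)).isZero
        (hfun n i fun j h1 h2 => h j h1 (by omega)) ?_ ?_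
      · intro n' hn'
        rw [← hpow]
        exact hfun n' (i + 1) fun j h1 h2 => by
          have := h (j + 1) (by omega) (by omega)
          rwa [add_assoc, add_comm 1 j]
      · intro n' hn'
        rw [← hpow]
        exact ihn n' (by omega) A τ hA g₀ hg₀ hτ hK (i + 1) fun j h1 h2 => by
          have := h (j + 1) (by omega) (by omega)
          rwa [add_assoc, add_comm 1 j]

instance isTrivial_chRep_one {G : Type} [Group G] :
    (Rep.of (chRep k (1 : G →* kˣ))).ρ.IsTrivial :=
  ⟨fun g => by
    apply LinearMap.ext
    intro x
    simp⟩

/-- There are no nonzero homomorphisms from a finite group to a torsion-free group. -/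
theorem isZero_one_of_torsionFree {G : Type} [Group G] [Finite G]
    (ht : ∀ n : ℕ, n ≠ 0 → ∀ x : k, (n : k) * x = 0 → x = 0) :
    IsZero (groupCohomology (Rep.of (chRep k (1 : G →* kˣ))) 1) := by
  refine IsZero.of_iso ?_ (groupCohomology.H1IsoOfIsTrivial (Rep.of (chRep k (1 : G →* kˣ))))
  rw [ModuleCat.isZero_iff_subsingleton]
  have hz : ∀ f : Additive G →+ k, f = 0 := by
    intro f
    refine AddMonoidHom.ext fun g => ?_
    refine ht (Nat.card (Additive G)) (Nat.card_pos.ne') _ ?_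
    rw [← nsmul_eq_mul, ← map_nsmul, card_nsmul_eq_zero']
    simp
  exact ⟨fun a b => (hz a).trans (hz b).symm⟩

/-- Coefficients in `ZMod p` determine the vanishing of cohomology with coefficients in a ring in
which the integers prime to `p` are invertible, as multiplication by the order of the group is
zero. -/
theorem isZero_of_isZero_mod [Algebra k (ZMod p)]
    (hu : ∀ n : ℕ, n.Coprime p → IsUnit (n : k))
    (hs : Function.Surjective (algebraMap k (ZMod p)))
    (hker : ∀ x : k, algebraMap k (ZMod p) x = 0 ↔ ∃ y, x = (p : k) * y)
    (hreg : ∀ x : k, (p : k) * x = 0 → x = 0)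
    {G : Type} [Group G] [Finite G] {n : ℕ}
    (h : IsZero (groupCohomology (Rep.of (chRep k (1 : G →* (ZMod p)ˣ))) n)) :
    IsZero (groupCohomology (Rep.of (chRep k (1 : G →* kˣ))) (n + 1)) := by
  have hp := (Fact.out : p.Prime)
  let red : (chRep k (1 : G →* kˣ)).IntertwiningMap (chRep k (1 : G →* (ZMod p)ˣ)) :=
    ⟨Algebra.linearMap k (ZMod p), fun g => by
      apply LinearMap.ext
      intro x
      simp⟩
  have hS : (ShortComplex.mk (Rep.ofHom (mulHom (chRep k (1 : G →* kˣ)) (p : k)).hom)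
      (Rep.ofHom red) _).ShortExact := shortExact_of _ _
    (fun a b hab => by
      have : (p : k) * (a - b) = 0 := by
        rw [mul_sub, sub_eq_zero]
        exact hab
      exact sub_eq_zero.1 (hreg _ this)) hs
    (fun x => (hker x).trans ⟨fun ⟨y, hy⟩ => ⟨y, hy.symm⟩, fun ⟨y, hy⟩ => ⟨y, hy.symm⟩⟩)
  have hmono : Mono ((groupCohomology.functor k G (n + 1)).map
      (mulHom (chRep k (1 : G →* kˣ)) (p : k))) :=
    (groupCohomology.mapShortComplex₁_exact hS (rfl : n + 1 = n + 1)).mono_g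
      (h.eq_zero_of_src _)
  obtain ⟨a, u, hpu, hcard⟩ := Nat.exists_eq_pow_mul_and_not_dvd
    (Nat.card_pos (α := G)).ne' p hp.ne_one
  have hmonoa : ∀ a : ℕ, Mono ((groupCohomology.functor k G (n + 1)).map
      (mulHom (chRep k (1 : G →* kˣ)) ((p : k) ^ a * u))) := by
    intro a
    induction a with
    | zero =>
      have : IsIso (mulHom (chRep k (1 : G →* kˣ)) ((p : k) ^ 0 * u)) := by
        rw [pow_zero, one_mul]
        exact isIso_mulHom _ (hu u ((hp.coprime_iff_not_dvd.2 hpu).symm))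
      infer_instance
    | succ a ih =>
      rw [pow_succ', mul_assoc, mulHom_mul, Functor.map_comp]
      exact mono_comp' ih hmono
  have hz := map_mulHom_card_eq_zero (k := k) (1 : G →* kˣ) n
  have hm := hmonoa a
  rw [hcard, Nat.cast_mul, Nat.cast_pow] at hz
  rw [hz] at hm
  have hz : IsZero ((groupCohomology.functor k G (n + 1)).obj (Rep.of (chRep k (1 : G →* kˣ)))) :=
    by
      rw [IsZero.iff_id_eq_zero]
      exact (cancel_mono (0 : (groupCohomology.functor k G (n + 1)).obj
        (Rep.of (chRep k (1 : G →* kˣ))) ⟶ (groupCohomology.functor k G (n + 1)).obj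
        (Rep.of (chRep k (1 : G →* kˣ))))).1 (by rw [comp_zero, comp_zero])
  exact hz

/-- The cohomology of a group that acts on the `p`-gon by rotations and reflections, if the kernel
of the action has no cohomology in a range of degrees. -/
theorem rim_iso (h2 : p ≠ 2) (hu2 : IsUnit (2 : k)) {G : Type} [Group G] [Finite G]
    (A : G →* Equiv.Perm (ZMod p)) (ε : G →* ℤˣ)
    (hA : ∀ g x y, A g x - A g y = ((ε g : ℤ) : ZMod p) * (x - y))
    (hr : ∃ r, A r = Equiv.addRight 1) {m : ℕ}
    (hK : ∀ n, n ≠ 0 → n < m →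
      IsZero (groupCohomology (Rep.of (chRep k (1 : A.ker →* kˣ))) n)) (c : G →* kˣ)
    (hc : ∀ g, ε g = 1 → c g = 1) :
    (∀ x y, ∃ g, A g x = y) ∧
    ∀ n, n ≠ 0 → n < m → IsZero (groupCohomology (Rep.of (funRep k A c)) n) := by
  have hp := (Fact.out : p.Prime)
  have htr : ∀ x y, ∃ g, A g x = y := by
    intro x y
    obtain ⟨r, hr⟩ := hr
    refine ⟨r ^ (y - x).val, ?_⟩
    have : ∀ j : ℕ, (A r ^ j) x = x + j := by
      intro j
      induction j with
      | zero => simp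
      | succ j ih =>
        rw [pow_succ', Equiv.Perm.mul_apply, ih, hr]
        simp [add_assoc]
    rw [map_pow, this, ZMod.natCast_zmod_val]
    ring
  refine ⟨htr, fun n hn hnm => isZero_funRep A c 0 (htr 0) ?_⟩
  -- the kernel of the action has index at most two in the stabilizer of a point
  let K : Subgroup (permStab A 0) := (ε.comp (permStab A 0).subtype).ker
  have hKi : IsUnit (K.index : k) := by
    have : K.index ∣ 2 := by
      have h3 := Subgroup.index_ker (ε.comp (permStab A 0).subtype)
      have h4 := Subgroup.card_subgroup_dvd_card (ε.comp (permStab A 0).subtype).range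
      have h5 : Nat.card ℤˣ = 2 := by simp
      rw [h5] at h4
      exact h3 ▸ h4
    rcases (Nat.dvd_prime Nat.prime_two).1 this with h | h <;> rw [h]
    · simp
    · exact_mod_cast hu2
  refine isZero_of_index K _ hKi ?_
  have hmem : ∀ g : K, (g : permStab A 0).1 ∈ A.ker := by
    intro g
    have hg : ε g.1.1 = 1 := g.2
    rw [MonoidHom.mem_ker]
    ext x
    have h3 := hA g.1.1 x 0
    have h4 : A g.1.1 0 = 0 := g.1.2
    rw [h4, hg] at h3
    simpa using h3
  let e : K ≃* A.ker :=
    { toFun := fun g => ⟨g.1.1, hmem g⟩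
      invFun := fun g => ⟨⟨g.1, by
        rw [mem_permStab, MonoidHom.mem_ker.1 g.2]
        rfl⟩, by
          change ε g.1 = 1
          have h3 := hA g.1 1 0
          rw [MonoidHom.mem_ker.1 g.2] at h3
          have h4 : ((ε g.1 : ℤ) : ZMod p) = 1 := by simpa using h3.symm
          rcases Int.units_eq_one_or (ε g.1) with h5 | h5
          · exact h5
          · exfalso
            rw [h5] at h4
            have h6 : (2 : ZMod p) = 0 := by
              have h7 : (-1 : ZMod p) = 1 := by simpa using h4
              linear_combination -h7
            have h8 := (ZMod.natCast_eq_zero_iff 2 p).1 (by exact_mod_cast h6)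
            rw [Nat.prime_dvd_prime_iff_eq hp Nat.prime_two] at h8
            exact h2 h8⟩
      left_inv := fun _ => rfl
      right_inv := fun _ => rfl
      map_mul' := fun _ _ => rfl }
  obtain ⟨i⟩ := nonempty_iso_of_mulEquiv (k := k) e (1 : A.ker →* kˣ) n
  have : (c.comp (permStab A 0).subtype).comp K.subtype = (1 : A.ker →* kˣ).comp (e : K →* A.ker) := by
    ext g
    have hg : ε g.1.1 = 1 := g.2
    simp [hc _ hg]
  rw [this]
  exact (hK n hn hnm).of_iso i.symm

/-- The sign of a dihedral action as a character with values in `k`. -/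
def signChar (k : Type) [CommRing k] {G : Type} [Group G] (ε : G →* ℤˣ) : G →* kˣ :=
  (Units.map (Int.castRingHom k : ℤ →* k)).comp ε

theorem signChar_of_one {G : Type} [Group G] (ε : G →* ℤˣ) {g : G} (h : ε g = 1) :
    signChar k ε g = 1 := by
  simp [signChar, h]

theorem signChar_sq {G : Type} [Group G] (ε : G →* ℤˣ) : signChar k ε * signChar k ε = 1 := by
  ext g
  rcases Int.units_eq_one_or (ε g) with h | h <;> simp [signChar, h]

/-- The cohomology in even positive degrees of a group of symmetries of the `p`-gon. -/
theorem rim_even (h2 : p ≠ 2) (hu2 : IsUnit (2 : k)) {G : Type} [Group G] [Finite G]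
    (A : G →* Equiv.Perm (ZMod p)) (ε : G →* ℤˣ)
    (hA : ∀ g x y, A g x - A g y = ((ε g : ℤ) : ZMod p) * (x - y))
    (hr : ∃ r, A r = Equiv.addRight 1) {m : ℕ}
    (hK : ∀ n, n ≠ 0 → n < m →
      IsZero (groupCohomology (Rep.of (chRep k (1 : A.ker →* kˣ))) n))
    (q : k →+ ZMod p) (hq : Function.Surjective q)
    (hker : ∀ x : k, q x = 0 ↔ ∃ y, x = (p : k) * y) (j : ℕ) :
    ∀ i : ℕ, signChar k ε ^ (i + j + 1) = 1 → 2 * (j + 1) < m →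
    Nonempty (groupCohomology (Rep.of (chRep k (signChar k ε ^ i))) (2 * (j + 1)) ≃+ ZMod p) := by
  have hfun : ∀ i : ℕ, ∀ n, n ≠ 0 → n < m →
      IsZero (groupCohomology (Rep.of (funRep k A (signChar k ε ^ i))) n) := fun i =>
    (rim_iso h2 hu2 A ε hA hr hK (signChar k ε ^ i) (fun g hg => by
      rw [MonoidHom.pow_apply, signChar_of_one ε hg, one_pow])).2
  have htr := (rim_iso h2 hu2 A ε hA hr hK 1 (fun _ _ => rfl)).1
  have hdiff : ∀ i : ℕ, IsDifference A (signChar k ε ^ i) (signChar k ε ^ (i + 1))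
      (centralDiff k p) := fun i => by
    have hpow : signChar k ε ^ (i + 1) = signChar k ε ^ i * signChar k ε := by
      ext
      simp [pow_succ]
    rw [hpow]
    exact isDifference_centralDiff h2 A ε hA (signChar k ε ^ i)
  induction j with
  | zero =>
    intro i hi hm
    refine (hdiff i).nonempty_addEquiv htr hi (hfun _ 1 one_ne_zero (by omega))
      (hfun _ 1 one_ne_zero (by omega)) (hfun _ 2 two_ne_zero (by omega)) q hq fun x => ?_
    rw [hker, ZMod.card]
    simp [nsmul_eq_mul]
  | succ j ih =>
    intro i hi hm
    obtain ⟨e⟩ := ih (i + 1) (by rw [← hi]; congr 1; ring) (by omega)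
    obtain ⟨e'⟩ := (hdiff i).nonempty_iso (n := 2 * (j + 1)) (hfun _ _ (by omega) (by omega))
      (hfun _ _ (by omega) (by omega)) (hfun _ _ (by omega) (by omega))
      (hfun _ _ (by omega) (by omega))
    exact ⟨e'.symm.toLinearEquiv.toAddEquiv.trans e⟩

/-- The second cohomology group vanishes in the presence of a reflection. -/
theorem rim_two (h2 : p ≠ 2) (hu2 : IsUnit (2 : k)) {G : Type} [Group G] [Finite G]
    (A : G →* Equiv.Perm (ZMod p)) (ε : G →* ℤˣ)
    (hA : ∀ g x y, A g x - A g y = ((ε g : ℤ) : ZMod p) * (x - y))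
    (hr : ∃ r, A r = Equiv.addRight 1) {m : ℕ} (hm : 2 < m)
    (hK : ∀ n, n ≠ 0 → n < m →
      IsZero (groupCohomology (Rep.of (chRep k (1 : A.ker →* kˣ))) n))
    (hε : ∃ g, ε g = -1) :
    IsZero (groupCohomology (Rep.of (chRep k (1 : G →* kˣ))) 2) := by
  have hd := isDifference_centralDiff (k := k) h2 A ε hA 1
  have hone : (1 : G →* kˣ) * (Units.map (Int.castRingHom k : ℤ →* k)).comp ε = signChar k ε := by
    ext
    simp [signChar]
  rw [hone] at hd
  refine hd.isZero ((rim_iso h2 hu2 A ε hA hr hK 1 (fun _ _ => rfl)).2 2 two_ne_zero hm) ?_ ?_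
  · rintro n hn
    obtain rfl : n = 1 := by omega
    exact (rim_iso h2 hu2 A ε hA hr hK (signChar k ε) (fun g hg => signChar_of_one ε hg)).2 1
      one_ne_zero (by omega)
  · rintro n hn
    obtain rfl : n = 0 := by omega
    refine isZero_zero_of_invariants _ fun v hv => ?_
    obtain ⟨g, hg⟩ := hε
    have h3 := hv g
    rw [chRep_apply] at h3
    have h4 : (2 : k) * v = 0 := by
      have : -v = v := by simpa [signChar, hg] using h3
      linear_combination -this
    exact (hu2.mul_right_eq_zero).1 h4

end Weights

end Auter

namespace Auter

/-! ### Cohomology with coefficients in `ℤ_(p)` -/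

open CategoryTheory Limits

section Localization

variable (p : ℕ) [Fact p.Prime]

theorem isUnit_zloc {n : ℕ} (h : n.Coprime p) : IsUnit (n : ZLoc p) := by
  have hp := (Fact.out : p.Prime)
  have : (n : ℤ) ∈ (Ideal.span {(p : ℤ)}).primeCompl := by
    intro hn
    have h1 : (n : ℤ) ∈ Ideal.span {(p : ℤ)} := hn
    rw [Ideal.mem_span_singleton] at h1
    exact (hp.coprime_iff_not_dvd.1 h.symm) (by exact_mod_cast h1)
  have h2 := IsLocalization.map_units (ZLoc p) (⟨(n : ℤ), this⟩ : (Ideal.span {(p : ℤ)}).primeCompl)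
  simpa using h2

/-- Reduction modulo `p`. -/
noncomputable def zlocRed : ZLoc p →+* ZMod p :=
  IsLocalization.lift (M := (Ideal.span {(p : ℤ)}).primeCompl) (g := Int.castRingHom (ZMod p))
    (by
      rintro ⟨y, hy⟩
      refine isUnit_iff_ne_zero.2 fun h => hy ?_
      change y ∈ Ideal.span {(p : ℤ)}
      rw [Ideal.mem_span_singleton]
      exact (ZMod.intCast_zmod_eq_zero_iff_dvd y p).1 h)

theorem zlocRed_surjective : Function.Surjective (zlocRed p) := by
  intro x
  refine ⟨(x.val : ZLoc p), ?_⟩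
  rw [map_natCast, ZMod.natCast_zmod_val]

theorem zlocRed_eq_zero_iff (x : ZLoc p) : zlocRed p x = 0 ↔ ∃ y, x = (p : ZLoc p) * y := by
  constructor
  · intro h
    obtain ⟨⟨a, s⟩, hx⟩ := IsLocalization.surj (Ideal.span {(p : ℤ)}).primeCompl x
    have h1 := congrArg (zlocRed p) hx
    simp only [map_mul, h, zero_mul] at h1
    have h2 : zlocRed p (algebraMap ℤ (ZLoc p) a) = (a : ZMod p) := by simp
    rw [h2] at h1
    obtain ⟨b, hb⟩ := (ZMod.intCast_zmod_eq_zero_iff_dvd a p).1 h1.symm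
    obtain ⟨u, hu⟩ := IsLocalization.map_units (ZLoc p) s
    refine ⟨algebraMap ℤ (ZLoc p) b * (u⁻¹ : (ZLoc p)ˣ), ?_⟩
    have h3 : x * u = p * algebraMap ℤ (ZLoc p) b := by
      rw [hu, hx, hb]
      simp
    rw [← mul_assoc, ← h3, Units.mul_inv_cancel_right]
  · rintro ⟨y, rfl⟩
    simp

theorem zloc_torsionFree (n : ℕ) (hn : n ≠ 0) (x : ZLoc p) (h : (n : ZLoc p) * x = 0) : x = 0 := by
  have : IsDomain (ZLoc p) := IsLocalization.isDomain_of_atPrime _ (Ideal.span {(p : ℤ)})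
  have : CharZero (ZLoc p) := by
    exact charZero_of_injective_algebraMap
      (IsLocalization.injective (ZLoc p) (M := (Ideal.span {(p : ℤ)}).primeCompl)
        (Ideal.primeCompl_le_nonZeroDivisors _))
  rcases mul_eq_zero.1 h with h | h
  · exact absurd (Nat.cast_eq_zero.1 h) hn
  · exact h

variable {p}

theorem trivial_eq_chRep (G : Type) [Group G] :
    Representation.trivial (ZLoc p) G (ZLoc p) = chRep (ZLoc p) (1 : G →* (ZLoc p)ˣ) := by
  apply MonoidHom.ext
  intro g
  apply LinearMap.ext
  intro x
  simp

end Localization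

section Orbits

variable {p : ℕ} [Fact p.Prime]

theorem pow_val_add {S : Type} [Group S] {z : S} (hz : z ^ p = 1) (x y : ZMod p) :
    z ^ (x + y).val = z ^ x.val * z ^ y.val := by
  rw [ZMod.val_add, ← pow_add]
  conv_rhs => rw [← Nat.div_add_mod (x.val + y.val) p, pow_add, pow_mul, hz, one_pow, one_mul]

theorem pow_natCast_val {S : Type} [Group S] {z : S} (hz : z ^ p = 1) (j : ℕ) :
    z ^ (j : ZMod p).val = z ^ j := by
  rw [ZMod.val_natCast]
  conv_rhs => rw [← Nat.div_add_mod j p, pow_add, pow_mul, hz, one_pow, one_mul]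

theorem pow_val_mul {S : Type} [Group S] {z : S} (hz : z ^ p = 1) (x y : ZMod p) :
    z ^ (x * y).val = (z ^ x.val) ^ y.val := by
  rw [← pow_mul, ← pow_natCast_val hz (x.val * y.val), Nat.cast_mul, ZMod.natCast_zmod_val,
    ZMod.natCast_zmod_val]

/-- Translations act freely on a nontrivial orbit of an element of order `p`. -/
theorem pow_val_injective {S D : Type} [Group S] {z : S} (hz : z ^ p = 1) (a : S →* Equiv.Perm D)
    {d : D} (hd : a z d ≠ d) {x y : ZMod p} (h : a (z ^ x.val) d = a (z ^ y.val) d) : x = y := by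
  have hp := (Fact.out : p.Prime)
  by_contra hxy
  have h1 : a (z ^ (x - y).val) d = d := by
    have h2 : z ^ x.val = z ^ y.val * z ^ (x - y).val := by
      rw [← pow_val_add hz]
      congr 2
      ring
    rw [h2, map_mul, Equiv.Perm.mul_apply] at h
    exact (a (z ^ y.val)).injective h
  have h3 : ∀ j : ℕ, a ((z ^ (x - y).val) ^ j) d = d := by
    intro j
    induction j with
    | zero => simp
    | succ j ih => rw [pow_succ, map_mul, Equiv.Perm.mul_apply, h1, ih]
  apply hd
  have h4 := h3 ((x - y)⁻¹).val
  rw [← pow_val_mul hz, mul_inv_cancel₀ (sub_ne_zero.2 hxy), ZMod.val_one, pow_one] at h4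
  exact h4

/-- Let `z` be an element of order `p` of a finite permutation group `S`, let `g` normalize the
subgroup generated by `z`, acting on it through a primitive root, and preserve all orbits of `z`.
If a Sylow subgroup of `S` centralizes `z` and preserves the orbits of `z`, then the cohomology
of `S` vanishes in suitable degrees. The number `m` counts the nontrivial orbits of `z`, up to an
involution `ι` that commutes with the action. -/
theorem isZero_of_orbits (h2 : p ≠ 2) {S D : Type} [Group S] [Finite S] (a : S →* Equiv.Perm D)
    (ha : Function.Injective a) (ι : D → D) (hι : ∀ s d, a s (ι d) = ι (a s d)) {z : S}
    (hz : z ^ p = 1) {m : ℕ} (d : Fin m → D) (hd : ∀ l, a z (d l) ≠ d l)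
    (hcov : ∀ e, a z e ≠ e → ∃ (l : Fin m) (x : ZMod p),
      e = a (z ^ x.val) (d l) ∨ e = ι (a (z ^ x.val) (d l)))
    (hm : 0 < m) {g : S} {r : ZMod p} (hr0 : r ≠ 0)
    (hr : ∀ j : ℕ, r ^ j = 1 → p - 1 ∣ j)
    (hg : g * z = z ^ r.val * g) (hgd : ∀ l, a g (d l) = d l) (hgf : ∀ e, a z e = e → a g e = e)
    (P : Sylow p S) (hP : ∀ β ∈ P, β * z = z * β)
    (hPo : ∀ β ∈ P, ∀ e, ∃ x : ZMod p, a β e = a (z ^ x.val) e) {n : ℕ}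
    (hn : ∀ j, n ≤ 2 * j → 2 * j ≤ n + m → ¬ (p - 1 ∣ j)) :
    IsZero (groupCohomology (Rep.trivial (ZLoc p) S (ZLoc p)) (n + 1)) := by
  have hp := (Fact.out : p.Prime)
  have hconj : ∀ (s : S) (t : ZMod p), s * z = z ^ t.val * s → ∀ x : ZMod p,
      s * z ^ x.val = z ^ (t * x).val * s := by
    intro s t hs x
    have : ∀ j : ℕ, s * z ^ j = (z ^ t.val) ^ j * s := by
      intro j
      induction j with
      | zero => simp
      | succ j ih => rw [pow_succ, ← mul_assoc, ih, mul_assoc, hs, ← mul_assoc, ← pow_succ]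
    rw [this, pow_val_mul hz]
  -- the elements that normalize `⟨z⟩` and preserve its orbits
  let N : Subgroup S :=
    { carrier := {s | (∃ t : ZMod p, t ≠ 0 ∧ s * z = z ^ t.val * s) ∧
        ∀ e, ∃ x : ZMod p, a s e = a (z ^ x.val) e}
      one_mem' := ⟨⟨1, one_ne_zero, by rw [ZMod.val_one]; simp⟩, fun e => ⟨0, by simp⟩⟩
      mul_mem' := by
        rintro s s' ⟨⟨t, ht, hs⟩, ho⟩ ⟨⟨t', ht', hs'⟩, ho'⟩
        refine ⟨⟨t * t', mul_ne_zero ht ht', ?_⟩, fun e => ?_⟩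
        · rw [mul_assoc, hs', ← mul_assoc, hconj s t hs, mul_assoc]
        · obtain ⟨x', hx'⟩ := ho' e
          obtain ⟨x, hx⟩ := ho (a (z ^ x'.val) e)
          exact ⟨x + x', by
            rw [map_mul, Equiv.Perm.mul_apply, hx', hx, pow_val_add hz, map_mul,
              Equiv.Perm.mul_apply]⟩
      inv_mem' := by
        rintro s ⟨⟨t, ht, hs⟩, ho⟩
        refine ⟨⟨t⁻¹, inv_ne_zero ht, ?_⟩, fun e => ?_⟩
        · have := hconj s t hs t⁻¹
          rw [mul_inv_cancel₀ ht, ZMod.val_one, pow_one] at this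
          rw [inv_mul_eq_iff_eq_mul, ← mul_assoc, this]
          simp
        · obtain ⟨x, hx⟩ := ho (a s⁻¹ e)
          refine ⟨-x, ?_⟩
          rw [← Equiv.Perm.mul_apply, ← map_mul, mul_inv_cancel, map_one, Equiv.Perm.one_apply] at hx
          have h3 := congrArg (a (z ^ (-x).val)) hx
          rw [← Equiv.Perm.mul_apply, ← map_mul, ← pow_val_add hz, neg_add_cancel, ZMod.val_zero,
            pow_zero, map_one, Equiv.Perm.one_apply] at h3
          exact h3.symm }
  have hPN : (P : Subgroup S) ≤ N := fun β hβ =>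
    ⟨⟨1, one_ne_zero, by rw [ZMod.val_one, pow_one]; exact hP β hβ⟩, hPo β hβ⟩
  have hidx : N.index.Coprime p := by
    have h3 := P.not_dvd_index
    rw [Nat.coprime_comm, hp.coprime_iff_not_dvd]
    exact fun h => h3 (h.trans (Subgroup.index_dvd_of_le hPN))
  have hlin : ∀ s : N, ∃ t : (ZMod p)ˣ, s.1 * z = z ^ (t : ZMod p).val * s.1 := fun s => by
    obtain ⟨t, ht, hs⟩ := s.2.1
    exact ⟨Units.mk0 t ht, hs⟩
  have huniq : ∀ (s : S) (t t' : ZMod p), s * z = z ^ t.val * s → s * z = z ^ t'.val * s →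
      t = t' := by
    intro s t t' hs hs'
    refine pow_val_injective hz a (hd ⟨0, hm⟩) ?_
    rw [mul_right_cancel (hs.symm.trans hs')]
  have hconj' : ∀ (s s' : N) (t t' : ZMod p), s.1 * z = z ^ t.val * s.1 →
      s'.1 * z = z ^ t'.val * s'.1 → s.1 * (s'.1 * z) = z ^ (t * t').val * (s.1 * s'.1) := by
    intro s s' t t' hs hs'
    rw [hs', ← mul_assoc, hconj s.1 t hs, mul_assoc]
  -- the action of `N` on `⟨z⟩` by conjugation is the common linear part on all orbits
  let τ : N →* (ZMod p)ˣ :=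
    { toFun := fun s => (hlin s).choose
      map_one' := Units.ext (huniq 1 _ _ (hlin 1).choose_spec (by
        rw [Units.val_one, ZMod.val_one]
        simp))
      map_mul' := fun s s' => Units.ext (huniq (s * s' : N) _ _ (hlin (s * s')).choose_spec (by
        have h3 := (hlin s').choose_spec
        rw [Units.val_mul, Subgroup.coe_mul, mul_assoc]
        exact hconj' s s' _ _ (hlin s).choose_spec h3)) }
  have hτ : ∀ s : N, s.1 * z = z ^ (τ s : ZMod p).val * s.1 := fun s => (hlin s).choose_spec
  -- coordinates on the orbits
  have hco : ∀ (l : Fin m) (s : N) (x : ZMod p), ∃ y : ZMod p,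
      a s (a (z ^ x.val) (d l)) = a (z ^ y.val) (d l) := by
    intro l s x
    obtain ⟨y, hy⟩ := s.2.2 (a (z ^ x.val) (d l))
    exact ⟨y + x, by rw [hy, pow_val_add hz, map_mul, Equiv.Perm.mul_apply]⟩
  choose co hco using hco
  have hcu : ∀ l (x y : ZMod p), a (z ^ x.val) (d l) = a (z ^ y.val) (d l) → x = y :=
    fun l x y h => pow_val_injective hz a (hd l) h
  have hco_mul : ∀ l s s' x, co l (s * s') x = co l s (co l s' x) := by
    intro l s s' x
    apply hcu l
    rw [← hco, ← hco, ← hco, Subgroup.coe_mul, map_mul, Equiv.Perm.mul_apply]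
  have hco_one : ∀ l x, co l 1 x = x := by
    intro l x
    apply hcu l
    rw [← hco]
    simp
  let A : Fin m → N →* Equiv.Perm (ZMod p) := fun l =>
    { toFun := fun s =>
        { toFun := co l s
          invFun := co l s⁻¹
          left_inv := fun x => by rw [← hco_mul, inv_mul_cancel, hco_one]
          right_inv := fun x => by rw [← hco_mul, mul_inv_cancel, hco_one] }
      map_one' := Equiv.ext (hco_one l)
      map_mul' := fun s s' => Equiv.ext (hco_mul l s s') }
  have hA : ∀ l s x y, A l s x - A l s y = (τ s : ZMod p) * (x - y) := by
    intro l s x y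
    change co l s x - co l s y = _
    rw [sub_eq_iff_eq_add]
    apply hcu l
    have h3 : z ^ x.val = z ^ (x - y).val * z ^ y.val := by
      rw [← pow_val_add hz, sub_add_cancel]
    rw [← hco, h3, map_mul, Equiv.Perm.mul_apply, ← Equiv.Perm.mul_apply, ← map_mul,
      hconj s _ (hτ s), map_mul, Equiv.Perm.mul_apply, hco, ← Equiv.Perm.mul_apply, ← map_mul,
      ← pow_val_add hz]
  have hgz : ∀ x : ZMod p, g * z ^ x.val = z ^ (r * x).val * g := hconj g r hg
  have hgN : g ∈ N := by
    refine ⟨⟨r, hr0, hg⟩, fun e => ?_⟩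
    by_cases he : a z e = e
    · exact ⟨0, by simp [hgf e he]⟩
    · obtain ⟨l, x, h | h⟩ := hcov e he
      · refine ⟨r * x - x, ?_⟩
        rw [h, ← Equiv.Perm.mul_apply, ← Equiv.Perm.mul_apply, ← map_mul, ← map_mul, hgz,
          ← pow_val_add hz, sub_add_cancel, map_mul, Equiv.Perm.mul_apply, hgd]
      · refine ⟨r * x - x, ?_⟩
        rw [h, hι, hι, ← Equiv.Perm.mul_apply, ← Equiv.Perm.mul_apply, ← map_mul, ← map_mul, hgz,
          ← pow_val_add hz, sub_add_cancel, map_mul, Equiv.Perm.mul_apply, hgd]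
  have hτg : (τ ⟨g, hgN⟩ : ZMod p) = r := huniq g _ _ (hτ ⟨g, hgN⟩) hg
  let _ : Algebra (ZLoc p) (ZMod p) := (zlocRed p).toAlgebra
  have hmod : IsZero (groupCohomology (Rep.of (chRep (ZLoc p) (1 : N →* (ZMod p)ˣ))) n) := by
    have h3 := isZero_of_weights (k := ZLoc p) h2 (fun n hn => isUnit_zloc p hn) m n A τ hA ⟨g, hgN⟩
      (fun l => hcu l _ _ ((hco l ⟨g, hgN⟩ 0).symm.trans (by simp [hgd])))
      (fun j hj => hr j (by rw [← hτg, ← Units.val_pow_eq_pow_val, hj, Units.val_one]))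
      (fun s hs hsp => ?_) 0 (by simpa using hn)
    · have h4 : τ⁻¹ ^ 0 = (1 : N →* (ZMod p)ˣ) := by
        apply MonoidHom.ext
        intro g
        simp only [pow_zero, MonoidHom.one_apply]
      rwa [h4] at h3
    · -- an element of order `p` that fixes all origins fixes everything
      have h4 : (τ s : ZMod p) = 1 := by
        have h5 := congrArg τ hsp
        rw [map_pow, map_one] at h5
        have h6 := congrArg Units.val h5
        rwa [Units.val_pow_eq_pow_val, ZMod.pow_card] at h6
      have h7 : ∀ l (x : ZMod p), a s (a (z ^ x.val) (d l)) = a (z ^ x.val) (d l) := by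
        intro l x
        have h8 := hA l s x 0
        rw [hs, h4] at h8
        have h9 : A l s x = x := by simpa using h8
        rw [hco]
        exact congrArg (fun y : ZMod p => a (z ^ y.val) (d l)) h9
      apply Subtype.ext
      apply ha
      ext e
      rw [Subgroup.coe_one, map_one, Equiv.Perm.one_apply]
      by_cases he : a z e = e
      · obtain ⟨x, hx⟩ := s.2.2 e
        rw [hx, map_pow]
        have : ∀ j : ℕ, (a z ^ j) e = e := by
          intro j
          induction j with
          | zero => simp
          | succ j ih => rw [pow_succ, Equiv.Perm.mul_apply, he, ih]
        exact this _
      · obtain ⟨l, x, h | h⟩ := hcov e he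
        · rw [h, h7]
        · rw [h, hι, h7]
  have hN := isZero_of_isZero_mod (k := ZLoc p) (fun n hn => isUnit_zloc p hn)
    (zlocRed_surjective p) (zlocRed_eq_zero_iff p) (zloc_torsionFree p p hp.ne_zero) hmod
  rw [Rep.trivial, trivial_eq_chRep]
  exact isZero_of_index N 1 (isUnit_zloc p hidx) hN

/-- There are no homomorphisms from a finite group to `ℤ_(p)`. -/
theorem isZero_one_zloc (S : Type) [Group S] [Finite S] :
    IsZero (groupCohomology (Rep.trivial (ZLoc p) S (ZLoc p)) 1) := by
  rw [Rep.trivial, trivial_eq_chRep]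
  exact isZero_one_of_torsionFree (zloc_torsionFree p)

theorem isZero_of_coprime (S : Type) [Group S] [Finite S] (h : (Nat.card S).Coprime p) (n : ℕ) :
    IsZero (groupCohomology (Rep.trivial (ZLoc p) S (ZLoc p)) (n + 1)) := by
  rw [Rep.trivial, trivial_eq_chRep]
  exact isZero_of_isUnit_card _ _ (isUnit_zloc p h)

/-- Cohomology of a group that acts on the `p`-gon by rotations and reflections, containing the
rotations, if the kernel of the action has no cohomology in small positive degrees. -/
theorem rim_zloc (h2 : p ≠ 2) {S : Type} [Group S] [Finite S]
    (A : S →* Equiv.Perm (ZMod p)) (ε : S →* ℤˣ)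
    (hA : ∀ g x y, A g x - A g y = ((ε g : ℤ) : ZMod p) * (x - y))
    (hr : ∃ r, A r = Equiv.addRight 1) {m : ℕ}
    (hK : ∀ n, n ≠ 0 → n < m →
      IsZero (groupCohomology (Rep.trivial (ZLoc p) A.ker (ZLoc p)) n)) :
    (∀ j, 0 < 4 * j → 4 * j < m →
      Nonempty (groupCohomology (Rep.trivial (ZLoc p) S (ZLoc p)) (4 * j) ≃+ ZMod p)) ∧
    ((∀ g, ε g = 1) → ∀ j, 0 < 2 * j → 2 * j < m →
      Nonempty (groupCohomology (Rep.trivial (ZLoc p) S (ZLoc p)) (2 * j) ≃+ ZMod p)) ∧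
    ((∃ g, ε g = -1) → 2 < m →
      IsZero (groupCohomology (Rep.trivial (ZLoc p) S (ZLoc p)) 2)) := by
  have hp := (Fact.out : p.Prime)
  have hu2 : IsUnit (2 : ZLoc p) := by
    exact_mod_cast isUnit_zloc p (n := 2) ((Nat.coprime_primes Nat.prime_two hp).2 h2.symm)
  rw [Rep.trivial, trivial_eq_chRep] at hK ⊢
  have hone : signChar (ZLoc p) ε ^ 0 = 1 := MonoidHom.ext fun g => by simp
  have hev : ∀ j, signChar (ZLoc p) ε ^ (j + 1) = 1 → 2 * (j + 1) < m →
      Nonempty (groupCohomology (Rep.of (chRep (ZLoc p) (1 : S →* (ZLoc p)ˣ))) (2 * (j + 1)) ≃+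
        ZMod p) := by
    intro j hj hjm
    have h3 := rim_even h2 hu2 A ε hA hr hK (zlocRed p).toAddMonoidHom (zlocRed_surjective p)
      (zlocRed_eq_zero_iff p) j 0 (by rwa [zero_add]) hjm
    rwa [hone] at h3
  refine ⟨fun j hj hjm => ?_, fun hε j hj hjm => ?_, fun hε hm => rim_two h2 hu2 A ε hA hr hm hK hε⟩
  · obtain ⟨l, rfl⟩ : ∃ l, j = l + 1 := ⟨j - 1, by omega⟩
    have h3 := hev (2 * l + 1) (by
      apply MonoidHom.ext
      intro g
      have h4 := DFunLike.congr_fun (signChar_sq (k := ZLoc p) ε) g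
      rw [MonoidHom.mul_apply] at h4
      rw [show 2 * l + 1 + 1 = 2 * (l + 1) by ring, MonoidHom.pow_apply, pow_mul, pow_two, h4]
      simp) (by omega)
    rwa [show 2 * (2 * l + 1 + 1) = 4 * (l + 1) by ring] at h3
  · obtain ⟨l, rfl⟩ : ∃ l, j = l + 1 := ⟨j - 1, by omega⟩
    refine hev l (MonoidHom.ext fun g => ?_) hjm
    rw [MonoidHom.pow_apply, signChar_of_one ε (hε g), one_pow]
    rfl

end Orbits

end Auter

namespace Auter

/-! ### Reduced edge words -/

namespace PGraph

open Classical in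
/-- The effect of a directed edge on reduced edge words: cancel or prepend. -/
noncomputable def push (G : PGraph) (d : G.D) : List G.D → List G.D
  | [] => [d]
  | e :: t => if e = G.inv d then t else d :: e :: t

theorem push_cons_self (G : PGraph) (d : G.D) (t : List G.D) : G.push d (G.inv d :: t) = t := by
  simp [push]

theorem push_of_reduced (G : PGraph) {d : G.D} {t : List G.D} (h : G.IsReduced (d :: t)) :
    G.push d t = d :: t := by
  cases t with
  | nil => rfl
  | cons e t =>
    have : e ≠ G.inv d := (List.isChain_cons_cons.1 h).1
    simp [push, this]

theorem IsReduced.tail {G : PGraph} {d : G.D} {t : List G.D} (h : G.IsReduced (d :: t)) :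
    G.IsReduced t := List.IsChain.tail h

theorem isReduced_push (G : PGraph) (d : G.D) {t : List G.D} (h : G.IsReduced t) :
    G.IsReduced (G.push d t) := by
  cases t with
  | nil => exact List.isChain_singleton _
  | cons e t =>
    by_cases he : e = G.inv d
    · subst he
      rw [push_cons_self]
      exact h.tail
    · have : G.push d (e :: t) = d :: e :: t := by simp [push, he]
      rw [this]
      exact List.isChain_cons_cons.2 ⟨he, h⟩

theorem push_push_inv (G : PGraph) (d : G.D) {t : List G.D} (h : G.IsReduced t) :
    G.push (G.inv d) (G.push d t) = t := by
  cases t with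
  | nil => simp [push, G.inv_inv]
  | cons e t =>
    by_cases he : e = G.inv d
    · subst he
      rw [push_cons_self, push_of_reduced _ h]
    · have : G.push d (e :: t) = d :: e :: t := by simp [push, he]
      rw [this]
      simp [push, G.inv_inv]

/-- The permutation of the reduced edge words given by a directed edge. -/
noncomputable def pushPerm (G : PGraph) (d : G.D) : Equiv.Perm {t : List G.D // G.IsReduced t} where
  toFun t := ⟨G.push d t.1, G.isReduced_push d t.2⟩
  invFun t := ⟨G.push (G.inv d) t.1, G.isReduced_push _ t.2⟩
  left_inv t := Subtype.ext (G.push_push_inv d t.2)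
  right_inv t := Subtype.ext (by
    have := G.push_push_inv (G.inv d) t.2
    rwa [G.inv_inv] at this)

/-- The edge group acts on the set of reduced edge words (van der Waerden's trick). -/
noncomputable def wordAction (G : PGraph) :
    G.EdgeGroup →* Equiv.Perm {t : List G.D // G.IsReduced t} :=
  PresentedGroup.toGroup (f := G.pushPerm) (by
    rintro _ ⟨d, rfl⟩
    rw [map_mul, FreeGroup.lift_apply_of, FreeGroup.lift_apply_of]
    ext t
    simp only [Equiv.Perm.mul_apply, Equiv.Perm.one_apply, pushPerm, Equiv.coe_fn_mk]
    have := G.push_push_inv (G.inv d) t.2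
    rw [G.inv_inv] at this
    rw [this])

theorem wordAction_gen (G : PGraph) (d : G.D) : G.wordAction (G.gen d) = G.pushPerm d :=
  PresentedGroup.toGroup.of _

@[simp] theorem walkProd_nil (G : PGraph) : G.walkProd [] = 1 := rfl

@[simp] theorem walkProd_cons (G : PGraph) (d : G.D) (t : List G.D) :
    G.walkProd (d :: t) = G.gen d * G.walkProd t := by simp [walkProd]

@[simp] theorem walkProd_append (G : PGraph) (s t : List G.D) :
    G.walkProd (s ++ t) = G.walkProd s * G.walkProd t := by simp [walkProd]

theorem wordAction_walkProd (G : PGraph) {t : List G.D} (h : G.IsReduced t) :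
    (G.wordAction (G.walkProd t) ⟨[], List.isChain_nil⟩).1 = t := by
  induction t with
  | nil => simp
  | cons d t ih =>
    rw [walkProd_cons, map_mul, Equiv.Perm.mul_apply, wordAction_gen]
    change G.push d _ = _
    rw [ih h.tail, push_of_reduced _ h]

/-- Reduced words represent distinct elements of the edge group. -/
theorem IsReduced.eq_of_walkProd_eq {G : PGraph} {s t : List G.D} (hs : G.IsReduced s)
    (ht : G.IsReduced t) (h : G.walkProd s = G.walkProd t) : s = t := by
  rw [← G.wordAction_walkProd hs, ← G.wordAction_walkProd ht, h]

theorem isWalk_append_iff (G : PGraph) {u v : G.V} {s t : List G.D} :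
    G.IsWalk u (s ++ t) v ↔ ∃ x, G.IsWalk u s x ∧ G.IsWalk x t v := by
  induction s generalizing u with
  | nil => exact ⟨fun h => ⟨u, rfl, h⟩, fun ⟨x, hx, h⟩ => by rw [show u = x from hx]; exact h⟩
  | cons d s ih =>
    constructor
    · rintro ⟨h1, h2⟩
      obtain ⟨x, hx, h3⟩ := ih.1 h2
      exact ⟨x, ⟨h1, hx⟩, h3⟩
    · rintro ⟨x, ⟨h1, h2⟩, h3⟩
      exact ⟨h1, ih.2 ⟨x, h2, h3⟩⟩

theorem isWalk_singleton (G : PGraph) (d : G.D) : G.IsWalk (G.src d) [d] (G.src (G.inv d)) :=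
  ⟨rfl, rfl⟩

/-- Backtracks can be removed from a walk. -/
theorem IsWalk.exists_reduced {G : PGraph} {u v : G.V} {t : List G.D} (h : G.IsWalk u t v) :
    ∃ s, G.IsWalk u s v ∧ G.IsReduced s ∧ G.walkProd s = G.walkProd t ∧ s.length ≤ t.length ∧
      ∀ d ∈ s, d ∈ t := by
  induction t generalizing u with
  | nil => exact ⟨[], h, List.isChain_nil, rfl, le_rfl, by simp⟩
  | cons d t ih =>
    obtain ⟨s, h1, h2, h3, h4, h5⟩ := ih h.2
    cases s with
    | nil =>
      exact ⟨[d], ⟨h.1, h1⟩, List.isChain_singleton _, by simp [← h3], by simp, by simp⟩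
    | cons e s =>
      by_cases he : e = G.inv d
      · subst he
        refine ⟨s, ?_, h2.tail, ?_, ?_, ?_⟩
        · have := h1.2
          rw [G.inv_inv, h.1] at this
          exact this
        · rw [walkProd_cons, ← h3, walkProd_cons, ← mul_assoc, gen_mul_gen_inv, one_mul]
        · simp only [List.length_cons] at h4 ⊢
          omega
        · intro x hx
          exact List.mem_cons_of_mem _ (h5 x (List.mem_cons_of_mem _ hx))
      · refine ⟨d :: e :: s, ⟨h.1, h1⟩, List.isChain_cons_cons.2 ⟨he, h2⟩, ?_, ?_, ?_⟩
        · rw [walkProd_cons, h3, walkProd_cons]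
        · simp only [List.length_cons] at h4 ⊢
          omega
        · intro x hx
          rcases List.mem_cons.1 hx with rfl | hx
          · exact List.mem_cons_self
          · exact List.mem_cons_of_mem _ (h5 x hx)

theorem IsReduced.reverse {G : PGraph} {t : List G.D} (h : G.IsReduced t) :
    G.IsReduced (t.map G.inv).reverse := by
  unfold IsReduced
  rw [List.isChain_reverse, List.isChain_map]
  refine List.IsChain.imp ?_ h
  intro a b hab hba
  exact hab (by rw [hba, G.inv_inv])

theorem Admissible.connected' {G : PGraph} (hG : G.Admissible) (u v : G.V) :
    ∃ w, G.IsWalk u w v := by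
  obtain ⟨w, hw⟩ := hG.connected u
  obtain ⟨w', hw'⟩ := hG.connected v
  exact ⟨_, hw.reverse.append hw'⟩

/-- The distance of a vertex to the basepoint. -/
noncomputable def dist (G : PGraph) (v : G.V) : ℕ :=
  sInf {n | ∃ w, G.IsWalk v w G.base ∧ w.length = n}

theorem Admissible.exists_geodesic {G : PGraph} (hG : G.Admissible) (v : G.V) :
    ∃ w, G.IsWalk v w G.base ∧ w.length = G.dist v ∧ G.IsReduced w := by
  obtain ⟨w, hw⟩ := hG.connected' v G.base
  have hne : {n | ∃ w, G.IsWalk v w G.base ∧ w.length = n}.Nonempty := ⟨_, w, hw, rfl⟩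
  obtain ⟨w', hw', hl⟩ := Nat.sInf_mem hne
  obtain ⟨s, h1, h2, -, h4, -⟩ := hw'.exists_reduced
  refine ⟨s, h1, le_antisymm (h4.trans hl.le) (Nat.sInf_le ⟨s, h1, rfl⟩), h2⟩

theorem dist_le {G : PGraph} {v : G.V} {w : List G.D} (h : G.IsWalk v w G.base) :
    G.dist v ≤ w.length := Nat.sInf_le ⟨w, h, rfl⟩

/-- A path can leave a vertex along an edge other than the one it arrived by. -/
theorem Admissible.exists_ne_of_src {G : PGraph} (hG : G.Admissible) (d : G.D) :
    ∃ e, G.src e = G.src d ∧ e ≠ d := by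
  by_contra! h
  apply hG.no_free_edge (G.src d)
  rw [valence, Nat.card_eq_one_iff_unique]
  exact ⟨⟨fun a b => Subtype.ext ((h a.1 a.2).trans (h b.1 b.2).symm)⟩, ⟨⟨d, rfl⟩⟩⟩

/-- Every directed edge is the first edge of a reduced path that ends at the basepoint. Otherwise
all reduced paths that start with this edge would lead away from the basepoint forever. -/
theorem Admissible.exists_reduced_to_base {G : PGraph} (hG : G.Admissible) (d : G.D) :
    ∃ t, G.IsWalk (G.src d) (d :: t) G.base ∧ G.IsReduced (d :: t) := by
  by_contra hd
  have hfin := hG.finite_V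
  let Bad : G.D → Prop := fun d =>
    ¬ ∃ t, G.IsWalk (G.src d) (d :: t) G.base ∧ G.IsReduced (d :: t)
  have hnext : ∀ d, Bad d → ∃ e, Bad e ∧ G.src e = G.src (G.inv d) := by
    intro d hd
    obtain ⟨e, he, hne⟩ := hG.exists_ne_of_src (G.inv d)
    refine ⟨e, ?_, he⟩
    rintro ⟨t, ht, hr⟩
    exact hd ⟨e :: t, ⟨rfl, by rw [← he]; exact ht⟩, List.isChain_cons_cons.2 ⟨hne, hr⟩⟩
  have hdist : ∀ d, Bad d → G.dist (G.src (G.inv d)) = G.dist (G.src d) + 1 := by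
    intro d hd
    obtain ⟨w, hw, hl, hr⟩ := hG.exists_geodesic (G.src (G.inv d))
    cases w with
    | nil =>
      exact absurd ⟨[], ⟨rfl, hw⟩, List.isChain_singleton _⟩ hd
    | cons e w =>
      have he : e = G.inv d := by
        by_contra he
        exact hd ⟨e :: w, ⟨rfl, hw⟩, List.isChain_cons_cons.2 ⟨he, hr⟩⟩
      subst he
      have h1 := hw.2
      rw [G.inv_inv] at h1
      have h2 := dist_le h1
      obtain ⟨w', hw', hl', -⟩ := hG.exists_geodesic (G.src d)
      have h3 : G.dist (G.src (G.inv d)) ≤ w'.length + 1 :=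
        dist_le (w := G.inv d :: w') ⟨rfl, by rw [G.inv_inv]; exact hw'⟩
      simp only [List.length_cons] at hl
      omega
  have hunb : ∀ n : ℕ, ∃ d, Bad d ∧ n ≤ G.dist (G.src d) := by
    intro n
    induction n with
    | zero => exact ⟨d, hd, Nat.zero_le _⟩
    | succ n ih =>
      obtain ⟨d', hd', hn⟩ := ih
      obtain ⟨e, he, hs⟩ := hnext d' hd'
      exact ⟨e, he, by rw [hs, hdist d' hd']; omega⟩
  obtain ⟨N, hN⟩ := (Set.finite_range G.dist).bddAbove
  obtain ⟨e, -, he⟩ := hunb (N + 1)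
  have := hN ⟨G.src e, rfl⟩
  omega

theorem isReduced_append {G : PGraph} {s t : List G.D} {d e : G.D} (hs : G.IsReduced (s ++ [d]))
    (ht : G.IsReduced (e :: t)) (h : e ≠ G.inv d) : G.IsReduced (s ++ [d] ++ e :: t) := by
  unfold IsReduced at *
  rw [List.isChain_append]
  refine ⟨hs, ht, ?_⟩
  intro x hx y hy
  simp only [List.getLast?_append, List.getLast?_singleton, Option.some_or, Option.mem_def,
    Option.some.injEq, List.head?_cons] at hx hy
  subst hx hy
  exact h

/-- A set of edges is determined by the numbers of edges outside this set in closed reduced paths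
at the basepoint: if `u` is a reduced path from the basepoint, extend it in two different ways to
a closed one. -/
theorem Admissible.filter_length_eq {G : PGraph} (hG : G.Admissible) (P Q : G.D → Bool)
    (hP : ∀ d, P (G.inv d) = P d) (hQ : ∀ d, Q (G.inv d) = Q d)
    (h : ∀ w, G.IsWalk G.base w G.base → G.IsReduced w →
      (w.filter P).length = (w.filter Q).length) {u : List G.D} {v : G.V}
    (hu : G.IsWalk G.base u v) (hr : G.IsReduced u) :
    (u.filter P).length = (u.filter Q).length := by
  by_cases hv : v = G.base
  · subst hv
    exact h u hu hr
  rcases List.eq_nil_or_concat' u with rfl | ⟨s, d, rfl⟩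
  · simp
  have hd : G.src (G.inv d) = v := by
    obtain ⟨x, -, h2⟩ := (G.isWalk_append_iff).1 hu
    exact h2.2
  have hfin := hG.finite_D
  have h3 : 2 < Nat.card {e : G.D // G.src e = v} := hG.three_le_valence v hv
  obtain ⟨e₁, e₂, he₁, he₂, hn1, hn2, h12⟩ : ∃ e₁ e₂ : G.D, G.src e₁ = v ∧ G.src e₂ = v ∧
      e₁ ≠ G.inv d ∧ e₂ ≠ G.inv d ∧ e₁ ≠ e₂ := by
    have : Fintype {e : G.D // G.src e = v} := Fintype.ofFinite _
    rw [Nat.card_eq_fintype_card] at h3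
    obtain ⟨a, ha⟩ := Fintype.exists_ne_of_one_lt_card (by omega : 1 < Fintype.card _)
      (⟨G.inv d, hd⟩ : {e : G.D // G.src e = v})
    obtain ⟨b, hb⟩ : ∃ b : {e : G.D // G.src e = v}, b ≠ ⟨G.inv d, hd⟩ ∧ b ≠ a := by
      classical
      obtain ⟨b, hb⟩ := Finset.exists_mem_notMem_of_card_lt_card
        (s := {⟨G.inv d, hd⟩, a}) (t := Finset.univ)
        (lt_of_le_of_lt Finset.card_le_two (by rwa [Finset.card_univ]))
      simp only [Finset.mem_insert, Finset.mem_singleton, not_or] at hb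
      exact ⟨b, hb.2⟩
    exact ⟨a, b, a.2, b.2, fun h => ha (Subtype.ext h), fun h => hb.1 (Subtype.ext h),
      fun h => hb.2 (Subtype.ext h.symm)⟩
  obtain ⟨t₁, ht₁, hr₁⟩ := hG.exists_reduced_to_base e₁
  obtain ⟨t₂, ht₂, hr₂⟩ := hG.exists_reduced_to_base e₂
  rw [he₁] at ht₁
  rw [he₂] at ht₂
  have q₁ := h _ (hu.append ht₁) (isReduced_append hr hr₁ hn1)
  have q₂ := h _ (hu.append ht₂) (isReduced_append hr hr₂ hn2)
  have hr₃ : G.IsReduced ((((e₁ :: t₁).map G.inv).reverse) ++ e₂ :: t₂) := by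
    have h4 := hr₁.reverse
    rw [List.map_cons, List.reverse_cons] at h4 ⊢
    refine isReduced_append h4 hr₂ ?_
    rw [G.inv_inv]
    exact h12.symm
  have q₃ := h _ (ht₁.reverse.append ht₂) hr₃
  have hrev : ∀ (R : G.D → Bool), (∀ d, R (G.inv d) = R d) → ∀ l : List G.D,
      (((l.map G.inv).reverse).filter R).length = (l.filter R).length := by
    intro R hR l
    rw [List.filter_reverse, List.length_reverse, List.filter_map, List.length_map]
    congr 2
    ext d
    exact hR d
  simp only [List.filter_append, List.length_append] at q₁ q₂ q₃ ⊢
  rw [hrev P hP, hrev Q hQ] at q₃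
  omega

theorem Admissible.exists_reduced_from_base {G : PGraph} (hG : G.Admissible) (d : G.D) :
    ∃ u, (G.IsWalk G.base (u ++ [d]) (G.src (G.inv d)) ∧ G.IsReduced (u ++ [d])) ∨
      (G.IsWalk G.base (u ++ [G.inv d]) (G.src d) ∧ G.IsReduced (u ++ [G.inv d])) := by
  obtain ⟨w, hw, -, hr⟩ := hG.exists_geodesic (G.src d)
  cases w with
  | nil =>
    refine ⟨[], Or.inl ⟨⟨(show G.src d = G.base from hw), rfl⟩, List.isChain_singleton _⟩⟩
  | cons e t =>
    have h1 := hw.reverse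
    have h2 := hr.reverse
    rw [List.map_cons, List.reverse_cons] at h1 h2
    by_cases he : e = d
    · subst he
      exact ⟨_, Or.inr ⟨h1, h2⟩⟩
    · refine ⟨(t.map G.inv).reverse ++ [G.inv e], Or.inl ⟨h1.append (G.isWalk_singleton d),
        isReduced_append h2 (List.isChain_singleton _) ?_⟩⟩
      rw [G.inv_inv]
      exact fun h => he h.symm

/-- A set of edges is determined by the number of times that reduced closed paths at the basepoint
run through it. -/
theorem Admissible.eq_of_filter_length {G : PGraph} (hG : G.Admissible) (P Q : G.D → Bool)
    (hP : ∀ d, P (G.inv d) = P d) (hQ : ∀ d, Q (G.inv d) = Q d)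
    (h : ∀ w, G.IsWalk G.base w G.base → G.IsReduced w →
      (w.filter P).length = (w.filter Q).length) (d : G.D) : P d = Q d := by
  have key : ∀ d u v, G.IsWalk G.base (u ++ [d]) v → G.IsReduced (u ++ [d]) → P d = Q d := by
    intro d u v hu hr
    obtain ⟨x, hx, -⟩ := (G.isWalk_append_iff).1 hu
    have h1 := hG.filter_length_eq P Q hP hQ h hu hr
    have h2 := hG.filter_length_eq P Q hP hQ h hx (List.IsChain.left_of_append hr)
    simp only [List.filter_append, List.length_append] at h1
    have h3 : ([d].filter P).length = ([d].filter Q).length := by omega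
    by_cases hPd : P d <;> by_cases hQd : Q d <;> simp_all
  obtain ⟨u, ⟨hu, hr⟩ | ⟨hu, hr⟩⟩ := hG.exists_reduced_from_base d
  · exact key _ _ _ hu hr
  · rw [← hP, ← hQ]
    exact key _ _ _ hu hr

/-- Every edge lies on a closed reduced path at the basepoint. -/
theorem Admissible.exists_closed_through {G : PGraph} (hG : G.Admissible) (d : G.D) :
    ∃ w, G.IsWalk G.base w G.base ∧ G.IsReduced w ∧ (d ∈ w ∨ G.inv d ∈ w) := by
  have key : ∀ d u, G.IsWalk G.base (u ++ [d]) (G.src (G.inv d)) → G.IsReduced (u ++ [d]) →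
      ∃ w, G.IsWalk G.base w G.base ∧ G.IsReduced w ∧ d ∈ w := by
    intro d u hu hr
    obtain ⟨e, he, hne⟩ := hG.exists_ne_of_src (G.inv d)
    obtain ⟨t, ht, hr'⟩ := hG.exists_reduced_to_base e
    rw [he] at ht
    exact ⟨_, hu.append ht, isReduced_append hr hr' hne, by simp⟩
  obtain ⟨u, ⟨hu, hr⟩ | ⟨hu, hr⟩⟩ := hG.exists_reduced_from_base d
  · obtain ⟨w, h1, h2, h3⟩ := key _ _ hu hr
    exact ⟨w, h1, h2, Or.inl h3⟩
  · obtain ⟨w, h1, h2, h3⟩ := key (G.inv d) u (by rw [G.inv_inv]; exact hu) hr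
    exact ⟨w, h1, h2, Or.inr h3⟩

end PGraph

end Auter

namespace Auter

/-! ### Collapses and isomorphisms on fundamental groups -/

namespace PGraph

variable {A B C : PGraph}

namespace Collapse

variable {F : Set A.D} (c : Collapse A F B)

theorem hom_gen (d : A.D) : c.hom (A.gen d) = (c.onD d).elim 1 B.gen :=
  PresentedGroup.toGroup.of _

theorem hom_walkProd (w : List A.D) : c.hom (A.walkProd w) = B.walkProd (w.filterMap c.onD) := by
  induction w with
  | nil => simp
  | cons d w ih =>
    rw [walkProd_cons, map_mul, ih, hom_gen]
    rcases h : c.onD d with _ | e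
    · simp [h]
    · simp [h]

theorem onV_src_inv {d : A.D} {e : B.D} (h : c.onD d = some e) :
    c.onV (A.src (A.inv d)) = B.src (B.inv e) :=
  (c.src_onD _ _ (by rw [c.onD_inv, h]; rfl)).symm

theorem isWalk {u v : A.V} {w : List A.D} (h : A.IsWalk u w v) :
    B.IsWalk (c.onV u) (w.filterMap c.onD) (c.onV v) := by
  induction w generalizing u with
  | nil => exact congrArg c.onV h
  | cons d w ih =>
    rcases hd : c.onD d with _ | e
    · rw [List.filterMap_cons, hd]
      have h1 := ih h.2
      have h2 : c.onV u = c.onV (A.src (A.inv d)) := by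
        rw [c.onV_eq_iff]
        exact ⟨[d], by simpa using (c.onD_eq_none d).1 hd, h.1, rfl⟩
      rw [h2]
      exact h1
    · rw [List.filterMap_cons, hd]
      refine ⟨?_, ?_⟩
      · rw [c.src_onD d e hd, h.1]
      · rw [← c.onV_src_inv hd]
        exact ih h.2

theorem eq_of_onD {d d' : A.D} {e : B.D} (h : c.onD d = some e) (h' : c.onD d' = some e) :
    d = d' := (c.onD_bijective e).unique h h'

/-- The image of a path without backtracking has no backtracking: the collapsed part between two
cancelling edges would be a closed path in the forest. -/
theorem isReduced {u v : A.V} {w : List A.D} (h : A.IsWalk u w v) (hr : A.IsReduced w) :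
    B.IsReduced (w.filterMap c.onD) := by
  induction w generalizing u with
  | nil => exact List.isChain_nil
  | cons d w ih =>
    have h1 := ih h.2 hr.tail
    rcases hd : c.onD d with _ | e
    · rwa [List.filterMap_cons, hd]
    · rw [List.filterMap_cons, hd]
      refine List.isChain_cons.2 ⟨fun f hf => ?_, h1⟩
      rintro rfl
      obtain ⟨l, hl⟩ : ∃ l, w.filterMap c.onD = B.inv e :: l := by
        cases hw : w.filterMap c.onD with
        | nil => simp [hw] at hf
        | cons x l => simp [hw] at hf; exact ⟨l, by rw [hf]⟩
      rw [List.filterMap_eq_cons_iff] at hl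
      obtain ⟨s, d', t, rfl, hs, hd', -⟩ := hl
      have h2 : d' = A.inv d := c.eq_of_onD hd' (by rw [c.onD_inv, hd]; rfl)
      subst h2
      obtain ⟨x, hx, hx'⟩ := (A.isWalk_append_iff).1 h.2
      have h3 : A.src (A.inv d) = x := hx'.1
      subst h3
      have h4 := c.forest.2 _ s (fun y hy => (c.onD_eq_none y).1 (hs y hy)) hx
        (List.IsChain.left_of_append hr.tail)
      subst h4
      exact (List.isChain_cons_cons.1 hr).1 rfl

theorem length_filterMap (w : List A.D) [DecidablePred (· ∈ F)] :
    (w.filterMap c.onD).length = (w.filter (fun d => decide (d ∉ F))).length := by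
  induction w with
  | nil => rfl
  | cons d w ih =>
    rcases hd : c.onD d with _ | e
    · have := (c.onD_eq_none d).1 hd
      simp [hd, this, ih]
    · have : d ∉ F := fun h => by
        rw [(c.onD_eq_none d).2 h] at hd
        cases hd
      simp [hd, this, ih]

theorem exists_lift (e : B.D) : ∃ d, c.onD d = some e := (c.onD_bijective e).exists

/-- Paths lift along a collapse, connecting the lifts of the edges by paths in the forest. -/
theorem exists_lift_walk {l : List B.D} {u v : A.V} (h : B.IsWalk (c.onV u) l (c.onV v))
    (hr : B.IsReduced l) :
    ∃ w, A.IsWalk u w v ∧ A.IsReduced w ∧ w.filterMap c.onD = l := by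
  have hF : ∀ {u v}, c.onV u = c.onV v → ∃ s, A.IsWalk u s v ∧ A.IsReduced s ∧ ∀ d ∈ s, d ∈ F := by
    intro u v huv
    obtain ⟨w, hw, hw'⟩ := (c.onV_eq_iff u v).1 huv
    obtain ⟨s, h1, h2, -, -, h5⟩ := hw'.exists_reduced
    exact ⟨s, h1, h2, fun d hd => hw d (h5 d hd)⟩
  have hFn : ∀ s : List A.D, (∀ d ∈ s, d ∈ F) → s.filterMap c.onD = [] := by
    intro s hs
    rw [List.filterMap_eq_nil_iff]
    exact fun d hd => (c.onD_eq_none d).2 (hs d hd)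
  induction l generalizing u with
  | nil =>
    obtain ⟨s, h1, h2, h3⟩ := hF (show c.onV u = c.onV v from h)
    exact ⟨s, h1, h2, hFn s h3⟩
  | cons e l ih =>
    obtain ⟨d, hd⟩ := c.exists_lift e
    have h0 := h.2
    rw [← c.onV_src_inv hd] at h0
    obtain ⟨w, hw, hwr, hwl⟩ := ih h0 hr.tail
    obtain ⟨s, h1, h2, h3⟩ := hF (u := u) (v := A.src d) (by rw [← c.src_onD d e hd]; exact h.1.symm)
    have hdF : d ∉ F := fun h => by
      rw [(c.onD_eq_none d).2 h] at hd
      cases hd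
    refine ⟨s ++ d :: w, h1.append ⟨rfl, hw⟩, ?_, ?_⟩
    · unfold IsReduced
      rw [List.isChain_append]
      refine ⟨h2, ?_, ?_⟩
      · cases w with
        | nil => exact List.isChain_singleton _
        | cons d' w =>
          refine List.isChain_cons_cons.2 ⟨?_, hwr⟩
          rintro rfl
          have h4 : c.onD (A.inv d) = some (B.inv e) := by rw [c.onD_inv, hd]; rfl
          rw [List.filterMap_cons, h4] at hwl
          simp only at hwl
          rw [← hwl] at hr
          exact (List.isChain_cons_cons.1 hr).1 rfl
      · intro x hx y hy
        simp only [List.head?_cons, Option.mem_def, Option.some.injEq] at hy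
        subst hy
        rintro rfl
        have h5 := h3 x (List.mem_of_getLast? hx)
        exact hdF (c.forest.1 _ h5)
    · rw [List.filterMap_append, hFn s h3, List.filterMap_cons, hd, List.nil_append, hwl]

theorem mem_pi1 {x : A.EdgeGroup} (hx : x ∈ A.pi1) : c.hom x ∈ B.pi1 := by
  obtain ⟨w, hw, rfl⟩ := hx
  refine ⟨w.filterMap c.onD, ?_, (c.hom_walkProd w).symm⟩
  have := c.isWalk hw
  rwa [c.onV_base] at this

end Collapse

theorem exists_reduced_of_mem_pi1 {x : A.EdgeGroup} (hx : x ∈ A.pi1) :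
    ∃ w, A.IsWalk A.base w A.base ∧ A.IsReduced w ∧ A.walkProd w = x := by
  obtain ⟨w, hw, rfl⟩ := hx
  obtain ⟨s, h1, h2, h3, -, -⟩ := hw.exists_reduced
  exact ⟨s, h1, h2, h3⟩

namespace Collapse

variable {F : Set A.D} (c : Collapse A F B)

/-- A forest collapse induces an isomorphism of fundamental groups. -/
theorem bijective_hom : Function.Bijective
    ((c.hom.comp A.pi1.subtype).codRestrict B.pi1 fun x => c.mem_pi1 x.2) := by
  constructor
  · rw [injective_iff_map_eq_one]
    rintro ⟨x, hx⟩ h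
    obtain ⟨w, hw, hr, rfl⟩ := exists_reduced_of_mem_pi1 hx
    have h1 : c.hom (A.walkProd w) = 1 := congrArg Subtype.val h
    rw [c.hom_walkProd] at h1
    have h2 : w.filterMap c.onD = [] :=
      (c.isReduced hw hr).eq_of_walkProd_eq List.isChain_nil (by rw [h1]; rfl)
    rw [List.filterMap_eq_nil_iff] at h2
    have h3 := c.forest.2 _ w (fun d hd => (c.onD_eq_none d).1 (h2 d hd)) hw hr
    subst h3
    rfl
  · rintro ⟨y, hy⟩
    obtain ⟨l, hl, hr, rfl⟩ := exists_reduced_of_mem_pi1 hy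
    rw [← c.onV_base] at hl
    obtain ⟨w, h1, -, h3⟩ := c.exists_lift_walk hl hr
    refine ⟨⟨A.walkProd w, w, h1, rfl⟩, Subtype.ext ?_⟩
    change c.hom (A.walkProd w) = _
    rw [c.hom_walkProd, h3]

/-- The isomorphism of fundamental groups induced by a forest collapse. -/
noncomputable def piEquiv : A.pi1 ≃* B.pi1 := MulEquiv.ofBijective _ c.bijective_hom

/-- The collapse of a forest is unique up to isomorphism. -/
theorem exists_iso {B' : PGraph} (c' : Collapse A F B') :
    ∃ j : Iso B B', ∀ x, j.hom (c.hom x) = c'.hom x := by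
  have lift : ∀ {B B' : PGraph} (c : Collapse A F B) (c' : Collapse A F B'),
      ∃ f : B.D → B'.D, ∀ d e, c.onD d = some e → c'.onD d = some (f e) := by
    intro B B' c c'
    have : ∀ e, ∃ e', ∀ d, c.onD d = some e → c'.onD d = some e' := by
      intro e
      obtain ⟨d, hd⟩ := c.exists_lift e
      rcases hd' : c'.onD d with _ | e'
      · rw [c'.onD_eq_none, ← c.onD_eq_none, hd] at hd'
        cases hd'
      · exact ⟨e', fun d' h => by rw [c.eq_of_onD h hd, hd']⟩
    choose f hf using this
    exact ⟨f, fun d e => hf e d⟩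
  have liftV : ∀ {B B' : PGraph} (c : Collapse A F B) (c' : Collapse A F B'),
      ∃ f : B.V → B'.V, ∀ v, f (c.onV v) = c'.onV v := by
    intro B B' c c'
    refine ⟨fun b => c'.onV (Function.surjInv c.onV_surjective b), fun v => ?_⟩
    rw [c'.onV_eq_iff, ← c.onV_eq_iff]
    exact Function.surjInv_eq c.onV_surjective _
  obtain ⟨f, hf⟩ := lift c c'
  obtain ⟨g, hg⟩ := lift c' c
  obtain ⟨fV, hfV⟩ := liftV c c'
  obtain ⟨gV, hgV⟩ := liftV c' c
  let j : Iso B B' :=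
    { onV := ⟨fV, gV, fun b => by
          obtain ⟨v, rfl⟩ := c.onV_surjective b
          rw [hfV, hgV], fun b => by
          obtain ⟨v, rfl⟩ := c'.onV_surjective b
          rw [hgV, hfV]⟩
      onD := ⟨f, g, fun e => by
          obtain ⟨d, hd⟩ := c.exists_lift e
          have := hg _ _ (hf _ _ hd)
          rw [hd] at this
          exact (Option.some.inj this).symm, fun e => by
          obtain ⟨d, hd⟩ := c'.exists_lift e
          have := hf _ _ (hg _ _ hd)
          rw [hd] at this
          exact (Option.some.inj this).symm⟩
      src_onD := fun e => by
        obtain ⟨d, hd⟩ := c.exists_lift e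
        change B'.src (f e) = fV (B.src e)
        rw [c'.src_onD d _ (hf _ _ hd), c.src_onD d e hd, hfV]
      onD_inv := fun e => by
        obtain ⟨d, hd⟩ := c.exists_lift e
        change f (B.inv e) = B'.inv (f e)
        have h1 : c.onD (A.inv d) = some (B.inv e) := by rw [c.onD_inv, hd]; rfl
        have h2 := hf _ _ h1
        rw [c'.onD_inv, hf _ _ hd] at h2
        exact (Option.some.inj h2).symm
      onV_base := by
        change fV B.base = _
        rw [← c.onV_base, hfV, c'.onV_base] }
  refine ⟨j, fun x => ?_⟩
  have h : j.hom.comp c.hom = c'.hom := PresentedGroup.ext fun d => by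
    change j.hom (c.hom (A.gen d)) = c'.hom (A.gen d)
    rw [hom_gen, hom_gen]
    rcases hd : c.onD d with _ | e
    · rw [(c'.onD_eq_none d).2 ((c.onD_eq_none d).1 hd)]
      simp
    · rw [hf _ _ hd]
      exact j.hom_gen e
  exact DFunLike.congr_fun h x

end Collapse

/-- The collapse of the empty forest. -/
def Collapse.refl (A : PGraph) : Collapse A ∅ A where
  forest := ⟨by simp, fun v w h _ _ => by
    cases w with
    | nil => rfl
    | cons d w => exact absurd (h d List.mem_cons_self) (Set.notMem_empty _)⟩
  onV := id
  onD := some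
  onV_base := rfl
  onV_surjective := Function.surjective_id
  onV_eq_iff v v' := by
    constructor
    · intro h
      exact ⟨[], by simp, h⟩
    · rintro ⟨w, hw, h⟩
      cases w with
      | nil => exact h
      | cons d w => exact absurd (hw d List.mem_cons_self) (Set.notMem_empty _)
  onD_eq_none d := by simp
  onD_inv d := rfl
  onD_bijective e := ⟨e, rfl, fun d h => Option.some.inj h⟩
  src_onD d e h := by rw [Option.some.inj h]; rfl

theorem Collapse.refl_hom (A : PGraph) (x : A.EdgeGroup) : (Collapse.refl A).hom x = x := by
  have h : (Collapse.refl A).hom = MonoidHom.id _ :=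
    PresentedGroup.ext fun d => (Collapse.refl A).hom_gen d
  rw [h]
  rfl

namespace Iso

variable (i : Iso A B)

theorem isWalk {u v : A.V} {w : List A.D} (h : A.IsWalk u w v) :
    B.IsWalk (i.onV u) (w.map i.onD) (i.onV v) := by
  induction w generalizing u with
  | nil => exact congrArg i.onV h
  | cons d w ih =>
    refine ⟨by rw [i.src_onD, h.1], ?_⟩
    rw [← i.onD_inv, i.src_onD]
    exact ih h.2

theorem isReduced {w : List A.D} (h : A.IsReduced w) : B.IsReduced (w.map i.onD) := by
  unfold IsReduced
  rw [List.isChain_map]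
  refine List.IsChain.imp ?_ h
  intro a b hab hba
  rw [← i.onD_inv] at hba
  exact hab (i.onD.injective hba)

theorem hom_walkProd (w : List A.D) : i.hom (A.walkProd w) = B.walkProd (w.map i.onD) := by
  induction w with
  | nil => simp
  | cons d w ih => rw [walkProd_cons, map_mul, ih, hom_gen, List.map_cons, walkProd_cons]

theorem mem_pi1 {x : A.EdgeGroup} (hx : x ∈ A.pi1) : i.hom x ∈ B.pi1 := by
  obtain ⟨w, hw, rfl⟩ := hx
  refine ⟨w.map i.onD, ?_, (i.hom_walkProd w).symm⟩
  have := i.isWalk hw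
  rwa [i.onV_base] at this

theorem hom_symm (x : B.EdgeGroup) : i.hom (i.symm.hom x) = x := i.symm.symm_hom x

/-- The isomorphism of fundamental groups induced by an isomorphism of graphs. -/
def piEquiv : A.pi1 ≃* B.pi1 where
  toFun x := ⟨i.hom x, i.mem_pi1 x.2⟩
  invFun x := ⟨i.symm.hom x, i.symm.mem_pi1 x.2⟩
  left_inv _ := Subtype.ext (i.symm_hom _)
  right_inv _ := Subtype.ext (i.hom_symm _)
  map_mul' _ _ := Subtype.ext (map_mul _ _ _)

theorem valence_onV (v : A.V) : B.valence (i.onV v) = A.valence v := by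
  refine (Nat.card_congr (Equiv.subtypeEquiv i.onD fun d => ?_)).symm
  rw [i.src_onD, i.onV.apply_eq_iff_eq]

theorem admissible (i : Iso A B) (hA : A.Admissible) : B.Admissible where
  finite_V := by
    have := hA.finite_V
    exact Finite.of_equiv _ i.onV
  finite_D := by
    have := hA.finite_D
    exact Finite.of_equiv _ i.onD
  connected v := by
    obtain ⟨w, hw⟩ := hA.connected (i.onV.symm v)
    have := i.isWalk hw
    rw [i.onV_base, Equiv.apply_symm_apply] at this
    exact ⟨_, this⟩
  no_free_edge v := by
    have := i.valence_onV (i.onV.symm v)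
    rw [Equiv.apply_symm_apply] at this
    rw [this]
    exact hA.no_free_edge _
  three_le_valence v hv := by
    have := i.valence_onV (i.onV.symm v)
    rw [Equiv.apply_symm_apply] at this
    rw [this]
    refine hA.three_le_valence _ fun h => hv ?_
    rw [← i.onV_base, ← h, Equiv.apply_symm_apply]

theorem isForest {F : Set A.D} (hF : A.IsForest F) : B.IsForest (i.onD '' F) := by
  constructor
  · rintro _ ⟨d, hd, rfl⟩
    exact ⟨A.inv d, hF.1 d hd, i.onD_inv d⟩
  · intro v w hw h hr
    have h1 := i.symm.isWalk h
    have h2 := hF.2 _ _ (fun d hd => by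
      obtain ⟨e, he, rfl⟩ := List.mem_map.1 hd
      obtain ⟨d, hd, rfl⟩ := hw e he
      change i.onD.symm (i.onD d) ∈ F
      rwa [Equiv.symm_apply_apply]) h1 (i.symm.isReduced hr)
    exact List.map_eq_nil_iff.1 h2

/-- Transport of a collapse along an isomorphism. -/
def collapse {F : Set A.D} (c : Collapse A F C) : Collapse B (i.onD '' F) C where
  forest := i.isForest c.forest
  onV v := c.onV (i.onV.symm v)
  onD d := c.onD (i.onD.symm d)
  onV_base := by rw [← i.onV_base, Equiv.symm_apply_apply, c.onV_base]
  onV_surjective := c.onV_surjective.comp i.onV.symm.surjective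
  onV_eq_iff v v' := by
    rw [c.onV_eq_iff]
    constructor
    · rintro ⟨w, hw, h⟩
      refine ⟨w.map i.onD, fun d hd => ?_, ?_⟩
      · obtain ⟨e, he, rfl⟩ := List.mem_map.1 hd
        exact ⟨e, hw e he, rfl⟩
      · have := i.isWalk h
        rwa [Equiv.apply_symm_apply, Equiv.apply_symm_apply] at this
    · rintro ⟨w, hw, h⟩
      refine ⟨w.map i.symm.onD, fun d hd => ?_, i.symm.isWalk h⟩
      obtain ⟨e, he, rfl⟩ := List.mem_map.1 hd
      obtain ⟨d, hd, rfl⟩ := hw e he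
      change i.onD.symm (i.onD d) ∈ F
      rwa [Equiv.symm_apply_apply]
  onD_eq_none d := by
    rw [c.onD_eq_none, Equiv.image_eq_preimage_symm]
    rfl
  onD_inv d := by
    rw [← c.onD_inv]
    exact congrArg c.onD (i.symm.onD_inv d)
  onD_bijective e := by
    obtain ⟨d, hd, hu⟩ := c.onD_bijective e
    refine ⟨i.onD d, by simpa using hd, fun d' hd' => ?_⟩
    rw [← hu _ hd', Equiv.apply_symm_apply]
  src_onD d e h := by
    rw [c.src_onD _ _ h]
    exact congrArg c.onV (i.symm.src_onD d)

theorem collapse_hom {F : Set A.D} (c : Collapse A F C) (x : A.EdgeGroup) :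
    (i.collapse c).hom (i.hom x) = c.hom x := by
  have h : (i.collapse c).hom.comp i.hom = c.hom := PresentedGroup.ext fun d => by
    change (i.collapse c).hom (i.hom (A.gen d)) = c.hom (A.gen d)
    rw [hom_gen, Collapse.hom_gen, Collapse.hom_gen]
    change (c.onD (i.onD.symm (i.onD d))).elim _ _ = _
    rw [Equiv.symm_apply_apply]
  exact DFunLike.congr_fun h x

@[ext] theorem ext {i j : Iso A B} (hV : ∀ v, i.onV v = j.onV v) (hD : ∀ d, i.onD d = j.onD d) :
    i = j := by
  obtain ⟨iV, iD, _, _, _⟩ := i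
  obtain ⟨jV, jD, _, _, _⟩ := j
  have h1 : iV = jV := Equiv.ext hV
  have h2 : iD = jD := Equiv.ext hD
  subst h1 h2
  rfl

instance : Group (Iso A A) where
  mul i j := j.trans i
  one := Iso.refl A
  inv i := i.symm
  mul_assoc i j k := rfl
  one_mul i := rfl
  mul_one i := rfl
  inv_mul_cancel i := ext (fun v => i.onV.symm_apply_apply v) fun d => i.onD.symm_apply_apply d

@[simp] theorem mul_onV (i j : Iso A A) (v : A.V) : (i * j).onV v = i.onV (j.onV v) := rfl
@[simp] theorem mul_onD (i j : Iso A A) (d : A.D) : (i * j).onD d = i.onD (j.onD d) := rfl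
@[simp] theorem one_onV (v : A.V) : (1 : Iso A A).onV v = v := rfl
@[simp] theorem one_onD (d : A.D) : (1 : Iso A A).onD d = d := rfl

/-- The action of the automorphisms of a graph on its directed edges. -/
def permD (A : PGraph) : Iso A A →* Equiv.Perm A.D where
  toFun i := i.onD
  map_one' := rfl
  map_mul' _ _ := rfl

/-- The action of the automorphisms of a graph on its vertices. -/
def permV (A : PGraph) : Iso A A →* Equiv.Perm A.V where
  toFun i := i.onV
  map_one' := rfl
  map_mul' _ _ := rfl

/-- The action of the automorphisms of a graph on its fundamental group. -/
def piAut (A : PGraph) : Iso A A →* MulAut A.pi1 where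
  toFun i := i.piEquiv
  map_one' := MulEquiv.ext fun x => Subtype.ext (Iso.refl_hom A x)
  map_mul' i j := MulEquiv.ext fun x => Subtype.ext (Iso.trans_hom j i x)

end Iso

theorem Admissible.eq_base_or {G : PGraph} (hG : G.Admissible) (v : G.V) :
    v = G.base ∨ ∃ d, G.src d = v := by
  by_cases hv : v = G.base
  · exact Or.inl hv
  · right
    by_contra! h
    have h1 := hG.three_le_valence v hv
    have : IsEmpty {d : G.D // G.src d = v} := ⟨fun d => h d.1 d.2⟩
    rw [valence, Nat.card_of_isEmpty] at h1
    omega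

/-- An isomorphism between admissible graphs is determined by its effect on directed edges. -/
theorem Admissible.iso_ext (hA : A.Admissible) {i j : Iso A B} (h : ∀ d, i.onD d = j.onD d) :
    i = j := by
  refine Iso.ext (fun v => ?_) h
  rcases hA.eq_base_or v with rfl | ⟨d, rfl⟩
  · rw [i.onV_base, j.onV_base]
  · rw [← i.src_onD, ← j.src_onD, h]

theorem Admissible.permD_injective (hA : A.Admissible) : Function.Injective (Iso.permD A) :=
  fun _ _ h => hA.iso_ext fun d => DFunLike.congr_fun h d

theorem Admissible.finite_iso (hA : A.Admissible) : Finite (Iso A A) := by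
  have := hA.finite_D
  exact Finite.of_injective _ hA.permD_injective

/-- The automorphisms of an admissible graph act faithfully on its fundamental group. -/
theorem Admissible.piAut_injective (hA : A.Admissible) : Function.Injective (Iso.piAut A) := by
  rw [injective_iff_map_eq_one]
  intro i hi
  refine hA.iso_ext fun d => ?_
  have key : ∀ w, A.IsWalk A.base w A.base → A.IsReduced w → w.map i.onD = w := by
    intro w hw hr
    refine (i.isReduced hr).eq_of_walkProd_eq hr ?_
    rw [← i.hom_walkProd]
    exact congrArg Subtype.val (DFunLike.congr_fun hi ⟨A.walkProd w, w, hw, rfl⟩)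
  have hmem : ∀ w, A.IsWalk A.base w A.base → A.IsReduced w → ∀ d ∈ w, i.onD d = d := by
    intro w hw hr d hd
    have h1 := key w hw hr
    obtain ⟨n, hn, rfl⟩ := List.mem_iff_getElem.1 hd
    have h2 : (w.map i.onD)[n]'(by simpa using hn) = w[n] := by simp [h1]
    simpa using h2
  obtain ⟨w, hw, hr, hd | hd⟩ := hA.exists_closed_through d
  · exact hmem w hw hr d hd
  · have h1 := hmem w hw hr _ hd
    rw [i.onD_inv] at h1
    have h2 := congrArg A.inv h1
    rwa [A.inv_inv, A.inv_inv] at h2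

end PGraph

end Auter

namespace Auter

/-! ### Quotients by forests -/

namespace PGraph

variable {G : PGraph} {F : Set G.D}

namespace IsForest

/-- In a forest, a reduced path is determined by its ends. -/
theorem eq_of_isWalk (hF : G.IsForest F) {u v : G.V} {w w' : List G.D} (hw : G.IsWalk u w v)
    (hw' : G.IsWalk u w' v) (hr : G.IsReduced w) (hr' : G.IsReduced w') (h : ∀ d ∈ w, d ∈ F)
    (h' : ∀ d ∈ w', d ∈ F) : w = w' := by
  obtain ⟨s, h1, h2, h3, -, h5⟩ := (hw.append hw'.reverse).exists_reduced
  have h6 := hF.2 u s (fun d hd => by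
    rcases List.mem_append.1 (h5 d hd) with hd | hd
    · exact h d hd
    · rw [List.mem_reverse, List.mem_map] at hd
      obtain ⟨e, he, rfl⟩ := hd
      exact hF.1 e (h' e he)) h1 h2
  subst h6
  refine hr.eq_of_walkProd_eq hr' ?_
  rw [walkProd_nil, walkProd_append, walkProd_reverse] at h3
  exact (mul_inv_eq_one.1 h3.symm)

/-- Being in the same component of a forest. -/
def setoid (hF : G.IsForest F) : Setoid G.V where
  r := G.JoinedIn F
  iseqv :=
    { refl := fun v => ⟨[], by simp, rfl⟩
      symm := by
        rintro u v ⟨w, hw, h⟩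
        refine ⟨_, fun d hd => ?_, h.reverse⟩
        rw [List.mem_reverse, List.mem_map] at hd
        obtain ⟨e, he, rfl⟩ := hd
        exact hF.1 e (hw e he)
      trans := by
        rintro u v x ⟨w, hw, h⟩ ⟨w', hw', h'⟩
        refine ⟨w ++ w', fun d hd => ?_, h.append h'⟩
        rcases List.mem_append.1 hd with hd | hd
        · exact hw d hd
        · exact hw' d hd }

/-- The graph obtained by collapsing each component of a forest to a point. -/
def quotient (hF : G.IsForest F) : PGraph where
  V := Quotient hF.setoid
  D := {d : G.D // d ∉ F}
  src d := Quotient.mk _ (G.src d)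
  inv d := ⟨G.inv d, fun h => d.2 (by have := hF.1 _ h; rwa [G.inv_inv] at this)⟩
  inv_inv d := Subtype.ext (G.inv_inv _)
  inv_ne d h := G.inv_ne _ (congrArg Subtype.val h)
  base := Quotient.mk _ G.base

/-- The vertex of the quotient given by a vertex of the graph. -/
def toQuot (hF : G.IsForest F) (v : G.V) : hF.quotient.V := Quotient.mk hF.setoid v

theorem toQuot_surjective (hF : G.IsForest F) : Function.Surjective hF.toQuot :=
  Quotient.mk_surjective

theorem toQuot_eq_iff (hF : G.IsForest F) {u v : G.V} :
    hF.toQuot u = hF.toQuot v ↔ G.JoinedIn F u v := Quotient.eq (r := hF.setoid)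

/-- The directed edge of the quotient given by an edge that is not collapsed. -/
def edge (hF : G.IsForest F) (d : G.D) (h : d ∉ F) : hF.quotient.D := ⟨d, h⟩

theorem edge_inj (hF : G.IsForest F) {d d' : G.D} {h : d ∉ F} {h' : d' ∉ F} :
    hF.edge d h = hF.edge d' h' ↔ d = d' := Subtype.ext_iff

theorem exists_edge (hF : G.IsForest F) (e : hF.quotient.D) : ∃ d h, hF.edge d h = e :=
  ⟨e.1, e.2, rfl⟩

open Classical in
/-- The collapse map to the quotient. -/
noncomputable def collapse (hF : G.IsForest F) : Collapse G F hF.quotient where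
  forest := hF
  onV := hF.toQuot
  onD d := if h : d ∈ F then none else some (hF.edge d h)
  onV_base := rfl
  onV_surjective := hF.toQuot_surjective
  onV_eq_iff v v' := hF.toQuot_eq_iff
  onD_eq_none d := by simp
  onD_inv d := by
    have h1 : G.inv d ∈ F ↔ d ∈ F :=
      ⟨fun h => by have := hF.1 _ h; rwa [G.inv_inv] at this, hF.1 d⟩
    by_cases h : d ∈ F
    · simp [h, h1.2 h]
    · have h2 : G.inv d ∉ F := fun h' => h (h1.1 h')
      simp only [h, h2, dite_false, Option.map_some]
      rfl
  onD_bijective e := by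
    obtain ⟨d, h, rfl⟩ := hF.exists_edge e
    refine ⟨d, by simp [h], fun d' hd => ?_⟩
    by_cases h : d' ∈ F
    · simp [h] at hd
    · simpa [h, edge_inj] using hd
  src_onD d e he := by
    by_cases h : d ∈ F
    · simp [h] at he
    · simp only [h, dite_false, Option.some.injEq] at he
      rw [← he]
      rfl

/-- A component of a forest that is not a single vertex has two leaves. -/
theorem exists_leaves [Finite G.V] (hF : G.IsForest F) {d₀ : G.D} (hd₀ : d₀ ∈ F) :
    ∃ u₁ u₂ : G.V, u₁ ≠ u₂ ∧ G.JoinedIn F u₁ (G.src d₀) ∧ G.JoinedIn F u₂ (G.src d₀) ∧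
      (∀ d ∈ F, ∀ e ∈ F, G.src d = u₁ → G.src e = u₁ → d = e) ∧
      (∀ d ∈ F, ∀ e ∈ F, G.src d = u₂ → G.src e = u₂ → d = e) := by
  let Q : ℕ → Prop := fun n => ∃ u v w, G.JoinedIn F u (G.src d₀) ∧ G.IsWalk u w v ∧
    G.IsReduced w ∧ (∀ d ∈ w, d ∈ F) ∧ w.length = n
  have hb : BddAbove {n | Q n} := by
    classical
    let f : G.V × G.V → ℕ := fun x => if h : ∃ w, G.IsWalk x.1 w x.2 ∧ G.IsReduced w ∧
      (∀ d ∈ w, d ∈ F) then h.choose.length else 0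
    refine ((Set.finite_range f).subset ?_).bddAbove
    rintro n ⟨u, v, w, -, h1, h2, h3, rfl⟩
    refine ⟨(u, v), ?_⟩
    have hex : ∃ w, G.IsWalk u w v ∧ G.IsReduced w ∧ (∀ d ∈ w, d ∈ F) := ⟨w, h1, h2, h3⟩
    have h4 : f (u, v) = hex.choose.length := dif_pos hex
    obtain ⟨g1, g2, g3⟩ := hex.choose_spec
    rw [h4, hF.eq_of_isWalk g1 h1 g2 h2 g3 h3]
  have hne : {n | Q n}.Nonempty := ⟨1, _, _, [d₀], ⟨[], by simp, rfl⟩, G.isWalk_singleton d₀,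
    List.isChain_singleton _, by simpa using hd₀, rfl⟩
  obtain ⟨u, v, w, h1, h2, h3, h4, h5⟩ := Nat.sSup_mem hne hb
  have hmax : ∀ u' v' w', G.JoinedIn F u' (G.src d₀) → G.IsWalk u' w' v' → G.IsReduced w' →
      (∀ d ∈ w', d ∈ F) → w'.length ≤ w.length := by
    intro u' v' w' g1 g2 g3 g4
    rw [h5]
    exact le_csSup hb ⟨u', v', w', g1, g2, g3, g4, rfl⟩
  have h1' : G.JoinedIn F v (G.src d₀) :=
    hF.setoid.trans (hF.setoid.symm (⟨w, h4, h2⟩ : G.JoinedIn F u v)) h1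
  -- no longest path can be prolonged at its start
  have leaf : ∀ u v w, G.JoinedIn F u (G.src d₀) → G.IsWalk u w v → G.IsReduced w →
      (∀ d ∈ w, d ∈ F) → w ≠ [] → (∀ u' v' w', G.JoinedIn F u' (G.src d₀) → G.IsWalk u' w' v' →
        G.IsReduced w' → (∀ d ∈ w', d ∈ F) → w'.length ≤ w.length) →
      ∃ d, ∀ e ∈ F, G.src e = u → e = d := by
    intro u v w g1 g2 g3 g4 g5 g6
    cases w with
    | nil => exact absurd rfl g5
    | cons d w =>
      refine ⟨d, fun e he hs => ?_⟩
      by_contra hne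
      have := g6 (G.src (G.inv e)) v (G.inv e :: d :: w)
        (hF.setoid.trans (⟨[G.inv e], by simpa using hF.1 e he, rfl, by rw [G.inv_inv]; exact hs⟩ :
          G.JoinedIn F _ u) g1)
        ⟨rfl, by rw [G.inv_inv, hs]; exact g2⟩
        (List.isChain_cons_cons.2 ⟨by rw [G.inv_inv]; exact fun h => hne h.symm, g3⟩)
        (by
          intro x hx
          rcases List.mem_cons.1 hx with rfl | hx
          · exact hF.1 e he
          · exact g4 x hx)
      simp at this
  have hw : w ≠ [] := by
    rintro rfl
    have := hmax _ _ [d₀] ⟨[], by simp, rfl⟩ (G.isWalk_singleton d₀) (List.isChain_singleton _)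
      (by simpa using hd₀)
    simp at this
  obtain ⟨d₁, hd₁⟩ := leaf u v w h1 h2 h3 h4 hw hmax
  obtain ⟨d₂, hd₂⟩ := leaf v u _ h1' h2.reverse h3.reverse (fun d hd => by
    rw [List.mem_reverse, List.mem_map] at hd
    obtain ⟨e, he, rfl⟩ := hd
    exact hF.1 e (h4 e he)) (by simpa using hw) (by simpa using hmax)
  refine ⟨u, v, ?_, h1, h1', fun d hd e he h h' => (hd₁ d hd h).trans (hd₁ e he h').symm,
    fun d hd e he h h' => (hd₂ d hd h).trans (hd₂ e he h').symm⟩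
  rintro rfl
  exact hw (hF.2 _ _ h4 h2 h3)

/-- Collapsing a forest of an admissible graph gives an admissible graph. -/
theorem admissible_quotient (hG : G.Admissible) (hF : G.IsForest F) : hF.quotient.Admissible := by
  classical
  have := hG.finite_V
  have := hG.finite_D
  have := Fintype.ofFinite G.D
  have hval : ∀ v, G.valence v = (Finset.univ.filter fun d => G.src d = v).card := fun v => by
    rw [valence, Nat.card_eq_fintype_card, Fintype.card_subtype]
  have hval' : ∀ v, hF.quotient.valence v =
      (Finset.univ.filter fun d => d ∉ F ∧ hF.toQuot (G.src d) = v).card := fun v => by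
    rw [← Fintype.card_subtype, ← Nat.card_eq_fintype_card]
    exact Nat.card_congr (Equiv.subtypeSubtypeEquivSubtypeInter (fun d => d ∉ F)
      fun d => hF.toQuot (G.src d) = v)
  -- a component with an edge has two leaves, and at least three other edges leave from there
  have key : ∀ d₀ ∈ F, 3 ≤ hF.quotient.valence (hF.toQuot (G.src d₀)) := by
    intro d₀ hd₀
    obtain ⟨u₁, u₂, hne, h1, h2, h3, h4⟩ := hF.exists_leaves hd₀
    let N : G.V → Finset G.D := fun u => Finset.univ.filter fun d => d ∉ F ∧ G.src d = u
    have hN : ∀ u, (∀ d ∈ F, ∀ e ∈ F, G.src d = u → G.src e = u → d = e) →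
        G.valence u ≤ (N u).card + 1 := by
      intro u hu
      have h5 : (Finset.univ.filter fun d => d ∈ F ∧ G.src d = u).card ≤ 1 := by
        rw [Finset.card_le_one]
        intro d hd e he
        simp only [Finset.mem_filter, Finset.mem_univ, true_and] at hd he
        exact hu d hd.1 e he.1 hd.2 he.2
      rw [hval]
      refine le_trans (le_trans (Finset.card_le_card fun d hd => ?_) (Finset.card_union_le (N u) _))
        (Nat.add_le_add_left h5 _)
      simp only [N, Finset.mem_filter, Finset.mem_univ, true_and, Finset.mem_union] at hd ⊢
      tauto
    have hsub : (N u₁ ∪ N u₂).card ≤ hF.quotient.valence (hF.toQuot (G.src d₀)) := by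
      rw [hval']
      refine Finset.card_le_card fun d hd => ?_
      simp only [N, Finset.mem_filter, Finset.mem_univ, true_and, Finset.mem_union] at hd ⊢
      rcases hd with ⟨hd, rfl⟩ | ⟨hd, rfl⟩
      · exact ⟨hd, hF.toQuot_eq_iff.2 h1⟩
      · exact ⟨hd, hF.toQuot_eq_iff.2 h2⟩
    have hdis : Disjoint (N u₁) (N u₂) := Finset.disjoint_filter.2 fun d _ hd hd' =>
      hne (hd.2.symm.trans hd'.2)
    rw [Finset.card_union_of_disjoint hdis] at hsub
    have h5 := hN u₁ h3
    have h6 := hN u₂ h4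
    have hpos : ∀ u, (∃ d, G.src d = u) → 2 ≤ G.valence u := by
      rintro u ⟨d, hd⟩
      have h7 := hG.no_free_edge u
      have h8 : 0 < G.valence u := by
        rw [hval, Finset.card_pos]
        exact ⟨d, by simpa using hd⟩
      omega
    have hex : ∀ u, G.JoinedIn F u (G.src d₀) → ∃ d, G.src d = u := by
      rintro u ⟨w, -, hw⟩
      cases w with
      | nil => exact ⟨d₀, (show u = _ from hw).symm⟩
      | cons d w => exact ⟨d, hw.1⟩
    have h7 := hpos _ (hex u₁ h1)
    have h8 := hpos _ (hex u₂ h2)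
    have h9 : 3 ≤ G.valence u₁ ∨ 3 ≤ G.valence u₂ := by
      by_cases hu : u₁ = G.base
      · exact Or.inr (hG.three_le_valence _ fun h => hne (hu.trans h.symm))
      · exact Or.inl (hG.three_le_valence _ hu)
    omega
  have key' : ∀ v : G.V, 3 ≤ hF.quotient.valence (hF.toQuot v) ∨
      (hF.quotient.valence (hF.toQuot v) = G.valence v ∧
        ∀ u, hF.toQuot u = hF.toQuot v → u = v) := by
    intro v
    by_cases h : ∃ d ∈ F, hF.toQuot (G.src d) = hF.toQuot v
    · obtain ⟨d, hd, he⟩ := h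
      left
      rw [← he]
      exact key d hd
    · push Not at h
      have hu : ∀ u, hF.toQuot u = hF.toQuot v → u = v := by
        intro u hu
        obtain ⟨w, hw, hw'⟩ : G.JoinedIn F u v := hF.toQuot_eq_iff.1 hu
        cases w with
        | nil => exact hw'
        | cons d w =>
          exact absurd (by rw [hw'.1]; exact hu) (h d (hw d List.mem_cons_self))
      refine Or.inr ⟨?_, hu⟩
      rw [hval', hval]
      congr 1
      ext d
      simp only [Finset.mem_filter, Finset.mem_univ, true_and]
      constructor
      · exact fun hd => hu _ hd.2
      · rintro hd
        exact ⟨fun h' => h d h' (by rw [hd]), by rw [hd]⟩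
  exact
    { finite_V := Quotient.finite _
      finite_D := Subtype.finite
      connected := by
        intro v
        obtain ⟨v, rfl⟩ := hF.toQuot_surjective v
        obtain ⟨w, hw⟩ := hG.connected v
        exact ⟨_, hF.collapse.isWalk hw⟩
      no_free_edge := by
        intro v
        obtain ⟨v, rfl⟩ := hF.toQuot_surjective v
        rcases key' v with h | ⟨h, -⟩
        · omega
        · rw [h]
          exact hG.no_free_edge v
      three_le_valence := by
        intro v hv
        obtain ⟨v, rfl⟩ := hF.toQuot_surjective v
        rcases key' v with h | ⟨h, -⟩
        · exact h
        · rw [h]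
          exact hG.three_le_valence v fun h' => hv (by rw [h']; rfl) }

end IsForest

/-- If `F ⊆ F'` are forests, then collapsing `F` and then the image of `F'` is collapsing `F'`. -/
theorem Collapse.exists_factor {B B' : PGraph} {F' : Set G.D} (c : Collapse G F B)
    (c' : Collapse G F' B') (h : F ⊆ F') :
    ∃ (E : Set B.D) (b : Collapse B E B'), ∀ x, b.hom (c.hom x) = c'.hom x := by
  choose l hl using c.exists_lift
  have hlD : ∀ d e, c.onD d = some e → l e = d := fun d e hd => c.eq_of_onD (hl e) hd
  have hlV : ∀ {u v}, c.onV u = c.onV v → c'.onV u = c'.onV v := by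
    intro u v huv
    obtain ⟨w, hw, hw'⟩ := (c.onV_eq_iff u v).1 huv
    exact (c'.onV_eq_iff u v).2 ⟨w, fun d hd => h (hw d hd), hw'⟩
  have hsV := Function.surjInv_eq c.onV_surjective
  set s := Function.surjInv c.onV_surjective
  have hb : ∀ v, c'.onV (s (c.onV v)) = c'.onV v := fun v => hlV (hsV _)
  have hinv : ∀ e, l (B.inv e) = G.inv (l e) := fun e =>
    hlD _ _ (by rw [c.onD_inv, hl]; rfl)
  have hmemE : ∀ {w : List G.D}, (∀ e ∈ w.filterMap c.onD, l e ∈ F') → ∀ d ∈ w, d ∈ F' := by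
    intro w hw d hd
    rcases hcd : c.onD d with _ | e
    · exact h ((c.onD_eq_none d).1 hcd)
    · have := hw e (List.mem_filterMap.2 ⟨d, hd, hcd⟩)
      rwa [hlD d e hcd] at this
  let b : Collapse B {e | l e ∈ F'} B' :=
    { forest := by
        refine ⟨fun e he => ?_, fun v w hw hv hr => ?_⟩
        · change l (B.inv e) ∈ F'
          rw [hinv]
          exact c'.forest.1 _ he
        · obtain ⟨u, rfl⟩ := c.onV_surjective v
          obtain ⟨w', h1, h2, h3⟩ := c.exists_lift_walk hv hr
          have h4 := c'.forest.2 u w' (hmemE (by rw [h3]; exact hw)) h1 h2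
          rw [← h3, h4]
          rfl
      onV := fun v => c'.onV (s v)
      onD := fun e => c'.onD (l e)
      onV_base := by rw [← c.onV_base, hb, c'.onV_base]
      onV_surjective := fun v => by
        obtain ⟨u, rfl⟩ := c'.onV_surjective v
        exact ⟨c.onV u, hb u⟩
      onV_eq_iff := fun v v' => by
        rw [c'.onV_eq_iff]
        constructor
        · rintro ⟨w, hw, hw'⟩
          refine ⟨w.filterMap c.onD, fun e he => ?_, ?_⟩
          · obtain ⟨d, hd, hde⟩ := List.mem_filterMap.1 he
            change l e ∈ F'
            rw [hlD d e hde]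
            exact hw d hd
          · have := c.isWalk hw'
            rwa [hsV, hsV] at this
        · rintro ⟨w, hw, hw'⟩
          obtain ⟨t, h1, h2, -, -, h5⟩ := hw'.exists_reduced
          rw [← hsV v, ← hsV v'] at h1
          obtain ⟨w', g1, -, g3⟩ := c.exists_lift_walk h1 h2
          exact ⟨w', hmemE (by rw [g3]; exact fun e he => hw e (h5 e he)), g1⟩
      onD_eq_none := fun e => c'.onD_eq_none _
      onD_inv := fun e => by rw [hinv, c'.onD_inv]
      onD_bijective := fun e' => by
        obtain ⟨d, hd⟩ := c'.exists_lift e'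
        rcases hcd : c.onD d with _ | e
        · have := (c'.onD_eq_none d).2 (h ((c.onD_eq_none d).1 hcd))
          rw [hd] at this
          cases this
        · refine ⟨e, by simpa [hlD d e hcd] using hd, fun e₁ he₁ => ?_⟩
          have h1 := c'.eq_of_onD he₁ hd
          have h2 := hl e₁
          rw [h1, hcd] at h2
          exact (Option.some.inj h2).symm
      src_onD := fun e e' he => by
        rw [c'.src_onD _ _ he, ← hb (G.src (l e)), ← c.src_onD _ _ (hl e)] }
  refine ⟨_, b, fun x => ?_⟩
  have hh : b.hom.comp c.hom = c'.hom := PresentedGroup.ext fun d => by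
    change b.hom (c.hom (G.gen d)) = c'.hom (G.gen d)
    rw [hom_gen, hom_gen]
    rcases hcd : c.onD d with _ | e
    · rw [(c'.onD_eq_none d).2 (h ((c.onD_eq_none d).1 hcd))]
      simp
    · rw [Option.elim_some, hom_gen, ← hlD d e hcd]
  exact DFunLike.congr_fun hh x

/-- The set of collapsed edges can be read off from the effect of a collapse on the lengths of
closed reduced paths. -/
theorem Admissible.eq_of_length_filterMap (hG : G.Admissible) {B B' : PGraph} {F' : Set G.D}
    (c : Collapse G F B) (c' : Collapse G F' B')
    (h : ∀ w, G.IsWalk G.base w G.base → G.IsReduced w →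
      (w.filterMap c.onD).length = (w.filterMap c'.onD).length) : F = F' := by
  classical
  have hinv : ∀ {F : Set G.D}, G.IsForest F → ∀ d, decide (G.inv d ∉ F) = decide (d ∉ F) := by
    intro F hF d
    rw [decide_eq_decide, not_iff_not]
    exact ⟨fun h => by have := hF.1 _ h; rwa [G.inv_inv] at this, hF.1 d⟩
  ext d
  have h1 := hG.eq_of_filter_length (fun d => decide (d ∉ F)) (fun d => decide (d ∉ F'))
    (hinv c.forest) (hinv c'.forest)
    (fun w hw hr => by
      rw [← c.length_filterMap, ← c'.length_filterMap]
      exact h w hw hr) d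
  rw [decide_eq_decide, not_iff_not] at h1
  exact h1

end PGraph

end Auter

namespace Auter

open PGraph

/-! ### Simplices and their stabilizers -/

/-- The automorphisms of `G` that preserve each of the sets of edges in `𝓕`. -/
def flagAut (G : PGraph) (𝓕 : Set (Set G.D)) : Subgroup (Iso G G) where
  carrier := {i | ∀ F ∈ 𝓕, ∀ d, i.onD d ∈ F ↔ d ∈ F}
  one_mem' := fun _ _ _ => Iff.rfl
  mul_mem' := fun {i j} hi hj F hF d => (hi F hF (j.onD d)).trans (hj F hF d)
  inv_mem' := fun {i} hi F hF d => by
    rw [← hi F hF]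
    change i.onD (i.onD.symm d) ∈ F ↔ d ∈ F
    rw [Equiv.apply_symm_apply]

theorem mem_flagAut {G : PGraph} {𝓕 : Set (Set G.D)} {i : Iso G G} :
    i ∈ flagAut G 𝓕 ↔ ∀ F ∈ 𝓕, ∀ d, i.onD d ∈ F ↔ d ∈ F := Iff.rfl

variable {n : ℕ} {G : PGraph} {𝓕 : Set (Set G.D)} {σ : Set (SpineVertex n)}

/-- The vertices of the simplex given by a marked graph and a flag of forests. -/
def flagVertices (G : PGraph) (𝓕 : Set (Set G.D)) (φ : FreeGroup (Fin n) ≃* G.pi1) :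
    Set (SpineVertex n) :=
  {x | ∃ F ∈ 𝓕, ∃ B : MarkedGraph n, Quotient.mk _ B = x ∧
      ∃ c : Collapse G F B.graph, ∀ g, c.hom (φ g) = B.marking g}

/-- The marked graph obtained by collapsing a forest. -/
noncomputable def quotientMarked (hG : G.Admissible) (φ : FreeGroup (Fin n) ≃* G.pi1)
    {F : Set G.D} (hF : G.IsForest F) : MarkedGraph n where
  graph := hF.quotient
  admissible := hF.admissible_quotient hG
  marking := φ.trans hF.collapse.piEquiv

theorem mk_eq_of_collapse {φ : FreeGroup (Fin n) ≃* G.pi1} {F : Set G.D} {B B' : MarkedGraph n}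
    (c : Collapse G F B.graph) (c' : Collapse G F B'.graph) (hc : ∀ g, c.hom (φ g) = B.marking g)
    (hc' : ∀ g, c'.hom (φ g) = B'.marking g) :
    (Quotient.mk _ B : SpineVertex n) = Quotient.mk _ B' := by
  obtain ⟨j, hj⟩ := c.exists_iso c'
  exact Quotient.sound ⟨j, fun g => by rw [← hc, hj, hc']⟩

theorem mem_flagVertices_iff (hG : G.Admissible) (h𝓕 : IsFlag G 𝓕)
    {φ : FreeGroup (Fin n) ≃* G.pi1} {x : SpineVertex n} :
    x ∈ flagVertices G 𝓕 φ ↔ ∃ F, ∃ hF : F ∈ 𝓕,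
      Quotient.mk _ (quotientMarked hG φ (h𝓕.2.1 F hF)) = x := by
  constructor
  · rintro ⟨F, hF, B, rfl, c, hc⟩
    exact ⟨F, hF, mk_eq_of_collapse (φ := φ) (h𝓕.2.1 F hF).collapse c (fun g => rfl) hc⟩
  · rintro ⟨F, hF, rfl⟩
    exact ⟨F, hF, _, rfl, (h𝓕.2.1 F hF).collapse, fun g => rfl⟩

/-- A simplex given by a flag of forests is a finite nonempty chain of vertices. -/
theorem IsSimplexOfFlag.isSimplex (h : IsSimplexOfFlag G 𝓕 σ) : IsSimplex σ := by
  obtain ⟨hG, h𝓕, φ, rfl⟩ := h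
  change IsSimplex (flagVertices G 𝓕 φ)
  have := hG.finite_D
  refine ⟨?_, ?_, ?_⟩
  · refine (Set.finite_range fun F : 𝓕 =>
      (Quotient.mk _ (quotientMarked hG φ (h𝓕.2.1 F F.2)) : SpineVertex n)).subset ?_
    intro x hx
    obtain ⟨F, hF, h⟩ := (mem_flagVertices_iff hG h𝓕).1 hx
    exact ⟨⟨F, hF⟩, h⟩
  · exact ⟨_, (mem_flagVertices_iff hG h𝓕).2 ⟨∅, h𝓕.1, rfl⟩⟩
  · have key : ∀ F F' (hF : F ∈ 𝓕) (hF' : F' ∈ 𝓕), F ⊆ F' →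
        (Quotient.mk _ (quotientMarked hG φ (h𝓕.2.1 F' hF')) : SpineVertex n) ≤
          Quotient.mk _ (quotientMarked hG φ (h𝓕.2.1 F hF)) := by
      intro F F' hF hF' h
      obtain ⟨E, b, hb⟩ := (h𝓕.2.1 F hF).collapse.exists_factor (h𝓕.2.1 F' hF').collapse h
      exact ⟨_, _, rfl, rfl, E, b, fun g => hb _⟩
    intro x hx y hy hxy
    obtain ⟨F, hF, rfl⟩ := (mem_flagVertices_iff hG h𝓕).1 hx
    obtain ⟨F', hF', rfl⟩ := (mem_flagVertices_iff hG h𝓕).1 hy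
    rcases h𝓕.2.2.total hF hF' with h | h
    · exact Or.inr (key F F' hF hF' h)
    · exact Or.inl (key F' F hF' hF h)

/-- An automorphism of `F_n` fixes a marked graph if and only if it is induced by an automorphism
of the graph. -/
theorem smul_mk_eq_iff {f : MulAut (FreeGroup (Fin n))} {B : MarkedGraph n} :
    f • (Quotient.mk _ B : SpineVertex n) = Quotient.mk _ B ↔
      ∃ i : Iso B.graph B.graph, ∀ g, i.hom (B.marking g) = B.marking (f g) := by
  constructor
  · intro h
    obtain ⟨i, hi⟩ : ∃ i : Iso B.graph B.graph,
        ∀ g, i.hom (B.marking ((f⁻¹ : MulAut _) g)) = B.marking g := Quotient.exact h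
    refine ⟨i, fun g => ?_⟩
    have := hi (f g)
    rwa [MulAut.inv_apply_self] at this
  · rintro ⟨i, hi⟩
    refine Quotient.sound ⟨i, fun g => ?_⟩
    change i.hom (B.marking ((f⁻¹ : MulAut _) g)) = _
    rw [hi, MulAut.apply_inv_self]

/-- The stabilizer of a simplex given by a flag of forests. -/
theorem IsSimplexOfFlag.nonempty_mulEquiv (h : IsSimplexOfFlag G 𝓕 σ) :
    Nonempty (flagAut G 𝓕 ≃* stab σ) := by
  obtain ⟨hG, h𝓕, φ, rfl⟩ := h
  change Nonempty (flagAut G 𝓕 ≃* stab (flagVertices G 𝓕 φ))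
  let θ : Iso G G →* MulAut (FreeGroup (Fin n)) :=
    (MulAut.congr φ.symm).toMonoidHom.comp (Iso.piAut G)
  have hθ : ∀ i g, i.hom (φ g) = φ (θ i g) := by
    intro i g
    change _ = ((φ (φ.symm (Iso.piAut G i (φ.symm.symm g))) : G.pi1) : G.EdgeGroup)
    rw [MulEquiv.apply_symm_apply]
    rfl
  have hinj : Function.Injective θ := (MulAut.congr φ.symm).injective.comp hG.piAut_injective
  have hmem : ∀ f, f ∈ stab (flagVertices G 𝓕 φ) ↔ ∀ F (hF : F ∈ 𝓕),
      ∃ j : Iso (h𝓕.2.1 F hF).quotient (h𝓕.2.1 F hF).quotient, ∀ g,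
        j.hom ((h𝓕.2.1 F hF).collapse.hom (φ g)) = (h𝓕.2.1 F hF).collapse.hom (φ (f g)) := by
    intro f
    rw [mem_fixingSubgroup_iff]
    constructor
    · intro hf F hF
      exact smul_mk_eq_iff.1 (hf _ ((mem_flagVertices_iff hG h𝓕).2 ⟨F, hF, rfl⟩))
    · intro hf x hx
      obtain ⟨F, hF, rfl⟩ := (mem_flagVertices_iff hG h𝓕).1 hx
      exact smul_mk_eq_iff.2 (hf F hF)
  have hθmem : ∀ i, θ i ∈ stab (flagVertices G 𝓕 φ) ↔ i ∈ flagAut G 𝓕 := by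
    intro i
    rw [hmem]
    constructor
    · intro hi F hF d
      obtain ⟨j, hj⟩ := hi F hF
      set c := (h𝓕.2.1 F hF).collapse
      -- compare `c` with the collapse of the image of `F`
      have h1 : i.symm.onD '' F = F := by
        refine hG.eq_of_length_filterMap (i.symm.collapse c) c fun w hw hr => ?_
        have h2 := i.isWalk hw
        rw [i.onV_base] at h2
        have h3 := c.isWalk h2
        have h4 : (w.map i.onD).filterMap c.onD = (w.filterMap c.onD).map j.onD := by
          refine (c.isReduced h2 (i.isReduced hr)).eq_of_walkProd_eq
            (j.isReduced (c.isReduced hw hr)) ?_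
          rw [← j.hom_walkProd, ← c.hom_walkProd, ← c.hom_walkProd, ← i.hom_walkProd]
          have h5 : φ (φ.symm ⟨G.walkProd w, w, hw, rfl⟩) = ⟨G.walkProd w, w, hw, rfl⟩ :=
            φ.apply_symm_apply _
          have h6 := hj (φ.symm ⟨G.walkProd w, w, hw, rfl⟩)
          rw [← hθ, h5] at h6
          exact h6.symm
        have h5 := congrArg List.length h4
        rw [List.length_map, List.filterMap_map] at h5
        exact h5
      constructor
      · intro hd
        rw [← h1]
        exact ⟨_, hd, i.onD.symm_apply_apply d⟩
      · intro hd
        rw [← h1] at hd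
        obtain ⟨e, he, rfl⟩ := hd
        change i.onD (i.onD.symm e) ∈ F
        rwa [Equiv.apply_symm_apply]
    · intro hi F hF
      have h1 : i.symm.onD '' F = F := by
        ext d
        constructor
        · rintro ⟨e, he, rfl⟩
          rw [← hi F hF]
          change i.onD (i.onD.symm e) ∈ F
          rwa [Equiv.apply_symm_apply]
        · intro hd
          exact ⟨i.onD d, (hi F hF d).2 hd, i.onD.symm_apply_apply d⟩
      set c := (h𝓕.2.1 F hF).collapse
      obtain ⟨c', hc'⟩ : ∃ c' : Collapse G F (h𝓕.2.1 F hF).quotient,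
          ∀ x, c'.hom x = c.hom (i.hom x) := by
        have h2 : ∀ x, (i.symm.collapse c).hom x = c.hom (i.hom x) := fun x => by
          rw [← i.symm.collapse_hom c, i.symm_hom]
        revert h2
        generalize i.symm.collapse c = c'
        revert c'
        rw [h1]
        exact fun c' h => ⟨c', h⟩
      obtain ⟨j, hj⟩ := c.exists_iso c'
      exact ⟨j, fun g => by rw [hj, hc', hθ]⟩
  refine ⟨MulEquiv.ofBijective
    ((θ.comp (flagAut G 𝓕).subtype).codRestrict (stab (flagVertices G 𝓕 φ))
      fun i => (hθmem i).2 i.2) ⟨?_, ?_⟩⟩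
  · intro i j hij
    exact Subtype.ext (hinj (congrArg Subtype.val hij))
  · rintro ⟨f, hf⟩
    obtain ⟨j, hj⟩ := (hmem f).1 hf ∅ h𝓕.1
    obtain ⟨k, hk⟩ := (h𝓕.2.1 ∅ h𝓕.1).collapse.exists_iso (Collapse.refl G)
    let i : Iso G G := (k.symm.trans j).trans k
    have hi : ∀ g, i.hom (φ g) = φ (f g) := by
      intro g
      have h1 : k.symm.hom (φ g) = (h𝓕.2.1 ∅ h𝓕.1).collapse.hom (φ g) := by
        have h3 := k.symm_hom ((h𝓕.2.1 ∅ h𝓕.1).collapse.hom (φ g))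
        rwa [hk, Collapse.refl_hom] at h3
      rw [Iso.trans_hom, Iso.trans_hom, h1, hj, hk, Collapse.refl_hom]
    have h2 : θ i = f := by
      refine MulEquiv.ext fun g => φ.injective (Subtype.ext ?_)
      rw [← hθ, hi]
    exact ⟨⟨i, (hθmem i).1 (by rw [h2]; exact hf)⟩, Subtype.ext h2⟩

/-- Every simplex is given by a flag of forests in a graph that represents its maximal vertex. -/
theorem IsSimplex.exists_flag (h : IsSimplex σ) :
    ∃ (G : PGraph) (𝓕 : Set (Set G.D)), IsSimplexOfFlag G 𝓕 σ := by
  obtain ⟨hfin, hne, hchain⟩ := h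
  -- the maximal vertex is the one with the largest number of edges
  let N : SpineVertex n → ℕ := Quotient.lift (fun B => Nat.card B.graph.D) (by
    rintro A B ⟨i, -⟩
    exact Nat.card_congr i.onD)
  obtain ⟨m, hm, hmax⟩ := Set.exists_max_image σ N hfin hne
  have hle : ∀ x ∈ σ, ∀ y ∈ σ, x ≤ y ∨ y ≤ x := by
    intro x hx y hy
    by_cases hxy : x = y
    · subst hxy
      obtain ⟨B, rfl⟩ := Quotient.exists_rep x
      exact Or.inl ⟨B, B, rfl, rfl, ∅, Collapse.refl _, fun g => Collapse.refl_hom _ _⟩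
    · exact hchain hx hy hxy
  have hcol : ∀ {G B : PGraph} {F : Set G.D}, Finite G.D → Collapse G F B →
      Nat.card G.D ≤ Nat.card B.D → F = ∅ := by
    intro G B F hG c hle
    choose l hl using c.exists_lift
    have hinj : Function.Injective l := fun e e' h => by
      have := hl e
      rw [h, hl] at this
      exact (Option.some.inj this).symm
    have hbij : Function.Bijective l := by
      have : Finite B.D := Finite.of_injective l hinj
      have := Fintype.ofFinite B.D
      have := Fintype.ofFinite G.D
      rw [Fintype.bijective_iff_injective_and_card]
      refine ⟨hinj, le_antisymm (Fintype.card_le_of_injective l hinj) ?_⟩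
      rwa [← Nat.card_eq_fintype_card, ← Nat.card_eq_fintype_card]
    rw [Set.eq_empty_iff_forall_notMem]
    intro d hd
    obtain ⟨e, rfl⟩ := hbij.2 d
    have := hl e
    rw [(c.onD_eq_none _).2 hd] at this
    cases this
  have htop : ∀ x ∈ σ, x ≤ m := by
    intro x hx
    rcases hle x hx m hm with h | h
    · exact h
    · obtain ⟨A, B, rfl, rfl, F, c, hc⟩ := h
      have h1 := hmax _ hx
      have hF := hcol B.admissible.finite_D c h1
      subst hF
      have h2 := mk_eq_of_collapse (φ := B.marking) (B := B) (Collapse.refl _) c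
        (fun g => Collapse.refl_hom _ _) hc
      rw [h2]
      exact ⟨A, A, rfl, rfl, ∅, Collapse.refl _, fun g => Collapse.refl_hom _ _⟩
  obtain ⟨M, rfl⟩ := Quotient.exists_rep m
  have hMfin := M.admissible.finite_D
  -- `Q x F` says that the vertex `x` is obtained by collapsing `F`
  let Q : SpineVertex n → Set M.graph.D → Prop := fun x F => ∃ B : MarkedGraph n,
    Quotient.mk _ B = x ∧ ∃ c : Collapse M.graph F B.graph, ∀ g, c.hom (M.marking g) = B.marking g
  have hQ : ∀ x ∈ σ, ∃ F, Q x F := by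
    intro x hx
    obtain ⟨A, B, hA, hB, F, c, hc⟩ := htop x hx
    obtain ⟨i, hi⟩ : ∃ i : Iso B.graph M.graph, ∀ g, i.hom (B.marking g) = M.marking g :=
      Quotient.exact hB
    exact ⟨_, A, hA, i.collapse c, fun g => by rw [← hi, i.collapse_hom, hc]⟩
  have hQle : ∀ x y F F', x ≤ y → Q x F → Q y F' → F' ⊆ F := by
    rintro x y F F' ⟨A, B, hA, hB, E, b, hb⟩ ⟨X, hX, c, hc⟩ ⟨Y, hY, c', hc'⟩
    obtain ⟨i, hi⟩ : ∃ i : Iso Y.graph B.graph, ∀ g, i.hom (Y.marking g) = B.marking g :=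
      Quotient.exact (hY.trans hB.symm)
    obtain ⟨j, hj⟩ : ∃ j : Iso A.graph X.graph, ∀ g, j.hom (A.marking g) = X.marking g :=
      Quotient.exact (hA.trans hX.symm)
    classical
    let P : M.graph.D → Bool := fun d => decide (d ∉ F)
    let P' : M.graph.D → Bool := fun d => ((c'.onD d).bind fun e => b.onD (i.onD e)).isSome
    have hPP : ∀ d, P d = P' d := by
      refine M.admissible.eq_of_filter_length P P' (fun d => ?_) (fun d => ?_) fun w hw hr => ?_
      · rw [decide_eq_decide, not_iff_not]
        exact ⟨fun h => by have := c.forest.1 _ h; rwa [inv_inv] at this, c.forest.1 d⟩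
      · simp only [P', c'.onD_inv]
        rcases c'.onD d with _ | e
        · rfl
        · simp only [Option.map_some, Option.bind_some, i.onD_inv, b.onD_inv, Option.isSome_map]
      · have h1 := c'.isWalk hw
        rw [c'.onV_base] at h1
        have h2 := i.isWalk h1
        rw [i.onV_base] at h2
        have h3 : ((((w.filterMap c'.onD).map i.onD).filterMap b.onD).map j.onD) =
            w.filterMap c.onD := by
          refine (j.isReduced (b.isReduced h2 (i.isReduced (c'.isReduced hw hr)))).eq_of_walkProd_eq
            (c.isReduced hw hr) ?_
          rw [← j.hom_walkProd, ← b.hom_walkProd, ← i.hom_walkProd, ← c'.hom_walkProd,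
            ← c.hom_walkProd]
          have h5 : M.marking (M.marking.symm ⟨M.graph.walkProd w, w, hw, rfl⟩) =
            ⟨M.graph.walkProd w, w, hw, rfl⟩ := M.marking.apply_symm_apply _
          have h6 := hc' (M.marking.symm ⟨M.graph.walkProd w, w, hw, rfl⟩)
          have h7 := hc (M.marking.symm ⟨M.graph.walkProd w, w, hw, rfl⟩)
          rw [h5] at h6 h7
          rw [h6, h7, hi, hb, hj]
        have h4 := congrArg List.length h3
        rw [List.length_map, List.filterMap_map, List.filterMap_filterMap] at h4
        rw [← c.length_filterMap, ← h4]
        clear h1 h2 h3 h4 hw hr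
        induction w with
        | nil => rfl
        | cons d w ih =>
          rcases hd : (c'.onD d).bind fun e => b.onD (i.onD e) with _ | e
          · simp [P', hd, ← ih]
          · simp [P', hd, ← ih]
    intro d hd
    by_contra hdF
    have h1 : P d = true := by simpa [P] using hdF
    rw [hPP] at h1
    simp [P', (c'.onD_eq_none d).2 hd] at h1
  refine ⟨M.graph, {F | ∃ x ∈ σ, Q x F}, M.admissible, ⟨?_, ?_, ?_⟩, M.marking, ?_⟩
  · exact ⟨_, hm, M, rfl, Collapse.refl _, fun g => Collapse.refl_hom _ _⟩
  · rintro F ⟨x, -, B, -, c, -⟩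
    exact c.forest
  · rintro F ⟨x, hx, hF⟩ F' ⟨y, hy, hF'⟩ -
    rcases hle x hx y hy with h | h
    · exact Or.inr (hQle _ _ _ _ h hF hF')
    · exact Or.inl (hQle _ _ _ _ h hF' hF)
  · ext x
    constructor
    · intro hx
      obtain ⟨F, hF⟩ := hQ x hx
      exact ⟨F, ⟨x, hx, hF⟩, hF⟩
    · rintro ⟨F, ⟨y, hy, Y, hY, c', hc'⟩, B, hB, c, hc⟩
      rw [← hB, mk_eq_of_collapse c c' hc hc', hY]
      exact hy

/-- Transport of a flag of forests along an isomorphism of graphs. -/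
theorem IsSimplexOfFlag.map {G' : PGraph} (i : Iso G G') (h : IsSimplexOfFlag G 𝓕 σ) :
    IsSimplexOfFlag G' ((fun F => i.onD '' F) '' 𝓕) σ := by
  obtain ⟨hG, h𝓕, φ, rfl⟩ := h
  refine ⟨i.admissible hG, ⟨⟨∅, h𝓕.1, Set.image_empty _⟩, ?_, ?_⟩, φ.trans i.piEquiv, ?_⟩
  · rintro _ ⟨F, hF, rfl⟩
    exact i.isForest (h𝓕.2.1 F hF)
  · rintro _ ⟨F, hF, rfl⟩ _ ⟨F', hF', rfl⟩ -
    rcases h𝓕.2.2.total hF hF' with h | h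
    · exact Or.inl (Set.image_mono h)
    · exact Or.inr (Set.image_mono h)
  · ext x
    constructor
    · rintro ⟨F, hF, B, hB, c, hc⟩
      exact ⟨_, ⟨F, hF, rfl⟩, B, hB, i.collapse c, fun g => by
        rw [← hc]
        exact i.collapse_hom c _⟩
    · rintro ⟨_, ⟨F, hF, rfl⟩, B, hB, c, hc⟩
      obtain ⟨c', hc'⟩ : ∃ c' : Collapse G F B.graph, ∀ x, c'.hom x = c.hom (i.hom x) := by
        have h1 : i.symm.onD '' (i.onD '' F) = F := by
          rw [Set.image_image]
          ext d
          constructor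
          · rintro ⟨e, he, rfl⟩
            change i.onD.symm (i.onD e) ∈ F
            rwa [Equiv.symm_apply_apply]
          · exact fun hd => ⟨d, hd, i.onD.symm_apply_apply d⟩
        have h2 : ∀ x, (i.symm.collapse c).hom x = c.hom (i.hom x) := fun x => by
          rw [← i.symm.collapse_hom c, i.symm_hom]
        revert h2
        generalize i.symm.collapse c = c'
        revert c'
        rw [h1]
        exact fun c' h => ⟨c', h⟩
      exact ⟨F, hF, B, hB, c', fun g => by rw [hc', ← hc]; rfl⟩

end Auter

namespace Auter

/-! ### The rank of the fundamental group -/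

namespace PGraph

variable {G : PGraph}

theorem exists_orientation (G : PGraph) [Finite G.D] :
    ∃ O : Set G.D, ∀ d, G.inv d ∈ O ↔ d ∉ O := by
  obtain ⟨m, ⟨e⟩⟩ := Finite.exists_equiv_fin G.D
  refine ⟨{d | e d < e (G.inv d)}, fun d => ?_⟩
  have : e d ≠ e (G.inv d) := fun h => G.inv_ne d (e.injective h).symm
  change e (G.inv d) < e (G.inv (G.inv d)) ↔ ¬ e d < e (G.inv d)
  rw [G.inv_inv]
  omega

theorem card_orientation [Finite G.D] {O : Set G.D} (hO : ∀ d, G.inv d ∈ O ↔ d ∉ O) :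
    Nat.card G.D = 2 * Nat.card O := by
  classical
  have h : G.D ≃ O ⊕ O :=
    { toFun := fun d => if h : d ∈ O then Sum.inl ⟨d, h⟩ else Sum.inr ⟨G.inv d, (hO d).2 h⟩
      invFun := Sum.elim (fun d => d.1) (fun d => G.inv d.1)
      left_inv := fun d => by
        by_cases h : d ∈ O
        · simp [h]
        · simp [h, G.inv_inv]
      right_inv := by
        rintro (⟨d, hd⟩ | ⟨d, hd⟩)
        · simp [hd]
        · have : G.inv d ∉ O := fun h => (hO d).1 h hd
          simp [this, G.inv_inv] }
  rw [Nat.card_congr h, Nat.card_sum, two_mul]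

open Classical in
/-- An orientation of the edges is a basis of the edge group. -/
noncomputable def edgeGroupEquiv {O : Set G.D} (hO : ∀ d, G.inv d ∈ O ↔ d ∉ O) :
    G.EdgeGroup ≃* FreeGroup O := by
  let f : G.D → FreeGroup O := fun d =>
    if h : d ∈ O then FreeGroup.of ⟨d, h⟩ else (FreeGroup.of ⟨G.inv d, (hO d).2 h⟩)⁻¹
  have hf : ∀ d, f d * f (G.inv d) = 1 := by
    intro d
    by_cases h : d ∈ O
    · have h' : G.inv d ∉ O := fun h' => (hO d).1 h' h
      simp [f, h, h', G.inv_inv]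
    · have h' : G.inv d ∈ O := (hO d).2 h
      simp [f, h, h']
  let φ : G.EdgeGroup →* FreeGroup O := PresentedGroup.toGroup (f := f) (by
    rintro _ ⟨d, rfl⟩
    simpa using hf d)
  let ψ : FreeGroup O →* G.EdgeGroup := FreeGroup.lift fun d => G.gen d.1
  have hφ : ∀ d, φ (G.gen d) = f d := fun d => PresentedGroup.toGroup.of _
  refine MonoidHom.toMulEquiv φ ψ ?_ ?_
  · refine PresentedGroup.ext fun d => ?_
    change ψ (φ (G.gen d)) = G.gen d
    rw [hφ]
    by_cases h : d ∈ O
    · simp [f, h, ψ]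
    · simp [f, h, ψ, gen_inv]
  · refine FreeGroup.ext_hom _ _ fun d => ?_
    simp [ψ, hφ, f]

/-- A homomorphism from the edge group is given by a homomorphism from the fundamental group and by
its values on paths from the basepoint to the other vertices. -/
theorem card_hom_edgeGroup (hc : ∀ v, ∃ w, G.IsWalk G.base w v) (M : Type) [Group M] :
    Nat.card (G.EdgeGroup →* M) =
      Nat.card ((G.pi1 →* M) × ({v : G.V // v ≠ G.base} → M)) := by
  classical
  choose t ht using hc
  let P : G.V → G.EdgeGroup := fun v => if v = G.base then 1 else G.walkProd (t v)
  have hPb : P G.base = 1 := if_pos rfl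
  have hP : ∀ v, ∃ w, G.IsWalk G.base w v ∧ G.walkProd w = P v := by
    intro v
    by_cases h : v = G.base
    · subst h
      exact ⟨[], rfl, hPb.symm⟩
    · exact ⟨t v, ht v, (if_neg h).symm⟩
  have hmem : ∀ {u w v}, G.IsWalk u w v → P u * G.walkProd w * (P v)⁻¹ ∈ G.pi1 := by
    intro u w v h
    obtain ⟨w₁, h1, h1'⟩ := hP u
    obtain ⟨w₂, h2, h2'⟩ := hP v
    refine ⟨w₁ ++ w ++ (w₂.map G.inv).reverse, (h1.append h).append h2.reverse, ?_⟩
    rw [walkProd_append, walkProd_append, walkProd_reverse, h1', h2']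
  have hmemd : ∀ d, P (G.src d) * G.gen d * (P (G.src (G.inv d)))⁻¹ ∈ G.pi1 := fun d => by
    have := hmem (G.isWalk_singleton d)
    simpa using this
  let ext : ({v : G.V // v ≠ G.base} → M) → G.V → M := fun g v =>
    if h : v = G.base then 1 else g ⟨v, h⟩
  have hextb : ∀ g, ext g G.base = 1 := fun g => dif_pos rfl
  have hext : ∀ g v (h : v ≠ G.base), ext g v = g ⟨v, h⟩ := fun g v h => dif_neg h
  let val : (G.pi1 →* M) → ({v : G.V // v ≠ G.base} → M) → G.D → M := fun h g d =>
    (ext g (G.src d))⁻¹ * h ⟨_, hmemd d⟩ * ext g (G.src (G.inv d))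
  have hval : ∀ h g d, val h g d * val h g (G.inv d) = 1 := by
    intro h g d
    have h1 : h ⟨_, hmemd d⟩ * h ⟨_, hmemd (G.inv d)⟩ = 1 := by
      rw [← map_mul, ← map_one h]
      congr 1
      refine Subtype.ext ?_
      simp only [Subgroup.coe_mul, Subgroup.coe_one, G.inv_inv, gen_inv]
      group
    have h2 : val h g (G.inv d) =
        (ext g (G.src (G.inv d)))⁻¹ * h ⟨_, hmemd (G.inv d)⟩ * ext g (G.src d) := by
      simp only [val, G.inv_inv]
    rw [h2, show val h g d = (ext g (G.src d))⁻¹ * h ⟨_, hmemd d⟩ * ext g (G.src (G.inv d)) from rfl,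
      eq_inv_of_mul_eq_one_left h1]
    group
  let ψ : (G.pi1 →* M) → ({v : G.V // v ≠ G.base} → M) → (G.EdgeGroup →* M) := fun h g =>
    PresentedGroup.toGroup (f := val h g) (by
      rintro _ ⟨d, rfl⟩
      simpa using hval h g d)
  have hψ : ∀ h g d, ψ h g (G.gen d) = val h g d := fun h g d => PresentedGroup.toGroup.of _
  have hψw : ∀ h g w u v (hw : G.IsWalk u w v),
      ψ h g (G.walkProd w) = (ext g u)⁻¹ * h ⟨_, hmem hw⟩ * ext g v := by
    intro h g w
    induction w with
    | nil =>
      intro u v hw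
      have huv : u = v := hw
      subst huv
      have h1 : (⟨_, hmem hw⟩ : G.pi1) = 1 := Subtype.ext (by simp)
      rw [h1]
      simp
    | cons d w ih =>
      rintro u v ⟨rfl, hw⟩
      have h2 : ψ h g (G.walkProd (d :: w)) =
          val h g d * ((ext g (G.src (G.inv d)))⁻¹ * h ⟨_, hmem hw⟩ * ext g v) := by
        rw [walkProd_cons, map_mul, hψ, ih _ _ hw]
      have h1 : (⟨_, hmem (show G.IsWalk (G.src d) (d :: w) v from ⟨rfl, hw⟩)⟩ : G.pi1) =
          ⟨_, hmemd d⟩ * ⟨_, hmem hw⟩ := by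
        refine Subtype.ext ?_
        simp only [Subgroup.coe_mul, walkProd_cons]
        group
      rw [h2, h1, map_mul]
      simp only [val]
      group
  refine Nat.card_congr
    { toFun := fun f => (f.comp G.pi1.subtype, fun v => f (P v.1))
      invFun := fun x => ψ x.1 x.2
      left_inv := fun f => by
        refine PresentedGroup.ext fun d => ?_
        change ψ _ _ (G.gen d) = f (G.gen d)
        rw [hψ]
        have h1 : ∀ v, ext (fun v : {v : G.V // v ≠ G.base} => f (P v.1)) v = f (P v) := by
          intro v
          by_cases h : v = G.base
          · subst h
            rw [hPb, map_one]
            exact hextb (fun v : {v : G.V // v ≠ G.base} => f (P v.1))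
          · exact hext (fun v : {v : G.V // v ≠ G.base} => f (P v.1)) v h
        simp only [val, h1, MonoidHom.comp_apply, Subgroup.subtype_apply, map_mul, map_inv]
        group
      right_inv := fun ⟨h, g⟩ => by
        refine Prod.ext ?_ ?_
        · refine MonoidHom.ext fun ⟨x, w, hw, hx⟩ => ?_
          subst hx
          change ψ h g (G.walkProd w) = _
          rw [hψw h g w _ _ hw, hextb]
          simp only [inv_one, one_mul, mul_one]
          congr 1
          refine Subtype.ext ?_
          change P G.base * G.walkProd w * (P G.base)⁻¹ = G.walkProd w
          rw [hPb, one_mul, inv_one, mul_one]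
        · funext v
          change ψ h g (P v.1) = g v
          have h2 : P v.1 = G.walkProd (t v.1) := if_neg v.2
          have h1 : (⟨_, hmem (ht v.1)⟩ : G.pi1) = 1 := Subtype.ext (by simp [hPb, h2])
          rw [h2, hψw h g _ _ _ (ht v.1), hextb, h1, hext g v.1 v.2]
          simp }

/-- The fundamental group is free. -/
theorem isFreeGroup_pi1 (G : PGraph) [Finite G.D] : IsFreeGroup G.pi1 := by
  obtain ⟨O, hO⟩ := G.exists_orientation
  have : IsFreeGroup G.EdgeGroup := IsFreeGroup.ofMulEquiv (edgeGroupEquiv hO).symm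
  exact subgroupIsFreeOfIsFree _

/-- The rank of the fundamental group, from the number of homomorphisms to a group of order two: the
homomorphisms from the edge group are pairs of one from the fundamental group and a function on the
vertices other than the basepoint. -/
theorem card_of_freeGroup_equiv [Finite G.D] [Finite G.V] (hc : ∀ v, ∃ w, G.IsWalk G.base w v)
    {X : Type} (φ : FreeGroup X ≃* G.pi1) :
    Finite X ∧ Nat.card G.D + 2 = 2 * Nat.card G.V + 2 * Nat.card X := by
  obtain ⟨O, hO⟩ := G.exists_orientation
  let M := Multiplicative (ZMod 2)
  have hM : Nat.card M = 2 := by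
    rw [Nat.card_congr (Multiplicative.toAdd (α := ZMod 2)), Nat.card_zmod]
  have hMf : Finite M := Nat.finite_of_card_ne_zero (by omega)
  have h1 := card_hom_edgeGroup hc M
  have h2 : Nat.card (G.EdgeGroup →* M) = 2 ^ Nat.card O := by
    rw [Nat.card_congr (((edgeGroupEquiv hO).monoidHomCongrLeftEquiv).trans FreeGroup.lift.symm),
      Nat.card_fun, hM]
  have h3 : Nat.card (G.pi1 →* M) = Nat.card (X → M) :=
    Nat.card_congr ((φ.symm.monoidHomCongrLeftEquiv).trans FreeGroup.lift.symm)
  have hV : Nat.card {v : G.V // v ≠ G.base} + 1 = Nat.card G.V := by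
    classical
    have := Fintype.ofFinite G.V
    have h4 := Fintype.card_subtype_compl (fun v => v = G.base)
    rw [Fintype.card_subtype_eq] at h4
    rw [Nat.card_eq_fintype_card, Nat.card_eq_fintype_card]
    have h5 : 0 < Fintype.card G.V := Fintype.card_pos_iff.2 ⟨G.base⟩
    rw [h4]
    omega
  rw [h2, Nat.card_prod, h3, Nat.card_fun (α := {v : G.V // v ≠ G.base}), hM] at h1
  have hXf : Finite X := by
    by_contra hX
    rw [not_finite_iff_infinite] at hX
    have : Infinite (X → M) := by
      have : Nontrivial M := Finite.one_lt_card_iff_nontrivial.1 (by omega)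
      infer_instance
    rw [Nat.card_eq_zero_of_infinite (α := X → M), zero_mul] at h1
    exact absurd h1 (by positivity)
  refine ⟨hXf, ?_⟩
  rw [Nat.card_fun, hM, ← pow_add] at h1
  have h4 := Nat.pow_right_injective le_rfl h1
  have h5 := card_orientation hO
  omega

/-- A connected graph with the right Euler characteristic has free fundamental group of rank `n`. -/
theorem nonempty_freeGroup_equiv [Finite G.D] [Finite G.V] (hc : ∀ v, ∃ w, G.IsWalk G.base w v)
    {n : ℕ} (h : Nat.card G.D + 2 = 2 * Nat.card G.V + 2 * n) :
    Nonempty (FreeGroup (Fin n) ≃* G.pi1) := by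
  have := G.isFreeGroup_pi1
  let φ := (IsFreeGroup.mulEquiv G.pi1)
  obtain ⟨hf, h1⟩ := card_of_freeGroup_equiv hc φ
  have h2 : Nat.card (IsFreeGroup.Generators G.pi1) = n := by omega
  exact ⟨(FreeGroup.freeGroupCongr (Finite.equivFinOfCardEq h2).symm).trans φ⟩

theorem Admissible.card_D (hG : G.Admissible) {n : ℕ} (φ : FreeGroup (Fin n) ≃* G.pi1) :
    Nat.card G.D + 2 = 2 * Nat.card G.V + 2 * n := by
  have := hG.finite_D
  have := hG.finite_V
  have := (card_of_freeGroup_equiv hG.connected φ).2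
  rwa [Nat.card_fin] at this

end PGraph

end Auter

namespace Auter

/-! ### Fixed graphs of groups of order a power of `p` -/

namespace PGraph

variable {G : PGraph}

/-- The group `P` moves the directed edge `d`. -/
def Moves (P : Subgroup (Iso G G)) (d : G.D) : Prop := ∃ i ∈ P, i.onD d ≠ d

/-- The group `P` moves the vertex `v`. -/
def MovesV (P : Subgroup (Iso G G)) (v : G.V) : Prop := ∃ i ∈ P, i.onV v ≠ v

/-- A fixed vertex at which a moved edge starts. -/
def Attaching (P : Subgroup (Iso G G)) (v : G.V) : Prop :=
  ¬ MovesV P v ∧ ∃ d, G.src d = v ∧ Moves P d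

section

variable {P : Subgroup (Iso G G)}

theorem not_moves_iff {d : G.D} : ¬ Moves P d ↔ ∀ i ∈ P, i.onD d = d := by
  simp [Moves]

theorem not_movesV_iff {v : G.V} : ¬ MovesV P v ↔ ∀ i ∈ P, i.onV v = v := by
  simp [MovesV]

theorem moves_of_src {d : G.D} (h : MovesV P (G.src d)) : Moves P d := by
  obtain ⟨i, hi, h⟩ := h
  exact ⟨i, hi, fun h' => h (by rw [← i.src_onD, h'])⟩

theorem moves_inv {d : G.D} : Moves P (G.inv d) ↔ Moves P d := by
  have : ∀ d, Moves P d → Moves P (G.inv d) := by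
    rintro d ⟨i, hi, h⟩
    refine ⟨i, hi, fun h' => h ?_⟩
    rw [i.onD_inv] at h'
    have := congrArg G.inv h'
    rwa [G.inv_inv, G.inv_inv] at this
  exact ⟨fun h => by have := this _ h; rwa [G.inv_inv] at this, this d⟩

theorem moves_onD {d : G.D} {i : Iso G G} (hi : i ∈ P) (h : Moves P d) : Moves P (i.onD d) := by
  by_contra hn
  rw [not_moves_iff] at hn
  obtain ⟨j, hj, hjd⟩ := h
  have h1 : d = i.onD d := (i.onD.symm_apply_apply d).symm.trans (hn i⁻¹ (P.inv_mem hi))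
  exact hjd (by rw [h1]; exact hn j hj)

theorem not_movesV_base : ¬ MovesV P G.base := by
  rw [not_movesV_iff]
  exact fun i _ => i.onV_base

/-- Every path from a fixed vertex that does not meet an attaching vertex is fixed. -/
theorem Admissible.exists_attaching (hG : G.Admissible) (h : ∃ d, Moves P d) :
    ∃ v, Attaching P v := by
  by_contra! hno
  obtain ⟨d, hd⟩ := h
  have key : ∀ (w : List G.D) (u v : G.V), G.IsWalk u w v → ¬ MovesV P u → ¬ MovesV P v := by
    intro w
    induction w with
    | nil =>
      intro u v h hu
      rwa [← (show u = v from h)]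
    | cons e w ih =>
      rintro u v ⟨rfl, h⟩ hu
      refine ih _ v h fun hm => hno _ ⟨hu, e, rfl, ?_⟩
      rw [← moves_inv]
      exact moves_of_src hm
  obtain ⟨w, hw⟩ := hG.connected (G.src d)
  exact hno _ ⟨key w _ _ hw not_movesV_base, d, rfl, hd⟩

/-- If no edge at an attaching vertex is fixed, then all fixed vertices are attaching and no edge
is fixed. -/
theorem Admissible.all_attaching (hG : G.Admissible) (h : ∃ d, Moves P d)
    (hfix : ∀ d, Attaching P (G.src d) → Moves P d) :
    (∀ v, ¬ MovesV P v → Attaching P v) ∧ ∀ d, Moves P d := by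
  have hatt : ∀ v, ¬ MovesV P v → Attaching P v := by
    by_contra! hn
    obtain ⟨v, hv, hva⟩ := hn
    obtain ⟨a, ha⟩ := hG.exists_attaching h
    -- fixed vertices that are not attaching only have neighbours of this kind
    have key : ∀ (w : List G.D) (u v : G.V), G.IsWalk u w v → ¬ MovesV P u → ¬ Attaching P u →
        ¬ Attaching P v := by
      intro w
      induction w with
      | nil =>
        intro u v h _ hu
        rwa [← (show u = v from h)]
      | cons e w ih =>
        rintro u v ⟨rfl, h⟩ hu hua
        have he : ¬ Moves P e := fun he => hua ⟨hu, e, rfl, he⟩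
        have he' : ¬ Moves P (G.inv e) := fun h => he (moves_inv.1 h)
        exact ih _ v h (fun hm => he' (moves_of_src hm)) fun hm => he' (hfix _ hm)
    obtain ⟨w, hw⟩ := hG.connected' v a
    exact key w v a hw hv hva ha
  refine ⟨hatt, fun d => ?_⟩
  by_contra hd
  exact hd (hfix d (hatt _ fun h => hd (moves_of_src h)))

open Classical in
/-- A moved edge at a fixed vertex has at least `p - 1` further translates at this vertex. -/
theorem card_moves_at [Fintype G.D] {p : ℕ} [Fact p.Prime] (hP : IsPGroup p P) {v : G.V}
    (hv : Attaching P v) :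
    p ≤ (Finset.univ.filter fun d => Moves P d ∧ G.src d = v).card := by
  obtain ⟨hv, d, rfl, hd⟩ := hv
  let φ : P →* Equiv.Perm G.D := (Iso.permD G).comp P.subtype
  let _ : MulAction P G.D := MulAction.compHom _ φ
  obtain ⟨m, hm⟩ := hP.card_orbit d
  have h1 : p ≤ Nat.card (MulAction.orbit P d) := by
    rw [hm]
    refine Nat.le_self_pow ?_ p
    rintro rfl
    rw [pow_zero, Nat.card_eq_one_iff_unique] at hm
    obtain ⟨i, hi, hid⟩ := hd
    have := hm.1.elim ⟨d, MulAction.mem_orbit_self d⟩ ⟨i.onD d, ⟨⟨i, hi⟩, rfl⟩⟩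
    exact hid (congrArg Subtype.val this).symm
  refine h1.trans ?_
  rw [← Fintype.card_subtype, ← Nat.card_eq_fintype_card]
  refine Nat.card_le_card_of_injective (fun e : MulAction.orbit P d =>
    (⟨e.1, ?_⟩ : {e // Moves P e ∧ G.src e = G.src d})) fun e e' h =>
      Subtype.ext (congrArg (fun x => x.1) h)
  obtain ⟨e, ⟨i, hi⟩, rfl⟩ := e
  refine ⟨moves_onD hi hd, ?_⟩
  change G.src (i.onD d) = _
  rw [i.src_onD]
  exact not_movesV_iff.1 hv i hi

open Classical in
/-- Edge counts for the action of a group `P` on a finite graph. -/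
theorem counts [Fintype G.D] [Fintype G.V] :
    (Finset.univ.filter fun d => Moves P d).card =
      (Finset.univ.filter fun d => Moves P d ∧ ¬ MovesV P (G.src d)).card +
        ∑ v ∈ Finset.univ.filter (fun v => MovesV P v), G.valence v ∧
    (∑ v ∈ Finset.univ.filter (fun v => ¬ MovesV P v),
      (Finset.univ.filter fun d => ¬ Moves P d ∧ G.src d = v).card) =
        (Finset.univ.filter fun d => ¬ Moves P d).card := by
  constructor
  · rw [← Finset.card_filter_add_card_filter_not (s := Finset.univ.filter fun d => Moves P d)
      (fun d => ¬ MovesV P (G.src d)), Finset.filter_filter, Finset.filter_filter]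
    congr 1
    rw [Finset.card_eq_sum_card_fiberwise (f := G.src)
      (t := Finset.univ.filter fun v => MovesV P v)]
    · refine Finset.sum_congr rfl fun v hv => ?_
      rw [valence, Nat.card_eq_fintype_card, Fintype.card_subtype]
      congr 1
      ext d
      simp only [Finset.mem_filter, Finset.mem_univ, true_and] at hv ⊢
      constructor
      · exact fun h => h.2
      · rintro rfl
        exact ⟨⟨moves_of_src hv, fun h => h hv⟩, rfl⟩
    · intro d hd
      simpa using (Finset.mem_filter.1 hd).2.2
  · rw [Finset.card_eq_sum_card_fiberwise (f := G.src)
      (t := Finset.univ.filter fun v => ¬ MovesV P v)]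
    · simp only [Finset.filter_filter]
    · intro d hd
      have := (Finset.mem_filter.1 hd).2
      simpa using fun h => this (moves_of_src h)

open Classical in
/-- The contribution of a fixed vertex to twice the Euler characteristic of the fixed graph is at
most `2`, and not positive unless moved edges are attached there. -/
theorem Admissible.two_le [Fintype G.D] [Fintype G.V] (hG : G.Admissible) (h : ∃ d, Moves P d)
    {v : G.V} (hv : ¬ MovesV P v) :
    2 ≤ (Finset.univ.filter fun d => ¬ Moves P d ∧ G.src d = v).card +
      if Attaching P v then 2 else 0 := by
  split_ifs with ha
  · omega
  have hval : (Finset.univ.filter fun d => ¬ Moves P d ∧ G.src d = v).card = G.valence v := by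
    rw [valence, Nat.card_eq_fintype_card, Fintype.card_subtype]
    congr 1
    ext d
    simp only [Finset.mem_filter, Finset.mem_univ, true_and, and_iff_right_iff_imp]
    exact fun hd hm => ha ⟨hv, d, hd, hm⟩
  rw [hval]
  have h1 := hG.no_free_edge v
  have h2 : G.valence v ≠ 0 := by
    intro h0
    have hno : ∀ d, G.src d ≠ v := by
      intro d hd
      rw [valence, Nat.card_eq_fintype_card, Fintype.card_eq_zero_iff] at h0
      exact h0.false ⟨d, hd⟩
    obtain ⟨d, hd⟩ := h
    obtain ⟨w, hw⟩ := hG.connected' v (G.src d)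
    cases w with
    | nil => exact hno d (show v = _ from hw).symm
    | cons e w => exact hno e hw.1
  omega

open Classical in
/-- The numerical constraints on a `p`-group that acts on an admissible graph. -/
theorem Admissible.card_bounds [Fintype G.D] [Fintype G.V] (hG : G.Admissible) {p : ℕ}
    [Fact p.Prime] (hP : IsPGroup p P) (h : ∃ d, Moves P d) :
    3 * (Finset.univ.filter fun v => MovesV P v).card +
        (Finset.univ.filter fun d => Moves P d ∧ ¬ MovesV P (G.src d)).card ≤
      (Finset.univ.filter fun d => Moves P d).card ∧
    p * (Finset.univ.filter fun v => Attaching P v).card ≤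
      (Finset.univ.filter fun d => Moves P d ∧ ¬ MovesV P (G.src d)).card ∧
    1 ≤ (Finset.univ.filter fun v => Attaching P v).card ∧
    2 * (Finset.univ.filter fun v => ¬ MovesV P v).card ≤
      (Finset.univ.filter fun d => ¬ Moves P d).card +
        2 * (Finset.univ.filter fun v => Attaching P v).card := by
  obtain ⟨h1, h2⟩ := counts (P := P)
  refine ⟨?_, ?_, ?_, ?_⟩
  · rw [h1, add_comm]
    refine Nat.add_le_add_left ?_ _
    rw [mul_comm, ← smul_eq_mul]
    refine Finset.card_nsmul_le_sum _ _ _ fun v hv => hG.three_le_valence v ?_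
    rintro rfl
    exact not_movesV_base (Finset.mem_filter.1 hv).2
  · rw [Finset.card_eq_sum_card_fiberwise (f := G.src)
      (t := Finset.univ.filter fun v => Attaching P v), mul_comm, ← smul_eq_mul]
    · refine Finset.card_nsmul_le_sum _ _ _ fun v hv => ?_
      have hv := (Finset.mem_filter.1 hv).2
      refine (card_moves_at hP hv).trans (Finset.card_le_card fun d hd => ?_)
      simp only [Finset.mem_filter, Finset.mem_univ, true_and] at hd ⊢
      exact ⟨⟨hd.1, by rw [hd.2]; exact hv.1⟩, hd.2⟩
    · intro d hd
      have := (Finset.mem_filter.1 hd).2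
      simpa using ⟨this.2, d, rfl, this.1⟩
  · obtain ⟨v, hv⟩ := hG.exists_attaching h
    exact Finset.card_pos.2 ⟨v, by simpa using hv⟩
  · have h3 : ∑ v ∈ Finset.univ.filter (fun v => ¬ MovesV P v), (if Attaching P v then 2 else 0) =
        2 * (Finset.univ.filter fun v => Attaching P v).card := by
      rw [← Finset.sum_filter, Finset.sum_const, smul_eq_mul, mul_comm, Finset.filter_filter]
      congr 2
      ext v
      simp only [Finset.mem_filter, Finset.mem_univ, true_and, and_iff_right_iff_imp]
      exact fun h => h.1
    rw [← h2, ← h3, ← Finset.sum_add_distrib, mul_comm, ← smul_eq_mul]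
    exact Finset.card_nsmul_le_sum _ _ _ fun v hv =>
      hG.two_le h (Finset.mem_filter.1 hv).2

end

end PGraph

end Auter

namespace Auter

/-! ### Small permutation representations of `p`-groups -/

section Generic

variable {p : ℕ} [Fact p.Prime] {P D : Type} [Group P] [Finite P] [Finite D]

open Classical in
/-- If a `p`-group acts faithfully on a small set with a free involution, then it is elementary
abelian, its orbits have at most `p` elements, and it contains an element that moves all points
which are not fixed by the whole group. -/
theorem exists_generic (hP : IsPGroup p P) (h2 : p ≠ 2) (a : P →* Equiv.Perm D)
    (ha : Function.Injective a) (ι : D → D) (hιι : ∀ d, ι (ι d) = d) (hιn : ∀ d, ι d ≠ d)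
    (hι : ∀ s d, a s (ι d) = ι (a s d)) (hb : Nat.card {d // ∃ i, a i d ≠ d} < 2 * p ^ 2) :
    ∃ z : P, z ^ p = 1 ∧ (∀ d, (∃ i, a i d ≠ d) → a z d ≠ d) ∧ (∀ β, β * z = z * β) ∧
      ∀ β d, ∃ x : ZMod p, a β d = a (z ^ x.val) d := by
  have hp := (Fact.out : p.Prime)
  let _ : MulAction P D := MulAction.compHom _ a
  have hsm : ∀ (i : P) (d : D), i • d = a i d := fun i d => rfl
  have := Fintype.ofFinite D
  have := Fintype.ofFinite P
  set M : Finset D := Finset.univ.filter fun d => ∃ i, a i d ≠ d with hM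
  have hMmem : ∀ d, d ∈ M ↔ ∃ i, a i d ≠ d := fun d => by simp [hM]
  rw [Nat.card_eq_fintype_card, Fintype.card_subtype] at hb
  change M.card < 2 * p ^ 2 at hb
  have hMa : ∀ (i : P) d, d ∈ M → a i d ∈ M := by
    intro i d hd
    rw [hMmem] at hd ⊢
    by_contra! hn
    obtain ⟨j, hj⟩ := hd
    have h1 : d = a i d := by
      have := hn i⁻¹
      rwa [← Equiv.Perm.mul_apply, ← map_mul, inv_mul_cancel, map_one] at this
    exact hj (by rw [h1]; exact hn j)
  have hMι : ∀ d, d ∈ M → ι d ∈ M := by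
    intro d hd
    rw [hMmem] at hd ⊢
    obtain ⟨j, hj⟩ := hd
    refine ⟨j, fun h => hj ?_⟩
    rw [hι] at h
    have := congrArg ι h
    rwa [hιι, hιι] at this
  -- an edge is not in the orbit of its reverse, as `P` has odd order
  have hodd : Odd (Nat.card P) := by
    obtain ⟨k, hk⟩ := IsPGroup.iff_card.1 hP
    rw [hk]
    exact (hp.odd_of_ne_two h2).pow
  have hιorb : ∀ (i : P) d, a i d ≠ ι d := by
    intro i d h
    have h3 : ∀ k : ℕ, a (i ^ (2 * k)) d = d := by
      intro k
      induction k with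
      | zero => simp
      | succ k ih =>
        rw [mul_add, pow_add, map_mul, Equiv.Perm.mul_apply, mul_one, pow_two i, map_mul,
          Equiv.Perm.mul_apply, h, hι, h, hιι, ih]
    obtain ⟨k, hk⟩ := hodd
    have h4 : a (i ^ Nat.card P) d = d := by rw [pow_card_eq_one']; simp
    rw [hk, pow_succ', map_mul, Equiv.Perm.mul_apply, h3, h] at h4
    exact hιn d h4
  -- a set of moved edges that contains an orbit and its reverse is large
  have hlarge : ∀ (d : D) (T : Finset D), (∀ i : P, a i d ∈ T) → (∀ i : P, ι (a i d) ∈ T) →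
      2 * Nat.card (MulAction.orbit P d) ≤ T.card := by
    intro d T h1 h3
    let O : Finset D := Finset.univ.image fun i : P => a i d
    have hO : O.card = Nat.card (MulAction.orbit P d) := by
      rw [Nat.card_eq_fintype_card, ← Set.toFinset_card]
      congr 1
      ext e
      simp [O, MulAction.mem_orbit_iff, hsm]
    have hOι : (O.image ι).card = O.card :=
      Finset.card_image_of_injective _ fun x y h => by rw [← hιι x, h, hιι]
    have hdis : Disjoint O (O.image ι) := by
      rw [Finset.disjoint_left]
      intro e he he'
      simp only [O, Finset.mem_image, Finset.mem_univ, true_and] at he he'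
      obtain ⟨i, rfl⟩ := he
      obtain ⟨_, ⟨j, rfl⟩, h⟩ := he'
      apply hιorb (i⁻¹ * j) (ι d)
      rw [map_mul, Equiv.Perm.mul_apply, hι, h, ← Equiv.Perm.mul_apply, ← map_mul, inv_mul_cancel,
        map_one, hιι]
      rfl
    rw [← hO, two_mul]
    nth_rewrite 2 [← hOι]
    rw [← Finset.card_union_of_disjoint hdis]
    refine Finset.card_le_card fun e he => ?_
    simp only [O, Finset.mem_union, Finset.mem_image, Finset.mem_univ, true_and] at he
    rcases he with ⟨i, rfl⟩ | ⟨_, ⟨i, rfl⟩, rfl⟩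
    · exact h1 i
    · exact h3 i
  have horb : ∀ d ∈ M, Nat.card (MulAction.orbit P d) = p := by
    intro d hd
    obtain ⟨m, hm⟩ := hP.card_orbit d
    have h3 := hlarge d M (fun i => hMa i d hd) fun i => hMι _ (hMa i d hd)
    have hm0 : m ≠ 0 := by
      rintro rfl
      rw [pow_zero, Nat.card_eq_one_iff_unique] at hm
      obtain ⟨i, hi⟩ := (hMmem d).1 hd
      have := hm.1.elim ⟨d, MulAction.mem_orbit_self d⟩ ⟨a i d, ⟨i, rfl⟩⟩
      exact hi (congrArg Subtype.val this).symm
    have hm2 : m < 2 := by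
      by_contra! hm2
      have := Nat.pow_le_pow_right hp.pos hm2
      omega
    obtain rfl : m = 1 := by omega
    rw [hm, pow_one]
  have hidx : ∀ d ∈ M, (MulAction.stabilizer P d).index = p := by
    intro d hd
    rw [MulAction.index_stabilizer, ← horb d hd]
    rfl
  have hnormal : ∀ d ∈ M, (MulAction.stabilizer P d).Normal := by
    intro d hd
    refine Subgroup.normal_of_index_eq_minFac_card ?_
    rw [hidx d hd]
    obtain ⟨k, hk⟩ := IsPGroup.iff_card.1 hP
    have hk0 : k ≠ 0 := by
      rintro rfl
      have h3 := (MulAction.stabilizer P d).index_dvd_card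
      rw [hidx d hd, hk, pow_zero] at h3
      exact hp.one_lt.ne' (Nat.dvd_one.1 h3)
    rw [hk, Nat.pow_minFac hk0, hp.minFac_eq]
  have hcomm : ∀ i j : P, i * j = j * i := by
    intro i j
    apply ha
    ext d
    by_cases hd : d ∈ M
    · have := hnormal d hd
      have hc : Nat.card (P ⧸ MulAction.stabilizer P d) = p := hidx d hd
      have hcyc : IsCyclic (P ⧸ MulAction.stabilizer P d) := isCyclic_of_prime_card hc
      have h3 : ((i * j : P) : P ⧸ MulAction.stabilizer P d) = (j * i : P) := by
        rw [QuotientGroup.mk_mul, QuotientGroup.mk_mul]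
        let _ := IsCyclic.commGroup (α := P ⧸ MulAction.stabilizer P d)
        exact mul_comm _ _
      rw [eq_comm, QuotientGroup.eq, MulAction.mem_stabilizer_iff, mul_smul, inv_smul_eq_iff] at h3
      exact h3
    · have h3 : ∀ i, a i d = d := by simpa [hMmem] using hd
      rw [h3, h3]
  have hpow : ∀ i : P, i ^ p = 1 := by
    intro i
    apply ha
    ext d
    rw [map_one, Equiv.Perm.one_apply]
    by_cases hd : d ∈ M
    · have := hnormal d hd
      have h3 := Subgroup.pow_index_mem (MulAction.stabilizer P d) i
      rw [hidx d hd] at h3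
      exact h3
    · have h3 : ∀ i, a i d = d := by simpa [hMmem] using hd
      rw [h3]
  -- on average, an element of `P` fixes fewer than `2 p` elements of `M`
  obtain ⟨z, hz⟩ : ∃ z : P, (M.filter fun d => a z d = d).card < 2 * p := by
    by_contra! hall
    have h3 : ∑ z : P, (M.filter fun d => a z d = d).card =
        ∑ d ∈ M, (Finset.univ.filter fun z : P => a z d = d).card :=
      Finset.sum_card_bipartiteAbove_eq_sum_card_bipartiteBelow _
    have h4 : ∀ d ∈ M, p * (Finset.univ.filter fun z : P => a z d = d).card = Nat.card P := by
      intro d hd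
      rw [← (MulAction.stabilizer P d).index_mul_card, hidx d hd]
      congr 1
      rw [← Fintype.card_subtype, ← Nat.card_eq_fintype_card]
      rfl
    have h5 : p * ∑ z : P, (M.filter fun d => a z d = d).card = M.card * Nat.card P := by
      rw [h3, Finset.mul_sum, Finset.sum_congr rfl h4, Finset.sum_const, smul_eq_mul]
    have h6 : Nat.card P * (2 * p) ≤ ∑ z : P, (M.filter fun d => a z d = d).card := by
      rw [Nat.card_eq_fintype_card, ← Finset.card_univ, ← smul_eq_mul]
      exact Finset.card_nsmul_le_sum _ _ _ fun z _ => hall z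
    have h7 : 0 < Nat.card P := Nat.card_pos
    have h8 := Nat.mul_le_mul_left p h6
    rw [h5] at h8
    nlinarith
  have hzM : ∀ d ∈ M, a z d ≠ d := by
    intro d hd hzd
    have h3 := hlarge d (M.filter fun d => a z d = d)
      (fun i => by
        rw [Finset.mem_filter, ← Equiv.Perm.mul_apply, ← map_mul, hcomm, map_mul,
          Equiv.Perm.mul_apply, hzd]
        exact ⟨hMa i d hd, rfl⟩)
      (fun i => by
        rw [Finset.mem_filter, hι, ← Equiv.Perm.mul_apply, ← map_mul, hcomm, map_mul,
          Equiv.Perm.mul_apply, hzd]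
        exact ⟨hMι _ (hMa i d hd), rfl⟩)
    rw [horb d hd] at h3
    omega
  refine ⟨z, hpow z, fun d hd => hzM d ((hMmem d).2 hd), fun β => hcomm β z, fun β d => ?_⟩
  by_cases hd : d ∈ M
  · let f : ZMod p → MulAction.orbit P d := fun x => ⟨a (z ^ x.val) d, ⟨z ^ x.val, rfl⟩⟩
    have hf : Function.Bijective f := by
      rw [Fintype.bijective_iff_injective_and_card]
      constructor
      · intro x y h
        exact pow_val_injective (hpow z) a (hzM d hd) (congrArg Subtype.val h)
      · rw [ZMod.card, ← horb d hd, Nat.card_eq_fintype_card]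
    obtain ⟨x, hx⟩ := hf.2 ⟨a β d, ⟨β, rfl⟩⟩
    exact ⟨x, (congrArg Subtype.val hx).symm⟩
  · have h3 : ∀ i, a i d = d := by simpa [hMmem] using hd
    exact ⟨0, by rw [h3, h3]⟩

end Generic

end Auter

open CategoryTheory CategoryTheory.Limits

namespace Auter

/-! ### Numbers of orbits of automorphisms of order `p` -/

namespace PGraph

variable {G : PGraph} {p : ℕ} [Fact p.Prime]

theorem Iso.pow_onV (z : Iso G G) (v : G.V) (h : z.onV v = v) (k : ℕ) : (z ^ k).onV v = v := by
  induction k with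
  | zero => rfl
  | succ k ih => rw [pow_succ, Iso.mul_onV, h, ih]

theorem Iso.pow_onD (z : Iso G G) (d : G.D) (h : z.onD d = d) (k : ℕ) : (z ^ k).onD d = d := by
  induction k with
  | zero => rfl
  | succ k ih => rw [pow_succ, Iso.mul_onD, h, ih]

theorem moves_zpowers_iff {z : Iso G G} {d : G.D} :
    Moves (Subgroup.zpowers z) d ↔ z.onD d ≠ d := by
  constructor
  · rintro ⟨i, ⟨k, rfl⟩, h⟩ hz
    apply h
    change (Iso.permD G (z ^ k)) d = d
    rw [map_zpow]
    exact Equiv.Perm.zpow_apply_eq_self_of_apply_eq_self hz k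
  · exact fun h => ⟨z, Subgroup.mem_zpowers z, h⟩

theorem movesV_zpowers_iff {z : Iso G G} {v : G.V} :
    MovesV (Subgroup.zpowers z) v ↔ z.onV v ≠ v := by
  constructor
  · rintro ⟨i, ⟨k, rfl⟩, h⟩ hz
    apply h
    change (Iso.permV G (z ^ k)) v = v
    rw [map_zpow]
    exact Equiv.Perm.zpow_apply_eq_self_of_apply_eq_self hz k
  · exact fun h => ⟨z, Subgroup.mem_zpowers z, h⟩

/-- The possible numbers of orbits of an automorphism of order `p`: `E` orbits of moved edges, `V`
orbits of moved vertices, `s` orbits of moved directed edges that start at a fixed vertex, `t`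
attaching vertices, `Df` fixed directed edges and `Vf` fixed vertices. -/
theorem orbit_numbers {p E V s t Df Vf : ℕ} (h5 : 5 ≤ p)
    (h1 : 2 * p * E + Df + 4 = 2 * (p * V + Vf) + 4 * p) (h2 : 3 * (p * V) + p * s ≤ 2 * p * E)
    (h3 : t ≤ s) (h4 : 1 ≤ t) (h6 : 2 * Vf ≤ Df + 2 * t) :
    (E = V + 2 ∧ V + s ≤ 4 ∧ 2 * Vf = Df + 4 ∧ 2 ≤ t) ∨
      (E = V + 1 ∧ V + s ≤ 2 ∧ 2 * Vf + 2 * p = Df + 4) := by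
  have h7 : 3 * V + s ≤ 2 * E := by
    refine Nat.le_of_mul_le_mul_left (c := p) ?_ (by omega)
    linarith
  obtain ⟨k, rfl⟩ : ∃ k, E = V + k := ⟨E - V, by omega⟩
  have hk : k < 3 := by
    by_contra! hk
    obtain ⟨l, rfl⟩ : ∃ l, k = l + 3 := ⟨k - 3, by omega⟩
    have h8 : 5 * (2 * l + 2) ≤ p * (2 * l + 2) := Nat.mul_le_mul_right _ h5
    have h9 : 2 * p * (V + (l + 3)) + 4 = 2 * (p * V) + p * (2 * l + 2) + 4 * p + 4 := by ring
    omega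
  interval_cases k
  · omega
  · right
    have h9 : 2 * p * (V + 1) = 2 * (p * V) + 2 * p := by ring
    omega
  · left
    have h9 : 2 * p * (V + 2) = 2 * (p * V) + 4 * p := by ring
    omega

/-- A set without fixed points under a `p`-group has cardinality divisible by `p`. -/
theorem dvd_card_of_forall_moved {P α : Type} [Group P] (hP : IsPGroup p P)
    (a : P →* Equiv.Perm α) (T : Finset α) (h1 : ∀ i, ∀ t ∈ T, a i t ∈ T)
    (h2 : ∀ t ∈ T, ∃ i, a i t ≠ t) : p ∣ T.card := by
  let _ : MulAction P T :=
    { smul := fun i t => ⟨a i t, h1 i t t.2⟩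
      one_smul := fun t => Subtype.ext (by change a 1 t = t; rw [map_one]; rfl)
      mul_smul := fun i j t => Subtype.ext (by
        change a (i * j) t = a i (a j t)
        rw [map_mul]
        rfl) }
  have h3 := hP.card_modEq_card_fixedPoints T
  have : IsEmpty (MulAction.fixedPoints P T) := by
    refine ⟨fun ⟨t, ht⟩ => ?_⟩
    obtain ⟨i, hi⟩ := h2 t t.2
    exact hi (congrArg Subtype.val (ht i))
  rw [Nat.card_of_isEmpty (α := MulAction.fixedPoints P T), Nat.card_eq_fintype_card,
    Fintype.card_coe] at h3
  exact (Nat.modEq_zero_iff_dvd).1 h3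

/-- A set of directed edges that is closed under reversal has even cardinality. -/
theorem two_dvd_card (T : Finset G.D) (h : ∀ d ∈ T, G.inv d ∈ T) : 2 ∣ T.card := by
  rw [← ZMod.natCast_eq_zero_iff, Finset.cast_card]
  exact Finset.sum_involution (fun d _ => G.inv d) (fun _ _ => by decide)
    (fun d _ _ => G.inv_ne d) (fun d hd => h d hd) (fun d _ => G.inv_inv d)

theorem isPGroup_zpowers {H : Type} [Group H] {z : H} {q : ℕ} (hz : z ^ q = 1) :
    IsPGroup q (Subgroup.zpowers z) := by
  rintro ⟨_, ⟨k, rfl⟩⟩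
  refine ⟨1, Subtype.ext ?_⟩
  change (z ^ k) ^ q ^ 1 = 1
  rw [pow_one, ← zpow_natCast, zpow_comm, zpow_natCast, hz, one_zpow]

/-- There is an element of order `p` in a Sylow subgroup of a group of automorphisms that has the
same orbits of edges as the Sylow subgroup, which is small by the Euler characteristic. -/
theorem Admissible.exists_generic (hG : G.Admissible) (h5 : 5 ≤ p)
    (hc : Nat.card G.D + 4 = 2 * Nat.card G.V + 4 * p) (S : Subgroup (Iso G G))
    (hS : p ∣ Nat.card S) :
    ∃ (P : Sylow p S) (z : S), z ≠ 1 ∧ z ^ p = 1 ∧ (∀ β ∈ P, β * z = z * β) ∧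
      ∀ β ∈ P, ∀ d, ∃ x : ZMod p, β.1.onD d = (z ^ x.val).1.onD d := by
  classical
  have hp := (Fact.out : p.Prime)
  have := hG.finite_D
  have := hG.finite_V
  have := hG.finite_iso
  have := Fintype.ofFinite G.D
  have := Fintype.ofFinite G.V
  obtain ⟨P⟩ : Nonempty (Sylow p S) := inferInstance
  let a : P →* Equiv.Perm G.D := ((Iso.permD G).comp S.subtype).comp (P : Subgroup S).subtype
  have ha : Function.Injective a :=
    (hG.permD_injective.comp Subtype.val_injective).comp Subtype.val_injective
  let Q : Subgroup (Iso G G) := (P : Subgroup S).map S.subtype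
  have hQ : IsPGroup p Q := P.isPGroup'.map S.subtype
  have hmov : ∀ d, Moves Q d ↔ ∃ i, a i d ≠ d := by
    intro d
    constructor
    · rintro ⟨_, ⟨i, hi, rfl⟩, h⟩
      exact ⟨⟨i, hi⟩, h⟩
    · rintro ⟨⟨i, hi⟩, h⟩
      exact ⟨_, ⟨i, hi, rfl⟩, h⟩
  have hne : ∃ d, Moves Q d := by
    by_contra! hn
    have hP1 : ∀ i : P, i = 1 := by
      intro i
      apply ha
      ext d
      have := hn d
      rw [hmov] at this
      push Not at this
      rw [this, map_one]
      rfl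
    have hdvd : p ∣ Nat.card P := P.dvd_card_of_dvd_card hS
    have hP2 : Nat.card (P : Subgroup S) = 1 :=
      Nat.card_eq_one_iff_unique.2 ⟨⟨fun i j => (hP1 i).trans (hP1 j).symm⟩, ⟨1⟩⟩
    rw [hP2] at hdvd
    exact hp.one_lt.ne' (Nat.dvd_one.1 hdvd)
  obtain ⟨h1, h2, h3, h4⟩ := hG.card_bounds hQ hne
  have h6 : (Finset.univ.filter fun d => Moves Q d).card +
      (Finset.univ.filter fun d => ¬ Moves Q d).card = (Finset.univ : Finset G.D).card :=
    Finset.card_filter_add_card_filter_not _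
  have h7 : (Finset.univ.filter fun v => MovesV Q v).card +
      (Finset.univ.filter fun v => ¬ MovesV Q v).card = (Finset.univ : Finset G.V).card :=
    Finset.card_filter_add_card_filter_not _
  rw [Finset.card_univ, ← Nat.card_eq_fintype_card] at h6 h7
  have hb : Nat.card {d // ∃ i, a i d ≠ d} < 2 * p ^ 2 := by
    have hM : Nat.card {d // ∃ i, a i d ≠ d} = (Finset.univ.filter fun d => Moves Q d).card := by
      rw [Nat.card_eq_fintype_card, Fintype.card_subtype]
      exact congrArg Finset.card (Finset.filter_congr fun d _ => (hmov d).symm)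
    rw [hM]
    have h8 : 5 * (Finset.univ.filter fun v => Attaching Q v).card ≤
        p * (Finset.univ.filter fun v => Attaching Q v).card := Nat.mul_le_mul_right _ h5
    have h9 : 5 * p ≤ p * p := Nat.mul_le_mul_right _ h5
    have h10 : p * 1 ≤ p * (Finset.univ.filter fun v => Attaching Q v).card :=
      Nat.mul_le_mul_left _ h3
    obtain ⟨t, ht⟩ : ∃ t, (Finset.univ.filter fun v => Attaching Q v).card = t + 1 :=
      ⟨_, (Nat.sub_add_cancel h3).symm⟩
    rw [ht] at h2 h4 h8 h10
    have h11 : p * (t + 1) = p * t + p := by ring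
    have h12 : 5 * t ≤ p * t := Nat.mul_le_mul_right _ h5
    rw [pow_two]
    omega
  obtain ⟨z, hz, hzm, hzc, hzo⟩ := Auter.exists_generic P.isPGroup' (by omega) a ha G.inv G.inv_inv
    G.inv_ne (fun s d => s.1.1.onD_inv d) hb
  refine ⟨P, z, ?_, ?_, ?_, ?_⟩
  · intro h
    obtain ⟨d, hd⟩ := hne
    refine hzm d ((hmov d).1 hd) ?_
    have : z = 1 := Subtype.ext h
    rw [this, map_one]
    rfl
  · exact congrArg Subtype.val hz
  · intro β hβ
    exact congrArg Subtype.val (hzc ⟨β, hβ⟩)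
  · intro β hβ d
    obtain ⟨x, hx⟩ := hzo ⟨β, hβ⟩ d
    exact ⟨x, hx⟩

open Classical in
/-- The numbers of orbits of an automorphism of order `p`. -/
theorem Admissible.orbit_numbers [Fintype G.D] [Fintype G.V] (hG : G.Admissible) (h5 : 5 ≤ p)
    (hc : Nat.card G.D + 4 = 2 * Nat.card G.V + 4 * p) {z : Iso G G} (hz : z ^ p = 1)
    (hz1 : z ≠ 1) :
    ∃ E V s : ℕ, (Finset.univ.filter fun d => Moves (Subgroup.zpowers z) d).card = 2 * p * E ∧
      (Finset.univ.filter fun v => MovesV (Subgroup.zpowers z) v).card = p * V ∧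
      (Finset.univ.filter fun d => Moves (Subgroup.zpowers z) d ∧
        ¬ MovesV (Subgroup.zpowers z) (G.src d)).card = p * s ∧
      (Finset.univ.filter fun v => Attaching (Subgroup.zpowers z) v).card ≤ s ∧ 1 ≤ s ∧
      ((E = V + 2 ∧ V + s ≤ 4 ∧ 2 ≤ (Finset.univ.filter fun v =>
          Attaching (Subgroup.zpowers z) v).card ∧
        2 * (Finset.univ.filter fun v => ¬ MovesV (Subgroup.zpowers z) v).card =
          (Finset.univ.filter fun d => ¬ Moves (Subgroup.zpowers z) d).card + 4) ∨
      (E = V + 1 ∧ V + s ≤ 2 ∧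
        2 * (Finset.univ.filter fun v => ¬ MovesV (Subgroup.zpowers z) v).card + 2 * p =
          (Finset.univ.filter fun d => ¬ Moves (Subgroup.zpowers z) d).card + 4)) := by
  have hp := (Fact.out : p.Prime)
  set Q := Subgroup.zpowers z with hQd
  have hQ : IsPGroup p Q := isPGroup_zpowers hz
  have hne : ∃ d, Moves Q d := by
    by_contra! hn
    exact hz1 (hG.iso_ext fun d => by simpa [Q, moves_zpowers_iff] using hn d)
  obtain ⟨h1, h2, h3, h4⟩ := hG.card_bounds hQ hne
  have h6 : (Finset.univ.filter fun d => Moves Q d).card +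
      (Finset.univ.filter fun d => ¬ Moves Q d).card = (Finset.univ : Finset G.D).card :=
    Finset.card_filter_add_card_filter_not _
  have h7 : (Finset.univ.filter fun v => MovesV Q v).card +
      (Finset.univ.filter fun v => ¬ MovesV Q v).card = (Finset.univ : Finset G.V).card :=
    Finset.card_filter_add_card_filter_not _
  rw [Finset.card_univ, ← Nat.card_eq_fintype_card] at h6 h7
  have hVmem : ∀ i ∈ Q, ∀ v, MovesV Q v → MovesV Q (i.onV v) := by
    rintro i hi v ⟨j, hj, h⟩
    by_contra hn
    rw [not_movesV_iff] at hn
    have h1 : v = i.onV v := (i.onV.symm_apply_apply v).symm.trans (hn i⁻¹ (Q.inv_mem hi))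
    exact h (by rw [h1]; exact hn j hj)
  have hA : ∀ i ∈ Q, ∀ d, ¬ MovesV Q (G.src d) → G.src (i.onD d) = G.src d := by
    intro i hi d hd
    rw [i.src_onD]
    exact not_movesV_iff.1 hd i hi
  have d1 : p ∣ (Finset.univ.filter fun d => Moves Q d).card := by
    refine dvd_card_of_forall_moved hQ ((Iso.permD G).comp Q.subtype) _ (fun i d hd => ?_)
      fun d hd => ?_
    · simp only [Finset.mem_filter, Finset.mem_univ, true_and] at hd ⊢
      exact moves_onD i.2 hd
    · obtain ⟨i, hi, h⟩ := (Finset.mem_filter.1 hd).2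
      exact ⟨⟨i, hi⟩, h⟩
  have d2 : 2 ∣ (Finset.univ.filter fun d => Moves Q d).card := two_dvd_card _ fun d hd => by
    simp only [Finset.mem_filter, Finset.mem_univ, true_and] at hd ⊢
    exact moves_inv.2 hd
  have d3 : p ∣ (Finset.univ.filter fun v => MovesV Q v).card := by
    refine dvd_card_of_forall_moved hQ ((Iso.permV G).comp Q.subtype) _ (fun i v hv => ?_)
      fun v hv => ?_
    · simp only [Finset.mem_filter, Finset.mem_univ, true_and] at hv ⊢
      exact hVmem i i.2 v hv
    · obtain ⟨i, hi, h⟩ := (Finset.mem_filter.1 hv).2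
      exact ⟨⟨i, hi⟩, h⟩
  have d4 : p ∣ (Finset.univ.filter fun d => Moves Q d ∧ ¬ MovesV Q (G.src d)).card := by
    refine dvd_card_of_forall_moved hQ ((Iso.permD G).comp Q.subtype) _ (fun i d hd => ?_)
      fun d hd => ?_
    · simp only [Finset.mem_filter, Finset.mem_univ, true_and] at hd ⊢
      refine ⟨moves_onD i.2 hd.1, ?_⟩
      change ¬ MovesV Q (G.src (i.1.onD d))
      rw [hA i i.2 d hd.2]
      exact hd.2
    · obtain ⟨i, hi, h⟩ := (Finset.mem_filter.1 hd).2.1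
      exact ⟨⟨i, hi⟩, h⟩
  have d12 : 2 * p ∣ (Finset.univ.filter fun d => Moves Q d).card :=
    Nat.Coprime.mul_dvd_of_dvd_of_dvd
      ((Nat.coprime_primes Nat.prime_two hp).2 (by omega)) d2 d1
  obtain ⟨E, hE⟩ := d12
  obtain ⟨V, hV⟩ := d3
  obtain ⟨s, hs⟩ := d4
  rw [hs] at h2
  have h8 : (Finset.univ.filter fun v => Attaching Q v).card ≤ s :=
    Nat.le_of_mul_le_mul_left h2 hp.pos
  rw [hs, hE, hV] at h1
  have h9 := PGraph.orbit_numbers (p := p) (E := E) (V := V) (s := s)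
    (Df := (Finset.univ.filter fun d => ¬ Moves Q d).card)
    (Vf := (Finset.univ.filter fun v => ¬ MovesV Q v).card) h5 (by rw [hE] at h6; rw [hV] at h7; omega)
    h1 h8 h3 h4
  refine ⟨E, V, s, hE, hV, hs, h8, h3.trans h8, ?_⟩
  rcases h9 with ⟨a, b, c, d⟩ | ⟨a, b, c⟩
  · exact Or.inl ⟨a, b, d, c⟩
  · exact Or.inr ⟨a, b, c⟩

end PGraph

end Auter

open CategoryTheory CategoryTheory.Limits

namespace Auter

/-! ### Scaling automorphisms -/

namespace PGraph

variable {G : PGraph} {p : ℕ} [Fact p.Prime]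

section Rotation

variable {z : Iso G G}

theorem onD_pow_ne (hz : z ^ p = 1) {d : G.D} (hd : z.onD d ≠ d) {x y : ZMod p}
    (h : (z ^ x.val).onD d = (z ^ y.val).onD d) : x = y :=
  pow_val_injective hz (Iso.permD G) hd h

theorem onV_pow_ne (hz : z ^ p = 1) {v : G.V} (hv : z.onV v ≠ v) {x y : ZMod p}
    (h : (z ^ x.val).onV v = (z ^ y.val).onV v) : x = y :=
  pow_val_injective hz (Iso.permV G) hv h

theorem pow_val_one (hz : z ^ p = 1) : z ^ (1 : ZMod p).val = z := by
  have := pow_natCast_val hz 1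
  rwa [Nat.cast_one, pow_one] at this

theorem pow_val_zero' : z ^ (0 : ZMod p).val = 1 := by rw [ZMod.val_zero, pow_zero]

theorem pow_val_succ (hz : z ^ p = 1) (x : ZMod p) : z ^ (x + 1).val = z ^ x.val * z := by
  rw [pow_val_add hz, pow_val_one hz]

theorem onD_pow_add (hz : z ^ p = 1) (x y : ZMod p) (d : G.D) :
    (z ^ (x + y).val).onD d = (z ^ x.val).onD ((z ^ y.val).onD d) := by
  rw [pow_val_add hz]
  rfl

theorem onV_pow_add (hz : z ^ p = 1) (x y : ZMod p) (v : G.V) :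
    (z ^ (x + y).val).onV v = (z ^ x.val).onV ((z ^ y.val).onV v) := by
  rw [pow_val_add hz]
  rfl

theorem onD_moved (hz : z ^ p = 1) {d : G.D} (x : ZMod p) :
    z.onD ((z ^ x.val).onD d) = (z ^ x.val).onD d ↔ z.onD d = d := by
  constructor
  · intro h
    by_contra hd
    have h1 : (z ^ (x + 1).val).onD d = (z ^ x.val).onD d := by
      rw [add_comm, onD_pow_add hz, pow_val_one hz, h]
    have h2 := onD_pow_ne hz hd h1
    have : Nontrivial (ZMod p) := inferInstance
    simp at h2
  · intro h
    rw [z.pow_onD d h, h]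

theorem onV_moved (hz : z ^ p = 1) {v : G.V} (x : ZMod p) :
    z.onV ((z ^ x.val).onV v) = (z ^ x.val).onV v ↔ z.onV v = v := by
  constructor
  · intro h
    by_contra hv
    have h1 : (z ^ (x + 1).val).onV v = (z ^ x.val).onV v := by
      rw [add_comm, onV_pow_add hz, pow_val_one hz, h]
    have h2 := onV_pow_ne hz hv h1
    simp at h2
  · intro h
    rw [z.pow_onV v h, h]

theorem onD_pow_cancel (hz : z ^ p = 1) (x : ZMod p) (d : G.D) :
    (z ^ (-x).val).onD ((z ^ x.val).onD d) = d := by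
  rw [← onD_pow_add hz, neg_add_cancel, pow_val_zero']
  rfl

/-- A rotation of odd order does not map an edge to its reverse. -/
theorem onD_pow_ne_inv (h2 : p ≠ 2) (hz : z ^ p = 1) (x : ZMod p) (d : G.D) :
    (z ^ x.val).onD d ≠ G.inv d := by
  intro h
  have hx : (z ^ (x + x).val).onD d = d := by
    rw [onD_pow_add hz, h, (z ^ x.val).onD_inv, h, G.inv_inv]
  by_cases hd : z.onD d = d
  · rw [z.pow_onD d hd] at h
    exact G.inv_ne d h.symm
  · have h3 : x + x = 0 := onD_pow_ne hz hd (by rw [hx, pow_val_zero']; rfl)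
    have h4 : x = 0 := by
      rw [← two_mul, mul_eq_zero] at h3
      rcases h3 with h3 | h3
      · have h5 : ((2 : ℕ) : ZMod p) = 0 := by exact_mod_cast h3
        rw [ZMod.natCast_eq_zero_iff] at h5
        exact absurd ((Nat.prime_dvd_prime_iff_eq Fact.out Nat.prime_two).1 h5) h2
      · exact h3
    rw [h4, pow_val_zero'] at h
    exact G.inv_ne d h.symm

/-- Two moved edges are equivalent if a rotation maps one to the other or to its reverse. -/
def edgeSetoid (hz : z ^ p = 1) : Setoid {d : G.D // z.onD d ≠ d} where
  r d e := ∃ x : ZMod p, e.1 = (z ^ x.val).onD d ∨ e.1 = G.inv ((z ^ x.val).onD d)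
  iseqv :=
    { refl := fun d => ⟨0, Or.inl (by rw [pow_val_zero']; rfl)⟩
      symm := by
        rintro ⟨d, hd⟩ ⟨e, he⟩ ⟨x, h | h⟩
        · simp only at h
          subst h
          exact ⟨-x, Or.inl (onD_pow_cancel hz x d).symm⟩
        · simp only at h
          subst h
          exact ⟨-x, Or.inr (by
            simp only [(z ^ (-x).val).onD_inv, G.inv_inv, onD_pow_cancel hz])⟩
      trans := by
        rintro ⟨d, hd⟩ ⟨e, he⟩ ⟨f, hf⟩ ⟨x, h | h⟩ ⟨y, h' | h'⟩ <;> simp only at h h' <;>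
          refine ⟨y + x, ?_⟩ <;> simp only [h', h, (z ^ y.val).onD_inv, G.inv_inv,
            onD_pow_add hz] <;> simp }

/-- The moved edges can be indexed by `ℤ/p` compatibly with the rotation, if the moved vertices can
and neighbouring moved vertices have the same index. -/
theorem exists_index (h2 : p ≠ 2) (hz : z ^ p = 1) (f : G.V → ZMod p)
    (hf : ∀ v, z.onV v ≠ v → f (z.onV v) = f v + 1)
    (hfd : ∀ d, z.onV (G.src d) ≠ G.src d → z.onV (G.src (G.inv d)) ≠ G.src (G.inv d) →
      f (G.src d) = f (G.src (G.inv d))) :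
    ∃ idx : G.D → ZMod p, (∀ d, z.onD d ≠ d → idx (z.onD d) = idx d + 1) ∧
      (∀ d, z.onD d ≠ d → idx (G.inv d) = idx d) ∧
      ∀ d, z.onV (G.src d) ≠ G.src d → idx d = f (G.src d) := by
  classical
  have hne : ∀ d, z.onD d ≠ d → z.onD (G.inv d) ≠ G.inv d := by
    intro d hd h
    rw [z.onD_inv] at h
    have := congrArg G.inv h
    rw [G.inv_inv, G.inv_inv] at this
    exact hd this
  -- an index for the edges with fixed ends, from representatives of the orbits
  obtain ⟨h, h1, h3⟩ : ∃ h : G.D → ZMod p, (∀ d, z.onD d ≠ d → h (z.onD d) = h d + 1) ∧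
      (∀ d, z.onD d ≠ d → h (G.inv d) = h d) := by
    let S := edgeSetoid (p := p) hz
    let rep : {d : G.D // z.onD d ≠ d} → {d : G.D // z.onD d ≠ d} := fun d =>
      (Quotient.mk S d).out
    have hrep : ∀ d, ∃ x : ZMod p, d.1 = (z ^ x.val).onD (rep d) ∨
        d.1 = G.inv ((z ^ x.val).onD (rep d)) := fun d => Quotient.mk_out (s := S) d
    choose x hx using hrep
    have huniq : ∀ d (y : ZMod p), (d.1 = (z ^ y.val).onD (rep d) ∨
        d.1 = G.inv ((z ^ y.val).onD (rep d))) → x d = y := by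
      have key : ∀ (r : {d : G.D // z.onD d ≠ d}) (x y : ZMod p),
          (z ^ x.val).onD r ≠ G.inv ((z ^ y.val).onD r) := by
        intro r x y h
        apply onD_pow_ne_inv h2 hz (x - y) ((z ^ y.val).onD r)
        rw [← onD_pow_add hz, sub_add_cancel, h]
      intro d y hy
      rcases hx d with h | h <;> rcases hy with h' | h'
      · exact onD_pow_ne hz (rep d).2 (h.symm.trans h')
      · exact absurd (h.symm.trans h') (key _ _ _)
      · exact absurd (h'.symm.trans h) (key _ _ _)
      · refine onD_pow_ne hz (rep d).2 ?_
        have := congrArg G.inv (h.symm.trans h')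
        rwa [G.inv_inv, G.inv_inv] at this
    have hrepeq : ∀ d e : {d : G.D // z.onD d ≠ d}, S d e → rep d = rep e := fun d e hde =>
      congrArg Quotient.out (Quotient.sound hde)
    refine ⟨fun d => if hd : z.onD d ≠ d then x ⟨d, hd⟩ else 0, fun d hd => ?_, fun d hd => ?_⟩
    · have hzd : z.onD (z.onD d) ≠ z.onD d := fun h => hd (z.onD.injective h)
      simp only [dif_pos hd, dif_pos hzd]
      refine huniq _ _ ?_
      have h4 : rep ⟨d, hd⟩ = rep ⟨z.onD d, hzd⟩ :=
        hrepeq _ _ ⟨1, Or.inl (by rw [pow_val_one hz])⟩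
      rw [← h4, add_comm, onD_pow_add hz, pow_val_one hz]
      rcases hx ⟨d, hd⟩ with h | h
      · exact Or.inl (congrArg z.onD h)
      · exact Or.inr ((congrArg z.onD h).trans (z.onD_inv _))
    · simp only [dif_pos hd, dif_pos (hne d hd)]
      refine huniq _ _ ?_
      have h4 : rep ⟨d, hd⟩ = rep ⟨G.inv d, hne d hd⟩ :=
        hrepeq _ _ ⟨0, Or.inr (by rw [pow_val_zero']; rfl)⟩
      rw [← h4]
      rcases hx ⟨d, hd⟩ with h | h
      · exact Or.inr (congrArg G.inv h)
      · exact Or.inl ((congrArg G.inv h).trans (G.inv_inv _))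
  have hsrc : ∀ d, G.src (z.onD d) = z.onV (G.src d) := z.src_onD
  have htgt : ∀ d, G.src (G.inv (z.onD d)) = z.onV (G.src (G.inv d)) := fun d => by
    rw [← z.onD_inv, z.src_onD]
  refine ⟨fun d => if z.onV (G.src d) ≠ G.src d then f (G.src d) else
    if z.onV (G.src (G.inv d)) ≠ G.src (G.inv d) then f (G.src (G.inv d)) else h d,
    fun d hd => ?_, fun d hd => ?_, fun d hd => if_pos hd⟩
  · simp only [hsrc, htgt, ne_eq, z.onV.apply_eq_iff_eq]
    split_ifs with ha hb
    · exact h1 d hd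
    · exact hf _ hb
    · exact hf _ ha
  · simp only [G.inv_inv, ne_eq]
    split_ifs with ha hb hb
    · exact h3 d hd
    · rfl
    · rfl
    · exact (hfd d hb ha).symm

/-- The automorphism that multiplies all indices by `r`. -/
theorem exists_scaling (hG : G.Admissible) (hz : z ^ p = 1) (f : G.V → ZMod p)
    (hf : ∀ v, z.onV v ≠ v → f (z.onV v) = f v + 1) (idx : G.D → ZMod p)
    (h1 : ∀ d, z.onD d ≠ d → idx (z.onD d) = idx d + 1)
    (h2 : ∀ d, z.onD d ≠ d → idx (G.inv d) = idx d)
    (h3 : ∀ d, z.onV (G.src d) ≠ G.src d → idx d = f (G.src d)) {r : ZMod p} (hr : r ≠ 0) :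
    ∃ g : Iso G G, (∀ d, g.onD d = (z ^ ((r - 1) * idx d).val).onD d) ∧ g * z = z ^ r.val * g := by
  have hpowD : ∀ d (x : ZMod p), z.onD d ≠ d → idx ((z ^ x.val).onD d) = idx d + x := by
    intro d x hd
    have : ∀ j : ℕ, idx ((z ^ j).onD d) = idx d + j ∧ z.onD ((z ^ j).onD d) ≠ (z ^ j).onD d := by
      intro j
      induction j with
      | zero => exact ⟨by rw [Nat.cast_zero, add_zero]; rfl, hd⟩
      | succ j ih =>
        rw [pow_succ', Iso.mul_onD]
        refine ⟨?_, fun h => ih.2 (z.onD.injective h)⟩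
        rw [h1 _ ih.2, ih.1, Nat.cast_succ, add_assoc]
    have h4 := (this x.val).1
    rwa [ZMod.natCast_zmod_val] at h4
  have hpowV : ∀ v (x : ZMod p), z.onV v ≠ v → f ((z ^ x.val).onV v) = f v + x := by
    intro v x hv
    have : ∀ j : ℕ, f ((z ^ j).onV v) = f v + j ∧ z.onV ((z ^ j).onV v) ≠ (z ^ j).onV v := by
      intro j
      induction j with
      | zero => exact ⟨by rw [Nat.cast_zero, add_zero]; rfl, hv⟩
      | succ j ih =>
        rw [pow_succ', Iso.mul_onV]
        refine ⟨?_, fun h => ih.2 (z.onV.injective h)⟩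
        rw [hf _ ih.2, ih.1, Nat.cast_succ, add_assoc]
    have h4 := (this x.val).1
    rwa [ZMod.natCast_zmod_val] at h4
  let gD : ZMod p → G.D → G.D := fun r d => (z ^ ((r - 1) * idx d).val).onD d
  let gV : ZMod p → G.V → G.V := fun r v => (z ^ ((r - 1) * f v).val).onV v
  have hinvD : ∀ r s : ZMod p, s * r = 1 → ∀ d, gD s (gD r d) = d := by
    intro r s hrs d
    by_cases hd : z.onD d = d
    · simp only [gD, z.pow_onD d hd]
    · change (z ^ ((s - 1) * idx ((z ^ ((r - 1) * idx d).val).onD d)).val).onD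
        ((z ^ ((r - 1) * idx d).val).onD d) = d
      rw [hpowD d _ hd, ← onD_pow_add hz, show (s - 1) * (idx d + (r - 1) * idx d) +
        (r - 1) * idx d = (s * r - 1) * idx d by ring, hrs, sub_self, zero_mul, pow_val_zero']
      rfl
  have hinvV : ∀ r s : ZMod p, s * r = 1 → ∀ v, gV s (gV r v) = v := by
    intro r s hrs v
    by_cases hv : z.onV v = v
    · simp only [gV, z.pow_onV v hv]
    · change (z ^ ((s - 1) * f ((z ^ ((r - 1) * f v).val).onV v)).val).onV
        ((z ^ ((r - 1) * f v).val).onV v) = v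
      rw [hpowV v _ hv, ← onV_pow_add hz, show (s - 1) * (f v + (r - 1) * f v) +
        (r - 1) * f v = (s * r - 1) * f v by ring, hrs, sub_self, zero_mul, pow_val_zero']
      rfl
  let g : Iso G G :=
    { onV := ⟨gV r, gV r⁻¹, hinvV r r⁻¹ (inv_mul_cancel₀ hr), hinvV r⁻¹ r (mul_inv_cancel₀ hr)⟩
      onD := ⟨gD r, gD r⁻¹, hinvD r r⁻¹ (inv_mul_cancel₀ hr), hinvD r⁻¹ r (mul_inv_cancel₀ hr)⟩
      src_onD := fun d => by
        change G.src ((z ^ ((r - 1) * idx d).val).onD d) =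
          (z ^ ((r - 1) * f (G.src d)).val).onV (G.src d)
        rw [Iso.src_onD]
        by_cases hv : z.onV (G.src d) = G.src d
        · rw [z.pow_onV _ hv, z.pow_onV _ hv]
        · rw [h3 d hv]
      onD_inv := fun d => by
        change (z ^ ((r - 1) * idx (G.inv d)).val).onD (G.inv d) =
          G.inv ((z ^ ((r - 1) * idx d).val).onD d)
        rw [Iso.onD_inv]
        by_cases hd : z.onD d = d
        · rw [z.pow_onD _ hd, z.pow_onD _ hd]
        · rw [h2 d hd]
      onV_base := (z ^ ((r - 1) * f G.base).val).onV_base }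
  refine ⟨g, fun d => rfl, hG.iso_ext fun d => ?_⟩
  change (z ^ ((r - 1) * idx (z.onD d)).val).onD (z.onD d) =
    (z ^ r.val).onD ((z ^ ((r - 1) * idx d).val).onD d)
  by_cases hd : z.onD d = d
  · rw [hd, z.pow_onD d hd, z.pow_onD d hd]
  · rw [h1 d hd, ← onD_pow_add hz]
    have h4 : z.onD d = (z ^ (1 : ZMod p).val).onD d := by rw [pow_val_one hz]
    nth_rewrite 1 [h4]
    rw [← onD_pow_add hz]
    congr 4
    ring

end Rotation

/-- A group of automorphisms that contains every automorphism whose effect on each edge agrees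
with that of some element of the group. -/
def IsOrbitClosed (S : Subgroup (Iso G G)) : Prop :=
  ∀ g : Iso G G, (∀ d, ∃ s ∈ S, g.onD d = s.onD d) → g ∈ S

theorem isOrbitClosed_flagAut (𝓕 : Set (Set G.D)) : IsOrbitClosed (flagAut G 𝓕) := by
  intro g hg F hF d
  obtain ⟨s, hs, h⟩ := hg d
  rw [h]
  exact hs F hF d

/-- There is a primitive root modulo `p`. -/
theorem exists_primitive : ∃ r : ZMod p, r ≠ 0 ∧ ∀ j : ℕ, r ^ j = 1 → p - 1 ∣ j := by
  obtain ⟨u, hu⟩ := IsCyclic.exists_generator (α := (ZMod p)ˣ)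
  refine ⟨u, u.ne_zero, fun j hj => ?_⟩
  rw [← ZMod.card_units p, ← Nat.card_eq_fintype_card, ← orderOf_eq_card_of_forall_mem_zpowers hu]
  exact orderOf_dvd_of_pow_eq_one (Units.ext (by simpa using hj))

/-- If the moved vertices have an index `f` that increases by one under the rotation `z` and is
constant along edges between moved vertices, then multiplying the indices by a primitive root gives
an automorphism, and the cohomology vanishes in low degrees. -/
theorem Admissible.isZero_of_untwisted (hG : G.Admissible) (h2 : p ≠ 2) (S : Subgroup (Iso G G))
    (hS : IsOrbitClosed S) (P : Sylow p S) {z : S} (hz1 : z ≠ 1) (hz : z ^ p = 1)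
    (hP : ∀ β ∈ P, β * z = z * β)
    (hPo : ∀ β ∈ P, ∀ d, ∃ x : ZMod p, β.1.onD d = (z ^ x.val).1.onD d) (f : G.V → ZMod p)
    (hf : ∀ v, z.1.onV v ≠ v → f (z.1.onV v) = f v + 1)
    (hfd : ∀ d, z.1.onV (G.src d) ≠ G.src d → z.1.onV (G.src (G.inv d)) ≠ G.src (G.inv d) →
      f (G.src d) = f (G.src (G.inv d))) {m n : ℕ}
    (hm : Nat.card {d // z.1.onD d ≠ d} ≤ 2 * p * m)
    (hn : ∀ j, n ≤ 2 * j → 2 * j ≤ n + m → ¬ (p - 1 ∣ j)) :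
    IsZero (groupCohomology (Rep.trivial (ZLoc p) S (ZLoc p)) (n + 1)) := by
  have hp := (Fact.out : p.Prime)
  have := hG.finite_D
  have := hG.finite_iso
  have hz' : z.1 ^ p = 1 := congrArg Subtype.val hz
  obtain ⟨idx, i1, i2, i3⟩ := exists_index h2 hz' f hf hfd
  obtain ⟨r, hr0, hr⟩ := exists_primitive (p := p)
  obtain ⟨g, hg, hgz⟩ := exists_scaling hG hz' f hf idx i1 i2 i3 hr0
  have hgS : g ∈ S := hS g fun d => ⟨_, (z ^ ((r - 1) * idx d).val).2, by rw [hg]; rfl⟩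
  have hpowD : ∀ d (x : ZMod p), z.1.onD d ≠ d → idx ((z.1 ^ x.val).onD d) = idx d + x := by
    intro d x hd
    have : ∀ j : ℕ, idx ((z.1 ^ j).onD d) = idx d + j ∧
        z.1.onD ((z.1 ^ j).onD d) ≠ (z.1 ^ j).onD d := by
      intro j
      induction j with
      | zero => exact ⟨by rw [Nat.cast_zero, add_zero]; rfl, hd⟩
      | succ j ih =>
        rw [pow_succ', Iso.mul_onD]
        refine ⟨?_, fun h => ih.2 (z.1.onD.injective h)⟩
        rw [i1 _ ih.2, ih.1, Nat.cast_succ, add_assoc]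
    have h4 := (this x.val).1
    rwa [ZMod.natCast_zmod_val] at h4
  let Q := Quotient (edgeSetoid (p := p) hz')
  have hQfin : Finite Q := Quotient.finite _
  have hQne : Nonempty Q := by
    by_contra hQ
    refine hz1 (Subtype.ext (hG.iso_ext fun d => ?_))
    by_contra hd
    exact hQ ⟨Quotient.mk _ ⟨d, hd⟩⟩
  -- representatives of index zero
  let rep : Q → G.D := fun q => (z.1 ^ (-idx q.out.1).val).onD q.out.1
  have hrep : ∀ q, z.1.onD (rep q) ≠ rep q := fun q h => q.out.2 ((onD_moved hz' _).1 h)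
  have hrep0 : ∀ q, idx (rep q) = 0 := fun q => by
    rw [hpowD _ _ q.out.2, add_neg_cancel]
  have hback : ∀ q (x : ZMod p), (z.1 ^ x.val).onD q.out.1 =
      (z.1 ^ (x + idx q.out.1).val).onD (rep q) := by
    intro q x
    rw [← onD_pow_add hz']
    congr 4
    ring
  have hcardQ : Nat.card Q ≤ m := by
    let F : Q × ZMod p × Bool → {d // z.1.onD d ≠ d} := fun t =>
      ⟨bif t.2.2 then G.inv ((z.1 ^ t.2.1.val).onD (rep t.1)) else (z.1 ^ t.2.1.val).onD (rep t.1), by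
        have h1 : z.1.onD ((z.1 ^ t.2.1.val).onD (rep t.1)) ≠ (z.1 ^ t.2.1.val).onD (rep t.1) :=
          fun h => hrep _ ((onD_moved hz' _).1 h)
        rcases t with ⟨q, x, b⟩
        cases b
        · exact h1
        · intro h
          simp only [cond_true] at h
          rw [z.1.onD_inv] at h
          have := congrArg G.inv h
          rw [G.inv_inv, G.inv_inv] at this
          exact h1 this⟩
    have hF : Function.Injective F := by
      rintro ⟨q, x, b⟩ ⟨q', x', b'⟩ h
      have h := congrArg Subtype.val h
      have hq : ∀ (q : Q) (x : ZMod p) (b : Bool), Quotient.mk _ (F ⟨q, x, b⟩) = q := by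
        intro q x b
        conv_rhs => rw [← q.out_eq]
        refine Quotient.sound ((edgeSetoid hz').symm ⟨x - idx q.out.1, ?_⟩)
        cases b
        · left
          rw [hback, sub_add_cancel]
          rfl
        · right
          rw [hback, sub_add_cancel]
          rfl
      obtain rfl : q = q' := by
        rw [← hq q x b, ← hq q' x' b']
        exact congrArg _ (Subtype.ext h)
      have key : ∀ x y : ZMod p, (z.1 ^ x.val).onD (rep q) ≠ G.inv ((z.1 ^ y.val).onD (rep q)) := by
        intro x y h
        apply onD_pow_ne_inv h2 hz' (x - y) ((z.1 ^ y.val).onD (rep q))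
        rw [← onD_pow_add hz', sub_add_cancel, h]
      cases b <;> cases b'
      · rw [onD_pow_ne (x := x) (y := x') hz' (hrep q) h]
      · exact absurd h (key _ _)
      · exact absurd h.symm (key _ _)
      · have h := congrArg G.inv h
        simp only [F, cond_true, G.inv_inv] at h
        rw [onD_pow_ne (x := x) (y := x') hz' (hrep q) h]
    have h3 := Nat.card_le_card_of_injective F hF
    rw [Nat.card_prod, Nat.card_prod, Nat.card_zmod, Nat.card_eq_fintype_card (α := Bool),
      Fintype.card_bool] at h3
    refine Nat.le_of_mul_le_mul_right (c := p * 2) (h3.trans (hm.trans (le_of_eq (by ring))))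
      (by have := hp.pos; omega)
  let e : Fin (Nat.card Q) ≃ Q := (Finite.equivFin Q).symm
  refine isZero_of_orbits h2 ((Iso.permD G).comp S.subtype)
    (hG.permD_injective.comp Subtype.val_injective) G.inv (fun s d => s.1.onD_inv d) (z := z) hz
    (m := Nat.card Q) (fun l => rep (e l)) (fun l => hrep _) ?_ Nat.card_pos (g := ⟨g, hgS⟩) hr0 hr
    (Subtype.ext hgz) ?_ ?_ P hP hPo (fun j hj hj' => hn j hj (by omega))
  · intro d hd
    obtain ⟨x, hx⟩ := Quotient.mk_out (s := edgeSetoid (p := p) hz') ⟨d, hd⟩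
    refine ⟨e.symm (Quotient.mk _ ⟨d, hd⟩), x + idx (Quotient.mk (edgeSetoid hz') ⟨d, hd⟩).out.1, ?_⟩
    rw [hback] at hx
    rw [Equiv.apply_symm_apply]
    exact hx
  · intro l
    change g.onD (rep (e l)) = rep (e l)
    rw [hg, hrep0, mul_zero, pow_val_zero']
    rfl
  · intro d hd
    change g.onD d = d
    rw [hg]
    exact z.1.pow_onD d hd _

end PGraph

end Auter

namespace Auter

/-! ### Recognition of the graphs `Υ` -/

namespace PGraph

variable {G : PGraph} {p : ℕ} [Fact p.Prime]

/-- A graph is simple if its directed edges are determined by their ends. -/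
def IsSimple (M : PGraph) : Prop :=
  ∀ d d' : M.D, M.src d = M.src d' → M.src (M.inv d) = M.src (M.inv d') → d = d'

/-- A map from a simple graph which is bijective on vertices is an isomorphism if the numbers of
edges agree. -/
theorem exists_iso_of_isSimple {M : PGraph} (hM : M.IsSimple) [Finite G.D] (fV : M.V → G.V)
    (hV : Function.Bijective fV) (fD : M.D → G.D) (hsrc : ∀ d, G.src (fD d) = fV (M.src d))
    (hinv : ∀ d, fD (M.inv d) = G.inv (fD d)) (hbase : fV M.base = G.base)
    (hcard : Nat.card G.D = Nat.card M.D) : ∃ i : Iso M G, ∀ d, i.onD d = fD d := by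
  have hinj : Function.Injective fD := fun d d' h => hM d d'
    (hV.1 (by rw [← hsrc, ← hsrc, h])) (hV.1 (by rw [← hsrc, ← hsrc, hinv, hinv, h]))
  have hbij : Function.Bijective fD := by
    have : Finite M.D := Finite.of_injective fD hinj
    have := Fintype.ofFinite M.D
    have := Fintype.ofFinite G.D
    rw [Fintype.bijective_iff_injective_and_card]
    exact ⟨hinj, by rw [← Nat.card_eq_fintype_card, ← Nat.card_eq_fintype_card, hcard]⟩
  exact ⟨⟨Equiv.ofBijective fV hV, Equiv.ofBijective fD hbij, hsrc, hinv, hbase⟩, fun d => rfl⟩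

theorem two_ne_zero_zmod (h2 : p ≠ 2) : (2 : ZMod p) ≠ 0 := by
  intro h
  have h5 : ((2 : ℕ) : ZMod p) = 0 := by exact_mod_cast h
  rw [ZMod.natCast_eq_zero_iff] at h5
  exact h2 ((Nat.prime_dvd_prime_iff_eq Fact.out Nat.prime_two).1 h5)

theorem add_one_ne (i : ZMod p) : i + 1 ≠ i := fun h => one_ne_zero (left_eq_add.1 h.symm)

theorem add_one_add_one_ne (h2 : p ≠ 2) (i : ZMod p) : i + 1 + 1 ≠ i := by
  intro h
  have h3 : (2 : ZMod p) = 0 := by linear_combination h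
  exact two_ne_zero_zmod h2 h3

theorem isSimple_upsilon (h2 : p ≠ 2) : (Upsilon p).IsSimple := by
  rintro ⟨⟨k, i⟩, b⟩ ⟨⟨k', i'⟩, b'⟩ h h'
  cases k <;> cases k' <;> cases b <;> cases b' <;>
    simp [Upsilon, ofEdges] at h h' ⊢
  all_goals first
    | exact h
    | exact h'
    | (subst h; exact absurd h' (add_one_add_one_ne h2 _))
    | (subst h'; exact absurd h (add_one_add_one_ne h2 _))

theorem isSimple_upsilonOne (h2 : p ≠ 2) : (UpsilonOne p).IsSimple := by
  rintro ⟨⟨k, i⟩, b⟩ ⟨⟨k', i'⟩, b'⟩ h h'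
  cases k <;> cases k' <;> cases b <;> cases b' <;>
    simp [UpsilonOne, ofEdges] at h h' ⊢
  all_goals first
    | exact h
    | exact h'
    | (subst h; exact absurd h' (add_one_add_one_ne h2 _))
    | (subst h'; exact absurd h (add_one_add_one_ne h2 _))

theorem isSimple_upsilonTwo : (UpsilonTwo p).IsSimple := by
  rintro ⟨⟨k, i⟩, b⟩ ⟨⟨k', i'⟩, b'⟩ h h'
  cases k <;> cases k' <;> cases b <;> cases b' <;>
    simp [UpsilonTwo, ofEdges] at h h' ⊢
  all_goals first
    | exact h
    | exact h'
    | (subst h; exact absurd h' (add_one_ne _))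
    | (subst h'; exact absurd h (add_one_ne _))

instance : Fintype UpsilonEdge :=
  ⟨⟨↑([.rim, .left, .right] : List UpsilonEdge), by simp⟩, fun x => by cases x <;> simp⟩

instance : Fintype UpsilonOneEdge :=
  ⟨⟨↑([.rim, .stem, .left, .right] : List UpsilonOneEdge), by simp⟩, fun x => by cases x <;> simp⟩

instance : Fintype UpsilonTwoEdge :=
  ⟨⟨↑([.rimA, .rimB, .left, .right] : List UpsilonTwoEdge), by simp⟩, fun x => by cases x <;> simp⟩

theorem card_upsilon : Nat.card (Upsilon p).D = 6 * p := by
  change Nat.card ((UpsilonEdge × ZMod p) × Bool) = _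
  rw [Nat.card_prod, Nat.card_prod, Nat.card_zmod, Nat.card_eq_fintype_card,
    Nat.card_eq_fintype_card, Fintype.card_bool, show Fintype.card UpsilonEdge = 3 from rfl]
  ring

theorem card_upsilonOne : Nat.card (UpsilonOne p).D = 8 * p := by
  change Nat.card ((UpsilonOneEdge × ZMod p) × Bool) = _
  rw [Nat.card_prod, Nat.card_prod, Nat.card_zmod, Nat.card_eq_fintype_card,
    Nat.card_eq_fintype_card, Fintype.card_bool, show Fintype.card UpsilonOneEdge = 4 from rfl]
  ring

theorem card_upsilonTwo : Nat.card (UpsilonTwo p).D = 8 * p := by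
  change Nat.card ((UpsilonTwoEdge × ZMod p) × Bool) = _
  rw [Nat.card_prod, Nat.card_prod, Nat.card_zmod, Nat.card_eq_fintype_card,
    Nat.card_eq_fintype_card, Fintype.card_bool, show Fintype.card UpsilonTwoEdge = 4 from rfl]
  ring

section Recognition

variable {y : Iso G G}

/-- The directed edges obtained by rotating given ones. -/
def rotated {K : Type} (y : Iso G G) (δ : K → G.D) (d : (K × ZMod p) × Bool) : G.D :=
  bif d.2 then G.inv ((y ^ d.1.2.val).onD (δ d.1.1)) else (y ^ d.1.2.val).onD (δ d.1.1)

theorem rotated_inv {K : Type} (δ : K → G.D) (d : (K × ZMod p) × Bool) :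
    rotated y δ (d.1, !d.2) = G.inv (rotated y δ d) := by
  rcases d with ⟨d, b⟩
  cases b
  · rfl
  · exact (G.inv_inv _).symm

theorem rotated_succ {K : Type} (hy : y ^ p = 1) (δ : K → G.D) (k : K) (j : ZMod p) (b : Bool) :
    rotated y δ ((k, j + 1), b) = y.onD (rotated y δ ((k, j), b)) := by
  have h : (y ^ (j + 1).val).onD (δ k) = y.onD ((y ^ j.val).onD (δ k)) := by
    rw [add_comm, onD_pow_add hy, pow_val_one hy]
  cases b
  · exact h
  · change G.inv ((y ^ (j + 1).val).onD (δ k)) = y.onD (G.inv ((y ^ j.val).onD (δ k)))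
    rw [h, y.onD_inv]

/-- A graph with the right number of edges is isomorphic to a simple model with edges `K × ZMod p`
if the rotations of suitable edges, one for each class in `K`, have the right ends. -/
theorem exists_iso_rotated {K V : Type} {s t : K × ZMod p → V} {base : V}
    (hM : (ofEdges V (K × ZMod p) s t base).IsSimple) [Finite G.D] (hy : y ^ p = 1) (fV : V → G.V)
    (hV : Function.Bijective fV) (hbase : fV base = G.base) (δ : K → G.D)
    (hs : ∀ k j, (y ^ j.val).onV (G.src (δ k)) = fV (s (k, j)))
    (ht : ∀ k j, (y ^ j.val).onV (G.src (G.inv (δ k))) = fV (t (k, j)))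
    (hcard : Nat.card G.D = Nat.card (ofEdges V (K × ZMod p) s t base).D) :
    ∃ i : Iso (ofEdges V (K × ZMod p) s t base) G,
      ∀ k j b, i.onD ((k, j + 1), b) = y.onD (i.onD ((k, j), b)) := by
  obtain ⟨i, hi⟩ := exists_iso_of_isSimple hM fV hV (rotated y δ) (by
    rintro ⟨⟨k, j⟩, b⟩
    cases b
    · exact ((y ^ j.val).src_onD _).trans (hs k j)
    · change G.src (G.inv ((y ^ j.val).onD (δ k))) = fV (t (k, j))
      rw [← Iso.onD_inv, Iso.src_onD, ht]) (fun d => rotated_inv δ d) hbase hcard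
  exact ⟨i, fun k j b =>
    (hi _).trans ((rotated_succ hy δ k j b).trans (congrArg y.onD (hi _).symm))⟩

theorem exists_iso_upsilon [Finite G.D] (h2 : p ≠ 2) (hy : y ^ p = 1) {x b : G.V}
    (hx : y.onV x ≠ x) (hb : y.onV b = b) (hbb : b ≠ G.base) {r e e' : G.D}
    (hr : G.src r = x) (hr' : G.src (G.inv r) = y.onV x)
    (he : G.src e = x) (he' : G.src (G.inv e) = G.base)
    (hf : G.src e' = x) (hf' : G.src (G.inv e') = b)
    (hcov : ∀ v, v = G.base ∨ v = b ∨ ∃ c : ZMod p, v = (y ^ c.val).onV x)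
    (hcard : Nat.card G.D = 6 * p) :
    ∃ i : Iso (Upsilon p) G, ∀ k j b, i.onD ((k, j + 1), b) = y.onD (i.onD ((k, j), b)) := by
  have hbase : y.onV G.base = G.base := y.onV_base
  have hfix : ∀ (c : ZMod p) v, y.onV v = v → v ≠ (y ^ c.val).onV x := by
    rintro c v hv rfl
    exact hx ((onV_moved hy c).1 hv)
  let fV : Bool ⊕ ZMod p → G.V := Sum.elim (fun b' => bif b' then b else G.base)
    fun j => (y ^ j.val).onV x
  refine exists_iso_rotated (isSimple_upsilon h2) hy fV ⟨?_, ?_⟩ rfl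
    (fun | .rim => r | .left => G.inv e | .right => G.inv e') ?_ ?_
    (hcard.trans card_upsilon.symm)
  · rintro (b₁ | j) (b₂ | j') h
    · cases b₁ <;> cases b₂ <;> simp [fV] at h ⊢
      · exact hbb h.symm
      · exact hbb h
    · cases b₁
      · exact absurd h (hfix j' _ hbase)
      · exact absurd h (hfix j' _ hb)
    · cases b₂
      · exact absurd h.symm (hfix j _ hbase)
      · exact absurd h.symm (hfix j _ hb)
    · rw [onV_pow_ne hy hx (show (y ^ j.val).onV x = (y ^ j'.val).onV x from h)]
  · intro v
    rcases hcov v with rfl | rfl | ⟨c, rfl⟩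
    · exact ⟨Sum.inl false, rfl⟩
    · exact ⟨Sum.inl true, rfl⟩
    · exact ⟨Sum.inr c, rfl⟩
  · rintro (_ | _ | _) j
    · simp only [hr]; rfl
    · simp only [he']; exact y.pow_onV _ hbase _
    · simp only [hf']; exact y.pow_onV _ hb _
  · rintro (_ | _ | _) j
    · simp only [hr']
      exact (DFunLike.congr_fun (congrArg Iso.onV (pow_val_succ hy j)) x).symm
    · simp only [G.inv_inv, he]; rfl
    · simp only [G.inv_inv, hf]; rfl

theorem bijective_two_orbits (hy : y ^ p = 1) {x w b : G.V}
    (hx : y.onV x ≠ x) (hw : y.onV w ≠ w) (hxw : ∀ c : ZMod p, w ≠ (y ^ c.val).onV x)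
    (hb : y.onV b = b) (hbb : b ≠ G.base)
    (hcov : ∀ v, v = G.base ∨ v = b ∨ (∃ c : ZMod p, v = (y ^ c.val).onV x) ∨
      ∃ c : ZMod p, v = (y ^ c.val).onV w) :
    Function.Bijective (Sum.elim (fun b' => bif b' then b else G.base)
      (fun j => (y ^ j.2.val).onV (bif j.1 then w else x)) : Bool ⊕ (Bool × ZMod p) → G.V) := by
  have hbase : y.onV G.base = G.base := y.onV_base
  have hm : ∀ (b' : Bool), y.onV (bif b' then w else x) ≠ (bif b' then w else x) := by
    intro b'
    cases b'
    · exact hx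
    · exact hw
  have hfix : ∀ (j : Bool × ZMod p) v, y.onV v = v →
      v ≠ (y ^ j.2.val).onV (bif j.1 then w else x) := by
    rintro j v hv rfl
    exact hm _ ((onV_moved hy j.2).1 hv)
  have hne : ∀ c c' : ZMod p, (y ^ c.val).onV x ≠ (y ^ c'.val).onV w := by
    intro c c' h
    apply hxw (-c' + c)
    rw [onV_pow_add hy, h, ← onV_pow_add hy, neg_add_cancel, pow_val_zero']
    rfl
  constructor
  · rintro (b₁ | j) (b₂ | j') h
    · cases b₁ <;> cases b₂ <;> simp at h ⊢
      · exact hbb h.symm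
      · exact hbb h
    · cases b₁
      · exact absurd h (hfix j' _ hbase)
      · exact absurd h (hfix j' _ hb)
    · cases b₂
      · exact absurd h.symm (hfix j _ hbase)
      · exact absurd h.symm (hfix j _ hb)
    · rcases j with ⟨b₁, j⟩
      rcases j' with ⟨b₂, j'⟩
      cases b₁ <;> cases b₂
      · rw [onV_pow_ne hy hx (show (y ^ j.val).onV x = (y ^ j'.val).onV x from h)]
      · exact absurd h (hne _ _)
      · exact absurd h.symm (hne _ _)
      · rw [onV_pow_ne hy hw (show (y ^ j.val).onV w = (y ^ j'.val).onV w from h)]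
  · intro v
    rcases hcov v with rfl | rfl | ⟨c, rfl⟩ | ⟨c, rfl⟩
    · exact ⟨Sum.inl false, rfl⟩
    · exact ⟨Sum.inl true, rfl⟩
    · exact ⟨Sum.inr (false, c), rfl⟩
    · exact ⟨Sum.inr (true, c), rfl⟩

theorem exists_iso_upsilonOne [Finite G.D] (h2 : p ≠ 2) (hy : y ^ p = 1) {x w b : G.V}
    (hx : y.onV x ≠ x) (hw : y.onV w ≠ w) (hxw : ∀ c : ZMod p, w ≠ (y ^ c.val).onV x)
    (hb : y.onV b = b) (hbb : b ≠ G.base) {r e h h' : G.D}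
    (hr : G.src r = x) (hr' : G.src (G.inv r) = y.onV x)
    (he : G.src e = x) (he' : G.src (G.inv e) = w)
    (hh : G.src h = w) (hh' : G.src (G.inv h) = G.base)
    (hk : G.src h' = w) (hk' : G.src (G.inv h') = b)
    (hcov : ∀ v, v = G.base ∨ v = b ∨ (∃ c : ZMod p, v = (y ^ c.val).onV x) ∨
      ∃ c : ZMod p, v = (y ^ c.val).onV w)
    (hcard : Nat.card G.D = 8 * p) :
    ∃ i : Iso (UpsilonOne p) G, ∀ k j b, i.onD ((k, j + 1), b) = y.onD (i.onD ((k, j), b)) := by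
  refine exists_iso_rotated (isSimple_upsilonOne h2) hy _
    (bijective_two_orbits hy hx hw hxw hb hbb hcov) rfl
    (fun | .rim => r | .stem => e | .left => G.inv h | .right => G.inv h') ?_ ?_
    (hcard.trans card_upsilonOne.symm)
  · rintro (_ | _ | _ | _) j
    · simp only [hr]; rfl
    · simp only [he]; rfl
    · simp only [hh']; exact y.pow_onV _ y.onV_base _
    · simp only [hk']; exact y.pow_onV _ hb _
  · rintro (_ | _ | _ | _) j
    · simp only [hr']
      exact (DFunLike.congr_fun (congrArg Iso.onV (pow_val_succ hy j)) x).symm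
    · simp only [he']; rfl
    · simp only [G.inv_inv, hh]; rfl
    · simp only [G.inv_inv, hk]; rfl

theorem exists_iso_upsilonTwo [Finite G.D] (hy : y ^ p = 1) {x w b : G.V}
    (hx : y.onV x ≠ x) (hw : y.onV w ≠ w) (hxw : ∀ c : ZMod p, w ≠ (y ^ c.val).onV x)
    (hb : y.onV b = b) (hbb : b ≠ G.base) {r e h h' : G.D}
    (hr : G.src r = x) (hr' : G.src (G.inv r) = w)
    (he : G.src e = w) (he' : G.src (G.inv e) = y.onV x)
    (hh : G.src h = x) (hh' : G.src (G.inv h) = G.base)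
    (hk : G.src h' = w) (hk' : G.src (G.inv h') = b)
    (hcov : ∀ v, v = G.base ∨ v = b ∨ (∃ c : ZMod p, v = (y ^ c.val).onV x) ∨
      ∃ c : ZMod p, v = (y ^ c.val).onV w)
    (hcard : Nat.card G.D = 8 * p) :
    ∃ i : Iso (UpsilonTwo p) G, ∀ k j b, i.onD ((k, j + 1), b) = y.onD (i.onD ((k, j), b)) := by
  refine exists_iso_rotated isSimple_upsilonTwo hy _
    (bijective_two_orbits hy hx hw hxw hb hbb hcov) rfl
    (fun | .rimA => r | .rimB => e | .left => G.inv h | .right => G.inv h') ?_ ?_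
    (hcard.trans card_upsilonTwo.symm)
  · rintro (_ | _ | _ | _) j
    · simp only [hr]; rfl
    · simp only [he]; rfl
    · simp only [hh']; exact y.pow_onV _ y.onV_base _
    · simp only [hk']; exact y.pow_onV _ hb _
  · rintro (_ | _ | _ | _) j
    · simp only [hr']; rfl
    · simp only [he']
      exact (DFunLike.congr_fun (congrArg Iso.onV (pow_val_succ hy j)) x).symm
    · simp only [G.inv_inv, hh]; rfl
    · simp only [G.inv_inv, hk]; rfl

end Recognition

end PGraph

end Auter

namespace Auter

/-! ### Edges at moved vertices -/

namespace PGraph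

variable {G : PGraph} {p : ℕ} [Fact p.Prime] {z : Iso G G}

/-- The reverse of a directed edge that ends at a vertex `z ^ c • v`, rotated to start at `v`. -/
def star (z : Iso G G) (c : ZMod p) (d : G.D) : G.D := (z ^ (-c).val).onD (G.inv d)

theorem src_star (hz : z ^ p = 1) {c : ZMod p} {d : G.D} {v : G.V}
    (h : G.src (G.inv d) = (z ^ c.val).onV v) : G.src (star z c d) = v := by
  rw [star, Iso.src_onD, h, ← onV_pow_add hz, neg_add_cancel, pow_val_zero']
  rfl

theorem src_inv_star (c : ZMod p) (d : G.D) :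
    G.src (G.inv (star z c d)) = (z ^ (-c).val).onV (G.src d) := by
  rw [star, ← Iso.onD_inv, G.inv_inv, Iso.src_onD]

theorem star_ne (h2 : p ≠ 2) (hz : z ^ p = 1) (c : ZMod p) (d : G.D) : star z c d ≠ d := by
  have := onD_pow_ne_inv h2 hz (-c) (G.inv d)
  rwa [G.inv_inv] at this

theorem star_star (hz : z ^ p = 1) (c : ZMod p) (d : G.D) : star z (-c) (star z c d) = d := by
  rw [star, star, ← Iso.onD_inv, G.inv_inv, ← onD_pow_add hz, neg_neg, add_neg_cancel,
    pow_val_zero']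
  rfl

/-- Rotated reverses of different edges at a moved vertex are different. -/
theorem star_inj (hz : z ^ p = 1) {x : G.V} (hx : z.onV x ≠ x) {c c' : ZMod p} {d d' : G.D}
    (hd : G.src d = x) (hd' : G.src d' = x) (h : star z c d = star z c' d') : d = d' := by
  have h1 := congrArg (fun e => G.src (G.inv e)) h
  simp only [src_inv_star, hd, hd'] at h1
  have h3 : c = c' := neg_injective (onV_pow_ne hz hx h1)
  rw [← star_star hz c d, h, h3, star_star hz]

/-- No nonempty set of orbits of moved vertices is closed under passing to neighbours: the graph is
connected, and the basepoint is fixed. -/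
theorem Admissible.false_of_closed (hG : G.Admissible) (hz : z ^ p = 1) (X : G.V → Prop)
    (hX : ∀ x, X x → z.onV x ≠ x)
    (hXd : ∀ d, X (G.src d) → ∃ (c : ZMod p) (y : G.V), X y ∧ G.src (G.inv d) = (z ^ c.val).onV y)
    {x : G.V} (hx : X x) : False := by
  have key : ∀ (w : List G.D) (u v : G.V), G.IsWalk u w v →
      (∃ (c : ZMod p) (y : G.V), X y ∧ u = (z ^ c.val).onV y) →
      ∃ (c : ZMod p) (y : G.V), X y ∧ v = (z ^ c.val).onV y := by
    intro w
    induction w with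
    | nil =>
      intro u v h hu
      rwa [← (show u = v from h)]
    | cons d w ih =>
      rintro u v ⟨rfl, h⟩ ⟨c, y, hy, hc⟩
      refine ih _ v h ?_
      have h1 : G.src ((z ^ (-c).val).onD d) = y := by
        rw [Iso.src_onD, hc, ← onV_pow_add hz, neg_add_cancel, pow_val_zero']
        rfl
      obtain ⟨k, y', hy', hk⟩ := hXd ((z ^ (-c).val).onD d) (by rwa [h1])
      refine ⟨c + k, y', hy', ?_⟩
      rw [onV_pow_add hz, ← hk, ← Iso.onD_inv, Iso.src_onD, ← onV_pow_add hz, add_neg_cancel,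
        pow_val_zero']
      rfl
  obtain ⟨w, hw⟩ := hG.connected' x G.base
  obtain ⟨c, y, hy, h⟩ := key w _ _ hw ⟨0, x, hx, by rw [pow_val_zero']; rfl⟩
  have h1 : z.onV G.base = G.base := z.onV_base
  rw [h, onV_moved hz] at h1
  exact hX y hy h1

/-- The last edge at a vertex of valence three. -/
theorem exists_third [Finite G.D] {x : G.V} (h : G.valence x = 3) {d d' : G.D} (hd : G.src d = x)
    (hd' : G.src d' = x) (hne : d ≠ d') :
    ∃ e, G.src e = x ∧ e ≠ d ∧ e ≠ d' ∧ ∀ f, G.src f = x → f = d ∨ f = d' ∨ f = e := by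
  classical
  have := Fintype.ofFinite G.D
  rw [valence, Nat.card_eq_fintype_card, Fintype.card_subtype] at h
  have h1 : ((((Finset.univ.filter fun f => G.src f = x)).erase d).erase d').card = 1 := by
    rw [Finset.card_erase_of_mem, Finset.card_erase_of_mem, h]
    · simpa using hd
    · simpa [hd'] using hne.symm
  obtain ⟨e, he⟩ := Finset.card_eq_one.1 h1
  have hmem : ∀ f, f ∈ ((((Finset.univ.filter fun f => G.src f = x)).erase d).erase d') ↔ f = e :=
    fun f => by rw [he, Finset.mem_singleton]
  simp only [Finset.mem_erase, Finset.mem_filter, Finset.mem_univ, true_and] at hmem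
  have he' := (hmem e).2 rfl
  refine ⟨e, he'.2.2, he'.2.1, he'.1, fun f hf => ?_⟩
  by_cases h2 : f = d
  · exact Or.inl h2
  by_cases h3 : f = d'
  · exact Or.inr (Or.inl h3)
  · exact Or.inr (Or.inr ((hmem f).1 ⟨h3, h2, hf⟩))

/-- The last two edges at a vertex of valence four. -/
theorem exists_third_fourth [Finite G.D] {x : G.V} (h : G.valence x = 4) {d d' : G.D}
    (hd : G.src d = x) (hd' : G.src d' = x) (hne : d ≠ d') :
    ∃ e e', G.src e = x ∧ G.src e' = x ∧ e ≠ e' ∧ e ≠ d ∧ e ≠ d' ∧ e' ≠ d ∧ e' ≠ d' ∧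
      ∀ f, G.src f = x → f = d ∨ f = d' ∨ f = e ∨ f = e' := by
  classical
  have := Fintype.ofFinite G.D
  rw [valence, Nat.card_eq_fintype_card, Fintype.card_subtype] at h
  have h1 : ((((Finset.univ.filter fun f => G.src f = x)).erase d).erase d').card = 2 := by
    rw [Finset.card_erase_of_mem, Finset.card_erase_of_mem, h]
    · simpa using hd
    · simpa [hd'] using hne.symm
  obtain ⟨e, e', hee, he⟩ := Finset.card_eq_two.1 h1
  have hmem : ∀ f, f ∈ ((((Finset.univ.filter fun f => G.src f = x)).erase d).erase d') ↔
      f = e ∨ f = e' := fun f => by rw [he, Finset.mem_insert, Finset.mem_singleton]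
  simp only [Finset.mem_erase, Finset.mem_filter, Finset.mem_univ, true_and] at hmem
  have he1 := (hmem e).2 (Or.inl rfl)
  have he2 := (hmem e').2 (Or.inr rfl)
  refine ⟨e, e', he1.2.2, he2.2.2, hee, he1.2.1, he1.1, he2.2.1, he2.1, fun f hf => ?_⟩
  by_cases h2 : f = d
  · exact Or.inl h2
  by_cases h3 : f = d'
  · exact Or.inr (Or.inl h3)
  · exact Or.inr (Or.inr ((hmem f).1 ⟨h3, h2, hf⟩))

/-- The rotated reverse of an edge between vertices of one orbit is different from the edges of the
rim. -/
theorem star_ne_rim (hz : z ^ p = 1) {x : G.V} (hx : z.onV x ≠ x) {t c : ZMod p} {r e : G.D}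
    (hr : G.src r = x) (hr' : G.src (G.inv r) = (z ^ t.val).onV x) (he : G.src e = x)
    (h1 : e ≠ r) (h3 : e ≠ star z t r) : star z c e ≠ r ∧ star z c e ≠ star z t r := by
  constructor
  · intro h
    have h4 : (z ^ (-c).val).onV x = (z ^ t.val).onV x := by
      rw [← hr', ← h, src_inv_star, he]
    have h5 := onV_pow_ne hz hx h4
    apply h3
    rw [← h, ← h5, star_star hz]
  · exact fun h => h1 (star_inj hz hx he hr h)

section Counting

variable [Fintype G.D] [Fintype G.V]

open Classical in
/-- If two orbits of edges join moved vertices to fixed vertices, no other edges are attached to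
fixed vertices, and the fixed graph has Euler characteristic `2`, then it consists of the ends of
these edges. -/
theorem Admissible.fixed_vertices (hG : G.Admissible) (hz : z ^ p = 1)
    (hA : (Finset.univ.filter fun d => Moves (Subgroup.zpowers z) d ∧
        ¬ MovesV (Subgroup.zpowers z) (G.src d)).card = p * 2)
    (ht : (Finset.univ.filter fun v => Attaching (Subgroup.zpowers z) v).card ≤ 2)
    (ht' : 2 ≤ (Finset.univ.filter fun v => Attaching (Subgroup.zpowers z) v).card)
    (hχ : 2 * (Finset.univ.filter fun v => ¬ MovesV (Subgroup.zpowers z) v).card =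
          (Finset.univ.filter fun d => ¬ Moves (Subgroup.zpowers z) d).card + 4)
    {h₁ h₂ : G.D} (m₁ : z.onV (G.src h₁) ≠ G.src h₁) (m₂ : z.onV (G.src h₂) ≠ G.src h₂)
    (f₁ : z.onV (G.src (G.inv h₁)) = G.src (G.inv h₁))
    (f₂ : z.onV (G.src (G.inv h₂)) = G.src (G.inv h₂))
    (hne : ∀ c : ZMod p, (z ^ c.val).onD h₁ ≠ h₂) :
    G.src (G.inv h₁) ≠ G.src (G.inv h₂) ∧
      (∀ v, z.onV v = v → v = G.src (G.inv h₁) ∨ v = G.src (G.inv h₂)) ∧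
      ∀ d, z.onD d ≠ d := by
  set Q := Subgroup.zpowers z with hQ
  have hmd : ∀ {d}, z.onV (G.src d) ≠ G.src d → z.onD d ≠ d := fun h h' =>
    h (by rw [← z.src_onD, h'])
  have hinv : ∀ {d}, z.onD d ≠ d → z.onD (G.inv d) ≠ G.inv d := fun {d} h => by
    have := (moves_inv (P := Q) (d := d)).2 (moves_zpowers_iff.2 h)
    exact moves_zpowers_iff.1 this
  -- the moved edges at fixed vertices are the translates of the reverses of the two given edges
  let F : ZMod p × Bool → G.D := fun t => G.inv ((z ^ t.1.val).onD (bif t.2 then h₂ else h₁))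
  have hF : Function.Injective F := by
    rintro ⟨c, b⟩ ⟨c', b'⟩ h
    have h' : (z ^ c.val).onD (bif b then h₂ else h₁) = (z ^ c'.val).onD (bif b' then h₂ else h₁) := by
      have := congrArg G.inv h
      simpa only [F, G.inv_inv] using this
    have key : ∀ c c' : ZMod p, (z ^ c.val).onD h₁ ≠ (z ^ c'.val).onD h₂ := by
      intro c c' h
      apply hne (-c' + c)
      rw [onD_pow_add hz, h, onD_pow_cancel hz]
    cases b <;> cases b'
    · rw [onD_pow_ne hz (hmd m₁) h']
    · exact absurd h' (key _ _)
    · exact absurd h'.symm (key _ _)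
    · rw [onD_pow_ne hz (hmd m₂) h']
  have hFsrc : ∀ t, G.src (F t) = G.src (G.inv (bif t.2 then h₂ else h₁)) := by
    rintro ⟨c, b⟩
    change G.src (G.inv ((z ^ c.val).onD _)) = _
    rw [← Iso.onD_inv, Iso.src_onD]
    cases b
    · exact z.pow_onV _ f₁ _
    · exact z.pow_onV _ f₂ _
  have himg : (Finset.univ.image F) = Finset.univ.filter fun d => Moves Q d ∧
      ¬ MovesV Q (G.src d) := by
    apply Finset.eq_of_subset_of_card_le
    · intro d hd
      obtain ⟨⟨c, b⟩, -, rfl⟩ := Finset.mem_image.1 hd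
      simp only [Finset.mem_filter, Finset.mem_univ, true_and, hFsrc]
      rw [movesV_zpowers_iff, not_not, moves_zpowers_iff]
      constructor
      · apply hinv
        rw [ne_eq, onD_moved hz]
        cases b
        · exact hmd m₁
        · exact hmd m₂
      · cases b
        · exact f₁
        · exact f₂
    · rw [hA, Finset.card_image_of_injective _ hF, Finset.card_univ, Fintype.card_prod, ZMod.card,
        Fintype.card_bool]
  have hatt : ∀ v, Attaching Q v → v = G.src (G.inv h₁) ∨ v = G.src (G.inv h₂) := by
    rintro v ⟨hv, d, rfl, hd⟩
    have h3 : d ∈ Finset.univ.image F := by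
      rw [himg]
      simpa using ⟨hd, hv⟩
    obtain ⟨⟨c, b⟩, -, rfl⟩ := Finset.mem_image.1 h3
    rw [hFsrc]
    cases b
    · exact Or.inl rfl
    · exact Or.inr rfl
  have hd₁ : ∃ d, Moves Q d := ⟨h₁, moves_zpowers_iff.2 (hmd m₁)⟩
  -- equality in the estimate of the Euler characteristic
  have hfix : ∀ d, Attaching Q (G.src d) → Moves Q d := by
    have h3 : ∑ v ∈ Finset.univ.filter (fun v => ¬ MovesV Q v), (if Attaching Q v then 2 else 0) =
        4 := by
      rw [← Finset.sum_filter, Finset.sum_const, smul_eq_mul, Finset.filter_filter]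
      have h4 : (Finset.univ.filter fun v => ¬ MovesV Q v ∧ Attaching Q v) =
          Finset.univ.filter fun v => Attaching Q v := by
        ext v
        simp only [Finset.mem_filter, Finset.mem_univ, true_and, and_iff_right_iff_imp]
        exact fun h => h.1
      rw [h4]
      omega
    have h4 := (Finset.sum_eq_sum_iff_of_le (s := Finset.univ.filter fun v => ¬ MovesV Q v)
      (f := fun _ => 2) (g := fun v => (Finset.univ.filter fun d => ¬ Moves Q d ∧ G.src d = v).card +
      if Attaching Q v then 2 else 0) fun v hv =>
        hG.two_le hd₁ (Finset.mem_filter.1 hv).2).1 (by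
          rw [Finset.sum_add_distrib, h3, (counts (P := Q)).2, Finset.sum_const, smul_eq_mul]
          omega)
    intro d hd
    have h5 := h4 (G.src d) (by simpa using hd.1)
    rw [if_pos hd] at h5
    by_contra hn
    have h6 : 0 < (Finset.univ.filter fun d' => ¬ Moves Q d' ∧ G.src d' = G.src d).card :=
      Finset.card_pos.2 ⟨d, by simpa using hn⟩
    omega
  obtain ⟨h3, h4⟩ := hG.all_attaching hd₁ hfix
  refine ⟨fun h => ?_, fun v hv => hatt v (h3 v fun h => movesV_zpowers_iff.1 h hv),
    fun d => moves_zpowers_iff.1 (h4 d)⟩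
  have h5 : (Finset.univ.filter fun v => Attaching Q v) ⊆ {G.src (G.inv h₁)} := by
    intro v hv
    rw [Finset.mem_singleton]
    rcases hatt v (Finset.mem_filter.1 hv).2 with h' | h'
    · exact h'
    · exact h'.trans h.symm
  have := Finset.card_le_card h5
  rw [Finset.card_singleton] at this
  omega

open Classical in
/-- If only `p` vertices are moved, they form one orbit. -/
theorem cover_one (hz : z ^ p = 1)
    (hV : (Finset.univ.filter fun v => MovesV (Subgroup.zpowers z) v).card = p) {x : G.V}
    (hx : z.onV x ≠ x) {v : G.V} (hv : z.onV v ≠ v) : ∃ c : ZMod p, v = (z ^ c.val).onV x := by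
  have himg : (Finset.univ.image fun c : ZMod p => (z ^ c.val).onV x) =
      Finset.univ.filter fun v => MovesV (Subgroup.zpowers z) v := by
    apply Finset.eq_of_subset_of_card_le
    · intro d hd
      obtain ⟨c, -, rfl⟩ := Finset.mem_image.1 hd
      simp only [Finset.mem_filter, Finset.mem_univ, true_and]
      rw [movesV_zpowers_iff, ne_eq, onV_moved hz]
      exact hx
    · rw [hV, Finset.card_image_of_injective _ fun a b h => onV_pow_ne hz hx h, Finset.card_univ,
        ZMod.card]
  have h1 : v ∈ Finset.univ.filter fun v => MovesV (Subgroup.zpowers z) v := by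
    simpa [movesV_zpowers_iff] using hv
  rw [← himg] at h1
  obtain ⟨c, -, h⟩ := Finset.mem_image.1 h1
  exact ⟨c, h.symm⟩

open Classical in
/-- If only `2 * p` vertices are moved, they form two orbits. -/
theorem cover_two (hz : z ^ p = 1)
    (hV : (Finset.univ.filter fun v => MovesV (Subgroup.zpowers z) v).card = p * 2) {x w : G.V}
    (hx : z.onV x ≠ x) (hw : z.onV w ≠ w) (hxw : ∀ c : ZMod p, w ≠ (z ^ c.val).onV x) {v : G.V}
    (hv : z.onV v ≠ v) :
    (∃ c : ZMod p, v = (z ^ c.val).onV x) ∨ ∃ c : ZMod p, v = (z ^ c.val).onV w := by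
  let F : ZMod p × Bool → G.V := fun t => (z ^ t.1.val).onV (bif t.2 then w else x)
  have hF : Function.Injective F := by
    have key : ∀ c c' : ZMod p, (z ^ c.val).onV x ≠ (z ^ c'.val).onV w := by
      intro c c' h
      apply hxw (-c' + c)
      rw [onV_pow_add hz, h, ← onV_pow_add hz, neg_add_cancel, pow_val_zero']
      rfl
    rintro ⟨c, b⟩ ⟨c', b'⟩ h
    cases b <;> cases b'
    · rw [onV_pow_ne (x := c) (y := c') hz hx h]
    · exact absurd h (key _ _)
    · exact absurd h.symm (key _ _)
    · rw [onV_pow_ne (x := c) (y := c') hz hw h]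
  have himg : Finset.univ.image F =
      Finset.univ.filter fun v => MovesV (Subgroup.zpowers z) v := by
    apply Finset.eq_of_subset_of_card_le
    · intro d hd
      obtain ⟨⟨c, b⟩, -, rfl⟩ := Finset.mem_image.1 hd
      simp only [Finset.mem_filter, Finset.mem_univ, true_and]
      rw [movesV_zpowers_iff, ne_eq, onV_moved hz]
      cases b
      · exact hx
      · exact hw
    · rw [hV, Finset.card_image_of_injective _ hF, Finset.card_univ, Fintype.card_prod, ZMod.card,
        Fintype.card_bool]
  have h1 : v ∈ Finset.univ.filter fun v => MovesV (Subgroup.zpowers z) v := by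
    simpa [movesV_zpowers_iff] using hv
  rw [← himg] at h1
  obtain ⟨⟨c, b⟩, -, h⟩ := Finset.mem_image.1 h1
  cases b
  · exact Or.inl ⟨c, h.symm⟩
  · exact Or.inr ⟨c, h.symm⟩

open Classical in
theorem exists_second_orbit
    (hV : (Finset.univ.filter fun v => MovesV (Subgroup.zpowers z) v).card = p * 2) (x : G.V) :
    ∃ w, z.onV w ≠ w ∧ ∀ c : ZMod p, w ≠ (z ^ c.val).onV x := by
  have hp := (Fact.out : p.Prime).pos
  obtain ⟨w, hw, hw'⟩ := Finset.exists_mem_notMem_of_card_lt_card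
    (s := Finset.univ.image fun c : ZMod p => (z ^ c.val).onV x)
    (t := Finset.univ.filter fun v => MovesV (Subgroup.zpowers z) v) (by
      refine lt_of_le_of_lt Finset.card_image_le ?_
      rw [hV, Finset.card_univ, ZMod.card]
      omega)
  refine ⟨w, movesV_zpowers_iff.1 (Finset.mem_filter.1 hw).2, fun c h => hw' ?_⟩
  exact Finset.mem_image.2 ⟨c, Finset.mem_univ _, h.symm⟩

end Counting

end PGraph

end Auter

namespace Auter

/-! ### Graphs with a twisted rotation -/

namespace PGraph

variable {G : PGraph} {p : ℕ} [Fact p.Prime]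

/-- A rotated rim with vertices of valence three, joined by spokes to a fixed vertex. -/
structure IsWheel (y : Iso G G) (x : G.V) (r e : G.D) : Prop where
  moved : y.onV x ≠ x
  src_rim : G.src r = x
  tgt_rim : G.src (G.inv r) = y.onV x
  src_spoke : G.src e = x
  tgt_spoke : y.onV (G.src (G.inv e)) = G.src (G.inv e)
  valence : G.valence x = 3

/-- An index of the moved vertices that is compatible with the rotation and constant along edges
between moved vertices. -/
def IsUntwisted (p : ℕ) (z : Iso G G) : Prop :=
  ∃ f : G.V → ZMod p, (∀ v, z.onV v ≠ v → f (z.onV v) = f v + 1) ∧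
    ∀ d, z.onV (G.src d) ≠ G.src d → z.onV (G.src (G.inv d)) ≠ G.src (G.inv d) →
      f (G.src d) = f (G.src (G.inv d))

variable {z : Iso G G}

theorem onV_pow_pow (hz : z ^ p = 1) {t : ZMod p} (ht : t ≠ 0) (c : ZMod p) (v : G.V) :
    (z ^ c.val).onV v = ((z ^ t.val) ^ (t⁻¹ * c).val).onV v := by
  rw [← pow_val_mul hz, mul_inv_cancel_left₀ ht]

theorem pow_val_pow (hz : z ^ p = 1) (t : ZMod p) : (z ^ t.val) ^ p = 1 := by
  rw [← pow_mul, mul_comm, pow_mul, hz, one_pow]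

theorem pow_moved (hz : z ^ p = 1) {t : ZMod p} (ht : t ≠ 0) {v : G.V} (hv : z.onV v ≠ v) :
    (z ^ t.val).onV v ≠ v := by
  intro h
  exact ht (onV_pow_ne hz hv (by rw [h, pow_val_zero']; rfl))

theorem exists_other_two [Finite G.D] {x : G.V} (h : G.valence x = 3) {d : G.D} (hd : G.src d = x) :
    ∃ e e', G.src e = x ∧ G.src e' = x ∧ e ≠ d ∧ e' ≠ d ∧ e ≠ e' ∧
      ∀ f, G.src f = x → f = d ∨ f = e ∨ f = e' := by
  have h1 : ∃ e, G.src e = x ∧ e ≠ d := by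
    by_contra! h1
    have : Subsingleton {f : G.D // G.src f = x} :=
      ⟨fun a b => Subtype.ext ((h1 a a.2).trans (h1 b b.2).symm)⟩
    have := Finite.card_le_one_iff_subsingleton.2 this
    rw [valence] at h
    omega
  obtain ⟨e, he, hed⟩ := h1
  obtain ⟨e', he', h2, h3, h4⟩ := exists_third h hd he hed.symm
  exact ⟨e, e', he, he', hed, h2, h3.symm, h4⟩

/-- The third edge at a vertex of valence three on a rim leaves the rim. -/
theorem exists_spoke [Finite G.D] (h2 : p ≠ 2) (hz : z ^ p = 1) {x : G.V} (hx : z.onV x ≠ x)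
    (hval : G.valence x = 3) {t : ZMod p} {r : G.D} (hr : G.src r = x)
    (hr' : G.src (G.inv r) = (z ^ t.val).onV x) :
    ∃ e, G.src e = x ∧ (∀ f, G.src f = x → f = r ∨ f = star z t r ∨ f = e) ∧
      ∀ c : ZMod p, G.src (G.inv e) ≠ (z ^ c.val).onV x := by
  obtain ⟨e, he, h1, h3, h4⟩ := exists_third hval hr (src_star hz hr') (star_ne h2 hz t r).symm
  refine ⟨e, he, h4, fun c hc => ?_⟩
  obtain ⟨h5, h6⟩ := star_ne_rim (c := c) hz hx hr hr' he h1 h3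
  rcases h4 _ (src_star hz hc) with h | h | h
  · exact h5 h
  · exact h6 h
  · exact star_ne h2 hz c e h

section

variable [Fintype G.D] [Fintype G.V]

/-- Two orbits of moved vertices which are joined by edges with different shifts, and have valence
three, are both joined to fixed vertices. -/
theorem Admissible.exists_fixed_neighbour (hG : G.Admissible) (h2 : p ≠ 2) (hz : z ^ p = 1)
    {x w : G.V} (hx : z.onV x ≠ x) (hw : z.onV w ≠ w) (hxw : ∀ c : ZMod p, w ≠ (z ^ c.val).onV x)
    (hcov : ∀ v, z.onV v ≠ v →
      (∃ c : ZMod p, v = (z ^ c.val).onV x) ∨ ∃ c : ZMod p, v = (z ^ c.val).onV w)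
    (hvx : G.valence x = 3) (hvw : G.valence w = 3)
    (hrim : ∀ d (t : ZMod p), G.src d = x → G.src (G.inv d) = (z ^ t.val).onV x → t = 0)
    {d₀ d₁ : G.D} {s t : ZMod p} (hst : s ≠ t) (h₀ : G.src d₀ = x)
    (h₀' : G.src (G.inv d₀) = (z ^ s.val).onV w) (h₁ : G.src d₁ = x)
    (h₁' : G.src (G.inv d₁) = (z ^ t.val).onV w) :
    ∃ e, G.src e = x ∧ z.onV (G.src (G.inv e)) = G.src (G.inv e) := by
  have hne : d₀ ≠ d₁ := by
    rintro rfl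
    exact hst (onV_pow_ne hz hw (h₀'.symm.trans h₁'))
  have hwx : ∀ c c' : ZMod p, (z ^ c.val).onV w ≠ (z ^ c'.val).onV x := by
    intro c c' h
    apply hxw (-c + c')
    rw [onV_pow_add hz, ← h, ← onV_pow_add hz, neg_add_cancel, pow_val_zero']
    rfl
  obtain ⟨e, he, he0, he1, hall⟩ := exists_third hvx h₀ h₁ hne
  refine ⟨e, he, ?_⟩
  by_contra hm
  rcases hcov _ hm with ⟨c, hc⟩ | ⟨c, hc⟩
  · obtain rfl := hrim e c he hc
    rcases hall _ (src_star hz hc) with h | h | h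
    · apply hwx s (-0)
      rw [← h₀', ← h, src_inv_star, he]
    · apply hwx t (-0)
      rw [← h₁', ← h, src_inv_star, he]
    · exact star_ne h2 hz _ _ h
  · -- all three edges at `w` would lead back to the orbit of `x`
    have g0 := src_star hz h₀'
    have g1 := src_star hz h₁'
    have g2 := src_star hz hc
    obtain ⟨e', -, -, -, hall'⟩ := exists_third hvw g0 g1 fun h => hne (star_inj hz hx h₀ h₁ h)
    have h3 : star z c e = e' := by
      rcases hall' _ g2 with h | h | h
      · exact absurd (star_inj hz hx he h₀ h) he0
      · exact absurd (star_inj hz hx he h₁ h) he1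
      · exact h
    refine hG.false_of_closed hz (fun v => v = x ∨ v = w) (by rintro v (rfl | rfl) <;> assumption)
      (fun d hd => ?_) (Or.inl rfl)
    rcases hd with hd | hd
    · rcases hall d hd with rfl | rfl | rfl
      · exact ⟨s, w, Or.inr rfl, h₀'⟩
      · exact ⟨t, w, Or.inr rfl, h₁'⟩
      · exact ⟨c, w, Or.inr rfl, hc⟩
    · rcases hall' d hd with rfl | rfl | rfl
      · exact ⟨-s, x, Or.inl rfl, by rw [src_inv_star, h₀]⟩
      · exact ⟨-t, x, Or.inl rfl, by rw [src_inv_star, h₁]⟩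
      · exact ⟨-c, x, Or.inl rfl, by rw [← h3, src_inv_star, he]⟩

open Classical in
/-- A graph of rank `2 p - 1` with a twisted rotation contains a wheel, or is one of the three graphs
`Υ`. In the first three cases an edge joins some vertex `x` to `(z ^ t) x`; in the last case two edges
that start at `x` lead to vertices of another orbit which differ by `z ^ (± t)`. -/
theorem Admissible.classify (hG : G.Admissible) (h5 : 5 ≤ p)
    (hc : Nat.card G.D + 4 = 2 * Nat.card G.V + 4 * p) (hz : z ^ p = 1) (hz1 : z ≠ 1)
    (htw : ¬ IsUntwisted p z) :
    ∃ t : ZMod p, t ≠ 0 ∧ ((∃ x r e, IsWheel (z ^ t.val) x r e) ∨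
      (∃ i : Iso (Upsilon p) G,
        ∀ k j b, i.onD ((k, j + 1), b) = (z ^ t.val).onD (i.onD ((k, j), b))) ∨
      (∃ i : Iso (UpsilonOne p) G,
        ∀ k j b, i.onD ((k, j + 1), b) = (z ^ t.val).onD (i.onD ((k, j), b))) ∨
      ∃ i : Iso (UpsilonTwo p) G,
        ∀ k j b, i.onD ((k, j + 1), b) = (z ^ t.val).onD (i.onD ((k, j), b))) := by
  have hp := (Fact.out : p.Prime)
  have h2 : p ≠ 2 := by omega
  obtain ⟨E, V, s, hE, hV, hs, htl, hs1, hk⟩ := hG.orbit_numbers h5 hc hz hz1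
  have hcount := (counts (P := Subgroup.zpowers z)).1
  rw [hE, hs] at hcount
  have hval3 : ∀ v, z.onV v ≠ v → 3 ≤ G.valence v := fun v hv =>
    hG.three_le_valence v fun h => hv (by rw [h]; exact z.onV_base)
  have hDcard : (∀ d, z.onD d ≠ d) → Nat.card G.D = 2 * p * E := by
    intro h
    rw [Nat.card_eq_fintype_card, ← Finset.card_univ, ← hE]
    congr 1
    ext d
    simpa [moves_zpowers_iff] using h d
  -- the numbers of the fixed graph in the case of two attaching orbits
  have hfixed : s = 2 → E = V + 2 → ∀ {h₁ h₂ : G.D}, z.onV (G.src h₁) ≠ G.src h₁ →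
      z.onV (G.src h₂) ≠ G.src h₂ → z.onV (G.src (G.inv h₁)) = G.src (G.inv h₁) →
      z.onV (G.src (G.inv h₂)) = G.src (G.inv h₂) → (∀ c : ZMod p, (z ^ c.val).onD h₁ ≠ h₂) →
      G.src (G.inv h₁) ≠ G.src (G.inv h₂) ∧
      (∀ v, z.onV v = v → v = G.src (G.inv h₁) ∨ v = G.src (G.inv h₂)) ∧ ∀ d, z.onD d ≠ d := by
    intro hs2 hEV h₁ h₂ m₁ m₂ f₁ f₂ hne
    subst hs2
    rcases hk with ⟨-, -, h6, h7⟩ | ⟨h6, -, -⟩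
    · exact hG.fixed_vertices hz hs htl h6 h7 m₁ m₂ f₁ f₂ hne
    · omega
  have horb : ∀ {h₁ h₂ : G.D}, z.onV (G.src h₁) ≠ G.src h₁ → G.src h₁ = G.src h₂ → h₁ ≠ h₂ →
      ∀ c : ZMod p, (z ^ c.val).onD h₁ ≠ h₂ := by
    intro h₁ h₂ m₁ h hne c hc
    have h6 := congrArg G.src hc
    rw [Iso.src_onD, ← h] at h6
    have h7 : c = 0 := onV_pow_ne hz m₁ (by rw [h6, pow_val_zero']; rfl)
    rw [h7, pow_val_zero'] at hc
    exact hne hc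
  have htr : ∀ (d : G.D) (a b : ZMod p) (x w : G.V), G.src d = (z ^ a.val).onV x →
      G.src (G.inv d) = (z ^ b.val).onV w → G.src ((z ^ (-a).val).onD d) = x ∧
        G.src (G.inv ((z ^ (-a).val).onD d)) = (z ^ (-a + b).val).onV w := by
    intro d a b x w h h'
    constructor
    · rw [Iso.src_onD, h, ← onV_pow_add hz, neg_add_cancel, pow_val_zero']
      rfl
    · rw [← Iso.onD_inv, Iso.src_onD, h', onV_pow_add hz]
  have hpow1 : ∀ x, z.onV x = (z ^ (1 : ZMod p).val).onV x := fun x => by rw [pow_val_one hz]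
  have hself : ∀ x : G.V, x = (z ^ (0 : ZMod p).val).onV x := fun x => by rw [pow_val_zero']; rfl
  have hmoved : ∀ {x} (c : ZMod p), z.onV x ≠ x → z.onV ((z ^ c.val).onV x) ≠ (z ^ c.val).onV x :=
    fun c hx h => hx ((onV_moved hz c).1 h)
  have hfixpow : ∀ {v} (t : ZMod p), z.onV v = v → (z ^ t.val).onV v = v := fun t h => z.pow_onV _ h _
  -- two orbits of moved vertices leave no room for valence greater than three
  have htwo : V ≠ 0 → V ≠ 1 → V = 2 ∧ s = 2 ∧ E = 4 ∧ ∀ v, z.onV v ≠ v → G.valence v = 3 := by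
    intro h0 h1
    have hV2 : V = 2 ∧ s = 2 ∧ E = 4 := by omega
    obtain ⟨rfl, rfl, rfl⟩ := hV2
    refine ⟨rfl, rfl, rfl, fun v hv => ?_⟩
    have h6 := (Finset.sum_eq_sum_iff_of_le
      (s := Finset.univ.filter fun v => MovesV (Subgroup.zpowers z) v)
      (f := fun _ => 3) (g := fun v => G.valence v) fun v hv =>
        hval3 v (movesV_zpowers_iff.1 (Finset.mem_filter.1 hv).2)).1 (by
          rw [Finset.sum_const, smul_eq_mul, hV]
          linarith)
    exact (h6 v (by simpa [movesV_zpowers_iff] using hv)).symm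
  -- either some orbit of moved vertices has edges of its own, or all edges leave their orbit
  by_cases hrim : ∃ x r, ∃ t : ZMod p, z.onV x ≠ x ∧ G.src r = x ∧
      G.src (G.inv r) = (z ^ t.val).onV x ∧ t ≠ 0
  · obtain ⟨x, r, t, hx, hr, hr', ht⟩ := hrim
    refine ⟨t, ht, ?_⟩
    have hxt := pow_moved hz ht hx
    have hwheel : ∀ e, G.valence x = 3 → G.src e = x → z.onV (G.src (G.inv e)) = G.src (G.inv e) →
        ∃ x r e, IsWheel (z ^ t.val) x r e := fun e h3 he he' =>
      ⟨x, r, e, hxt, hr, hr', he, hfixpow t he', h3⟩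
    have hV0 : V ≠ 0 := by
      rintro rfl
      rw [mul_zero, Finset.card_eq_zero] at hV
      have : x ∈ Finset.univ.filter fun v => MovesV (Subgroup.zpowers z) v := by
        simpa [movesV_zpowers_iff] using hx
      rw [hV] at this
      exact absurd this (Finset.notMem_empty _)
    by_cases hV1 : V = 1
    · subst hV1
      rw [mul_one] at hV
      have hcov := fun {v} (hv : z.onV v ≠ v) => cover_one hz hV hx hv
      have hvx : 2 * E = s + G.valence x := by
        have h6 : ∑ v ∈ Finset.univ.filter (fun v => MovesV (Subgroup.zpowers z) v), G.valence v =
            p * G.valence x := by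
          rw [Finset.sum_const_nat (m := G.valence x), hV]
          intro v hv
          obtain ⟨c, rfl⟩ := hcov (movesV_zpowers_iff.1 (Finset.mem_filter.1 hv).2)
          exact Iso.valence_onV _ _
        rw [h6] at hcount
        refine Nat.eq_of_mul_eq_mul_left hp.pos ?_
        linarith
      by_cases hvx3 : G.valence x = 3
      · left
        obtain ⟨e, he, -, he'⟩ := exists_spoke h2 hz hx hvx3 hr hr'
        refine hwheel e hvx3 he ?_
        by_contra hm
        obtain ⟨c, h⟩ := hcov hm
        exact he' c h
      · -- one orbit of vertices of valence four
        right; left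
        have h6 := hval3 x hx
        have hvx4 : G.valence x = 4 := by omega
        have hs2 : s = 2 := by omega
        have hE3 : E = 3 := by omega
        obtain ⟨e, e', he, he', hee, he1, he2, he3, he4, hall⟩ :=
          exists_third_fourth hvx4 hr (src_star hz hr') (star_ne h2 hz t r).symm
        have hback : ∀ f f', G.src f = x → f ≠ r → f ≠ star z t r →
            (∀ g, G.src g = x → g = r ∨ g = star z t r ∨ g = f ∨ g = f') →
            z.onV (G.src (G.inv f)) ≠ G.src (G.inv f) →
            (∃ c : ZMod p, G.src (G.inv f) = (z ^ c.val).onV x) ∧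
              ∃ c : ZMod p, G.src (G.inv f') = (z ^ c.val).onV x := by
          intro f f' hf hf1 hf2 hall hm
          obtain ⟨c, h⟩ := hcov hm
          obtain ⟨g1, g2⟩ := star_ne_rim (c := c) hz hx hr hr' hf hf1 hf2
          refine ⟨⟨c, h⟩, -c, ?_⟩
          rcases hall _ (src_star hz h) with h' | h' | h' | h'
          · exact absurd h' g1
          · exact absurd h' g2
          · exact absurd h' (star_ne h2 hz _ _)
          · rw [← h', src_inv_star, hf]
        -- the two edges off the rim cannot both return to it, as the graph is connected
        have hclosed : ∀ {c c' : ZMod p}, G.src (G.inv e) = (z ^ c.val).onV x →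
            G.src (G.inv e') = (z ^ c'.val).onV x → False := by
          intro c c' h h'
          refine hG.false_of_closed hz (fun v => v = x) (by rintro v rfl; exact hx)
            (fun d hd => ?_) rfl
          rcases hall d hd with rfl | rfl | rfl | rfl
          · exact ⟨t, x, rfl, hr'⟩
          · exact ⟨-t, x, rfl, by rw [src_inv_star, hr]⟩
          · exact ⟨c, x, rfl, h⟩
          · exact ⟨c', x, rfl, h'⟩
        have hf : z.onV (G.src (G.inv e)) = G.src (G.inv e) := by
          by_contra hm
          obtain ⟨⟨c, h⟩, c', h'⟩ := hback e e' he he1 he2 hall hm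
          exact hclosed h h'
        have hf' : z.onV (G.src (G.inv e')) = G.src (G.inv e') := by
          by_contra hm
          obtain ⟨⟨c, h⟩, c', h'⟩ := hback e' e he' he3 he4 (fun g hg => by
            rcases hall g hg with h | h | h | h <;> simp [h]) hm
          exact hclosed h' h
        obtain ⟨hab, hfv, hall'⟩ := hfixed hs2 (by omega) (by rwa [he]) (by rwa [he']) hf hf'
          (horb (by rwa [he]) (he.trans he'.symm) hee)
        have hcardD : Nat.card G.D = 6 * p := by rw [hDcard hall', hE3]; ring
        have hcov' : ∀ v, (v = G.src (G.inv e) ∨ v = G.src (G.inv e')) ∨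
            ∃ c : ZMod p, v = ((z ^ t.val) ^ c.val).onV x := by
          intro v
          by_cases hv : z.onV v = v
          · exact Or.inl (hfv v hv)
          · obtain ⟨c, h⟩ := hcov hv
            exact Or.inr ⟨t⁻¹ * c, by rw [h]; exact onV_pow_pow hz ht c x⟩
        rcases hfv _ z.onV_base with hb | hb
        · exact exists_iso_upsilon h2 (pow_val_pow hz t) hxt (hfixpow t hf') (by rw [hb]; exact hab.symm)
            hr hr' he hb.symm he' rfl (fun v => by rw [hb, ← or_assoc]; exact hcov' v) hcardD
        · exact exists_iso_upsilon h2 (pow_val_pow hz t) hxt (hfixpow t hf) (by rw [hb]; exact hab)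
            hr hr' he' hb.symm he rfl
            (fun v => by rw [hb, ← or_assoc, or_comm (a := v = _)]; exact hcov' v) hcardD
    · obtain ⟨rfl, rfl, rfl, hv3⟩ := htwo hV0 hV1
      obtain ⟨e, he, hall, he'⟩ := exists_spoke h2 hz hx (hv3 x hx) hr hr'
      by_cases hw : z.onV (G.src (G.inv e)) = G.src (G.inv e)
      · exact Or.inl (hwheel e (hv3 x hx) he hw)
      right; right; left
      -- the third edge at `x` leads to a second orbit, the rest of which leads to fixed vertices
      obtain ⟨w, hwe⟩ : ∃ w, G.src (G.inv e) = w := ⟨_, rfl⟩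
      rw [hwe] at hw he'
      have hcov := fun {v} (hv : z.onV v ≠ v) => cover_two hz hV hx hw he' hv
      have hxw : ∀ c c' : ZMod p, (z ^ c.val).onV w ≠ (z ^ c'.val).onV x := by
        intro c c' h
        apply he' (-c + c')
        rw [onV_pow_add hz, ← h, ← onV_pow_add hz, neg_add_cancel, pow_val_zero']
        rfl
      obtain ⟨h, h', hh, hh', hhe, hhe', hne, hall'⟩ := exists_other_two (hv3 w hw) hwe
      have key : ∀ h h', G.src h = w → h ≠ G.inv e →
          (∀ f, G.src f = w → f = G.inv e ∨ f = h ∨ f = h') →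
          z.onV (G.src (G.inv h)) = G.src (G.inv h) := by
        intro h h' hh hhe hall'
        by_contra hm
        rcases hcov hm with ⟨c, hc⟩ | ⟨c, hc⟩
        · rcases hall _ (src_star hz hc) with h6 | h6 | h6
          · apply hxw (-c) t
            rw [← hr', ← h6, src_inv_star, hh]
          · apply hxw (-c) (-t)
            rw [← hr, ← src_inv_star, ← h6, src_inv_star, hh]
          · have h8 := src_inv_star (z := z) c h
            rw [h6, hwe, hh] at h8
            have h7 : -c = 0 := onV_pow_ne hz hw (h8.symm.trans (hself w))
            apply hhe
            rw [← star_star hz c h, h6, h7, star, neg_zero, pow_val_zero']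
            rfl
        · refine hG.false_of_closed hz (fun v => v = x ∨ v = w)
            (by rintro v (rfl | rfl) <;> assumption) (fun d hd => ?_) (Or.inl rfl)
          rcases hd with hd | hd
          · rcases hall d hd with rfl | rfl | rfl
            · exact ⟨t, x, Or.inl rfl, hr'⟩
            · exact ⟨-t, x, Or.inl rfl, by rw [src_inv_star, hr]⟩
            · exact ⟨0, w, Or.inr rfl, by rw [hwe]; exact hself w⟩
          · rcases hall' d hd with rfl | rfl | rfl
            · exact ⟨0, x, Or.inl rfl, by rw [G.inv_inv, he]; exact hself x⟩
            · exact ⟨c, w, Or.inr rfl, hc⟩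
            · rcases hall' _ (src_star hz hc) with h6 | h6 | h6
              · exfalso
                apply hxw (-c) 0
                rw [← hself x, ← he, ← G.inv_inv e, ← h6, src_inv_star, hh]
              · exact absurd h6 (star_ne h2 hz _ _)
              · exact ⟨-c, w, Or.inr rfl, by rw [← h6, src_inv_star, hh]⟩
      have hf := key h h' hh hhe hall'
      have hf' := key h' h hh' hhe' fun f hf => by rcases hall' f hf with h | h | h <;> simp [h]
      obtain ⟨hab, hfv, hall''⟩ := hfixed rfl rfl (by rwa [hh]) (by rwa [hh']) hf hf'
        (horb (by rwa [hh]) (hh.trans hh'.symm) hne)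
      have hcardD : Nat.card G.D = 8 * p := by rw [hDcard hall'']; ring
      have hcov' : ∀ v, (v = G.src (G.inv h) ∨ v = G.src (G.inv h')) ∨
          (∃ c : ZMod p, v = ((z ^ t.val) ^ c.val).onV x) ∨
            ∃ c : ZMod p, v = ((z ^ t.val) ^ c.val).onV w := by
        intro v
        by_cases hv : z.onV v = v
        · exact Or.inl (hfv v hv)
        · rcases hcov hv with ⟨c, h⟩ | ⟨c, h⟩
          · exact Or.inr (Or.inl ⟨t⁻¹ * c, by rw [h]; exact onV_pow_pow hz ht c x⟩)
          · exact Or.inr (Or.inr ⟨t⁻¹ * c, by rw [h]; exact onV_pow_pow hz ht c w⟩)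
      have hxw' : ∀ c : ZMod p, w ≠ ((z ^ t.val) ^ c.val).onV x := fun c h6 =>
        he' (t * c) (by rw [h6, ← pow_val_mul hz])
      rcases hfv _ z.onV_base with hb | hb
      · exact exists_iso_upsilonOne h2 (pow_val_pow hz t) hxt (pow_moved hz ht hw) hxw'
          (hfixpow t hf') (by rw [hb]; exact hab.symm) hr hr' he hwe hh hb.symm hh' rfl
          (fun v => by rw [hb, ← or_assoc]; exact hcov' v) hcardD
      · exact exists_iso_upsilonOne h2 (pow_val_pow hz t) hxt (pow_moved hz ht hw) hxw'
          (hfixpow t hf) (by rw [hb]; exact hab) hr hr' he hwe hh' hb.symm hh rfl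
          (fun v => by rw [hb, ← or_assoc, or_comm (a := v = _)]; exact hcov' v) hcardD
  · have hrim' : ∀ x, z.onV x ≠ x → ∀ d (t : ZMod p), G.src d = x →
        G.src (G.inv d) = (z ^ t.val).onV x → t = 0 := by
      intro x hx d t h h'
      by_contra ht
      exact hrim ⟨x, d, t, hx, h, h', ht⟩
    have hV0 : V ≠ 0 := by
      rintro rfl
      rw [mul_zero, Finset.card_eq_zero] at hV
      refine htw ⟨fun _ => 0, fun v hv => ?_, fun _ _ _ => rfl⟩
      have : v ∈ Finset.univ.filter fun v => MovesV (Subgroup.zpowers z) v := by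
        simpa [movesV_zpowers_iff] using hv
      rw [hV] at this
      exact absurd this (Finset.notMem_empty _)
    have hex : ∃ x, z.onV x ≠ x := by
      by_contra! h
      exact htw ⟨fun _ => 0, fun v hv => absurd (h v) hv, fun _ _ _ => rfl⟩
    obtain ⟨x, hx⟩ := hex
    have hsucc : ∀ (c : ZMod p) v, z.onV ((z ^ c.val).onV v) = (z ^ (c + 1).val).onV v := by
      intro c v
      rw [add_comm, onV_pow_add hz, ← hpow1]
    -- a single orbit without edges of its own would give an untwisted index
    by_cases hV1 : V = 1
    · exfalso
      subst hV1
      rw [mul_one] at hV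
      have hcov := fun {v} (hv : z.onV v ≠ v) => cover_one hz hV hx hv
      choose! f hf using fun v => (@hcov v)
      have hfx : ∀ c : ZMod p, f ((z ^ c.val).onV x) = c := fun c =>
        (onV_pow_ne hz hx (hf _ (hmoved c hx))).symm
      refine htw ⟨f, fun v hv => ?_, fun d h h' => ?_⟩
      · obtain ⟨c, rfl⟩ := hcov hv
        rw [hsucc, hfx, hfx]
      · obtain ⟨a, ha⟩ := hcov h
        obtain ⟨b, hb⟩ := hcov h'
        obtain ⟨h6, h7⟩ := htr d a b x x ha hb
        have h8 := hrim' x hx _ _ h6 h7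
        rw [ha, hb, hfx, hfx]
        exact (neg_add_eq_zero.1 h8)
    · obtain ⟨rfl, rfl, rfl, hv3⟩ := htwo hV0 hV1
      obtain ⟨w, hw, hxw⟩ := exists_second_orbit hV x
      -- For each choice of the origin `w` of the second orbit some edge has a nonzero shift, as `z`
      -- is twisted. The end of such an edge, taken as the new origin, gives two different shifts.
      have hshift : ∀ w, z.onV w ≠ w → (∀ c : ZMod p, w ≠ (z ^ c.val).onV x) →
          ∃ d, ∃ t : ZMod p, G.src d = x ∧ G.src (G.inv d) = (z ^ t.val).onV w ∧ t ≠ 0 := by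
        intro w hw hxw
        have hcov := fun {v} (hv : z.onV v ≠ v) => cover_two hz hV hx hw hxw hv
        by_contra! hno
        choose! f hf using fun v => (show z.onV v ≠ v → ∃ c : ZMod p,
          v = (z ^ c.val).onV x ∨ v = (z ^ c.val).onV w from fun hv => by
            rcases hcov hv with ⟨c, h⟩ | ⟨c, h⟩
            exacts [⟨c, Or.inl h⟩, ⟨c, Or.inr h⟩])
        have hxw' : ∀ c c' : ZMod p, (z ^ c.val).onV w ≠ (z ^ c'.val).onV x := by
          intro c c' h
          apply hxw (-c + c')
          rw [onV_pow_add hz, ← h, ← onV_pow_add hz, neg_add_cancel, pow_val_zero']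
          rfl
        have hfx : ∀ c : ZMod p, f ((z ^ c.val).onV x) = c := fun c => by
          rcases hf _ (hmoved c hx) with h | h
          · exact (onV_pow_ne hz hx h).symm
          · exact absurd h.symm (hxw' _ _)
        have hfw : ∀ c : ZMod p, f ((z ^ c.val).onV w) = c := fun c => by
          rcases hf _ (hmoved c hw) with h | h
          · exact absurd h (hxw' _ _)
          · exact (onV_pow_ne hz hw h).symm
        refine htw ⟨f, fun v hv => ?_, fun d h h' => ?_⟩
        · rcases hcov hv with ⟨c, rfl⟩ | ⟨c, rfl⟩
          · rw [hsucc, hfx, hfx]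
          · rw [hsucc, hfw, hfw]
        · rcases hcov h with ⟨a, ha⟩ | ⟨a, ha⟩ <;> rcases hcov h' with ⟨b, hb⟩ | ⟨b, hb⟩ <;>
            obtain ⟨h6, h7⟩ := htr d a b _ _ ha hb
          · rw [ha, hb, hfx, hfx]
            exact neg_add_eq_zero.1 (hrim' x hx _ _ h6 h7)
          · rw [ha, hb, hfx, hfw]
            exact neg_add_eq_zero.1 (hno _ _ h6 h7)
          · rw [ha, hb, hfx, hfw]
            have h8 : G.src (G.inv (G.inv d)) = (z ^ a.val).onV w := by rw [G.inv_inv, ha]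
            obtain ⟨h6, h7⟩ := htr (G.inv d) b a _ _ hb h8
            exact (neg_add_eq_zero.1 (hno _ _ h6 h7)).symm
          · rw [ha, hb, hfw, hfw]
            exact neg_add_eq_zero.1 (hrim' w hw _ _ h6 h7)
      obtain ⟨r, t₀, hr, hr', -⟩ := hshift w hw hxw
      obtain ⟨w, hw₀⟩ : ∃ w', (z ^ t₀.val).onV w = w' := ⟨_, rfl⟩
      rw [hw₀] at hr'
      have hxw₀ : ∀ c : ZMod p, w ≠ (z ^ c.val).onV x := by
        intro c h
        apply hxw (-t₀ + c)
        rw [onV_pow_add hz, ← h, ← hw₀, ← onV_pow_add hz, neg_add_cancel, pow_val_zero']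
        rfl
      replace hw : z.onV w ≠ w := hw₀ ▸ hmoved t₀ hw
      obtain ⟨d, t, hd, hd', ht⟩ := hshift w hw hxw₀
      have hxw₁ : ∀ c : ZMod p, x ≠ (z ^ c.val).onV w := by
        intro c h
        apply hxw₀ (-c)
        rw [h, ← onV_pow_add hz, neg_add_cancel, pow_val_zero']
        rfl
      have hcov := fun {v} (hv : z.onV v ≠ v) => cover_two hz hV hx hw hxw₀ hv
      have hr₁ := hr'.trans (hself w)
      obtain ⟨h, hh, hf⟩ := hG.exists_fixed_neighbour h2 hz hx hw hxw₀ (fun v => hcov) (hv3 x hx)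
        (hv3 w hw) (hrim' x hx) ht.symm hr hr₁ hd hd'
      have hr₂ : G.src (G.inv (star z (0 : ZMod p) r)) = (z ^ (0 : ZMod p).val).onV x := by
        rw [src_inv_star, hr, neg_zero]
      have hd₂ : G.src (G.inv (star z t d)) = (z ^ (-t).val).onV x := by rw [src_inv_star, hd]
      obtain ⟨h', hh', hf'⟩ := hG.exists_fixed_neighbour h2 hz hw hx hxw₁
        (fun v hv => (hcov hv).symm) (hv3 w hw) (hv3 x hx) (hrim' w hw) (neg_ne_zero.2 ht).symm
        (src_star hz hr₁) hr₂ (src_star hz hd') hd₂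
      obtain ⟨hab, hfv, hall''⟩ := hfixed rfl rfl (by rwa [hh]) (by rwa [hh']) hf hf'
        (fun c h6 => by
          have := congrArg G.src h6
          rw [Iso.src_onD, hh, hh'] at this
          exact hxw₀ c this.symm)
      have hcardD : Nat.card G.D = 8 * p := by rw [hDcard hall'']; ring
      have hcov' : ∀ {t : ZMod p}, t ≠ 0 → ∀ v, (v = G.src (G.inv h) ∨ v = G.src (G.inv h')) ∨
          (∃ c : ZMod p, v = ((z ^ t.val) ^ c.val).onV x) ∨
            ∃ c : ZMod p, v = ((z ^ t.val) ^ c.val).onV w := by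
        intro t ht v
        by_cases hv : z.onV v = v
        · exact Or.inl (hfv v hv)
        · rcases hcov hv with ⟨c, h⟩ | ⟨c, h⟩
          · exact Or.inr (Or.inl ⟨t⁻¹ * c, by rw [h]; exact onV_pow_pow hz ht c x⟩)
          · exact Or.inr (Or.inr ⟨t⁻¹ * c, by rw [h]; exact onV_pow_pow hz ht c w⟩)
      rcases hfv _ z.onV_base with hb | hb
      · have ht' : -t ≠ 0 := neg_ne_zero.2 ht
        exact ⟨-t, ht', Or.inr <| Or.inr <| Or.inr <| exists_iso_upsilonTwo (pow_val_pow hz _)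
          (pow_moved hz ht' hx) (pow_moved hz ht' hw)
          (fun c h6 => hxw₀ (-t * c) (by rw [h6, ← pow_val_mul hz]))
          (hfixpow _ hf') (by rw [hb]; exact hab.symm) hr hr' (src_star hz hd') hd₂ hh hb.symm hh'
          rfl (fun v => by rw [hb, ← or_assoc]; exact hcov' ht' v) hcardD⟩
      · exact ⟨t, ht, Or.inr <| Or.inr <| Or.inr <| exists_iso_upsilonTwo (pow_val_pow hz _)
          (pow_moved hz ht hw) (pow_moved hz ht hx)
          (fun c h6 => hxw₁ (t * c) (by rw [h6, ← pow_val_mul hz]))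
          (hfixpow _ hf) (by rw [hb]; exact hab) (src_star hz hr₁) (hr₂.trans (hself x).symm) hd hd'
          hh' hb.symm hh rfl (fun v => by
            rw [hb, ← or_assoc, or_comm (a := v = _), or_comm (a := ∃ _, _)]; exact hcov' ht v)
          hcardD⟩

end

end PGraph

end Auter

namespace Auter

/-! ### One-point unions with a wheel -/

namespace PGraph

variable {G : PGraph} {p : ℕ} [Fact p.Prime]

/-- The subgraph spanned by a set of vertices which contains the basepoint. -/
def spanned (G : PGraph) (U : Set G.V) (hU : G.base ∈ U) : PGraph where
  V := U
  D := {d : G.D // G.src d ∈ U ∧ G.src (G.inv d) ∈ U}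
  src d := ⟨G.src d.1, d.2.1⟩
  inv d := ⟨G.inv d.1, d.2.2, by rw [G.inv_inv]; exact d.2.1⟩
  inv_inv d := Subtype.ext (G.inv_inv d.1)
  inv_ne d h := G.inv_ne d.1 (congrArg Subtype.val h)
  base := ⟨G.base, hU⟩

/-- A spanned subgraph onto which the graph retracts is connected. -/
theorem spanned_connected {U : Set G.V} (hU : G.base ∈ U) (hG : ∀ v, ∃ w, G.IsWalk G.base w v)
    (ρ : G.V → U) (hρ : ∀ v (h : v ∈ U), ρ v = ⟨v, h⟩)
    (hd : ∀ d, ¬ (G.src d ∈ U ∧ G.src (G.inv d) ∈ U) → ρ (G.src d) = ρ (G.src (G.inv d))) :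
    ∀ v, ∃ w, (G.spanned U hU).IsWalk (G.spanned U hU).base w v := by
  have key : ∀ (w : List G.D) (u v : G.V), G.IsWalk u w v →
      ∃ w', (G.spanned U hU).IsWalk (ρ u) w' (ρ v) := by
    intro w
    induction w with
    | nil =>
      intro u v h
      exact ⟨[], congrArg ρ h⟩
    | cons d w ih =>
      rintro u v ⟨rfl, h⟩
      obtain ⟨w', hw'⟩ := ih _ _ h
      by_cases h1 : G.src d ∈ U ∧ G.src (G.inv d) ∈ U
      · refine ⟨⟨d, h1⟩ :: w', (hρ _ h1.1).symm, ?_⟩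
        rw [hρ _ h1.2] at hw'
        exact hw'
      · exact ⟨w', by rw [hd d h1]; exact hw'⟩
  intro v
  obtain ⟨w, hw⟩ := hG v.1
  obtain ⟨w', hw'⟩ := key w _ _ hw
  rw [hρ _ hU, hρ _ v.2] at hw'
  exact ⟨w', hw'⟩

theorem wedge_src_inr_of_eq {A B : PGraph} {a : A.V} {d : B.D} (h : B.src d = B.base) :
    (A.wedge a B).src (Sum.inr d) = Sum.inl a := dif_pos h

theorem wedge_src_inr_of_ne {A B : PGraph} {a : A.V} {d : B.D} (h : B.src d ≠ B.base) :
    (A.wedge a B).src (Sum.inr d) = Sum.inr ⟨B.src d, h⟩ := dif_neg h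

theorem isSimple_xi (h2 : p ≠ 2) : (Xi p).IsSimple := by
  rintro ⟨⟨k, i⟩, b⟩ ⟨⟨k', i'⟩, b'⟩ h h'
  cases k <;> cases k' <;> cases b <;> cases b' <;>
    simp [Xi, ofEdges] at h h' ⊢
  all_goals first
    | exact h
    | exact h'
    | (subst h; exact absurd h' (add_one_add_one_ne h2 _))
    | (subst h'; exact absurd h (add_one_add_one_ne h2 _))

instance : Fintype XiEdge := ⟨⟨↑([.rim, .spoke] : List XiEdge), by simp⟩, fun x => by cases x <;> simp⟩

theorem card_xi : Nat.card (Xi p).D = 4 * p := by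
  change Nat.card ((XiEdge × ZMod p) × Bool) = _
  rw [Nat.card_prod, Nat.card_prod, Nat.card_zmod, Nat.card_eq_fintype_card,
    Nat.card_eq_fintype_card, Fintype.card_bool, show Fintype.card XiEdge = 2 from rfl]
  ring

variable {y : Iso G G} {x : G.V} {r e : G.D}

/-- The edges at the vertices of the rim are edges of the wheel. -/
theorem IsWheel.eq_rotated [Finite G.D] (h2 : p ≠ 2) (hy : y ^ p = 1) (hw : IsWheel y x r e)
    {d : G.D} {j : ZMod p} (hd : G.src d = (y ^ j.val).onV x) :
    ∃ d', d = rotated (p := p) y (fun | XiEdge.rim => r | .spoke => G.inv e) d' := by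
  have hr' : G.src (G.inv r) = (y ^ (1 : ZMod p).val).onV x := by rw [pow_val_one hy]; exact hw.tgt_rim
  have hne : e ≠ r := by
    rintro rfl
    apply hw.moved
    apply y.onV.injective
    rw [← hw.tgt_rim]
    exact hw.tgt_spoke
  have hne' : e ≠ star y (1 : ZMod p) r := by
    intro h
    have h1 := hw.tgt_spoke
    rw [h, src_inv_star, hw.src_rim, onV_moved hy] at h1
    exact hw.moved h1
  obtain ⟨f, -, -, -, hall⟩ := exists_third hw.valence hw.src_rim (src_star hy hr')
    (star_ne h2 hy _ _).symm
  have hall' : ∀ f, G.src f = x → f = r ∨ f = star y (1 : ZMod p) r ∨ f = e := by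
    intro f' hf'
    rcases hall _ hw.src_spoke with h | h | h
    · exact absurd h hne
    · exact absurd h hne'
    · rw [h]; exact hall _ hf'
  have h1 : G.src ((y ^ (-j).val).onD d) = x := by
    rw [Iso.src_onD, hd, ← onV_pow_add hy, neg_add_cancel, pow_val_zero']
    rfl
  have h3 : d = (y ^ j.val).onD ((y ^ (-j).val).onD d) := by
    rw [← onD_pow_add hy, add_neg_cancel, pow_val_zero']
    rfl
  rw [h3]
  rcases hall' _ h1 with h | h | h
  · exact ⟨((.rim, j), false), by rw [h]; rfl⟩
  · refine ⟨((.rim, j - 1), true), ?_⟩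
    rw [h, star, ← onD_pow_add hy, Iso.onD_inv, ← sub_eq_add_neg]
    rfl
  · refine ⟨((.spoke, j), true), ?_⟩
    rw [h]
    change _ = G.inv ((y ^ j.val).onD (G.inv e))
    rw [← Iso.onD_inv, G.inv_inv]

/-- A graph that contains a wheel on which a symmetry acts by rotation is the one-point union of the
wheel and another graph. -/
theorem IsWheel.exists_iso (hG : G.Admissible) (h5 : 5 ≤ p)
    (hc : Nat.card G.D + 4 = 2 * Nat.card G.V + 4 * p) (hy : y ^ p = 1) (hw : IsWheel y x r e) :
    ∃ (Γ : PGraph) (a : Γ.V) (i : Iso (Γ.wedge a (Xi p)) G),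
      Nonempty (FreeGroup (Fin (p - 1)) ≃* Γ.pi1) ∧
      ∀ d, i.onD (Sum.inr (Xi.rotate p d)) = y.onD (i.onD (Sum.inr d)) := by
  classical
  have h2 : p ≠ 2 := by omega
  have := hG.finite_D
  have := hG.finite_V
  set U : Set G.V := {v | ∀ j : ZMod p, v ≠ (y ^ j.val).onV x} with hU
  have hfix : ∀ v, y.onV v = v → v ∈ U := by
    rintro v hv j rfl
    exact hw.moved ((onV_moved hy j).1 hv)
  have hbU : G.base ∈ U := hfix _ y.onV_base
  have haU := hfix _ hw.tgt_spoke
  let δ : XiEdge → G.D := fun | XiEdge.rim => r | .spoke => G.inv e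
  let vm : Option (ZMod p) → G.V := fun o => o.elim (G.src (G.inv e)) fun j => (y ^ j.val).onV x
  have hvm : Function.Injective vm := by
    rintro (_ | j) (_ | j') h
    · rfl
    · exact absurd h (haU j')
    · exact absurd (Eq.symm h) (haU j)
    · rw [onV_pow_ne hy hw.moved (show (y ^ j.val).onV x = (y ^ j'.val).onV x from h)]
  have hsrc : ∀ d : (Xi p).D, G.src (rotated y δ d) = vm ((Xi p).src d) := by
    have hsucc : ∀ j : ZMod p, (y ^ (j + 1).val).onV x = (y ^ j.val).onV (y.onV x) := fun j =>
      DFunLike.congr_fun (congrArg Iso.onV (pow_val_succ hy j)) x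
    rintro ⟨⟨_ | _, j⟩, _ | _⟩
    · exact ((y ^ j.val).src_onD r).trans (congrArg _ hw.src_rim)
    · refine (congrArg G.src ((y ^ j.val).onD_inv r).symm).trans (((y ^ j.val).src_onD _).trans ?_)
      rw [hw.tgt_rim]
      exact (hsucc j).symm
    · exact ((y ^ j.val).src_onD _).trans (y.pow_onV _ hw.tgt_spoke _)
    · refine (congrArg G.src ((y ^ j.val).onD_inv _).symm).trans (((y ^ j.val).src_onD _).trans ?_)
      rw [G.inv_inv, hw.src_spoke]
      rfl
  have hinv : ∀ d : (Xi p).D, rotated y δ ((Xi p).inv d) = G.inv (rotated y δ d) := rotated_inv δ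
  have hinj : Function.Injective (fun d : (Xi p).D => rotated y δ d) := fun d d' h =>
    isSimple_xi h2 d d' (hvm (by rw [← hsrc, ← hsrc]; exact congrArg G.src h))
      (hvm (by rw [← hsrc, ← hsrc, hinv, hinv]; exact congrArg (fun d => G.src (G.inv d)) h))
  -- the edges of the wheel are those which meet the rim
  have hout : ∀ d : (Xi p).D, ¬ (G.src (rotated y δ d) ∈ U ∧ G.src (G.inv (rotated y δ d)) ∈ U) := by
    intro d h
    rw [← hinv, hsrc, hsrc] at h
    rcases d with ⟨⟨_ | _, j⟩, _ | _⟩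
    · exact h.1 j rfl
    · exact h.2 j rfl
    · exact h.2 j rfl
    · exact h.1 j rfl
  have hin : ∀ d, ¬ (G.src d ∈ U ∧ G.src (G.inv d) ∈ U) → ∃ d' : (Xi p).D, d = rotated y δ d' := by
    intro d h
    by_cases h1 : G.src d ∈ U
    · have h3 : G.src (G.inv d) ∉ U := fun h3 => h ⟨h1, h3⟩
      simp only [hU, Set.mem_ofPred_eq, not_forall, not_not] at h3
      obtain ⟨j, hj⟩ := h3
      obtain ⟨d', hd'⟩ := hw.eq_rotated h2 hy hj
      exact ⟨(Xi p).inv d', ((G.inv_inv d).symm.trans (congrArg G.inv hd')).trans (hinv d').symm⟩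
    · simp only [hU, Set.mem_ofPred_eq, not_forall, not_not] at h1
      obtain ⟨j, hj⟩ := h1
      exact hw.eq_rotated h2 hy hj
  let Γ := G.spanned U hbU
  let a : Γ.V := ⟨_, haU⟩
  let fV : (Γ.wedge a (Xi p)).V → G.V := Sum.elim (fun v => v.1) fun v => vm v.1
  let fD : (Γ.wedge a (Xi p)).D → G.D := Sum.elim (fun d => d.1) fun d => rotated y δ d
  have hfV : Function.Bijective fV := by
    constructor
    · rintro (v | ⟨_ | j, hv⟩) (v' | ⟨_ | j', hv'⟩) h
      · exact congrArg Sum.inl (Subtype.ext h)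
      · exact absurd rfl hv'
      · exact absurd h (v.2 j')
      · exact absurd rfl hv
      · exact absurd rfl hv
      · exact absurd rfl hv
      · exact absurd (Eq.symm h) (v'.2 j)
      · exact absurd rfl hv'
      · exact congrArg Sum.inr (Subtype.ext (hvm h))
    · intro v
      by_cases hv : v ∈ U
      · exact ⟨Sum.inl ⟨v, hv⟩, rfl⟩
      · simp only [hU, Set.mem_ofPred_eq, not_forall, not_not] at hv
        obtain ⟨j, hj⟩ := hv
        exact ⟨Sum.inr ⟨some j, fun h => Option.some_ne_none _ h⟩, hj.symm⟩
  have hfD : Function.Bijective fD := by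
    constructor
    · rintro (d | d) (d' | d') h
      · exact congrArg Sum.inl (Subtype.ext h)
      · exact absurd d.2 (by rw [show d.1 = rotated y δ d' from h]; exact hout d')
      · exact absurd d'.2 (by rw [← show rotated y δ d = d'.1 from h]; exact hout d)
      · exact congrArg Sum.inr (hinj h)
    · intro d
      by_cases hd : G.src d ∈ U ∧ G.src (G.inv d) ∈ U
      · exact ⟨Sum.inl ⟨d, hd⟩, rfl⟩
      · obtain ⟨d', rfl⟩ := hin d hd
        exact ⟨Sum.inr d', rfl⟩
  have hfsrc : ∀ d, G.src (fD d) = fV ((Γ.wedge a (Xi p)).src d) := by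
    rintro (d | d)
    · rfl
    · refine (hsrc d).trans ?_
      by_cases h : (Xi p).src d = (Xi p).base
      · exact (congrArg vm h).trans (congrArg fV (wedge_src_inr_of_eq h)).symm
      · exact (congrArg fV (wedge_src_inr_of_ne (a := a) h)).symm
  let i : Iso (Γ.wedge a (Xi p)) G :=
    ⟨Equiv.ofBijective fV hfV, Equiv.ofBijective fD hfD, hfsrc, by
      rintro (d | d)
      · rfl
      · exact hinv d, rfl⟩
  refine ⟨Γ, a, i, ?_, fun d => rotated_succ hy δ d.1.1 d.1.2 d.2⟩
  have : Finite Γ.D := Subtype.finite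
  have : Finite Γ.V := Subtype.finite
  apply nonempty_freeGroup_equiv
  · refine spanned_connected hbU hG.connected
      (fun v => if h : v ∈ U then ⟨v, h⟩ else a) (fun v h => dif_pos h) ?_
    intro d hd
    obtain ⟨d', rfl⟩ := hin d hd
    have key : ∀ o, (if h : vm o ∈ U then (⟨vm o, h⟩ : U) else a) = a := by
      rintro (_ | j)
      · exact dif_pos haU
      · exact dif_neg fun h => h j rfl
    rw [← hinv, hsrc, hsrc]
    exact (key _).trans (key _).symm
  · have hD : Nat.card G.D = Nat.card Γ.D + 4 * p := by
      rw [← Nat.card_congr i.onD, ← card_xi]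
      have : Finite (Xi p).D := inferInstanceAs (Finite ((XiEdge × ZMod p) × Bool))
      exact Nat.card_sum
    have hV : Nat.card G.V = Nat.card Γ.V + p := by
      rw [← Nat.card_congr i.onV]
      have : Finite {v : (Xi p).V // v ≠ (Xi p).base} :=
        inferInstanceAs (Finite {v : Option (ZMod p) // v ≠ none})
      refine Nat.card_sum.trans ?_
      congr 1
      refine (Nat.card_congr (β := ZMod p) ?_).trans (Nat.card_zmod p)
      refine (Equiv.ofBijective (fun j : ZMod p => ⟨some j, fun h => Option.some_ne_none _ h⟩)
        ⟨fun j j' h => Option.some_injective _ (congrArg Subtype.val h), ?_⟩).symm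
      rintro ⟨_ | j, hj⟩
      · exact absurd rfl hj
      · exact ⟨j, rfl⟩
    omega

end PGraph

open PGraph

variable {p : ℕ} [Fact p.Prime]

/-- A simplex whose stabilizer rotates a wheel of its maximal vertex. -/
theorem hasWheelWedgeForm_of_isWheel (h5 : 5 ≤ p) {G : PGraph} {𝓕 : Set (Set G.D)} {n : ℕ}
    {σ : Set (SpineVertex n)} (hσ : IsSimplexOfFlag G 𝓕 σ)
    (hc : Nat.card G.D + 4 = 2 * Nat.card G.V + 4 * p) {y : Iso G G} (hy : y ^ p = 1)
    (hyF : y ∈ flagAut G 𝓕) {x : G.V} {r e : G.D} (hw : IsWheel y x r e) :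
    HasWheelWedgeForm p σ := by
  obtain ⟨Γ, a, i, hΓ, hi⟩ := hw.exists_iso hσ.1 h5 hc hy
  refine ⟨Γ, a, _, hΓ, ?_, hσ.map i.symm⟩
  rintro _ ⟨F, hF, rfl⟩ d
  have key : ∀ d, d ∈ i.symm.onD '' F ↔ i.onD d ∈ F := fun d =>
    ⟨by rintro ⟨d', h, rfl⟩; change i.onD (i.onD.symm d') ∈ F; rwa [Equiv.apply_symm_apply],
      fun h => ⟨_, h, i.onD.symm_apply_apply d⟩⟩
  have h := mem_flagAut.1 hyF F hF (i.onD (Sum.inr d))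
  rw [← hi] at h
  exact (key _).trans (h.symm.trans (key _).symm)

end Auter

namespace Auter

/-! ### Rotation-invariant flags of forests -/

namespace PGraph

/-- A forest contains no closed sequence of edges without backtracking. -/
theorem IsForest.false_of_cycle {G : PGraph} {F : Set G.D} (hF : G.IsForest F) (f : ℕ → G.D)
    (hf : ∀ n, f n ∈ F) (hsrc : ∀ n, G.src (G.inv (f n)) = G.src (f (n + 1)))
    (hred : ∀ n, f (n + 1) ≠ G.inv (f n)) {m : ℕ} (hm : m ≠ 0) (hper : f m = f 0) : False := by
  have hwalk : ∀ m a, G.IsWalk (G.src (f a)) ((List.range' a m).map f) (G.src (f (a + m))) := by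
    intro m
    induction m with
    | zero => exact fun a => rfl
    | succ m ih =>
      intro a
      rw [List.range'_succ, List.map_cons]
      refine ⟨rfl, ?_⟩
      rw [hsrc, show a + (m + 1) = a + 1 + m by omega]
      exact ih (a + 1)
  have hchain : ∀ m a, G.IsReduced ((List.range' a m).map f) := by
    intro m
    induction m with
    | zero => exact fun a => List.isChain_nil
    | succ m ih =>
      intro a
      cases m with
      | zero => exact List.isChain_singleton _
      | succ m => exact List.isChain_cons_cons.2 ⟨hred a, ih (a + 1)⟩
  have h := hwalk m 0
  rw [zero_add, hper] at h
  have h1 := congrArg List.length (hF.2 _ _ (by simp [hf]) h (hchain m 0))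
  simp at h1
  exact hm h1

variable {p : ℕ}

/-- The forests of a rotation invariant flag are determined by the classes of their edges. -/
theorem IsFlag.exists_classes [Fact p.Prime] {K V : Type} {s t : K × ZMod p → V} {base : V}
    {𝓕 : Set (Set (ofEdges V (K × ZMod p) s t base).D)}
    (h : IsFlag (ofEdges V (K × ZMod p) s t base) 𝓕)
    (hrot : ∀ F ∈ 𝓕, ∀ k j b, ((k, j + 1), b) ∈ F ↔ ((k, j), b) ∈ F) :
    ∃ T : Set (Set K), 𝓕 = edgesOf p '' T ∧ ∅ ∈ T ∧ IsChain (· ⊆ ·) T ∧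
      ∀ S ∈ T, (ofEdges V (K × ZMod p) s t base).IsForest (edgesOf p S) := by
  have hF : ∀ F ∈ 𝓕, F = edgesOf p {k | ((k, 0), false) ∈ F} := by
    intro F hF
    have h1 : ∀ k (n : ℕ) b, ((k, (n : ZMod p)), b) ∈ F ↔ ((k, 0), b) ∈ F := by
      intro k n b
      induction n with
      | zero => rw [Nat.cast_zero]
      | succ n ih => rw [Nat.cast_succ, hrot F hF, ih]
    have h2 : ∀ k j b, ((k, j), b) ∈ F ↔ ((k, 0), b) ∈ F := by
      intro k j b
      have := h1 k j.val b
      rwa [ZMod.natCast_zmod_val] at this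
    ext ⟨⟨k, j⟩, b⟩
    refine (h2 k j b).trans ?_
    cases b
    · exact Iff.rfl
    · exact ⟨fun h' => (h.2.1 F hF).1 _ h', fun h' => (h.2.1 F hF).1 _ h'⟩
  have hmono : ∀ S S' : Set K, edgesOf p S ⊆ edgesOf p S' → S ⊆ S' := fun S S' h' k hk =>
    @h' ((k, 0), false) hk
  refine ⟨{S | edgesOf p S ∈ 𝓕}, ?_, ?_, ?_, fun S hS => h.2.1 _ hS⟩
  · ext F
    constructor
    · intro h'
      refine ⟨_, ?_, (hF F h').symm⟩
      change edgesOf p _ ∈ 𝓕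
      rwa [← hF F h']
    · rintro ⟨S, hS, rfl⟩
      exact hS
  · have h1 : edgesOf p (∅ : Set K) = ∅ := rfl
    change edgesOf p (∅ : Set K) ∈ 𝓕
    rw [h1]
    exact h.1
  · intro S hS S' hS' hne
    rcases h.2.2.total hS hS' with h' | h'
    · exact Or.inl (hmono _ _ h')
    · exact Or.inr (hmono _ _ h')

/-- A chain of sets with at most two elements. -/
theorem chain_cases {K : Type} [Finite K] {T : Set (Set K)} (h0 : ∅ ∈ T) (hT : IsChain (· ⊆ ·) T)
    (P : K → K → Prop) (hP : ∀ S ∈ T, ∃ k l, P k l ∧ S ⊆ {k, l}) :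
    ∃ k l, P k l ∧ (T = {∅} ∨ T = {∅, {k}} ∨ T = {∅, {l}} ∨ T = {∅, {k, l}} ∨
      T = {∅, {k}, {k, l}} ∨ T = {∅, {l}, {k, l}}) := by
  obtain ⟨M, hM⟩ := Set.Finite.exists_maximal (Set.toFinite T) ⟨_, h0⟩
  have hmax : ∀ S ∈ T, S ⊆ M := fun S hS => by
    rcases hT.total hS hM.1 with h | h
    · exact h
    · exact hM.2 hS h
  obtain ⟨k, l, hkl, hMkl⟩ := hP M hM.1
  refine ⟨k, l, hkl, ?_⟩
  have hsub : ∀ S ∈ T, S = ∅ ∨ S = {k} ∨ S = {l} ∨ S = {k, l} := fun S hS =>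
    Set.subset_pair_iff_eq.1 ((hmax S hS).trans hMkl)
  have hchain : {k} ∈ T → {l} ∈ T → k = l := fun hk hl => by
    rcases hT.total hk hl with h | h
    · simpa using h
    · simpa [eq_comm] using h
  have key : ∀ T' : Set (Set K), (∀ S ∈ T', S ∈ T) →
      (∀ S ∈ T, S = ∅ ∨ S = {k} ∨ S = {l} ∨ S = {k, l} → S ∈ T') → T = T' := fun T' h h' =>
    Set.Subset.antisymm (fun S hS => h' S hS (hsub S hS)) h
  by_cases hk : {k} ∈ T <;> by_cases hl : {l} ∈ T
  · obtain rfl := hchain hk hl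
    refine Or.inr (Or.inl (key _ (by simp [h0, hk]) ?_))
    rintro S - (rfl | rfl | rfl | rfl) <;> simp
  · by_cases h2 : {k, l} ∈ T
    · refine Or.inr (Or.inr (Or.inr (Or.inr (Or.inl (key _ (by simp [h0, hk, h2]) ?_)))))
      rintro S hS (rfl | rfl | rfl | rfl) <;> first | exact absurd hS hl | simp
    · refine Or.inr (Or.inl (key _ (by simp [h0, hk]) ?_))
      rintro S hS (rfl | rfl | rfl | rfl) <;>
        first | exact absurd hS hl | exact absurd hS h2 | simp
  · by_cases h2 : {k, l} ∈ T
    · refine Or.inr (Or.inr (Or.inr (Or.inr (Or.inr (key _ (by simp [h0, hl, h2]) ?_)))))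
      rintro S hS (rfl | rfl | rfl | rfl) <;> first | exact absurd hS hk | simp
    · refine Or.inr (Or.inr (Or.inl (key _ (by simp [h0, hl]) ?_)))
      rintro S hS (rfl | rfl | rfl | rfl) <;>
        first | exact absurd hS hk | exact absurd hS h2 | simp
  · by_cases h2 : {k, l} ∈ T
    · refine Or.inr (Or.inr (Or.inr (Or.inl (key _ (by simp [h0, h2]) ?_))))
      rintro S hS (rfl | rfl | rfl | rfl) <;>
        first | exact absurd hS hk | exact absurd hS hl | simp
    · refine Or.inl (key _ (by simp [h0]) ?_)
      rintro S hS (rfl | rfl | rfl | rfl) <;>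
        first | exact absurd hS hk | exact absurd hS hl | exact absurd hS h2 | simp

theorem IsForest.eq_nil {K V : Type} {s t : K × ZMod p → V} {base : V} {S : Set K}
    (h : (ofEdges V (K × ZMod p) s t base).IsForest (edgesOf p S)) (v : V)
    (l : List ((K × ZMod p) × Bool)) (hl : ∀ d ∈ l, d.1.1 ∈ S)
    (hw : (ofEdges V (K × ZMod p) s t base).IsWalk v l v)
    (hr : l.IsChain fun d e => e ≠ (d.1, !d.2)) : l = [] :=
  h.2 v l hl hw hr

/-- A forest contains neither the rim nor both classes of spokes. -/
theorem isForest_upsilon [Fact p.Prime] {S : Set UpsilonEdge}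
    (h : (Upsilon p).IsForest (edgesOf p S)) : .rim ∉ S ∧ ¬ (.left ∈ S ∧ .right ∈ S) := by
  constructor
  · intro hr
    refine h.false_of_cycle (fun n => ((.rim, (n : ZMod p)), false)) (fun n => hr)
      (fun n => congrArg Sum.inr (Nat.cast_succ n).symm)
      (fun n h => Bool.false_ne_true (congrArg Prod.snd h)) (Fact.out : p.Prime).ne_zero
      (congrArg (fun j : ZMod p => ((UpsilonEdge.rim, j), false))
        ((ZMod.natCast_self p).trans Nat.cast_zero.symm))
  · rintro ⟨hl, hr⟩
    have h1 := IsForest.eq_nil h (.inl false) [((.left, 0), false), ((.right, 0), true), ((.right, 1), false),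
      ((.left, 1), true)] (by simp [hl, hr]) ⟨rfl, rfl, rfl, rfl, rfl⟩
      (by simp)
    simp at h1

theorem isForest_upsilonOne [Fact p.Prime] {S : Set UpsilonOneEdge}
    (h : (UpsilonOne p).IsForest (edgesOf p S)) : .rim ∉ S ∧ ¬ (.left ∈ S ∧ .right ∈ S) := by
  constructor
  · intro hr
    refine h.false_of_cycle (fun n => ((.rim, (n : ZMod p)), false)) (fun n => hr)
      (fun n => congrArg (fun i => Sum.inr (false, i)) (Nat.cast_succ n).symm)
      (fun n h => Bool.false_ne_true (congrArg Prod.snd h)) (Fact.out : p.Prime).ne_zero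
      (congrArg (fun j : ZMod p => ((UpsilonOneEdge.rim, j), false))
        ((ZMod.natCast_self p).trans Nat.cast_zero.symm))
  · rintro ⟨hl, hr⟩
    have h1 := IsForest.eq_nil h (.inl false) [((.left, 0), false), ((.right, 0), true), ((.right, 1), false),
      ((.left, 1), true)] (by simp [hl, hr]) ⟨rfl, rfl, rfl, rfl, rfl⟩
      (by simp)
    simp at h1

theorem isForest_upsilonTwo [Fact p.Prime] {S : Set UpsilonTwoEdge}
    (h : (UpsilonTwo p).IsForest (edgesOf p S)) : ¬ (.rimA ∈ S ∧ .rimB ∈ S) ∧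
      ¬ (.left ∈ S ∧ .right ∈ S ∧ .rimA ∈ S) ∧ ¬ (.left ∈ S ∧ .right ∈ S ∧ .rimB ∈ S) := by
  refine ⟨?_, ?_, ?_⟩
  · rintro ⟨ha, hb⟩
    let f : ℕ → (UpsilonTwoEdge × ZMod p) × Bool := fun n =>
      ((if n % 2 = 0 then .rimA else .rimB, ((n / 2 : ℕ) : ZMod p)), false)
    refine IsForest.false_of_cycle h f (fun n => ?_) (fun n => ?_)
      (fun n h => Bool.false_ne_true (congrArg Prod.snd h)) (m := 2 * p)
      (by have := (Fact.out : p.Prime).pos; omega) (show f (2 * p) = f 0 by simp [f])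
    · change (if n % 2 = 0 then UpsilonTwoEdge.rimA else .rimB) ∈ S
      split_ifs <;> assumption
    · rcases Nat.even_or_odd' n with ⟨k, rfl | rfl⟩
      · have h1 : f (2 * k) = ((.rimA, (k : ZMod p)), false) := by simp [f]
        have h2 : f (2 * k + 1) = ((.rimB, (k : ZMod p)), false) := by
          simp [f, show (2 * k + 1) / 2 = k by omega]
        rw [h1, h2]
        rfl
      · have h1 : f (2 * k + 1 + 1) = ((.rimA, (k + 1 : ZMod p)), false) := by
          simp [f, show (2 * k + 1 + 1) / 2 = k + 1 by omega,
            show (2 * k + 1 + 1) % 2 = 0 by omega]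
        have h2 : f (2 * k + 1) = ((.rimB, (k : ZMod p)), false) := by
          simp [f, show (2 * k + 1) / 2 = k by omega]
        rw [h1, h2]
        rfl
  · rintro ⟨hl, hr, ha⟩
    have h1 := IsForest.eq_nil h (.inl false) [((.left, 0), false), ((.rimA, 0), false), ((.right, 0), true),
      ((.right, 1), false), ((.rimA, 1), true), ((.left, 1), true)]
      (by simp [hl, hr, ha]) ⟨rfl, rfl, rfl, rfl, rfl, rfl, rfl⟩
      (by simp)
    simp at h1
  · rintro ⟨hl, hr, ha⟩
    have h1 := IsForest.eq_nil h (.inl false) [((.left, (0 + 1)), false), ((.rimB, 0), true), ((.right, 0), true),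
      ((.right, 1), false), ((.rimB, 1), false), ((.left, 1 + 1), true)]
      (by simp [hl, hr, ha]) ⟨rfl, rfl, rfl, rfl, rfl, rfl, rfl⟩
      (by simp)
    simp at h1

end PGraph

open PGraph

section Lists

variable {p : ℕ} [Fact p.Prime] {n : ℕ} {σ : Set (SpineVertex n)}

/-- The list of rotation-invariant flags in `Υ`; all forests consist of edges of at most one class. -/
theorem inDihedralList_of_upsilon {𝓕 : Set (Set (Upsilon p).D)}
    (hσ : IsSimplexOfFlag (Upsilon p) 𝓕 σ)
    (hrot : ∀ F ∈ 𝓕, ∀ k j b, ((k, j + 1), b) ∈ F ↔ ((k, j), b) ∈ F) : InDihedralList p σ := by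
  obtain ⟨T, rfl, h0, hT, hF⟩ := IsFlag.exists_classes hσ.2.1 hrot
  refine Or.inl ⟨T, ?_, hσ⟩
  obtain ⟨k, l, hkl, h⟩ := chain_cases h0 hT (fun k l => k = l ∧ (k = .left ∨ k = .right)) (by
    intro S hS
    obtain ⟨h1, h2⟩ := isForest_upsilon (hF S hS)
    by_cases hl : .left ∈ S
    · refine ⟨.left, .left, by simp, fun c hc => ?_⟩
      cases c <;> simp_all
    · refine ⟨.right, .right, by simp, fun c hc => ?_⟩
      cases c <;> simp_all)
  rcases hkl with ⟨rfl, rfl | rfl⟩ <;> rcases h with rfl | rfl | rfl | rfl | rfl | rfl <;>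
    simp [upsilonFlags]

theorem inDihedralList_of_upsilonOne {𝓕 : Set (Set (UpsilonOne p).D)}
    (hσ : IsSimplexOfFlag (UpsilonOne p) 𝓕 σ)
    (hrot : ∀ F ∈ 𝓕, ∀ k j b, ((k, j + 1), b) ∈ F ↔ ((k, j), b) ∈ F) : InDihedralList p σ := by
  obtain ⟨T, rfl, h0, hT, hF⟩ := IsFlag.exists_classes hσ.2.1 hrot
  refine Or.inr (Or.inl ⟨T, ?_, hσ⟩)
  obtain ⟨k, l, hkl, h⟩ := chain_cases h0 hT
    (fun k l => k = .stem ∧ (l = .left ∨ l = .right)) (by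
    intro S hS
    obtain ⟨h1, h2⟩ := isForest_upsilonOne (hF S hS)
    by_cases hl : .left ∈ S
    · refine ⟨.stem, .left, by simp, fun c hc => ?_⟩
      cases c <;> simp_all
    · refine ⟨.stem, .right, by simp, fun c hc => ?_⟩
      cases c <;> simp_all)
  rcases hkl with ⟨rfl, rfl | rfl⟩ <;> rcases h with rfl | rfl | rfl | rfl | rfl | rfl <;>
    simp [upsilonOneFlags]

/-- The reflection of `Υ²`. -/
theorem exists_reflection_upsilonTwo : ∃ i : Iso (UpsilonTwo p) (UpsilonTwo p),
    (∀ j b, i.onD ((.rimA, j), b) = ((.rimB, -j - 1), !b)) ∧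
    (∀ j b, i.onD ((.rimB, j), b) = ((.rimA, -j - 1), !b)) ∧
    (∀ j b, i.onD ((.left, j), b) = ((.left, -j), b)) ∧
    (∀ j b, i.onD ((.right, j), b) = ((.right, -j - 1), b)) := by
  have : Finite (UpsilonTwo p).D := inferInstanceAs (Finite ((UpsilonTwoEdge × ZMod p) × Bool))
  let fV : (UpsilonTwo p).V → (UpsilonTwo p).V :=
    fun | .inl b => .inl b | .inr (false, j) => .inr (false, -j) | .inr (true, j) => .inr (true, -j - 1)
  have hfV : Function.Involutive fV := by
    rintro (b | ⟨_ | _, j⟩)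
    · rfl
    · exact congrArg (fun j => Sum.inr (false, j)) (neg_neg j)
    · exact congrArg (fun j => Sum.inr (true, j)) (show - (-j - 1) - 1 = j by ring)
  obtain ⟨i, hi⟩ := exists_iso_of_isSimple isSimple_upsilonTwo fV hfV.bijective
    (fun | ((.rimA, j), b) => ((.rimB, -j - 1), !b) | ((.rimB, j), b) => ((.rimA, -j - 1), !b)
         | ((.left, j), b) => ((.left, -j), b) | ((.right, j), b) => ((.right, -j - 1), b))
    (by
      rintro ⟨⟨_ | _ | _ | _, j⟩, _ | _⟩
      · exact congrArg (fun j => Sum.inr (false, j)) (show -j - 1 + 1 = -j by ring)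
      · rfl
      · rfl
      · exact congrArg (fun j => Sum.inr (false, j)) (show -j - 1 = -(j + 1) by ring)
      all_goals rfl)
    (by rintro ⟨⟨_ | _ | _ | _, j⟩, _ | _⟩ <;> rfl) rfl rfl
  exact ⟨i, fun j b => hi _, fun j b => hi _, fun j b => hi _, fun j b => hi _⟩

/-- The rotation-invariant flags in `Υ²`, up to the reflection that exchanges the two classes of rim
edges. -/
theorem inDihedralList_of_upsilonTwo {𝓕 : Set (Set (UpsilonTwo p).D)}
    (hσ : IsSimplexOfFlag (UpsilonTwo p) 𝓕 σ)
    (hrot : ∀ F ∈ 𝓕, ∀ k j b, ((k, j + 1), b) ∈ F ↔ ((k, j), b) ∈ F) : InDihedralList p σ := by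
  -- the reflection moves the flag to one without edges of class `rimB`
  suffices H : ∀ T : Set (Set UpsilonTwoEdge), IsSimplexOfFlag (UpsilonTwo p) (edgesOf p '' T) σ →
      ∅ ∈ T → IsChain (· ⊆ ·) T → (∀ S ∈ T, (UpsilonTwo p).IsForest (edgesOf p S)) →
      (∀ S ∈ T, .rimB ∉ S) → InDihedralList p σ by
    obtain ⟨T, rfl, h0, hT, hF⟩ := IsFlag.exists_classes hσ.2.1 hrot
    by_cases hB : ∀ S ∈ T, .rimB ∉ S
    · exact H T hσ h0 hT hF hB
    · push Not at hB
      obtain ⟨S₀, hS₀, hB⟩ := hB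
      have hA : ∀ S ∈ T, .rimA ∉ S := fun S hS hA => by
        rcases hT.total hS hS₀ with h | h
        · exact (isForest_upsilonTwo (hF _ hS₀)).1 ⟨h hA, hB⟩
        · exact (isForest_upsilonTwo (hF _ hS)).1 ⟨hA, h hB⟩
      obtain ⟨i, h1, h2, h3, h4⟩ := exists_reflection_upsilonTwo (p := p)
      let τ : UpsilonTwoEdge → UpsilonTwoEdge :=
        fun | .rimA => .rimB | .rimB => .rimA | .left => .left | .right => .right
      have hτ : ∀ k, τ (τ k) = k := by rintro (_ | _ | _ | _) <;> rfl
      have hiτ : ∀ d : (UpsilonTwo p).D, (i.onD d).1.1 = τ d.1.1 := by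
        rintro ⟨⟨_ | _ | _ | _, j⟩, b⟩
        exacts [congrArg (·.1.1) (h1 j b), congrArg (·.1.1) (h2 j b), congrArg (·.1.1) (h3 j b),
          congrArg (·.1.1) (h4 j b)]
      have himg : ∀ S : Set UpsilonTwoEdge, i.onD '' (edgesOf p S) = edgesOf p (τ ⁻¹' S) := by
        intro S
        ext d
        constructor
        · rintro ⟨d', hd', rfl⟩
          change τ (i.onD d').1.1 ∈ S
          rw [hiτ, hτ]
          exact hd'
        · intro hd
          refine ⟨i.onD.symm d, ?_, i.onD.apply_symm_apply d⟩
          have h5 := hiτ (i.onD.symm d)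
          rw [Equiv.apply_symm_apply] at h5
          change (i.onD.symm d).1.1 ∈ S
          rw [← hτ (i.onD.symm d).1.1, ← h5]
          exact hd
      have hσ' := hσ.map i
      have hTi : (fun F => i.onD '' F) '' (edgesOf p '' T) = edgesOf p '' ((τ ⁻¹' ·) '' T) := by
        exact (Set.image_image _ _ _).trans
          ((Set.image_congr fun S _ => himg S).trans (Set.image_image _ _ _).symm)
      replace hσ' : IsSimplexOfFlag (UpsilonTwo p) (edgesOf p '' ((τ ⁻¹' ·) '' T)) σ :=
        (congrArg (fun X => IsSimplexOfFlag (UpsilonTwo p) X σ) hTi).mp hσ'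
      refine H _ hσ' ⟨∅, h0, rfl⟩ ?_ ?_ ?_
      · rintro _ ⟨S, hS, rfl⟩ _ ⟨S', hS', rfl⟩ -
        rcases hT.total hS hS' with h | h
        · exact Or.inl (Set.preimage_mono h)
        · exact Or.inr (Set.preimage_mono h)
      · rintro _ ⟨S, hS, rfl⟩
        exact hσ'.2.1.2.1 _ ⟨_, ⟨S, hS, rfl⟩, rfl⟩
      · rintro _ ⟨S, hS, rfl⟩
        exact hA S hS
  intro T hσ h0 hT hF hB
  refine Or.inr (Or.inr ⟨T, ?_, hσ⟩)
  obtain ⟨k, l, hkl, h⟩ := chain_cases h0 hT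
    (fun k l => k = .rimA ∧ (l = .left ∨ l = .right) ∨ k = .left ∧ l = .right) (by
    intro S hS
    obtain ⟨h1, h2, h3⟩ := isForest_upsilonTwo (hF S hS)
    have h4 := hB S hS
    by_cases hl : .left ∈ S
    · by_cases hr : .right ∈ S
      · refine ⟨.left, .right, by simp, fun c hc => ?_⟩
        cases c <;> simp_all
      · refine ⟨.rimA, .left, by simp, fun c hc => ?_⟩
        cases c <;> simp_all
    · refine ⟨.rimA, .right, by simp, fun c hc => ?_⟩
      cases c <;> simp_all)
  rcases hkl with ⟨rfl, rfl | rfl⟩ | ⟨rfl, rfl⟩ <;>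
    rcases h with rfl | rfl | rfl | rfl | rfl | rfl <;>
    simp [upsilonTwoDihedralFlags, upsilonTwoCyclicFlags]

/-- Transport of rotation invariant flags to a model graph. -/
theorem mem_image_symm_iff {K V : Type} {s t : K × ZMod p → V} {base : V} {G : PGraph}
    {𝓕 : Set (Set G.D)} {y : Iso G G} (hy : y ∈ flagAut G 𝓕)
    (i : Iso (ofEdges V (K × ZMod p) s t base) G)
    (hi : ∀ k j b, i.onD ((k, j + 1), b) = y.onD (i.onD ((k, j), b))) :
    ∀ F ∈ (fun F => i.symm.onD '' F) '' 𝓕, ∀ k j b, ((k, j + 1), b) ∈ F ↔ ((k, j), b) ∈ F := by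
  rintro _ ⟨F, hF, rfl⟩ k j b
  have key : ∀ d, d ∈ i.symm.onD '' F ↔ i.onD d ∈ F := fun d =>
    ⟨by rintro ⟨d', h, rfl⟩; change i.onD (i.onD.symm d') ∈ F; rwa [Equiv.apply_symm_apply],
      fun h => ⟨_, h, i.onD.symm_apply_apply d⟩⟩
  have h := mem_flagAut.1 hy F hF (i.onD ((k, j), b))
  rw [← hi] at h
  exact (key _).trans (h.trans (key _).symm)

end Lists

end Auter

namespace Auter

/-! ### Simplices with a nontrivial contribution in degree four -/

open PGraph CategoryTheory CategoryTheory.Limits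

variable {p : ℕ} [Fact p.Prime]

theorem nonempty_iso_zloc {H S : Type} [Group H] [Group S] (e : H ≃* S) (n : ℕ) :
    Nonempty (groupCohomology (Rep.trivial (ZLoc p) S (ZLoc p)) n ≅
      groupCohomology (Rep.trivial (ZLoc p) H (ZLoc p)) n) := by
  rw [Rep.trivial, Rep.trivial, trivial_eq_chRep, trivial_eq_chRep]
  exact nonempty_iso_of_mulEquiv e 1 n

variable {n : ℕ} {G : PGraph} {𝓕 : Set (Set G.D)} {σ : Set (SpineVertex n)}

/-- The contribution of a simplex is determined by the automorphisms of its graph that preserve the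
flag. -/
theorem IsSimplexOfFlag.contributesOneCopy_iff (h : IsSimplexOfFlag G 𝓕 σ) (s : ℕ) :
    ContributesOneCopy p σ s ↔
      Nonempty (groupCohomology (Rep.trivial (ZLoc p) (flagAut G 𝓕) (ZLoc p)) s ≃+ ZMod p) := by
  obtain ⟨e⟩ := h.nonempty_mulEquiv
  obtain ⟨i⟩ := nonempty_iso_zloc (p := p) e s
  have j := i.toLinearEquiv.toAddEquiv
  exact ⟨fun ⟨f⟩ => ⟨j.symm.trans f⟩, fun ⟨f⟩ => ⟨j.trans f⟩⟩

theorem not_nonempty_of_isZero {M : ModuleCat (ZLoc p)} (h : IsZero M) : ¬ Nonempty (M ≃+ ZMod p) := by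
  rintro ⟨e⟩
  have := ModuleCat.subsingleton_of_isZero h
  have h1 : e.symm 1 = e.symm 0 := Subsingleton.elim _ _
  exact one_ne_zero (e.symm.injective h1)

theorem IsSimplexOfFlag.inSingularLocus_iff (h : IsSimplexOfFlag G 𝓕 σ) :
    InSingularLocus p σ ↔ ∃ y ∈ flagAut G 𝓕, orderOf y = p := by
  obtain ⟨e⟩ := h.nonempty_mulEquiv
  constructor
  · rintro ⟨g, hg, ho⟩
    refine ⟨e.symm ⟨g, hg⟩, (e.symm ⟨g, hg⟩).2, ?_⟩
    rw [Subgroup.orderOf_coe, MulEquiv.orderOf_eq, Subgroup.orderOf_mk, ho]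
  · rintro ⟨y, hy, ho⟩
    refine ⟨e ⟨y, hy⟩, (e ⟨y, hy⟩).2, ?_⟩
    rw [Subgroup.orderOf_coe, MulEquiv.orderOf_eq, Subgroup.orderOf_mk, ho]

open Classical in
/-- A simplex with a nontrivial contribution in degree four belongs to one of the lists. -/
theorem inList_of_symmetry (h5 : 5 ≤ p) {σ : Set (SpineVertex (2 * p - 1))}
    (h : HasAtMostDihedralSymmetry p σ) : InDihedralList p σ ∨ HasWheelWedgeForm p σ := by
  have hp := (Fact.out : p.Prime)
  have h2 : p ≠ 2 := by omega
  obtain ⟨G, 𝓕, hσ⟩ := h.1.exists_flag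
  have hG := hσ.1
  have hc : Nat.card G.D + 4 = 2 * Nat.card G.V + 4 * p := by
    obtain ⟨-, -, φ, -⟩ := hσ
    have := hG.card_D φ
    omega
  have := hG.finite_D
  have := hG.finite_V
  have := hG.finite_iso
  have := Fintype.ofFinite G.D
  have := Fintype.ofFinite G.V
  obtain ⟨y, hy, ho⟩ := hσ.inSingularLocus_iff.1 h.2.1
  have hS : p ∣ Nat.card (flagAut G 𝓕) := by
    have := orderOf_dvd_natCard (⟨y, hy⟩ : flagAut G 𝓕)
    rwa [Subgroup.orderOf_mk, ho] at this
  obtain ⟨P, z, hz1, hz, hP, hPo⟩ := hG.exists_generic h5 hc _ hS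
  have hz' : z.1 ^ p = 1 := congrArg Subtype.val hz
  have hz1' : z.1 ≠ 1 := fun h => hz1 (Subtype.ext h)
  -- an untwisted rotation would make the cohomology in degree four vanish
  have htw : ¬ IsUntwisted p z.1 := by
    rintro ⟨f, hf, hfd⟩
    obtain ⟨E, V, s, hE, -, -, ht, hs, hk⟩ := hG.orbit_numbers h5 hc hz' hz1'
    have h3 := (hσ.contributesOneCopy_iff 4).1 (h.2.2 1 (by omega) (by omega))
    refine not_nonempty_of_isZero (hG.isZero_of_untwisted h2 _ (isOrbitClosed_flagAut 𝓕) P hz1 hz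
      hP hPo f hf hfd (m := 4) (n := 3) ?_ ?_) h3
    · have h4 : Nat.card {d // z.1.onD d ≠ d} = 2 * p * E := by
        rw [Nat.card_eq_fintype_card, Fintype.card_subtype, ← hE]
        congr 1
        ext d
        simp [moves_zpowers_iff]
      rw [h4]
      exact Nat.mul_le_mul_left _ (by omega)
    · intro j h6 h7 h8
      have := Nat.le_of_dvd (by omega) h8
      omega
  obtain ⟨t, ht, hcl⟩ := hG.classify h5 hc hz' hz1' htw
  have hyF : z.1 ^ t.val ∈ flagAut G 𝓕 := pow_mem z.2 _
  rcases hcl with ⟨x, r, e, hw⟩ | ⟨i, hi⟩ | ⟨i, hi⟩ | ⟨i, hi⟩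
  · exact Or.inr (hasWheelWedgeForm_of_isWheel h5 hσ hc (pow_val_pow hz' t) hyF hw)
  · exact Or.inl (inDihedralList_of_upsilon (hσ.map i.symm) (mem_image_symm_iff hyF i hi))
  · exact Or.inl (inDihedralList_of_upsilonOne (hσ.map i.symm) (mem_image_symm_iff hyF i hi))
  · exact Or.inl (inDihedralList_of_upsilonTwo (hσ.map i.symm) (mem_image_symm_iff hyF i hi))

end Auter

namespace Auter

/-! ### Stabilizers that act on a `p`-gon -/

open PGraph CategoryTheory CategoryTheory.Limits

variable {p : ℕ} [Fact p.Prime]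

/-- Permutations of the vertices of the `p`-gon that preserve adjacency are affine. -/
theorem exists_sign (h2 : p ≠ 2) {S : Type} [Group S] (A : S →* Equiv.Perm (ZMod p))
    (h : ∀ g i, A g (i + 1) - A g i = 1 ∨ A g (i + 1) - A g i = -1) :
    ∃ ε : S →* ℤˣ, ∀ g x y, A g x - A g y = ((ε g : ℤ) : ZMod p) * (x - y) := by
  have hstep : ∀ g i, A g (i + 1 + 1) - A g (i + 1) = A g (i + 1) - A g i := by
    intro g i
    have hne : A g (i + 1 + 1) ≠ A g i := fun h' =>
      add_one_add_one_ne h2 i ((A g).injective h')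
    rcases h g i with h1 | h1 <;> rcases h g (i + 1) with h3 | h3
    · rw [h1, h3]
    · exact absurd (by linear_combination h1 + h3) hne
    · exact absurd (by linear_combination h1 + h3) hne
    · rw [h1, h3]
  have hlin : ∀ g (n : ℕ), A g (n + 1) - A g n = A g 1 - A g 0 ∧
      A g n - A g 0 = (A g 1 - A g 0) * n := by
    intro g n
    induction n with
    | zero => simp
    | succ n ih =>
      rw [Nat.cast_succ, hstep, ih.1]
      exact ⟨rfl, by linear_combination ih.1 + ih.2⟩
  have hex : ∀ g, ∃ s : ℤˣ, ((s : ℤ) : ZMod p) = A g 1 - A g 0 := by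
    intro g
    rcases h g 0 with h1 | h1 <;> rw [zero_add] at h1
    · exact ⟨1, by rw [h1]; simp⟩
    · exact ⟨-1, by rw [h1]; simp⟩
  choose ε hε using hex
  have hA : ∀ g x y, A g x - A g y = ((ε g : ℤ) : ZMod p) * (x - y) := by
    intro g x y
    have h1 := (hlin g x.val).2
    have h3 := (hlin g y.val).2
    rw [ZMod.natCast_zmod_val] at h1 h3
    rw [hε]
    linear_combination h1 - h3
  have hinj : Function.Injective fun s : ℤˣ => ((s : ℤ) : ZMod p) := by
    intro s s' hs
    have h3 := two_ne_zero_zmod h2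
    rcases Int.units_eq_one_or s with rfl | rfl <;> rcases Int.units_eq_one_or s' with rfl | rfl
    · rfl
    · exact absurd (by simp at hs; linear_combination hs) h3
    · exact absurd (by simp at hs; linear_combination -hs) h3
    · rfl
  refine ⟨MonoidHom.mk' ε fun g g' => hinj ?_, hA⟩
  have h1 := hA (g * g') 1 0
  rw [map_mul, Equiv.Perm.mul_apply, Equiv.Perm.mul_apply, hA g, hA g'] at h1
  simp only [Units.val_mul, Int.cast_mul]
  linear_combination -h1

namespace PGraph

variable {G : PGraph}

/-- A group that permutes the vertices `x j` acts on the index set. -/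
theorem exists_rim_action {S : Subgroup (Iso G G)} {x : ZMod p → G.V} (hx : Function.Injective x)
    (h : ∀ g ∈ S, ∀ j, ∃ j', g.onV (x j) = x j') :
    ∃ A : S →* Equiv.Perm (ZMod p), ∀ g j, x (A g j) = g.1.onV (x j) := by
  choose! f hf using h
  have hfi : ∀ g : S, Function.Injective (f g.1) := fun g i j hij => by
    have h1 := hf g.1 g.2 i
    rw [hij, ← hf g.1 g.2 j] at h1
    exact hx (g.1.onV.injective h1)
  refine ⟨MonoidHom.mk' (fun g => Equiv.ofBijective (f g.1) (Finite.injective_iff_bijective.1 (hfi g)))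
    fun g g' => Equiv.ext fun j => hx ?_, fun g j => (hf g.1 g.2 j).symm⟩
  change x (f (g.1 * g'.1) j) = x (f g.1 (f g'.1 j))
  rw [← hf _ (mul_mem g.2 g'.2), ← hf g.1 g.2, ← hf g'.1 g'.2]
  rfl

/-- The automorphisms in `S` that fix the vertices `x j`. -/
def fixing (S : Subgroup (Iso G G)) (x : ZMod p → G.V) : Subgroup (Iso G G) where
  carrier := {g | g ∈ S ∧ ∀ j, g.onV (x j) = x j}
  one_mem' := ⟨one_mem S, fun j => rfl⟩
  mul_mem' := fun {g g'} h h' => ⟨mul_mem h.1 h'.1, fun j => by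
    rw [Iso.mul_onV, h'.2, h.2]⟩
  inv_mem' := fun {g} h => ⟨inv_mem h.1, fun j => by
    apply g.onV.injective
    rw [← Iso.mul_onV, mul_inv_cancel, h.2]
    rfl⟩

end PGraph

/-- The symmetry of a simplex whose stabilizer acts on a `p`-gon by rotations and possibly
reflections, where the pointwise stabilizer of the `p`-gon is negligible. -/
theorem IsSimplexOfFlag.symmetry {n : ℕ} {G : PGraph} {𝓕 : Set (Set G.D)} {σ : Set (SpineVertex n)}
    (hσ : IsSimplexOfFlag G 𝓕 σ) (h2 : p ≠ 2) {x : ZMod p → G.V} (hx : Function.Injective x)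
    (hS : ∀ g ∈ flagAut G 𝓕, ∀ j, ∃ j', g.onV (x j) = x j')
    (hadj : ∀ g ∈ flagAut G 𝓕, ∀ j k l, g.onV (x j) = x k → g.onV (x (j + 1)) = x l →
      l - k = 1 ∨ l - k = -1)
    {y : Iso G G} (hyS : y ∈ flagAut G 𝓕) (hy : y ^ p = 1) (hyx : ∀ j, y.onV (x j) = x (j + 1))
    (hK : ∀ n, n ≠ 0 → n < 2 * (p - 1) → IsZero (groupCohomology
      (Rep.trivial (ZLoc p) (fixing (flagAut G 𝓕) x) (ZLoc p)) n)) :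
    HasAtMostDihedralSymmetry p σ ∧
    ((∀ g ∈ flagAut G 𝓕, g.onV (x 0) = x 0 → g.onV (x 1) = x 1) → HasExactlyCyclicSymmetry p σ) ∧
    (5 ≤ p → (∃ g ∈ flagAut G 𝓕, g.onV (x 0) = x 0 ∧ g.onV (x 1) = x (-1)) →
      ¬ HasExactlyCyclicSymmetry p σ) := by
  have := hσ.1.finite_iso
  obtain ⟨A, hA⟩ := exists_rim_action hx hS
  obtain ⟨ε, hε⟩ := exists_sign h2 A fun g i => hadj g.1 g.2 i _ _ (hA g i).symm (hA g _).symm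
  have hyA : A ⟨y, hyS⟩ = Equiv.addRight 1 := Equiv.ext fun j => hx (by rw [hA, hyx]; rfl)
  have hne : y ≠ 1 := by
    rintro rfl
    exact add_one_ne (0 : ZMod p) (hx (hyx 0).symm)
  have hsing : InSingularLocus p σ :=
    hσ.inSingularLocus_iff.2 ⟨y, hyS, orderOf_eq_prime hy hne⟩
  let e : A.ker ≃* fixing (flagAut G 𝓕) x :=
    { toFun := fun g => ⟨g.1.1, g.1.2, fun j => by
        rw [← hA, show A g.1 = 1 from g.2, Equiv.Perm.one_apply]⟩
      invFun := fun g => ⟨⟨g.1, g.2.1⟩, Equiv.ext fun j => hx (by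
        rw [hA, Equiv.Perm.one_apply]; exact g.2.2 j)⟩
      left_inv := fun g => rfl
      right_inv := fun g => rfl
      map_mul' := fun g g' => rfl }
  obtain ⟨h4, hc, hd⟩ := rim_zloc h2 A ε hε ⟨_, hyA⟩ (m := 2 * (p - 1)) (by
    intro n h0 hn
    obtain ⟨i⟩ := nonempty_iso_zloc (p := p) e.symm n
    exact (hK n h0 hn).of_iso i)
  refine ⟨⟨hσ.isSimplex, hsing, fun k h h' => (hσ.contributesOneCopy_iff _).2 (h4 k h h')⟩,
    fun h => ⟨hσ.isSimplex, hsing, fun k h0 h' => (hσ.contributesOneCopy_iff _).2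
      (hc (fun g => ?_) k h0 h')⟩, ?_⟩
  · -- a reflection composed with a rotation fixes the vertex with index zero
    by_contra hg
    have hg' := (Int.units_eq_one_or (ε g)).resolve_left hg
    let t : flagAut G 𝓕 := ⟨y, hyS⟩ ^ (-(A g 0)).val * g
    have hA' : ∀ (k : ℕ) j, A (⟨y, hyS⟩ ^ k) j = j + k := by
      intro k
      induction k with
      | zero => simp
      | succ k ih =>
        intro j
        rw [pow_succ', map_mul, Equiv.Perm.mul_apply, ih, hyA, Nat.cast_succ, ← add_assoc]
        rfl
    have ht : ∀ j, A t j = A g j - A g 0 := fun j => by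
      change A (_ * g) j = _
      rw [map_mul, Equiv.Perm.mul_apply, hA', ZMod.natCast_zmod_val, sub_eq_add_neg]
    have h0 : t.1.onV (x 0) = x 0 := by rw [← hA, ht, sub_self]
    have h1 := h t.1 t.2 h0
    rw [← hA, ht, hε, hg'] at h1
    have h3 := hx h1
    simp at h3
    exact two_ne_zero_zmod h2 (by linear_combination -h3)
  · rintro h5 ⟨g, hg, h0, h1⟩ hcyc
    refine not_nonempty_of_isZero (hd ⟨⟨g, hg⟩, ?_⟩ (by omega))
      ((hσ.contributesOneCopy_iff 2).1 (hcyc.2.2 1 (by omega) (by omega)))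
    rcases Int.units_eq_one_or (ε ⟨g, hg⟩) with h | h
    · have h3 := hε ⟨g, hg⟩ 1 0
      rw [hx ((hA ⟨g, hg⟩ 0).trans h0), hx ((hA ⟨g, hg⟩ 1).trans h1), h] at h3
      simp at h3
      exact absurd (by linear_combination -h3) (two_ne_zero_zmod h2)
    · exact h

end Auter

namespace Auter

/-! ### The symmetry of the simplices with graph `Υ` -/

open PGraph CategoryTheory CategoryTheory.Limits

variable {p : ℕ} [Fact p.Prime]

namespace PGraph

/-- Two vertices joined by an edge. -/
def Adjacent (G : PGraph) (v w : G.V) : Prop := ∃ d, G.src d = v ∧ G.src (G.inv d) = w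

variable {G : PGraph}

theorem Adjacent.map (g : Iso G G) {v w : G.V} (h : G.Adjacent v w) :
    G.Adjacent (g.onV v) (g.onV w) := by
  obtain ⟨d, rfl, rfl⟩ := h
  exact ⟨g.onD d, g.src_onD d, by rw [← g.onD_inv, g.src_onD]⟩

theorem adjacent_onV_iff (g : Iso G G) {v w : G.V} :
    G.Adjacent (g.onV v) (g.onV w) ↔ G.Adjacent v w := by
  refine ⟨fun h => ?_, fun h => h.map g⟩
  have h1 := h.map g⁻¹
  rwa [← Iso.mul_onV, ← Iso.mul_onV, inv_mul_cancel] at h1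

theorem IsSimple.eq_one (hM : G.IsSimple) (hG : G.Admissible) {g : Iso G G}
    (h : ∀ v, g.onV v = v) : g = 1 :=
  hG.iso_ext fun d => hM _ _ (by rw [g.src_onD, h]; rfl)
    (by rw [← g.onD_inv, g.src_onD, h]; rfl)

end PGraph

/-- The symmetry of a simplex with maximal vertex a simple graph whose automorphisms are determined
by their effect on a `p`-gon. -/
theorem IsSimplexOfFlag.symmetry_of_isSimple {n : ℕ} {G : PGraph} {𝓕 : Set (Set G.D)}
    {σ : Set (SpineVertex n)} (hσ : IsSimplexOfFlag G 𝓕 σ) (h2 : p ≠ 2) (hM : G.IsSimple)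
    {x : ZMod p → G.V} (hx : Function.Injective x)
    (hS : ∀ g : Iso G G, ∀ j, ∃ j', g.onV (x j) = x j')
    (hadj : ∀ (g : Iso G G) j k l, g.onV (x j) = x k → g.onV (x (j + 1)) = x l →
      l - k = 1 ∨ l - k = -1)
    (hfix : ∀ g : Iso G G, (∀ j, g.onV (x j) = x j) → ∀ v, g.onV v = v)
    {y : Iso G G} (hyS : y ∈ flagAut G 𝓕) (hyx : ∀ j, y.onV (x j) = x (j + 1)) :
    HasAtMostDihedralSymmetry p σ ∧
    ((∀ g ∈ flagAut G 𝓕, g.onV (x 0) = x 0 → g.onV (x 1) = x 1) → HasExactlyCyclicSymmetry p σ) ∧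
    (5 ≤ p → (∃ g ∈ flagAut G 𝓕, g.onV (x 0) = x 0 ∧ g.onV (x 1) = x (-1)) →
      ¬ HasExactlyCyclicSymmetry p σ) := by
  have := hσ.1.finite_iso
  have hone : ∀ g : Iso G G, (∀ j, g.onV (x j) = x j) → g = 1 := fun g h =>
    hM.eq_one hσ.1 (hfix g h)
  refine hσ.symmetry h2 hx (fun g _ => hS g) (fun g _ => hadj g) hyS (hone _ fun j => ?_) hyx ?_
  · have h1 : ∀ k : ℕ, (y ^ k).onV (x j) = x (j + k) := by
      intro k
      induction k with
      | zero => rw [pow_zero, Nat.cast_zero, add_zero]; rfl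
      | succ k ih => rw [pow_succ', Iso.mul_onV, ih, hyx, Nat.cast_succ, add_assoc]
    rw [h1, ZMod.natCast_self, add_zero]
  · intro n h0 _
    obtain ⟨n, rfl⟩ := Nat.exists_eq_succ_of_ne_zero h0
    have : Subsingleton (fixing (flagAut G 𝓕) x) := ⟨fun a b => Subtype.ext (by
      rw [hone a.1 a.2.2, hone b.1 b.2.2])⟩
    refine isZero_of_coprime (p := p) _ ?_ n
    rw [Nat.card_of_subsingleton (1 : fixing (flagAut G 𝓕) x)]
    exact Nat.coprime_one_left p

/-- Automorphisms that permute the classes of edges without changing the forests. -/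
theorem mem_flagAut_of_classes {K V : Type} {s t : K × ZMod p → V} {base : V}
    {i : Iso (ofEdges V (K × ZMod p) s t base) (ofEdges V (K × ZMod p) s t base)} {τ : K → K}
    (hi : ∀ d, (i.onD d).1.1 = τ d.1.1) {T : Set (Set K)}
    (hT : ∀ S ∈ T, ∀ k, τ k ∈ S ↔ k ∈ S) :
    i ∈ flagAut (ofEdges V (K × ZMod p) s t base) (edgesOf p '' T) := by
  rintro _ ⟨S, hS, rfl⟩ d
  change (i.onD d).1.1 ∈ S ↔ d.1.1 ∈ S
  rw [hi]
  exact hT S hS _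

theorem sub_eq_of_or {k l : ZMod p} (h : l = k + 1 ∨ k = l + 1) : l - k = 1 ∨ l - k = -1 := by
  rcases h with rfl | rfl
  · exact Or.inl (by ring)
  · exact Or.inr (by ring)

/-- A permutation that fixes all points but one fixes this point as well. -/
theorem onV_eq_self_of_ne {V : Type} (g : V ≃ V) {b : V} (h : ∀ v, v ≠ b → g v = v) (v : V) :
    g v = v := by
  by_cases hv : v = b
  · subst hv
    by_contra hne
    exact hne (g.injective (h _ hne))
  · exact h v hv

section Upsilon

theorem adjacent_upsilon_base {v : (Upsilon p).V} :
    (Upsilon p).Adjacent (.inl false) v ↔ ∃ j, v = .inr j := by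
  constructor
  · rintro ⟨⟨⟨_ | _ | _, j⟩, _ | _⟩, h, rfl⟩ <;> first | exact ⟨_, rfl⟩ | cases h
  · rintro ⟨j, rfl⟩
    exact ⟨((.left, j), false), rfl, rfl⟩

theorem adjacent_upsilon_rim {i j : ZMod p} :
    (Upsilon p).Adjacent (.inr i) (.inr j) ↔ j = i + 1 ∨ i = j + 1 := by
  constructor
  · rintro ⟨⟨⟨_ | _ | _, k⟩, _ | _⟩, h, h'⟩
    · exact Or.inl ((Sum.inr_injective h').symm.trans (congrArg (· + 1) (Sum.inr_injective h)))
    · exact Or.inr ((Sum.inr_injective h).symm.trans (congrArg (· + 1) (Sum.inr_injective h')))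
    all_goals first | (cases h; done) | cases h'
  · rintro (rfl | rfl)
    · exact ⟨((.rim, i), false), rfl, rfl⟩
    · exact ⟨((.rim, j), true), rfl, rfl⟩

theorem IsSimplexOfFlag.symmetry_upsilon {n : ℕ} {σ : Set (SpineVertex n)}
    {T : Set (Set UpsilonEdge)} (hσ : IsSimplexOfFlag (Upsilon p) (edgesOf p '' T) σ)
    (h5 : 5 ≤ p) : HasAtMostDihedralSymmetry p σ ∧ ¬ HasExactlyCyclicSymmetry p σ := by
  have h2 : p ≠ 2 := by omega
  have := hσ.1.finite_D
  obtain ⟨y, hy⟩ := exists_iso_of_isSimple (G := Upsilon p) (isSimple_upsilon h2)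
    (Sum.map id (· + 1)) (Sum.map_bijective.2 ⟨Function.bijective_id, (Equiv.addRight 1).bijective⟩)
    (fun d => ((d.1.1, d.1.2 + 1), d.2)) (by rintro ⟨⟨_ | _ | _, j⟩, _ | _⟩ <;> rfl)
    (fun d => rfl) rfl rfl
  obtain ⟨i, hi⟩ := exists_iso_of_isSimple (G := Upsilon p) (isSimple_upsilon h2)
    (Sum.map id Neg.neg) (Sum.map_bijective.2 ⟨Function.bijective_id, neg_involutive.bijective⟩)
    (fun | ((.rim, j), b) => ((.rim, -j - 1), !b) | ((.left, j), b) => ((.left, -j), b)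
         | ((.right, j), b) => ((.right, -j), b)) (by
      rintro ⟨⟨_ | _ | _, j⟩, _ | _⟩
      · exact congrArg Sum.inr (show -j - 1 + 1 = -j by ring)
      · exact congrArg Sum.inr (show -j - 1 = -(j + 1) by ring)
      all_goals rfl) (by rintro ⟨⟨_ | _ | _, j⟩, _ | _⟩ <;> rfl) rfl rfl
  have hyV : ∀ j : ZMod p, y.onV (.inr j) = .inr (j + 1) := fun j =>
    (y.src_onD ((.left, j), true)).symm.trans (congrArg _ (hy _))
  have hiV : ∀ j : ZMod p, i.onV (.inr j) = .inr (-j) := fun j =>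
    (i.src_onD ((.left, j), true)).symm.trans (congrArg _ (hi _))
  have hb : ∀ g : Iso (Upsilon p) (Upsilon p), g.onV (.inl false) = .inl false := fun g => g.onV_base
  obtain ⟨hA, -, hC⟩ := hσ.symmetry_of_isSimple (p := p) h2 (isSimple_upsilon h2)
    (x := (Sum.inr : ZMod p → _)) Sum.inr_injective
    (fun g j => by
      have h := (adjacent_upsilon_base.2 ⟨j, rfl⟩).map g
      rw [hb] at h
      exact adjacent_upsilon_base.1 h)
    (fun g j k l hk hl => by
      have h := (adjacent_upsilon_rim.2 (Or.inl (rfl : j + 1 = j + 1))).map g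
      rw [hk, hl] at h
      exact sub_eq_of_or (adjacent_upsilon_rim.1 h))
    (fun g h => onV_eq_self_of_ne (b := .inl true) _ fun v hv => by
      rcases v with (_ | _) | j
      · exact hb g
      · exact absurd rfl hv
      · exact h j)
    (mem_flagAut_of_classes (τ := id) (fun d => congrArg (·.1.1) (hy d)) fun _ _ _ => Iff.rfl) hyV
  refine ⟨hA, hC h5 ⟨i, mem_flagAut_of_classes (τ := id) ?_ fun _ _ _ => Iff.rfl, ?_, hiV 1⟩⟩
  · rintro ⟨⟨_ | _ | _, j⟩, b⟩ <;> exact congrArg (·.1.1) (hi _)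
  · rw [hiV, neg_zero]

end Upsilon

section UpsilonOne

theorem adjacent_upsilonOne_base {v : (UpsilonOne p).V} :
    (UpsilonOne p).Adjacent (.inl false) v ↔ ∃ j, v = .inr (true, j) := by
  constructor
  · rintro ⟨⟨⟨_ | _ | _ | _, j⟩, _ | _⟩, h, rfl⟩ <;> first | exact ⟨_, rfl⟩ | cases h
  · rintro ⟨j, rfl⟩
    exact ⟨((.left, j), false), rfl, rfl⟩

theorem adjacent_upsilonOne_outer {j : ZMod p} {v : (UpsilonOne p).V} :
    (UpsilonOne p).Adjacent (.inr (true, j)) v ↔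
      v = .inl false ∨ v = .inl true ∨ v = .inr (false, j) := by
  constructor
  · rintro ⟨⟨⟨_ | _ | _ | _, j⟩, _ | _⟩, h, rfl⟩ <;> cases h
    · exact Or.inr (Or.inr rfl)
    · exact Or.inl rfl
    · exact Or.inr (Or.inl rfl)
  · rintro (rfl | rfl | rfl)
    · exact ⟨((.left, j), true), rfl, rfl⟩
    · exact ⟨((.right, j), true), rfl, rfl⟩
    · exact ⟨((.stem, j), true), rfl, rfl⟩

theorem adjacent_upsilonOne_rim {i j : ZMod p} :
    (UpsilonOne p).Adjacent (.inr (false, i)) (.inr (false, j)) ↔ j = i + 1 ∨ i = j + 1 := by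
  have hinj : ∀ {a b : ZMod p}, (.inr (false, a) : (UpsilonOne p).V) = .inr (false, b) → a = b :=
    fun h => congrArg Prod.snd (Sum.inr_injective h)
  constructor
  · rintro ⟨⟨⟨_ | _ | _ | _, k⟩, _ | _⟩, h, h'⟩
    · exact Or.inl ((hinj h').symm.trans (congrArg (· + 1) (hinj h)))
    · exact Or.inr ((hinj h).symm.trans (congrArg (· + 1) (hinj h')))
    all_goals first | (cases h; done) | cases h'
  · rintro (rfl | rfl)
    · exact ⟨((.rim, i), false), rfl, rfl⟩
    · exact ⟨((.rim, j), true), rfl, rfl⟩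

theorem IsSimplexOfFlag.symmetry_upsilonOne {n : ℕ} {σ : Set (SpineVertex n)}
    {T : Set (Set UpsilonOneEdge)} (hσ : IsSimplexOfFlag (UpsilonOne p) (edgesOf p '' T) σ)
    (h5 : 5 ≤ p) : HasAtMostDihedralSymmetry p σ ∧ ¬ HasExactlyCyclicSymmetry p σ := by
  have h2 : p ≠ 2 := by omega
  have := hσ.1.finite_D
  obtain ⟨y, hy⟩ := exists_iso_of_isSimple (G := UpsilonOne p) (isSimple_upsilonOne h2)
    (Sum.map id (Prod.map id (· + 1))) (Sum.map_bijective.2 ⟨Function.bijective_id,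
      Function.bijective_id.prodMap (Equiv.addRight 1).bijective⟩)
    (fun d => ((d.1.1, d.1.2 + 1), d.2)) (by rintro ⟨⟨_ | _ | _ | _, j⟩, _ | _⟩ <;> rfl)
    (fun d => rfl) rfl rfl
  obtain ⟨i, hi⟩ := exists_iso_of_isSimple (G := UpsilonOne p) (isSimple_upsilonOne h2)
    (Sum.map id (Prod.map id Neg.neg)) (Sum.map_bijective.2 ⟨Function.bijective_id,
      Function.bijective_id.prodMap neg_involutive.bijective⟩)
    (fun | ((.rim, j), b) => ((.rim, -j - 1), !b) | ((.stem, j), b) => ((.stem, -j), b)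
         | ((.left, j), b) => ((.left, -j), b) | ((.right, j), b) => ((.right, -j), b)) (by
      rintro ⟨⟨_ | _ | _ | _, j⟩, _ | _⟩
      · exact congrArg (fun j => Sum.inr (false, j)) (show -j - 1 + 1 = -j by ring)
      · exact congrArg (fun j => Sum.inr (false, j)) (show -j - 1 = -(j + 1) by ring)
      all_goals rfl) (by rintro ⟨⟨_ | _ | _ | _, j⟩, _ | _⟩ <;> rfl) rfl rfl
  have hyV : ∀ j : ZMod p, y.onV (.inr (true, j)) = .inr (true, j + 1) := fun j =>
    (y.src_onD ((.left, j), true)).symm.trans (congrArg _ (hy _))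
  have hiV : ∀ j : ZMod p, i.onV (.inr (true, j)) = .inr (true, -j) := fun j =>
    (i.src_onD ((.left, j), true)).symm.trans (congrArg _ (hi _))
  have hb : ∀ g : Iso (UpsilonOne p) (UpsilonOne p), g.onV (.inl false) = .inl false :=
    fun g => g.onV_base
  have hS : ∀ (g : Iso (UpsilonOne p) (UpsilonOne p)) (j : ZMod p),
      ∃ j', g.onV (.inr (true, j)) = .inr (true, j') := fun g j => by
    have h := (adjacent_upsilonOne_base.2 ⟨j, rfl⟩).map g
    rw [hb] at h
    exact adjacent_upsilonOne_base.1 h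
  -- the other suspension point is adjacent to all `y j`, and `x j` to only one of them
  have hinner : ∀ (g : Iso (UpsilonOne p) (UpsilonOne p)) (j k : ZMod p),
      g.onV (.inr (true, j)) = .inr (true, k) → g.onV (.inr (false, j)) = .inr (false, k) := by
    intro g j k h
    have h1 := (adjacent_upsilonOne_outer.2 (Or.inr (Or.inr (rfl :
      (.inr (false, j) : (UpsilonOne p).V) = _)))).map g
    rw [h, adjacent_upsilonOne_outer] at h1
    rcases h1 with h1 | h1 | h1
    · rw [← hb g] at h1
      cases g.onV.injective h1
    · obtain ⟨k', hk'⟩ := hS g (j + 1)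
      have h3 : (UpsilonOne p).Adjacent (g.onV (.inr (true, j + 1))) (g.onV (.inr (false, j))) := by
        rw [hk', h1]
        exact adjacent_upsilonOne_outer.2 (Or.inr (Or.inl rfl))
      replace h3 := adjacent_upsilonOne_outer.1 ((adjacent_onV_iff g).1 h3)
      rcases h3 with h3 | h3 | h3
      · cases h3
      · cases h3
      · exact absurd (congrArg Prod.snd (Sum.inr_injective h3)).symm (add_one_ne j)
    · exact h1
  obtain ⟨hA, -, hC⟩ := hσ.symmetry_of_isSimple (p := p) h2 (isSimple_upsilonOne h2)
    (x := fun j : ZMod p => .inr (true, j))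
    (fun j k h => congrArg Prod.snd (Sum.inr_injective h)) hS
    (fun g j k l hk hl => by
      have h := (adjacent_upsilonOne_rim.2 (Or.inl (rfl : j + 1 = j + 1))).map g
      rw [hinner g _ _ hk, hinner g _ _ hl] at h
      exact sub_eq_of_or (adjacent_upsilonOne_rim.1 h))
    (fun g h => onV_eq_self_of_ne (b := .inl true) _ fun v hv => by
      rcases v with (_ | _) | ⟨_ | _, j⟩
      · exact hb g
      · exact absurd rfl hv
      · exact hinner g _ _ (h j)
      · exact h j)
    (mem_flagAut_of_classes (τ := id) (fun d => congrArg (·.1.1) (hy d)) fun _ _ _ => Iff.rfl) hyV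
  refine ⟨hA, hC h5 ⟨i, mem_flagAut_of_classes (τ := id) ?_ fun _ _ _ => Iff.rfl, ?_, hiV 1⟩⟩
  · rintro ⟨⟨_ | _ | _ | _, j⟩, b⟩ <;> exact congrArg (·.1.1) (hi _)
  · rw [hiV, neg_zero]

end UpsilonOne

section UpsilonTwo

theorem adjacent_upsilonTwo_base {v : (UpsilonTwo p).V} :
    (UpsilonTwo p).Adjacent (.inl false) v ↔ ∃ j, v = .inr (false, j) := by
  constructor
  · rintro ⟨⟨⟨_ | _ | _ | _, j⟩, _ | _⟩, h, rfl⟩ <;> first | exact ⟨_, rfl⟩ | cases h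
  · rintro ⟨j, rfl⟩
    exact ⟨((.left, j), false), rfl, rfl⟩

theorem adjacent_upsilonTwo_outer {i : ZMod p} {v : (UpsilonTwo p).V} :
    (UpsilonTwo p).Adjacent (.inr (false, i)) v ↔
      v = .inl false ∨ ∃ m, v = .inr (true, m) ∧ (m = i ∨ i = m + 1) := by
  constructor
  · rintro ⟨⟨⟨_ | _ | _ | _, j⟩, _ | _⟩, h, rfl⟩ <;> cases h
    · exact Or.inr ⟨i, rfl, Or.inl rfl⟩
    · exact Or.inr ⟨j, rfl, Or.inr rfl⟩
    · exact Or.inl rfl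
  · rintro (rfl | ⟨m, rfl, rfl | rfl⟩)
    · exact ⟨((.left, i), true), rfl, rfl⟩
    · exact ⟨((.rimA, m), false), rfl, rfl⟩
    · exact ⟨((.rimB, m), true), rfl, rfl⟩

/-- A reflection exchanges the two classes of rim edges of `Υ²`, so it does not preserve a forest that
contains only one of them, and it preserves all forests without rim edges. -/
theorem IsSimplexOfFlag.symmetry_upsilonTwo {n : ℕ} {σ : Set (SpineVertex n)}
    {T : Set (Set UpsilonTwoEdge)} (hσ : IsSimplexOfFlag (UpsilonTwo p) (edgesOf p '' T) σ)
    (h5 : 5 ≤ p) : HasAtMostDihedralSymmetry p σ ∧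
      ((∃ S ∈ T, .rimA ∈ S ∧ .rimB ∉ S) → HasExactlyCyclicSymmetry p σ) ∧
      ((∀ S ∈ T, .rimA ∉ S ∧ .rimB ∉ S) → ¬ HasExactlyCyclicSymmetry p σ) := by
  have h2 : p ≠ 2 := by omega
  have := hσ.1.finite_D
  obtain ⟨y, hy⟩ := exists_iso_of_isSimple (G := UpsilonTwo p) (isSimple_upsilonTwo)
    (Sum.map id (Prod.map id (· + 1))) (Sum.map_bijective.2 ⟨Function.bijective_id,
      Function.bijective_id.prodMap (Equiv.addRight 1).bijective⟩)
    (fun d => ((d.1.1, d.1.2 + 1), d.2)) (by rintro ⟨⟨_ | _ | _ | _, j⟩, _ | _⟩ <;> rfl)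
    (fun d => rfl) rfl rfl
  obtain ⟨i, hi1, hi2, hi3, hi4⟩ := exists_reflection_upsilonTwo (p := p)
  have hyV : ∀ j : ZMod p, y.onV (.inr (false, j)) = .inr (false, j + 1) := fun j =>
    (y.src_onD ((.left, j), true)).symm.trans (congrArg _ (hy _))
  have hiV : ∀ j : ZMod p, i.onV (.inr (false, j)) = .inr (false, -j) := fun j =>
    (i.src_onD ((.left, j), true)).symm.trans (congrArg _ (hi3 _ _))
  have hb : ∀ g : Iso (UpsilonTwo p) (UpsilonTwo p), g.onV (.inl false) = .inl false :=
    fun g => g.onV_base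
  have hinj : Function.Injective fun j : ZMod p => (.inr (false, j) : (UpsilonTwo p).V) :=
    fun j k h => congrArg Prod.snd (Sum.inr_injective h)
  have hS : ∀ (g : Iso (UpsilonTwo p) (UpsilonTwo p)) (j : ZMod p),
      ∃ j', g.onV (.inr (false, j)) = .inr (false, j') := fun g j => by
    have h := (adjacent_upsilonTwo_base.2 ⟨j, rfl⟩).map g
    rw [hb] at h
    exact adjacent_upsilonTwo_base.1 h
  have hw : ∀ (g : Iso (UpsilonTwo p) (UpsilonTwo p)) (j k l : ZMod p),
      g.onV (.inr (false, j)) = .inr (false, k) → g.onV (.inr (false, j + 1)) = .inr (false, l) →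
      ∃ m, g.onV (.inr (true, j)) = .inr (true, m) ∧ (m = k ∨ k = m + 1) ∧
        (m = l ∨ l = m + 1) := by
    intro g j k l hk hl
    have h1 := (adjacent_upsilonTwo_outer.2 (Or.inr ⟨j, rfl, Or.inl (rfl : j = j)⟩)).map g
    have h3 := (adjacent_upsilonTwo_outer.2 (Or.inr ⟨j, rfl,
      Or.inr (rfl : j + 1 = j + 1)⟩)).map g
    rw [hk, adjacent_upsilonTwo_outer] at h1
    rw [hl, adjacent_upsilonTwo_outer] at h3
    rcases h1 with h1 | ⟨m, hm, hm'⟩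
    · rw [← hb g] at h1
      cases g.onV.injective h1
    · rcases h3 with h3 | ⟨m', hm1, hm2⟩
      · rw [← hb g] at h3
        cases g.onV.injective h3
      · obtain rfl : m = m' := congrArg Prod.snd (Sum.inr_injective (hm.symm.trans hm1))
        exact ⟨m, hm, hm', hm2⟩
  have hne : ∀ (g : Iso (UpsilonTwo p) (UpsilonTwo p)) (j k : ZMod p),
      g.onV (.inr (false, j)) = .inr (false, k) → g.onV (.inr (false, j + 1)) ≠ .inr (false, k) :=
    fun g j k h h' => add_one_ne j (hinj (g.onV.injective (h'.trans h.symm)))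
  obtain ⟨hA, hB, hC⟩ := hσ.symmetry_of_isSimple (p := p) h2 isSimple_upsilonTwo
    (x := fun j : ZMod p => .inr (false, j)) hinj hS
    (fun g j k l hk hl => by
      obtain ⟨m, -, h1, h3⟩ := hw g j k l hk hl
      have h4 : l ≠ k := fun h => hne g j k hk (hl.trans (by rw [h]))
      apply sub_eq_of_or
      rcases h1 with rfl | rfl <;> rcases h3 with rfl | rfl
      · exact absurd rfl h4
      · exact Or.inl rfl
      · exact Or.inr rfl
      · exact absurd rfl h4)
    (fun g h => onV_eq_self_of_ne (b := .inl true) _ fun v hv => by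
      rcases v with (_ | _) | ⟨_ | _, j⟩
      · exact hb g
      · exact absurd rfl hv
      · exact h j
      · obtain ⟨m, hm, h1, h3⟩ := hw g j _ _ (h j) (h (j + 1))
        rw [hm]
        rcases h1 with rfl | rfl
        · rfl
        · rcases h3 with h3 | h3
          · exact absurd h3.symm (add_one_add_one_ne h2 m)
          · exact absurd (add_right_cancel h3) (add_one_ne m))
    (mem_flagAut_of_classes (τ := id) (fun d => congrArg (·.1.1) (hy d)) fun _ _ _ => Iff.rfl) hyV
  refine ⟨hA, ?_, ?_⟩
  · rintro ⟨S, hST, hSA, hSB⟩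
    refine hB fun g hg h0 => ?_
    obtain ⟨l, hl⟩ := hS g 1
    obtain ⟨m, hm, h1, h3⟩ := hw g 0 0 l h0 (by rw [zero_add]; exact hl)
    have hd : g.onD ((.rimA, 0), false) ∈ edgesOf p S :=
      (mem_flagAut.1 hg _ ⟨S, hST, rfl⟩ ((.rimA, 0), false)).2 hSA
    have hs := (g.src_onD ((.rimA, 0), false)).trans h0
    have ht := (congrArg _ (g.onD_inv ((.rimA, 0), false))).symm.trans
      ((g.src_onD ((UpsilonTwo p).inv ((.rimA, 0), false))).trans hm)
    have hm0 : m = 0 := by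
      generalize g.onD ((.rimA, 0), false) = d at hd hs ht
      rcases d with ⟨⟨_ | _ | _ | _, j⟩, _ | _⟩
      · have h5 : j = 0 := hinj hs
        have h6 : j = m := congrArg Prod.snd (Sum.inr_injective ht)
        exact h6.symm.trans h5
      · cases hs
      · exact absurd hd hSB
      · exact absurd hd hSB
      all_goals first | (cases hs; done) | cases ht
    subst hm0
    have h4 := hne g 0 0 h0
    rw [zero_add] at h4
    rcases h3 with rfl | rfl
    · exact absurd hl h4
    · rw [zero_add] at hl
      exact hl
  · intro hT
    refine hC h5 ⟨i, mem_flagAut_of_classes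
      (τ := fun | .rimA => .rimB | .rimB => .rimA | .left => .left | .right => .right) ?_ ?_, ?_, hiV 1⟩
    · rintro ⟨⟨_ | _ | _ | _, j⟩, b⟩
      exacts [congrArg (·.1.1) (hi1 _ _), congrArg (·.1.1) (hi2 _ _), congrArg (·.1.1) (hi3 _ _),
        congrArg (·.1.1) (hi4 _ _)]
    · rintro S hS (_ | _ | _ | _)
      · exact iff_of_false (hT S hS).2 (hT S hS).1
      · exact iff_of_false (hT S hS).1 (hT S hS).2
      all_goals exact Iff.rfl
    · rw [hiV, neg_zero]

end UpsilonTwo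

end Auter

namespace Auter

/-! ### Automorphisms that fix a wheel -/

open CategoryTheory CategoryTheory.Limits

variable {p : ℕ} [Fact p.Prime]

namespace PGraph

variable {G : PGraph}

open Classical in
/-- An automorphism of order `p` that fixes a wheel with `p` spokes moves no vertex and only one
orbit of edges: the rank of the graph leaves no room for more. -/
theorem Admissible.fixed_wheel (hG : G.Admissible) (h5 : 5 ≤ p)
    (hc : Nat.card G.D + 4 = 2 * Nat.card G.V + 4 * p) {z : Iso G G} (hz : z ^ p = 1) (hz1 : z ≠ 1)
    {x : ZMod p → G.V} (hx : Function.Injective x) {a : G.V} (ha : ∀ j, x j ≠ a) {e : ZMod p → G.D}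
    (he : ∀ j, G.src (e j) = a) (he' : ∀ j, G.src (G.inv (e j)) = x j)
    (hxb : ∀ j, x j ≠ G.base)
    (ht : ∀ d j, G.src d = x j → G.src (G.inv d) = a ∨ ∃ i, G.src (G.inv d) = x i)
    (hfix : ∀ d j, G.src d = x j → z.onD d = d) :
    (∀ v, z.onV v = v) ∧ Nat.card {d // z.onD d ≠ d} = 2 * p := by
  have hp := (Fact.out : p.Prime)
  have := hG.finite_D
  have := hG.finite_V
  have := Fintype.ofFinite G.D
  have := Fintype.ofFinite G.V
  obtain ⟨E, V, s, hE, hV, -, htl, -, hk⟩ := hG.orbit_numbers h5 hc hz hz1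
  set Q := Subgroup.zpowers z with hQ
  have hm : ∃ d, Moves Q d := by
    by_contra! hn
    exact hz1 (hG.iso_ext fun d => by simpa [Q, moves_zpowers_iff] using hn d)
  have hfm : ∀ d j, G.src d = x j → ¬ Moves Q d := fun d j h => by
    rw [moves_zpowers_iff, not_not]
    exact hfix d j h
  have hem : ∀ j, ¬ Moves Q (e j) := fun j => by
    rw [← moves_inv]
    exact hfm _ j (he' j)
  have hxm : ∀ j, ¬ MovesV Q (x j) := fun j h => by
    rw [← he' j] at h
    exact hfm _ j (he' j) (moves_of_src h)
  have ham : ¬ MovesV Q a := fun h => by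
    rw [← he 0] at h
    exact hem 0 (moves_of_src h)
  have heinj : Function.Injective e := fun i j h => hx (by rw [← he', ← he', h])
  -- The fixed edges at `v`, with a correction at attaching vertices. This is at least `2` at all
  -- fixed vertices, at least `3` on the rim, and at least `p + 1` at the hub.
  let f : G.V → ℕ := fun v => (Finset.univ.filter fun d => ¬ Moves Q d ∧ G.src d = v).card +
    if Attaching Q v then 2 else 0
  have hfx : ∀ j, 3 ≤ f (x j) := by
    intro j
    have h1 : (Finset.univ.filter fun d => ¬ Moves Q d ∧ G.src d = x j).card = G.valence (x j) := by
      rw [valence, Nat.card_eq_fintype_card, Fintype.card_subtype]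
      congr 1
      ext d
      simpa using hfm d j
    have h3 := hG.three_le_valence (x j) (hxb j)
    change 3 ≤ _ + _
    omega
  have hfa : p + 1 ≤ f a := by
    have hsub : Finset.univ.image e ⊆ Finset.univ.filter fun d => ¬ Moves Q d ∧ G.src d = a := by
      intro d hd
      obtain ⟨j, -, rfl⟩ := Finset.mem_image.1 hd
      simpa using ⟨hem j, he j⟩
    have hcard : (Finset.univ.image e).card = p := by
      rw [Finset.card_image_of_injective _ heinj, Finset.card_univ, ZMod.card]
    have hle := Finset.card_le_card hsub
    rw [hcard] at hle
    by_cases hat : Attaching Q a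
    · simp only [f, if_pos hat]
      omega
    · simp only [f, if_neg hat, add_zero]
      by_contra hlt
      have hafix : ∀ d, G.src d = a → ¬ Moves Q d := fun d hd hmd => hat ⟨ham, d, hd, hmd⟩
      have heq := Finset.eq_of_subset_of_card_le hsub (by omega)
      -- otherwise the wheel is the whole graph
      have key : ∀ (w : List G.D) (u v : G.V), G.IsWalk u w v → (u = a ∨ ∃ j, u = x j) →
          v = a ∨ ∃ j, v = x j := by
        intro w
        induction w with
        | nil =>
          intro u v h hu
          rwa [← (show u = v from h)]
        | cons d w ih =>
          rintro u v ⟨rfl, h⟩ hu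
          refine ih _ v h ?_
          rcases hu with hu | ⟨j, hu⟩
          · have h1 : d ∈ Finset.univ.image e := by
              rw [heq]
              simpa using ⟨hafix d hu, hu⟩
            obtain ⟨j, -, rfl⟩ := Finset.mem_image.1 h1
            exact Or.inr ⟨j, he' j⟩
          · exact ht d j hu
      obtain ⟨d, hd⟩ := hm
      obtain ⟨w, hw⟩ := hG.connected' a (G.src d)
      rcases key w _ _ hw (Or.inl rfl) with h | ⟨j, h⟩
      · exact hafix d h hd
      · exact hfm d j h hd
  have hsum : 2 * (Finset.univ.filter fun v => ¬ MovesV Q v).card + p + (p - 1) ≤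
      (Finset.univ.filter fun d => ¬ Moves Q d).card +
        2 * (Finset.univ.filter fun v => Attaching Q v).card := by
    have h1 : ∑ v ∈ Finset.univ.filter (fun v => ¬ MovesV Q v), (if Attaching Q v then 2 else 0) =
        2 * (Finset.univ.filter fun v => Attaching Q v).card := by
      rw [← Finset.sum_filter, Finset.sum_const, smul_eq_mul, mul_comm, Finset.filter_filter]
      congr 2
      ext v
      simp only [Finset.mem_filter, Finset.mem_univ, true_and, and_iff_right_iff_imp]
      exact fun h => h.1
    rw [← h1, ← (counts (P := Q)).2, ← Finset.sum_add_distrib]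
    have h3 : ∑ v ∈ Finset.univ.filter (fun v => ¬ MovesV Q v),
        (2 + (if v ∈ Finset.univ.image x then 1 else 0) + if v = a then p - 1 else 0) =
        2 * (Finset.univ.filter fun v => ¬ MovesV Q v).card + p + (p - 1) := by
      rw [Finset.sum_add_distrib, Finset.sum_add_distrib, Finset.sum_const, smul_eq_mul, mul_comm,
        Finset.sum_ite_eq', if_pos (by simpa using ham), ← Finset.card_filter]
      congr 2
      rw [show (Finset.univ.filter (fun v => ¬ MovesV Q v)).filter (· ∈ Finset.univ.image x) =
        Finset.univ.image x from ?_, Finset.card_image_of_injective _ hx, Finset.card_univ, ZMod.card]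
      ext v
      simp only [Finset.mem_filter, Finset.mem_univ, true_and, and_iff_right_iff_imp]
      intro hv
      obtain ⟨j, -, rfl⟩ := Finset.mem_image.1 hv
      exact hxm j
    rw [← h3]
    refine Finset.sum_le_sum fun v hv => ?_
    have hv' : ¬ MovesV Q v := (Finset.mem_filter.1 hv).2
    by_cases hva : v = a
    · subst hva
      rw [if_pos rfl, if_neg (by simpa using ha)]
      have : p + 1 ≤ _ + _ := hfa
      omega
    · rw [if_neg hva]
      by_cases hvx : v ∈ Finset.univ.image x
      · rw [if_pos hvx]
        obtain ⟨j, -, rfl⟩ := Finset.mem_image.1 hvx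
        exact hfx j
      · rw [if_neg hvx]
        exact hG.two_le hm hv'
  have hV0 : V = 0 ∧ E = 1 := by omega
  obtain ⟨rfl, rfl⟩ := hV0
  constructor
  · intro v
    by_contra hv
    have h1 : v ∈ Finset.univ.filter fun v => MovesV Q v := by
      simpa [Q, movesV_zpowers_iff] using hv
    rw [Finset.card_eq_zero.1 (hV.trans (mul_zero p))] at h1
    exact absurd h1 (Finset.notMem_empty _)
  · rw [mul_one] at hE
    rw [← hE, Nat.card_eq_fintype_card, Fintype.card_subtype]
    congr 1
    ext d
    simp [Q, moves_zpowers_iff]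

/-- Extension of an automorphism of one summand to a one-point union. -/
noncomputable def wedgeMap {A B : PGraph} (a : A.V) (j : Iso B B) :
    Iso (A.wedge a B) (A.wedge a B) where
  onV := Equiv.sumCongr (Equiv.refl _) (j.onV.subtypeEquiv fun v => by
    rw [ne_eq, ne_eq, not_iff_not, ← j.onV_base, j.onV.injective.eq_iff, j.onV_base])
  onD := Equiv.sumCongr (Equiv.refl _) j.onD
  src_onD := by
    rintro (d | d)
    · rfl
    · change (A.wedge a B).src (Sum.inr (j.onD d)) = _
      by_cases h : B.src d = B.base
      · rw [wedge_src_inr_of_eq h, wedge_src_inr_of_eq (by rw [j.src_onD, h, j.onV_base])]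
        rfl
      · have h' : B.src (j.onD d) ≠ B.base := by
          rw [j.src_onD, ← j.onV_base]
          exact fun h' => h (j.onV.injective h')
        rw [wedge_src_inr_of_ne h, wedge_src_inr_of_ne h']
        exact congrArg Sum.inr (Subtype.ext (j.src_onD d))
  onD_inv := by
    rintro (d | d)
    · rfl
    · exact congrArg Sum.inr (j.onD_inv d)
  onV_base := rfl

end PGraph

end Auter

namespace Auter

/-! ### The symmetry of the simplices with a wheel -/

open PGraph CategoryTheory CategoryTheory.Limits

variable {p : ℕ} [Fact p.Prime]

theorem exists_rotation_xi (h2 : p ≠ 2) : ∃ y : Iso (Xi p) (Xi p), ∀ d, y.onD d = Xi.rotate p d := by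
  have : Finite (Xi p).D := inferInstanceAs (Finite ((XiEdge × ZMod p) × Bool))
  exact exists_iso_of_isSimple (G := Xi p) (isSimple_xi h2) (Option.map (· + 1))
    ((Equiv.optionCongr (Equiv.addRight (1 : ZMod p))).bijective)
    (Xi.rotate p) (by rintro ⟨⟨_ | _, j⟩, _ | _⟩ <;> rfl) (fun d => rfl) rfl rfl

theorem exists_reflection_xi (h2 : p ≠ 2) : ∃ i : Iso (Xi p) (Xi p),
    (∀ j b, i.onD ((.rim, j), b) = ((.rim, -j - 1), !b)) ∧
    ∀ j b, i.onD ((.spoke, j), b) = ((.spoke, -j), b) := by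
  have : Finite (Xi p).D := inferInstanceAs (Finite ((XiEdge × ZMod p) × Bool))
  obtain ⟨i, hi⟩ := exists_iso_of_isSimple (G := Xi p) (isSimple_xi h2) (Option.map Neg.neg)
    ((Equiv.optionCongr (Equiv.neg (ZMod p))).bijective)
    (fun | ((.rim, j), b) => ((.rim, -j - 1), !b) | ((.spoke, j), b) => ((.spoke, -j), b)) (by
      rintro ⟨⟨_ | _, j⟩, _ | _⟩
      · exact congrArg some (show -j - 1 + 1 = -j by ring)
      · exact congrArg some (show -j - 1 = -(j + 1) by ring)
      all_goals rfl) (by rintro ⟨⟨_ | _, j⟩, _ | _⟩ <;> rfl) rfl rfl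
  exact ⟨i, fun j b => hi _, fun j b => hi _⟩

section Wedge

variable {Γ : PGraph} {a : Γ.V}

/-- The vertices of the rim. -/
def rimV (a : Γ.V) (j : ZMod p) : (Γ.wedge a (Xi p)).V :=
  Sum.inr ⟨some j, fun h => Option.some_ne_none _ h⟩

theorem rimV_injective : Function.Injective (rimV (p := p) a) := fun _ _ h =>
  Option.some_injective _ (congrArg Subtype.val (Sum.inr_injective h))

theorem rimV_ne (j : ZMod p) (v : Γ.V) : rimV a j ≠ (Sum.inl v : (Γ.wedge a (Xi p)).V) :=
  Sum.inr_ne_inl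

theorem wedge_src_of_none {d : (Xi p).D} (h : (Xi p).src d = none) :
    (Γ.wedge a (Xi p)).src (Sum.inr d) = Sum.inl a := wedge_src_inr_of_eq h

theorem wedge_src_of_some {d : (Xi p).D} {j : ZMod p} (h : (Xi p).src d = some j) :
    (Γ.wedge a (Xi p)).src (Sum.inr d) = rimV a j :=
  (wedge_src_inr_of_ne (B := Xi p) fun h' => Option.some_ne_none j (h.symm.trans h')).trans
    (congrArg Sum.inr (Subtype.ext h))

/-- The edges at a vertex of the rim. -/
theorem wedge_rim_cases {d : (Γ.wedge a (Xi p)).D} {j : ZMod p}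
    (h : (Γ.wedge a (Xi p)).src d = rimV a j) :
    (d = Sum.inr ((.rim, j), false) ∧
      (Γ.wedge a (Xi p)).src ((Γ.wedge a (Xi p)).inv d) = rimV a (j + 1)) ∨
    (d = Sum.inr ((.rim, j - 1), true) ∧
      (Γ.wedge a (Xi p)).src ((Γ.wedge a (Xi p)).inv d) = rimV a (j - 1)) ∨
    (d = Sum.inr ((.spoke, j), true) ∧
      (Γ.wedge a (Xi p)).src ((Γ.wedge a (Xi p)).inv d) = Sum.inl a) := by
  rcases d with d | ⟨⟨_ | _, i⟩, _ | _⟩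
  · exact absurd h.symm (rimV_ne _ _)
  · obtain rfl : i = j := rimV_injective ((wedge_src_of_some (a := a) rfl).symm.trans h)
    exact Or.inl ⟨rfl, wedge_src_of_some rfl⟩
  · obtain rfl : i + 1 = j := rimV_injective ((wedge_src_of_some (a := a) rfl).symm.trans h)
    rw [add_sub_cancel_right]
    exact Or.inr (Or.inl ⟨rfl, wedge_src_of_some rfl⟩)
  · exact absurd (h.symm.trans (wedge_src_of_none (a := a) rfl)) (rimV_ne _ _)
  · obtain rfl : i = j := rimV_injective ((wedge_src_of_some (a := a) rfl).symm.trans h)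
    exact Or.inr (Or.inr ⟨rfl, wedge_src_of_none rfl⟩)

/-- Every edge of the wheel has an end on the rim. -/
theorem wedge_inr_cases (d : (Xi p).D) : ∃ j, (Γ.wedge a (Xi p)).src (Sum.inr d) = rimV a j ∨
    (Γ.wedge a (Xi p)).src ((Γ.wedge a (Xi p)).inv (Sum.inr d)) = rimV a j := by
  rcases d with ⟨⟨_ | _, i⟩, _ | _⟩
  · exact ⟨i, Or.inl (wedge_src_of_some rfl)⟩
  · exact ⟨i, Or.inr (wedge_src_of_some rfl)⟩
  · exact ⟨i, Or.inr (wedge_src_of_some rfl)⟩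
  · exact ⟨i, Or.inl (wedge_src_of_some rfl)⟩

theorem valence_rimV_le (j : ZMod p) : (Γ.wedge a (Xi p)).valence (rimV a j) ≤ 3 := by
  classical
  let s : Finset (Γ.wedge a (Xi p)).D :=
    {Sum.inr ((.rim, j), false), Sum.inr ((.rim, j - 1), true), Sum.inr ((.spoke, j), true)}
  have h : {d | (Γ.wedge a (Xi p)).src d = rimV a j} ⊆ (s : Set (Γ.wedge a (Xi p)).D) := by
    intro d hd
    rcases wedge_rim_cases hd with ⟨h, -⟩ | ⟨h, -⟩ | ⟨h, -⟩
    · exact Finset.mem_insert.2 (Or.inl h)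
    · exact Finset.mem_insert.2 (Or.inr (Finset.mem_insert.2 (Or.inl h)))
    · exact Finset.mem_insert.2 (Or.inr (Finset.mem_insert.2 (Or.inr (Finset.mem_singleton.2 h))))
  refine (Nat.card_mono s.finite_toSet h).trans ?_
  rw [Nat.card_eq_card_toFinset, Finset.toFinset_coe]
  exact Finset.card_le_three

/-- The hub has larger valence than the vertices of the rim. -/
theorem le_valence_hub (hG : (Γ.wedge a (Xi p)).Admissible) :
    p ≤ (Γ.wedge a (Xi p)).valence (Sum.inl a) := by
  have := hG.finite_D
  let f : ZMod p → {d : (Γ.wedge a (Xi p)).D // (Γ.wedge a (Xi p)).src d = Sum.inl a} :=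
    fun j => ⟨Sum.inr ((.spoke, j), false), wedge_src_of_none rfl⟩
  have hf : Function.Injective f := fun i j h => by
    have h1 := Sum.inr_injective (congrArg Subtype.val h)
    exact congrArg (fun d : (XiEdge × ZMod p) × Bool => d.1.2) h1
  have := Nat.card_le_card_of_injective f hf
  rwa [Nat.card_zmod] at this

/-- The symmetry of a simplex whose maximal vertex is a one-point union with a wheel. -/
theorem symmetry_of_hasWheelWedgeForm (h5 : 5 ≤ p) {σ : Set (SpineVertex (2 * p - 1))}
    (h : HasWheelWedgeForm p σ) :
    HasAtMostDihedralSymmetry p σ ∧ ¬ HasExactlyCyclicSymmetry p σ := by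
  have hp := (Fact.out : p.Prime)
  have h2 : p ≠ 2 := by omega
  obtain ⟨Γ, a, h⟩ := h
  set G := Γ.wedge a (Xi p) with hGdef
  obtain ⟨𝓕, -, h𝓕, hσ⟩ := h
  have hG : G.Admissible := hσ.1
  have hc : Nat.card G.D + 4 = 2 * Nat.card G.V + 4 * p := by
    obtain ⟨-, -, φ, -⟩ := hσ
    have : Nat.card G.D + 2 = 2 * Nat.card G.V + 2 * (2 * p - 1) := hG.card_D φ
    omega
  have := hG.finite_D
  have := hG.finite_iso
  let x : ZMod p → G.V := rimV a
  let hub : G.V := Sum.inl a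
  let rim : ZMod p → G.D := fun j => Sum.inr ((.rim, j), false)
  have hx : Function.Injective x := rimV_injective
  -- rotations and reflections
  obtain ⟨y₀, hy₀⟩ := exists_rotation_xi (p := p) h2
  obtain ⟨i₀, hi₀, hi₁⟩ := exists_reflection_xi (p := p) h2
  let y : Iso G G := wedgeMap a y₀
  let i : Iso G G := wedgeMap a i₀
  have hrot : ∀ F ∈ 𝓕, ∀ k (j : ZMod p) b, (Sum.inr ((k, j), b) : G.D) ∈ F ↔
      (Sum.inr ((k, 0), false) : G.D) ∈ F := by
    intro F hF k j b
    have h1 : ∀ n : ℕ, (Sum.inr ((k, (n : ZMod p)), b) : G.D) ∈ F ↔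
        (Sum.inr ((k, 0), b) : G.D) ∈ F := by
      intro n
      induction n with
      | zero => rw [Nat.cast_zero]
      | succ n ih =>
        rw [Nat.cast_succ]
        exact (h𝓕 F hF ((k, (n : ZMod p)), b)).symm.trans ih
    have h3 := h1 j.val
    rw [ZMod.natCast_zmod_val] at h3
    refine h3.trans ?_
    cases b
    · exact Iff.rfl
    · exact ⟨fun h' => (hσ.2.1.2.1 F hF).1 _ h', fun h' => (hσ.2.1.2.1 F hF).1 _ h'⟩
  have hyS : y ∈ flagAut G 𝓕 := by
    rintro F hF (d | ⟨⟨k, j⟩, b⟩)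
    · exact Iff.rfl
    · refine Iff.trans (Eq.to_iff (congrArg (fun d => (Sum.inr d : G.D) ∈ F) (hy₀ ((k, j), b)))) ?_
      exact (h𝓕 F hF _).symm
  have hiS : i ∈ flagAut G 𝓕 := by
    rintro F hF (d | ⟨⟨_ | _, j⟩, b⟩)
    · exact Iff.rfl
    · refine Iff.trans (Eq.to_iff (congrArg (fun d => (Sum.inr d : G.D) ∈ F) (hi₀ j b))) ?_
      exact (hrot F hF _ _ _).trans (hrot F hF _ _ _).symm
    · refine Iff.trans (Eq.to_iff (congrArg (fun d => (Sum.inr d : G.D) ∈ F) (hi₁ j b))) ?_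
      exact (hrot F hF _ _ _).trans (hrot F hF _ _ _).symm
  have hyx : ∀ j, y.onV (x j) = x (j + 1) := fun j => by
    have h1 := y.src_onD (Sum.inr ((.spoke, j), true))
    rw [show G.src (Sum.inr ((.spoke, j), true)) = x j from wedge_src_of_some rfl] at h1
    exact h1.symm.trans ((congrArg (fun d => G.src (Sum.inr d)) (hy₀ _)).trans
      (wedge_src_of_some rfl))
  have hix : ∀ j, i.onV (x j) = x (-j) := fun j => by
    have h1 := i.src_onD (Sum.inr ((.spoke, j), true))
    rw [show G.src (Sum.inr ((.spoke, j), true)) = x j from wedge_src_of_some rfl] at h1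
    exact h1.symm.trans ((congrArg (fun d => G.src (Sum.inr d)) (hi₁ _ _)).trans
      (wedge_src_of_some rfl))
  have hyp : y ^ p = 1 := by
    refine hG.iso_ext fun d => ?_
    rcases d with d | ⟨⟨k, j⟩, b⟩
    · exact y.pow_onD _ rfl p
    · have h1 : ∀ m : ℕ, (y ^ m).onD (Sum.inr ((k, j), b)) = Sum.inr ((k, j + m), b) := by
        intro m
        induction m with
        | zero => rw [pow_zero, Nat.cast_zero, add_zero]; rfl
        | succ m ih =>
          rw [pow_succ']
          refine (congrArg y.onD ih).trans ((congrArg Sum.inr (hy₀ _)).trans ?_)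
          refine congrArg (fun t => Sum.inr ((k, t), b)) ?_
          rw [Nat.cast_succ, ← add_assoc]
      refine (h1 p).trans ?_
      rw [ZMod.natCast_self, add_zero]
      rfl
  have hyd : ∀ d, y.onD d ≠ d → ∃ j, G.src d = x j ∨ G.src (G.inv d) = x j := by
    rintro (d | d) hd
    · exact absurd rfl hd
    · exact wedge_inr_cases d
  -- the hub is not an image of a vertex of the rim
  have hhub : ∀ (g : Iso G G) j, g.onV (x j) ≠ hub := by
    intro g j h1
    have h3 := g.valence_onV (x j)
    rw [h1] at h3
    have h4 : p ≤ G.valence hub := le_valence_hub hG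
    have h6 : G.valence (x j) ≤ 3 := valence_rimV_le j
    omega
  have hends : ∀ d j, G.src d = x j → G.src (G.inv d) = hub ∨ ∃ k, G.src (G.inv d) = x k := by
    intro d j hd
    rcases wedge_rim_cases hd with ⟨-, h⟩ | ⟨-, h⟩ | ⟨-, h⟩
    · exact Or.inr ⟨_, h⟩
    · exact Or.inr ⟨_, h⟩
    · exact Or.inl h
  have hfixed : ∀ {z : Iso G G}, z ^ p = 1 → z ≠ 1 → (∀ d j, G.src d = x j → z.onD d = d) →
      (∀ v, z.onV v = v) ∧ Nat.card {d // z.onD d ≠ d} = 2 * p := fun hz hz1 hfix =>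
    hG.fixed_wheel h5 hc hz hz1 hx (a := hub) (fun j => rimV_ne _ _)
      (e := fun j => Sum.inr ((.spoke, j), false)) (fun j => wedge_src_of_none rfl)
      (fun j => wedge_src_of_some rfl) (fun j => rimV_ne _ _) hends hfix
  have hrim : ∀ j : ZMod p, G.src (rim j) = x j ∧
      G.src (G.inv (rim j)) = x (j + 1) := fun j =>
    ⟨wedge_src_of_some rfl, wedge_src_of_some rfl⟩
  have hy1 : y ≠ 1 := by
    intro h1
    have h3 := hyx 0
    rw [h1] at h3
    exact add_one_ne (0 : ZMod p) (hx h3).symm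
  have hS : ∀ (g : Iso G G) j, ∃ j', g.onV (x j) = x j' := by
    intro g
    by_cases hmeet : ∃ j k, g.onV (x j) = x k
    · obtain ⟨j₀, k₀, h₀⟩ := hmeet
      have hstep : ∀ m : ℕ, ∃ k, g.onV (x (j₀ + m)) = x k := by
        intro m
        induction m with
        | zero => exact ⟨k₀, by rw [Nat.cast_zero, add_zero, h₀]⟩
        | succ m ih =>
          obtain ⟨k, hk⟩ := ih
          have h1 := g.src_onD (rim (j₀ + m))
          rw [(hrim _).1, hk] at h1
          have h3 : G.src (G.inv (g.onD (rim (j₀ + m)))) =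
              g.onV (x (j₀ + m + 1)) := by rw [← g.onD_inv, g.src_onD, (hrim _).2]
          rw [Nat.cast_succ, ← add_assoc, ← h3]
          rcases hends _ _ h1 with h4 | h4
          · exact absurd (h3.symm.trans h4) (hhub g _)
          · exact h4
      intro j
      obtain ⟨k, hk⟩ := hstep (j - j₀).val
      rw [ZMod.natCast_zmod_val, add_sub_cancel] at hk
      exact ⟨k, hk⟩
    · -- a conjugate of the rotation would fix this wheel and move the vertices of a disjoint one
      exfalso
      push Not at hmeet
      have hg : ∀ v, g.onV (g⁻¹.onV v) = v := fun v => by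
        rw [← Iso.mul_onV, mul_inv_cancel]
        rfl
      have h1 := (hfixed (z := g * y * g⁻¹) (by rw [conj_pow, hyp, mul_one, mul_inv_cancel])
        (fun h1 => hy1 (by rwa [conj_eq_one_iff] at h1)) (fun d j hd => by
          have h3 : y.onD (g⁻¹.onD d) = g⁻¹.onD d := by
            by_contra h3
            obtain ⟨k, hk | hk⟩ := hyd _ h3
            · rw [Iso.src_onD, hd] at hk
              exact hmeet k j (by rw [← hk, hg])
            · rw [← Iso.onD_inv, Iso.src_onD] at hk
              rcases hends d j hd with h4 | ⟨l, h4⟩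
              · rw [h4] at hk
                exact hhub g k (by rw [← hk, hg])
              · rw [h4] at hk
                exact hmeet k l (by rw [← hk, hg])
          rw [Iso.mul_onD, Iso.mul_onD, h3, ← Iso.mul_onD, mul_inv_cancel]
          rfl)).1 (g.onV (x 0))
      rw [Iso.mul_onV, Iso.mul_onV, ← Iso.mul_onV g⁻¹ g, inv_mul_cancel] at h1
      have h3 := g.onV.injective h1
      rw [Iso.one_onV, hyx] at h3
      exact add_one_ne (0 : ZMod p) (hx h3)
  have hadj : ∀ (g : Iso G G) j k l, g.onV (x j) = x k → g.onV (x (j + 1)) = x l →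
      l - k = 1 ∨ l - k = -1 := by
    intro g j k l hk hl
    have h1 := g.src_onD (rim j)
    rw [(hrim _).1, hk] at h1
    have h3 : G.src (G.inv (g.onD (rim j))) = x l := by
      rw [← g.onD_inv, g.src_onD, (hrim _).2, hl]
    rcases wedge_rim_cases h1 with ⟨-, h4⟩ | ⟨-, h4⟩ | ⟨-, h4⟩
    · exact Or.inl (by rw [hx (h3.symm.trans h4)]; ring)
    · exact Or.inr (by rw [hx (h3.symm.trans h4)]; ring)
    · exact absurd (h3.symm.trans h4) (rimV_ne _ _)
  -- automorphisms that fix the rim fix the wheel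
  have hwheel : ∀ g : Iso G G, (∀ j, g.onV (x j) = x j) → ∀ d j, G.src d = x j → g.onD d = d := by
    intro g hg d j hd
    have hd' : G.src (g.onD d) = x j := by rw [g.src_onD, hd, hg]
    have ht : G.src (G.inv (g.onD d)) = g.onV (G.src (G.inv d)) := by rw [← g.onD_inv, g.src_onD]
    have h22 : j + 1 ≠ j - 1 := fun h => two_ne_zero_zmod h2 (by linear_combination h)
    rcases wedge_rim_cases hd with ⟨h, h'⟩ | ⟨h, h'⟩ | ⟨h, h'⟩ <;>
      rcases wedge_rim_cases hd' with ⟨k, k'⟩ | ⟨k, k'⟩ | ⟨k, k'⟩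
    · rw [k, h]
    · exact absurd (hx ((hg _).symm.trans ((congrArg g.onV h').symm.trans (ht.symm.trans k')))) h22
    · exact absurd ((hg _).symm.trans ((congrArg g.onV h').symm.trans (ht.symm.trans k')))
        (rimV_ne _ _)
    · exact absurd (hx ((hg _).symm.trans ((congrArg g.onV h').symm.trans (ht.symm.trans k')))).symm
        h22
    · rw [k, h]
    · exact absurd ((hg _).symm.trans ((congrArg g.onV h').symm.trans (ht.symm.trans k')))
        (rimV_ne _ _)
    · have h1 := (congrArg g.onV h').symm.trans (ht.symm.trans k')
      exact absurd (g.onV.injective (h1.trans (hg _).symm)).symm (rimV_ne _ _)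
    · have h1 := (congrArg g.onV h').symm.trans (ht.symm.trans k')
      exact absurd (g.onV.injective (h1.trans (hg _).symm)).symm (rimV_ne _ _)
    · rw [k, h]
  obtain ⟨hA, -, hC⟩ := hσ.symmetry h2 hx (fun g _ => hS g) (fun g _ => hadj g) hyS hyp hyx (by
    intro n h0 hn
    obtain ⟨n, rfl⟩ := Nat.exists_eq_succ_of_ne_zero h0
    set K := fixing (flagAut G 𝓕) x with hK
    have hKo : IsOrbitClosed K := by
      intro g hg
      refine ⟨isOrbitClosed_flagAut 𝓕 g fun d => ?_, fun j => ?_⟩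
      · obtain ⟨s, hs, h⟩ := hg d
        exact ⟨s, hs.1, h⟩
      · obtain ⟨s, hs, h⟩ := hg (rim j)
        have h1 := congrArg G.src h
        rwa [g.src_onD, s.src_onD, (hrim j).1, hs.2] at h1
    -- The only further `p`-torsion is a single orbit of edges between fixed vertices, which
    -- contributes no cohomology in degrees below `2 (p - 1)`.
    by_cases hpK : p ∣ Nat.card K
    · rcases Nat.eq_zero_or_pos n with rfl | hn0
      · exact isZero_one_zloc (p := p) K
      · obtain ⟨P, z, hz1, hz, hP, hPo⟩ := hG.exists_generic h5 hc K hpK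
        obtain ⟨hv, hd⟩ := hfixed (z := z.1) (congrArg Subtype.val hz)
          (fun h => hz1 (Subtype.ext h)) (hwheel z.1 z.2.2)
        refine hG.isZero_of_untwisted h2 K hKo P hz1 hz hP hPo (fun _ => 0)
          (fun v h => absurd (hv v) h) (fun _ _ _ => rfl) (m := 1) (by rw [hd, mul_one])
          fun j h1 h3 h4 => ?_
        have := Nat.le_of_dvd (by omega) h4
        omega
    · exact isZero_of_coprime (p := p) K
        ((Nat.Prime.coprime_iff_not_dvd hp).2 hpK).symm n)
  exact ⟨hA, hC h5 ⟨i, hiS, by rw [hix, neg_zero], hix 1⟩⟩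

end Wedge

end Auter

namespace Auter

/-! ### The symmetry of the listed simplices -/

open PGraph

variable {p : ℕ} [Fact p.Prime] {n : ℕ} {σ : Set (SpineVertex n)}

theorem InDihedralList.symmetry (h5 : 5 ≤ p) (h : InDihedralList p σ) :
    HasAtMostDihedralSymmetry p σ ∧ (HasExactlyCyclicSymmetry p σ → InCyclicList p σ) := by
  rcases h with ⟨T, -, hσ⟩ | ⟨T, -, hσ⟩ | ⟨T, hT | hT, hσ⟩
  · exact ⟨(hσ.symmetry_upsilon h5).1, fun h => absurd h (hσ.symmetry_upsilon h5).2⟩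
  · exact ⟨(hσ.symmetry_upsilonOne h5).1, fun h => absurd h (hσ.symmetry_upsilonOne h5).2⟩
  · refine ⟨(hσ.symmetry_upsilonTwo h5).1,
      fun h => absurd h ((hσ.symmetry_upsilonTwo h5).2.2 ?_)⟩
    rcases hT with rfl | rfl | rfl | rfl | rfl | rfl <;> simp
  · exact ⟨(hσ.symmetry_upsilonTwo h5).1, fun _ => ⟨T, hT, hσ⟩⟩

theorem InCyclicList.symmetry (h5 : 5 ≤ p) (h : InCyclicList p σ) :
    HasExactlyCyclicSymmetry p σ := by
  obtain ⟨T, hT, hσ⟩ := h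
  refine (hσ.symmetry_upsilonTwo h5).2.1 ?_
  rcases hT with rfl | rfl | rfl | rfl | rfl | rfl | rfl <;> simp

theorem HasExactlyCyclicSymmetry.hasAtMostDihedralSymmetry (h : HasExactlyCyclicSymmetry p σ) :
    HasAtMostDihedralSymmetry p σ :=
  ⟨h.1, h.2.1, fun k h0 h1 => by
    have := h.2.2 (2 * k) (by omega) (by omega)
    rwa [show 2 * (2 * k) = 4 * k by ring] at this⟩

end Auter

theorem corollary4p3 (p : ℕ) [Fact p.Prime] (hp : 5 ≤ p)
    (σ : Set (Auter.SpineVertex (2 * p - 1))) :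
    (Auter.HasAtMostDihedralSymmetry p σ ↔
      Auter.InDihedralList p σ ∨ Auter.HasWheelWedgeForm p σ) ∧
    (Auter.HasExactlyCyclicSymmetry p σ ↔ Auter.InCyclicList p σ) := by
  refine ⟨⟨Auter.inList_of_symmetry hp, ?_⟩, fun h => ?_, fun h => h.symmetry hp⟩
  · rintro (h | h)
    · exact (h.symmetry hp).1
    · exact (Auter.symmetry_of_hasWheelWedgeForm hp h).1
  · rcases Auter.inList_of_symmetry hp h.hasAtMostDihedralSymmetry with h' | h'
    · exact (h'.symmetry hp).2 h
    · exact absurd h (Auter.symmetry_of_hasWheelWedgeForm hp h').2
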